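/- Let $S=\mathbb{C}[x,y,z]$. For $d\ge 1$ let $A(d)\subset\mathbb{P}(S_d)$ be the set of curves $f=0$ in $\mathbb{P}^2$ such that $f$ is a product of $d$ pairwise non-proportional linear forms (arrangements of $d$ distinct lines), with the Zariski topology. For $f \in A(d)$ let $\tau(f)$ be the total Tjurina number of the curve $f=0$ (the sum of the Tjurina numbers of its singular points), and let $A(d,\tau)=\{f\in A(d):\tau(f)=\tau\}$. For a lattice $L$ let $A(L)$ be the set of arrangements in $A(d)$ whose intersection lattice is isomorphic to $L$. Let $AR(f)$ be the graded $S$-module of triples $(a,b,c)\in S^3$ with $af_x+bf_y+cf_z=0$. The arrangement $f=0$ is *free* with exponents $0\le d_1\le d_2$ if $AR(f)\cong S(-d_1)\oplus S(-d_2)$ as graded modules. It is *nearly free* with exponents $1\le d_1\le d_2$ if the Milnor algebra $S/(f_x,f_y,f_z)$ has a minimal graded resolution $$0\to S(-d-d_2)\to S(-d-d_1+1)\oplus S(-d-d_2+1)^2\to S(-d+1)^3\xrightarrow{(f_x,f_y,f_z)}S.$$ Consider the following intersection lattices of arrangements of $6$ lines: $L(6,4)$, of an arrangement with one point of multiplicity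 $4$ and otherwise only double points; $L'(3,3)$, of $x(y-z)(x-y)(x-2y)(x-2z)(x-3z)=0$; $\hat L(3,4)$, of an arrangement in which one line contains a point of multiplicity $3$ and a point of multiplicity $4$, all other multiple points being double; $L(\Delta)$, of $(x^2-y^2)(x^2-z^2)(y^2-z^2)=0$. **Proposition 5.3.** The set of free arrangements of $6$ lines is $A(6,19)\cup A(6,21)\cup A(6,25)$, and the set of nearly free arrangements of $6$ lines is $A(6,18)$. Moreover: 1. The set $A(6,18)$ has exactly two irreducible components, namely $A(L(6,4))$, of dimension $10$, and $A(L'(3,3))$, of dimension $9$; they consist only of nearly free arrangements, with exponents $(d_1,d_2)=(2,4)$ and $(d_1,d_2)=(3,3)$ respectively. 2. The set $A(6,19)$ has exactly two irreducible components, namely $A(\hat L(3,4))$, of dimension $9$, and $A(L(\Delta))$, of dimension $8$; they consist only of free arrangements with exponents $(d_1,d_2)=(2,3)$. 3. The set $A(6,21)$ is irreducible, of dimension $9$, and consists only of free arrangements with exponents $(d_1,d_2)=(1,4)$. 4. The set $A(6,25)$ is irreducible, of dimension $8$, and consists only of free arrangements with exponents $(d_1,d_2)=(0,5)$. -/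

import Mathlib

open MvPolynomial

namespace PlaneArr

/-! ### Plane curves and the Zariski topology on their parameter space -/

/-- The graded polynomial ring `ℂ[x, y, z]`. -/
abbrev S : Type := MvPolynomial (Fin 3) ℂ

/-- The projective space `ℙ(S_d)` of plane curves of degree `d`. -/
def Curve (d : ℕ) : Type :=
  Projectivization ℂ (homogeneousSubmodule (Fin 3) ℂ d)

/-- A defining polynomial of a curve (well defined up to a nonzero scalar). -/
noncomputable def Curve.form {d : ℕ} (p : Curve d) : S :=
  ((Projectivization.rep p : homogeneousSubmodule (Fin 3) ℂ d) : S)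

/-- The Zariski topology on `ℙ(S_d)`: it is generated by the complements `{F ≠ 0}` of the
hypersurfaces defined by homogeneous polynomials `F` in the coefficients of the curve (the variable
of `F` with index `m` stands for the coefficient of the monomial `m`; variables whose index does not
have degree `d` take the value `0`). These sets are stable under finite intersections, so that the
closed sets are exactly the zero loci of families of homogeneous polynomials. -/
instance Curve.zariski (d : ℕ) : TopologicalSpace (Curve d) :=
  TopologicalSpace.generateFrom
    {U | ∃ (n : ℕ) (F : MvPolynomial (Fin 3 →₀ ℕ) ℂ), F.IsHomogeneous n ∧
      U = {p : Curve d | eval (fun m => coeff m p.form) F ≠ 0}}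

/-- The irreducible components of a subset `A` of a topological space (for the induced topology),
seen as subsets of the ambient space. -/
def componentsOf {T : Type*} [TopologicalSpace T] (A : Set T) : Set (Set T) :=
  (fun Z : Set A => Subtype.val '' Z) '' irreducibleComponents A

/-! ### Line arrangements -/

/-- The projective plane over `ℂ`. It serves both for the points `[v]` and, through
`[a] ↦ (a₀ x + a₁ y + a₂ z = 0)`, for the lines. -/
abbrev Plane : Type := Projectivization ℂ (Fin 3 → ℂ)

/-- The linear form `a₀ x + a₁ y + a₂ z`. -/
noncomputable def linearForm (a : Fin 3 → ℂ) : S := ∑ i, C (a i) * X i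

lemma linearForm_isHomogeneous (a : Fin 3 → ℂ) : (linearForm a).IsHomogeneous 1 :=
  IsHomogeneous.sum _ _ _ fun i _ => by
    simpa using (isHomogeneous_C (Fin 3) (a i)).mul (isHomogeneous_X ℂ i)

lemma linearForm_ne_zero {a : Fin 3 → ℂ} (ha : a ≠ 0) : linearForm a ≠ 0 := by
  intro h
  apply ha
  funext j
  have h1 := congrArg (eval (Pi.single j (1 : ℂ))) h
  simpa [linearForm, Pi.single_apply] using h1

lemma prod_linearForm_mem {d : ℕ} (l : Fin d → Plane) :
    ∏ i, linearForm (l i).rep ∈ homogeneousSubmodule (Fin 3) ℂ d := by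
  have h := IsHomogeneous.prod Finset.univ (fun i => linearForm (l i).rep) (fun _ => 1)
    (fun i _ => linearForm_isHomogeneous _)
  simpa [mem_homogeneousSubmodule] using h

lemma prod_linearForm_ne_zero {d : ℕ} (l : Fin d → Plane) :
    (⟨∏ i, linearForm (l i).rep, prod_linearForm_mem l⟩ :
      homogeneousSubmodule (Fin 3) ℂ d) ≠ 0 := by
  intro h
  have h1 : ∏ i, linearForm (l i).rep = 0 := congrArg Subtype.val h
  exact Finset.prod_ne_zero_iff.mpr
    (fun i _ => linearForm_ne_zero (Projectivization.rep_nonzero _)) h1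

/-- The map `(ℓ₁, …, ℓ_d) ↦ ℓ₁ ⋯ ℓ_d` from `ℙ(S_1)^d` to `ℙ(S_d)`. -/
noncomputable def psi {d : ℕ} (l : Fin d → Plane) : Curve d :=
  Projectivization.mk ℂ ⟨∏ i, linearForm (l i).rep, prod_linearForm_mem l⟩
    (prod_linearForm_ne_zero l)

/-- The space `X(d)` of ordered arrangements of `d` distinct lines. -/
def orderedArrangements (d : ℕ) : Set (Fin d → Plane) := {l | Function.Injective l}

/-- The space `A(d)` of arrangements of `d` distinct lines. -/
def arrangements (d : ℕ) : Set (Curve d) := psi '' orderedArrangements d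

/-! ### The total Tjurina number -/

/-- The index of an affine chart around the point `[v]`. -/
noncomputable def chart (v : Fin 3 → ℂ) : Fin 3 :=
  if v 0 ≠ 0 then 0 else if v 1 ≠ 0 then 1 else 2

/-- The local equation of `f = 0` at `[v]`, in affine coordinates centred at this point: the
coordinate with index `i = chart v` is kept constant, equal to `v i`, and the two others are
translated by the corresponding coordinates of `v`. -/
noncomputable def localEquation (f : S) (v : Fin 3 → ℂ) : MvPolynomial (Fin 2) ℂ :=
  aeval (Fin.insertNth (α := fun _ => MvPolynomial (Fin 2) ℂ) (chart v) (C (v (chart v)))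
    (fun j => C (v ((chart v).succAbove j)) + X j)) f

/-- The Tjurina ideal `(g, ∂g/∂s, ∂g/∂t)` in `ℂ⟦s, t⟧`. -/
noncomputable def tjurinaIdeal (g : MvPolynomial (Fin 2) ℂ) :
    Ideal (MvPowerSeries (Fin 2) ℂ) :=
  Ideal.span {(g : MvPowerSeries (Fin 2) ℂ), (pderiv 0 g).toMvPowerSeries,
    (pderiv 1 g).toMvPowerSeries}

/-- The Tjurina number of the curve `f = 0` at `[v]`. It is the dimension of the Tjurina algebra
(finite-dimensional when the curve is reduced), and it is `0` exactly at the points which are smooth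
or not on the curve. -/
noncomputable def localTjurina (f : S) (v : Fin 3 → ℂ) : ℕ :=
  Module.finrank ℂ (MvPowerSeries (Fin 2) ℂ ⧸ tjurinaIdeal (localEquation f v))

/-- The total Tjurina number of a reduced curve: the sum of the Tjurina numbers of its (finitely
many) singular points. -/
noncomputable def tjurina {d : ℕ} (p : Curve d) : ℕ :=
  ∑ᶠ q : Plane, localTjurina p.form q.rep

/-- The set `A(d, τ)` of arrangements of `d` lines with total Tjurina number `τ`. -/
def arrangementsTau (d τ : ℕ) : Set (Curve d) := {p ∈ arrangements d | tjurina p = τ}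

/-! ### Free and nearly free curves -/

/-- The map `(a, b, c) ↦ a f_x + b f_y + c f_z`. -/
noncomputable def gradMap (f : S) : (Fin 3 → S) →ₗ[S] S :=
  Fintype.linearCombination S fun i => pderiv i f

/-- The module `AR(f)` of Jacobian syzygies of `f`. -/
noncomputable def AR (f : S) : Submodule S (Fin 3 → S) := LinearMap.ker (gradMap f)

/-- The curve is free with exponents `d₁ ≤ d₂`: the graded module `AR(f)` is isomorphic to
`S(-d₁) ⊕ S(-d₂)`, that is, it has a basis of two homogeneous elements of degrees `d₁`, `d₂`. -/
def IsFreeWith {d : ℕ} (p : Curve d) (d₁ d₂ : ℕ) : Prop :=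
  d₁ ≤ d₂ ∧ ∃ b : Module.Basis (Fin 2) S (AR p.form),
    (∀ j, ((b 0 : Fin 3 → S) j).IsHomogeneous d₁) ∧
    (∀ j, ((b 1 : Fin 3 → S) j).IsHomogeneous d₂)

/-- The curve is a free divisor. -/
def IsFree {d : ℕ} (p : Curve d) : Prop := ∃ d₁ d₂, IsFreeWith p d₁ d₂

/-- The curve is nearly free with exponents `1 ≤ d₁ ≤ d₂`: the Milnor algebra
`S / (f_x, f_y, f_z)` has a minimal graded resolution
`0 → S(-d-d₂) → S(-d-d₁+1) ⊕ S(-d-d₂+1)² → S(-d+1)³ → S`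
whose last map is `(f_x, f_y, f_z)`. The rows of `r` are the images of the generators of the second
module and `c` is the image of the generator of the first one; as all entries are homogeneous of
positive degree, such a resolution is minimal. -/
def IsNearlyFreeWith {d : ℕ} (p : Curve d) (d₁ d₂ : ℕ) : Prop :=
  1 ≤ d₁ ∧ d₁ ≤ d₂ ∧ ∃ (r : Fin 3 → Fin 3 → S) (c : Fin 3 → S),
    (∀ j, (r 0 j).IsHomogeneous d₁) ∧ (∀ j, (r 1 j).IsHomogeneous d₂) ∧
    (∀ j, (r 2 j).IsHomogeneous d₂) ∧
    (c 0).IsHomogeneous (d₂ - d₁ + 1) ∧ (c 1).IsHomogeneous 1 ∧ (c 2).IsHomogeneous 1 ∧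
    Function.Injective (LinearMap.toSpanSingleton S (Fin 3 → S) c) ∧
    Function.Exact (LinearMap.toSpanSingleton S (Fin 3 → S) c) (Fintype.linearCombination S r) ∧
    Function.Exact (Fintype.linearCombination S r) (gradMap p.form)

/-- The curve is a nearly free divisor. -/
def IsNearlyFree {d : ℕ} (p : Curve d) : Prop := ∃ d₁ d₂, IsNearlyFreeWith p d₁ d₂

/-! ### Intersection lattices and the strata `A(L)` -/

/-- The intersection lattice of the arrangement of the planes `a i ⬝ᵥ v = 0` in `ℂ³`: the set of all
intersections of these planes (with `ℂ³` as the empty intersection). It is ordered by inclusion; the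
opposite order has the same isomorphisms. -/
def intersectionLattice {d : ℕ} (a : Fin d → Fin 3 → ℂ) : Set (Set (Fin 3 → ℂ)) :=
  Set.range fun I : Finset (Fin d) => ⋂ i ∈ I, {v : Fin 3 → ℂ | a i ⬝ᵥ v = 0}

/-- The intersection lattice of an ordered line arrangement. -/
def latticeOf {d : ℕ} (l : Fin d → Plane) : Set (Set (Fin 3 → ℂ)) :=
  intersectionLattice fun i => (l i).rep

/-- The set `A(L)` of arrangements of `d` lines with intersection lattice isomorphic to `L`. -/
def stratum (d : ℕ) (L : Set (Set (Fin 3 → ℂ))) : Set (Curve d) :=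
  psi '' {l ∈ orderedArrangements d | Nonempty (latticeOf l ≃o L)}

/-- The number of lines of an arrangement that pass through the point `q`. -/
noncomputable def multiplicity {d : ℕ} (l : Fin d → Plane) (q : Plane) : ℕ :=
  {i | (l i).rep ⬝ᵥ q.rep = 0}.ncard

/-- `A(L(d, m))`, where `L(d, m)` is the lattice of an arrangement of `d` lines with one point of
multiplicity `m` and no other multiple points than double points. -/
def stratumL (d m : ℕ) : Set (Curve d) :=
  {p | ∃ l ∈ orderedArrangements d,
    (∃ q, multiplicity l q = m ∧ ∀ q', q' ≠ q → multiplicity l q' ≤ 2) ∧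
    p ∈ stratum d (latticeOf l)}

/-- `A(L̂(m₁, m₂))`, where `L̂(m₁, m₂)` is the lattice of an arrangement of `m₁ + m₂ - 1` lines such
that one of the lines contains a point of multiplicity `m₁` and another point of multiplicity `m₂`,
and such that all other multiple points are double points. -/
def stratumLHat (m₁ m₂ : ℕ) : Set (Curve (m₁ + m₂ - 1)) :=
  {p | ∃ l ∈ orderedArrangements (m₁ + m₂ - 1),
    (∃ i q₁ q₂, q₁ ≠ q₂ ∧ (l i).rep ⬝ᵥ q₁.rep = 0 ∧ (l i).rep ⬝ᵥ q₂.rep = 0 ∧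
      multiplicity l q₁ = m₁ ∧ multiplicity l q₂ = m₂ ∧
      ∀ q, q ≠ q₁ → q ≠ q₂ → multiplicity l q ≤ 2) ∧
    p ∈ stratum (m₁ + m₂ - 1) (latticeOf l)}

/-- The lattice `L'(3, 3)` of the arrangement `x (y - z) (x - y) (x - 2y) (x - 2z) (x - 3z) = 0`. -/
def latticeLPrime33 : Set (Set (Fin 3 → ℂ)) :=
  intersectionLattice
    ![![1, 0, 0], ![0, 1, -1], ![1, -1, 0], ![1, -2, 0], ![1, 0, -2], ![1, 0, -3]]

/-- The lattice `L(Δ)` of the arrangement `(x² - y²) (x² - z²) (y² - z²) = 0`. -/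
def latticeLDelta : Set (Set (Fin 3 → ℂ)) :=
  intersectionLattice
    ![![1, -1, 0], ![1, 1, 0], ![1, 0, -1], ![1, 0, 1], ![0, 1, -1], ![0, 1, 1]]

end PlaneArr

open PlaneArr

namespace PlaneArr

open scoped Matrix

/-! ### Linear forms in three variables and the lines of a curve. -/

section

/-! An arrangement of six lines is governed by its concurrent triples. If at least four lines meet
in a point, it has one of the types `type6`, `type5`, `type4`, `type43`. Otherwise it contains a
triangle whose vertices are triple points (`type333`, or `type3333` when the other three lines are
concurrent too), or its concurrent triples are among those of a configuration with two triple points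
(`weakCurves`); this is `arrangements_six`. At a point of multiplicity m the curve is, up to a unit,
a product of m distinct linear forms in two variables, whose Jacobian ideal has colength (m - 1)^2.
The total Tjurina number is the sum of these squares: 25, 21, 18, 19, 18, 19 for the six types and
at most 17 for the rest. An isomorphism of intersection lattices is a relabelling that preserves
concurrency (`nonempty_orderIso_iff`), so the strata in question are the types.

Geometry. Up to closure, each type is the image of a Zariski open subset of an affine space of
normal forms, in which lines are vectors (1, y, z) or members A + βB of a pencil. Hence it is
irreducible. Its dimension is at most the number of parameters, by a transcendence degree count on
the affine cone, and at least that number, because freeing the parameters one by one gives a strict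
chain of irreducible families (`irreducible_and_dim`). A limit of arrangements keeps their
concurrent triples, by an integrality argument (`exists_rep_of_mem_closure`). Comparing triples
shows that neither of the two types with τ = 18 meets the closure of the other, and likewise for τ =
19.

Algebra. The cross product of two Jacobian syzygies is H times the gradient of f
(`exists_cross_eq`). Comparing degrees gives Saito's criterion for freeness and an analogue for
three syzygies with one relation; explicit vector fields then settle the six types. Conversely H
must be a unit for a basis, so the exponents add up to 5 in the free case and, by a similar
argument, to 6 in the nearly free case. For weak arrangements, removing lines one at a time shows
that three syzygies of degree 3 are always dependent over ℂ, hence that no nonzero one has degree at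
most 2; this excludes both properties. Finally, no curve is both free and nearly free, since `AR`
would need three generators and also be generated by two. -/

lemma eval_aeval {σ τ : Type*} (v : τ → ℂ) (g : σ → MvPolynomial τ ℂ) (F : MvPolynomial σ ℂ) :
    eval v (aeval g F) = eval (fun i => eval v (g i)) F := by
  induction F using MvPolynomial.induction_on with
  | C c => simp
  | add p q hp hq => rw [map_add, map_add, hp, hq, map_add]
  | mul_X p i hp => rw [map_mul, map_mul, hp, aeval_X, map_mul, eval_X]

lemma eval_linearForm (a v : Fin 3 → ℂ) : eval v (linearForm a) = a ⬝ᵥ v := by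
  simp [linearForm, dotProduct]

lemma linearForm_smul (c : ℂ) (a : Fin 3 → ℂ) : linearForm (c • a) = C c * linearForm a := by
  simp [linearForm, Finset.mul_sum, mul_assoc]

lemma linearForm_add (a b : Fin 3 → ℂ) : linearForm (a + b) = linearForm a + linearForm b := by
  simp [linearForm, add_mul, Finset.sum_add_distrib]

lemma pderiv_linearForm (a : Fin 3 → ℂ) (i : Fin 3) : pderiv i (linearForm a) = C (a i) := by
  simp [linearForm, pderiv_X, Pi.single_apply]

/-- The substitution that eliminates the variable `X k` by means of the linear form of `a`. -/
noncomputable def elimHom (a : Fin 3 → ℂ) (k : Fin 3) : S →ₐ[ℂ] S :=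
  aeval fun i => X i - if i = k then C (a k)⁻¹ * linearForm a else 0

/-- The substitution moves each variable by a multiple of the form, so it is the identity modulo the
form. -/
lemma linearForm_dvd_sub_elimHom (a : Fin 3 → ℂ) (k : Fin 3) (F : S) :
    linearForm a ∣ F - elimHom a k F := by
  induction F using MvPolynomial.induction_on with
  | C c => simp [elimHom]
  | add p q hp hq =>
    rw [map_add]
    have := dvd_add hp hq
    convert this using 1
    ring
  | mul_X p i hp =>
    have h1 : linearForm a ∣ X i - elimHom a k (X i) := by
      rw [elimHom, aeval_X]
      split_ifs <;> simp
    have h2 : p * X i - elimHom a k (p * X i) =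
        (p - elimHom a k p) * X i + elimHom a k p * (X i - elimHom a k (X i)) := by
      rw [map_mul]; ring
    rw [h2]
    exact dvd_add (hp.mul_right _) (h1.mul_left _)

lemma elimHom_linearForm {a : Fin 3 → ℂ} {k : Fin 3} (hk : a k ≠ 0) :
    elimHom a k (linearForm a) = 0 := by
  have h : elimHom a k (linearForm a) =
      linearForm a - C (a k) * (C (a k)⁻¹ * linearForm a) := by
    conv_lhs => rw [linearForm]
    rw [map_sum]
    simp only [map_mul, elimHom, aeval_X, algHom_C, mul_sub, Finset.sum_sub_distrib, mul_ite,
      mul_zero, Finset.sum_ite_eq', Finset.mem_univ, if_true, algebraMap_eq]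
    rfl
  rw [h, ← mul_assoc, ← C_mul, mul_inv_cancel₀ hk]
  simp

/-- `elimHom` kills the form and is the identity modulo it, so its kernel is the principal ideal of
the form. Primality follows, since the target is a domain. -/
lemma linearForm_dvd_iff {a : Fin 3 → ℂ} {k : Fin 3} (hk : a k ≠ 0) {F : S} :
    linearForm a ∣ F ↔ elimHom a k F = 0 := by
  constructor
  · rintro ⟨G, rfl⟩
    rw [map_mul, elimHom_linearForm hk, zero_mul]
  · intro h
    simpa [h] using linearForm_dvd_sub_elimHom a k F

lemma prime_linearForm {a : Fin 3 → ℂ} (ha : a ≠ 0) : Prime (linearForm a) := by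
  obtain ⟨k, hk⟩ := Function.ne_iff.mp ha
  refine ⟨linearForm_ne_zero ha, fun hu => ?_, fun F G h => ?_⟩
  · have := (linearForm_dvd_iff hk (F := 1)).mp hu.dvd
    simp at this
  · rw [linearForm_dvd_iff hk, map_mul, mul_eq_zero] at h
    rwa [linearForm_dvd_iff hk, linearForm_dvd_iff hk]

lemma linearForm_dvd_of_eval {a : Fin 3 → ℂ} (ha : a ≠ 0) {F : S}
    (h : ∀ v, a ⬝ᵥ v = 0 → eval v F = 0) : linearForm a ∣ F := by
  obtain ⟨k, hk⟩ := Function.ne_iff.mp ha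
  rw [linearForm_dvd_iff hk]
  apply MvPolynomial.funext
  intro v
  -- The point `w` is the projection of `v` onto the plane of `a` along the `k`-th axis.
  set w : Fin 3 → ℂ := fun i => eval v (elimHom a k (X i)) with hw
  have h1 : eval v (elimHom a k F) = eval w F := by
    rw [elimHom, eval_aeval]
    simp only [hw, elimHom, aeval_X]
  rw [h1, map_zero]
  apply h
  have h2 : eval v (elimHom a k (linearForm a)) = 0 := by rw [elimHom_linearForm hk, map_zero]
  rw [linearForm, map_sum, map_sum] at h2
  simpa [dotProduct, hw, elimHom] using h2

lemma cross_eq_zero_of_dvd {a b : Fin 3 → ℂ}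
    (h : linearForm a ∣ linearForm b) : a ⨯₃ b = 0 := by
  have key : ∀ v, a ⬝ᵥ v = 0 → b ⬝ᵥ v = 0 := by
    intro v hv
    obtain ⟨G, hG⟩ := h
    rw [← eval_linearForm, hG, map_mul, eval_linearForm, hv, zero_mul]
  -- The three test vectors are orthogonal to `a`, and their products with `b` are, up to sign, the
  -- coordinates of the cross product.
  have h0 := key ![0, a 2, -a 1] (by simp [dotProduct, Fin.sum_univ_three]; ring)
  have h1 := key ![a 2, 0, -a 0] (by simp [dotProduct, Fin.sum_univ_three]; ring)
  have h2 := key ![a 1, -a 0, 0] (by simp [dotProduct, Fin.sum_univ_three]; ring)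
  simp [dotProduct, Fin.sum_univ_three] at h0 h1 h2
  rw [cross_apply]
  ext i
  fin_cases i <;> simp <;>
    first | linear_combination -h0 | linear_combination h1 | linear_combination -h2

/-- Proportional vectors. -/
lemma cross_eq_zero_iff {a b : Fin 3 → ℂ} (ha : a ≠ 0) : a ⨯₃ b = 0 ↔ ∃ c : ℂ, b = c • a := by
  constructor
  · intro h
    obtain ⟨k, hk⟩ := Function.ne_iff.mp ha
    refine ⟨b k / a k, ?_⟩
    rw [cross_apply] at h
    have h0 := congrFun h 0
    have h1 := congrFun h 1
    have h2 := congrFun h 2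
    simp at h0 h1 h2 hk
    ext i
    simp only [Pi.smul_apply, smul_eq_mul]
    field_simp
    fin_cases k <;> fin_cases i <;> simp <;>
      first | done | ring1 | linear_combination h0 | linear_combination h1 | linear_combination h2 |
        linear_combination -h0 | linear_combination -h1 | linear_combination -h2
  · rintro ⟨c, rfl⟩
    simp

/-- The vectors are nonzero and pairwise not proportional. -/
def Distinct {ι : Type*} (a : ι → Fin 3 → ℂ) : Prop :=
  (∀ i, a i ≠ 0) ∧ ∀ i j, i ≠ j → a i ⨯₃ a j ≠ 0

/-- The vectors `a` are the coefficients of the lines of the curve `p`. -/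
def Rep {d : ℕ} (p : Curve d) (a : Fin d → Fin 3 → ℂ) : Prop :=
  ∃ c : ℂ, c ≠ 0 ∧ p.form = C c * ∏ i, linearForm (a i)

variable {d : ℕ}

lemma Curve.form_ne_zero (p : Curve d) : p.form ≠ 0 := by
  intro h
  exact Projectivization.rep_nonzero p (Subtype.ext h)

lemma Curve.form_isHomogeneous (p : Curve d) : p.form.IsHomogeneous d :=
  (mem_homogeneousSubmodule _ _).mp (Projectivization.rep p).2

lemma Curve.eq_of_form {p q : Curve d} {c : ℂ} (h : p.form = C c * q.form) : p = q := by
  have h1 : Projectivization.rep p = c • Projectivization.rep q := by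
    apply Subtype.ext
    exact h.trans (by rw [C_mul']; rfl)
  rw [← Projectivization.mk_rep p, ← Projectivization.mk_rep q]
  exact (Projectivization.mk_eq_mk_iff' _ _ _ _ _).mpr ⟨c, h1.symm⟩

lemma Rep.eq {p q : Curve d} {a : Fin d → Fin 3 → ℂ} (hp : Rep p a) (hq : Rep q a) : p = q := by
  obtain ⟨c, hc, h⟩ := hp
  obtain ⟨e, he, h'⟩ := hq
  apply Curve.eq_of_form (c := c * e⁻¹)
  rw [h, h', ← mul_assoc, ← C_mul, mul_assoc, inv_mul_cancel₀ he, mul_one]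

lemma Rep.smul {p : Curve d} {a b : Fin d → Fin 3 → ℂ} (hp : Rep p a)
    (h : ∀ i, ∃ c : ℂ, c ≠ 0 ∧ a i = c • b i) : Rep p b := by
  obtain ⟨e, he, h'⟩ := hp
  choose c hc hcb using h
  refine ⟨e * ∏ i, c i, mul_ne_zero he (Finset.prod_ne_zero_iff.mpr fun i _ => hc i), ?_⟩
  rw [h', C_mul, map_prod, mul_assoc, ← Finset.prod_mul_distrib]
  congr 1
  exact Finset.prod_congr rfl fun i _ => by rw [hcb i, linearForm_smul]

lemma Rep.perm {p : Curve d} {a : Fin d → Fin 3 → ℂ} (hp : Rep p a) (σ : Equiv.Perm (Fin d)) :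
    Rep p (a ∘ σ) := by
  obtain ⟨c, hc, h⟩ := hp
  exact ⟨c, hc, by rw [h]; congr 1; exact (Equiv.prod_comp σ fun i => linearForm (a i)).symm⟩

lemma rep_psi (l : Fin d → Plane) : Rep (psi l) fun i => (l i).rep := by
  have h := Projectivization.mk_rep (psi l)
  rw [psi] at h
  obtain ⟨c, hc⟩ := (Projectivization.mk_eq_mk_iff _ _ _ _ _).mp h
  refine ⟨c, c.ne_zero, ?_⟩
  have h2 := congrArg Subtype.val hc
  rw [C_mul']
  exact h2.symm

lemma exists_rep_mk (a : Fin 3 → ℂ) (ha : a ≠ 0) :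
    ∃ c : ℂ, c ≠ 0 ∧ (Projectivization.mk ℂ a ha).rep = c • a := by
  obtain ⟨c, hc⟩ := Projectivization.exists_smul_eq_mk_rep ℂ a ha
  exact ⟨c, c.ne_zero, hc.symm⟩

lemma rep_psi_mk (a : Fin d → Fin 3 → ℂ) (ha : ∀ i, a i ≠ 0) :
    Rep (psi fun i => Projectivization.mk ℂ (a i) (ha i)) a :=
  (rep_psi _).smul fun i => exists_rep_mk (a i) (ha i)

lemma distinct_rep_iff {l : Fin d → Plane} :
    (Distinct fun i => (l i).rep) ↔ l ∈ orderedArrangements d := by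
  constructor
  · rintro ⟨-, h⟩ i j hij
    by_contra hne
    apply h i j hne
    simp [hij]
  · intro h
    refine ⟨fun i => Projectivization.rep_nonzero _, fun i j hij h0 => hij (h ?_)⟩
    rw [← Projectivization.mk_rep (l i), ← Projectivization.mk_rep (l j)]
    exact (Projectivization.mk_eq_mk_iff_crossProduct_eq_zero _ _).mpr h0

lemma mk_mem_orderedArrangements {a : Fin d → Fin 3 → ℂ} (ha : Distinct a) :
    (fun i => Projectivization.mk ℂ (a i) (ha.1 i)) ∈ orderedArrangements d := by
  intro i j hij
  by_contra hne
  exact ha.2 i j hne ((Projectivization.mk_eq_mk_iff_crossProduct_eq_zero _ _).mp hij)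

lemma mem_arrangements_iff {p : Curve d} :
    p ∈ arrangements d ↔ ∃ a : Fin d → Fin 3 → ℂ, Distinct a ∧ Rep p a := by
  constructor
  · rintro ⟨l, hl, rfl⟩
    exact ⟨_, distinct_rep_iff.mpr hl, rep_psi l⟩
  · rintro ⟨a, ha, hp⟩
    exact ⟨_, mk_mem_orderedArrangements ha, (rep_psi_mk a ha.1).eq hp⟩

/-- Unique factorisation: each prime `linearForm (a i)` divides the product of the forms of `b`,
hence one of them, and is then proportional to it. -/
lemma Rep.exists_perm {p : Curve d} {a b : Fin d → Fin 3 → ℂ} (ha : Rep p a) (hb : Rep p b)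
    (da : Distinct a) (db : ∀ i, b i ≠ 0) :
    ∃ σ : Equiv.Perm (Fin d), ∀ i, ∃ c : ℂ, c ≠ 0 ∧ b (σ i) = c • a i := by
  obtain ⟨c, hc, h⟩ := ha
  obtain ⟨e, he, h'⟩ := hb
  have key : ∀ i, ∃ j, ∃ c : ℂ, c ≠ 0 ∧ b j = c • a i := by
    intro i
    have h1 : linearForm (a i) ∣ C e * ∏ j, linearForm (b j) := by
      rw [← h', h]
      exact (Finset.dvd_prod_of_mem _ (Finset.mem_univ i)).mul_left _
    have hp := prime_linearForm (da.1 i)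
    rcases hp.dvd_or_dvd h1 with h2 | h2
    · exact absurd (isUnit_of_dvd_unit h2 ((isUnit_iff_ne_zero.mpr he).map C)) hp.not_isUnit
    · obtain ⟨j, -, hj⟩ := (hp.dvd_finsetProd_iff _).mp h2
      obtain ⟨s, hs⟩ := (cross_eq_zero_iff (da.1 i)).mp (cross_eq_zero_of_dvd hj)
      refine ⟨j, s, ?_, hs⟩
      rintro rfl
      exact db j (by simpa using hs)
  choose σ s hs hσ using key
  have inj : Function.Injective σ := by
    intro i j hij
    by_contra hne
    apply da.2 i j hne
    have h1 : s i • a i = s j • a j := by rw [← hσ, ← hσ, hij]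
    refine (cross_eq_zero_iff (da.1 i)).mpr ⟨(s j)⁻¹ * s i, ?_⟩
    rw [mul_smul, h1, smul_smul, inv_mul_cancel₀ (hs j), one_smul]
  exact ⟨Equiv.ofBijective σ (Finite.injective_iff_bijective.mp inj), fun i => ⟨s i, hs i, hσ i⟩⟩

end

/-! ### Coefficients of curves, basic open sets and closures. -/

section
variable {d : ℕ}

/-- The coefficients of a polynomial, as a point of affine space. -/
noncomputable def coeffs {R : Type*} [CommSemiring R] (f : MvPolynomial (Fin 3) R) :
    (Fin 3 →₀ ℕ) → R := fun m => coeff m f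

lemma eval_smul_of_isHomogeneous {σ : Type*} {F : MvPolynomial σ ℂ} {n : ℕ}
    (hF : F.IsHomogeneous n) (c : ℂ) (v : σ → ℂ) : eval (c • v) F = c ^ n * eval v F := by
  rw [eval_eq, eval_eq, Finset.mul_sum]
  refine Finset.sum_congr rfl fun m hm => ?_
  have h1 := hF (mem_support_iff.mp hm)
  rw [Finsupp.weight_apply] at h1
  simp only [Pi.smul_apply, smul_eq_mul, mul_pow, Finset.prod_mul_distrib, Finset.prod_pow_eq_pow_sum]
  have h2 : ∑ i ∈ m.support, m i = n := by
    rw [← h1]; simp [Finsupp.sum]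
  rw [h2]
  ring

lemma coeffs_C_mul (c : ℂ) (f : S) : coeffs (C c * f) = c • coeffs f := by
  ext m
  simp [coeffs]

/-- The basic open subset `F ≠ 0` of the space of curves. -/
def basicOpen (d : ℕ) (F : MvPolynomial (Fin 3 →₀ ℕ) ℂ) : Set (Curve d) :=
  {p | eval (coeffs p.form) F ≠ 0}

lemma isOpen_basicOpen {F : MvPolynomial (Fin 3 →₀ ℕ) ℂ} {n : ℕ} (hF : F.IsHomogeneous n) :
    IsOpen (basicOpen d F) :=
  TopologicalSpace.isOpen_generateFrom_of_mem ⟨n, F, hF, rfl⟩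

/-- The generating sets already form a basis: the intersection of two of them is given by the
product of the two homogeneous polynomials. -/
lemma exists_basicOpen {U : Set (Curve d)} (hU : IsOpen U) {p : Curve d} (hp : p ∈ U) :
    ∃ (n : ℕ) (F : MvPolynomial (Fin 3 →₀ ℕ) ℂ), F.IsHomogeneous n ∧
      p ∈ basicOpen d F ∧ basicOpen d F ⊆ U := by
  induction hU with
  | basic s hs =>
    obtain ⟨n, F, hF, rfl⟩ := hs
    exact ⟨n, F, hF, hp, subset_rfl⟩
  | univ => exact ⟨0, 1, isHomogeneous_one _ _, by simp [basicOpen], Set.subset_univ _⟩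
  | inter s t _ _ hs ht =>
    obtain ⟨n, F, hF, hpF, hFs⟩ := hs hp.1
    obtain ⟨m, G, hG, hpG, hGs⟩ := ht hp.2
    refine ⟨n + m, F * G, hF.mul hG, ?_, fun q hq => ?_⟩
    · simpa [basicOpen] using ⟨hpF, hpG⟩
    · have : eval (coeffs q.form) F ≠ 0 ∧ eval (coeffs q.form) G ≠ 0 := by
        simpa [basicOpen] using hq
      exact ⟨hFs this.1, hGs this.2⟩
  | sUnion K _ ih =>
    obtain ⟨s, hs, hps⟩ := hp
    obtain ⟨n, F, hF, hpF, hFs⟩ := ih s hs hps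
    exact ⟨n, F, hF, hpF, hFs.trans (Set.subset_sUnion_of_mem hs)⟩

lemma mem_basicOpen_iff {F : MvPolynomial (Fin 3 →₀ ℕ) ℂ} {n : ℕ} (hF : F.IsHomogeneous n)
    {p : Curve d} {a : Fin d → Fin 3 → ℂ} (hp : Rep p a) :
    p ∈ basicOpen d F ↔ eval (coeffs (∏ i, linearForm (a i))) F ≠ 0 := by
  obtain ⟨c, hc, h⟩ := hp
  rw [basicOpen, Set.mem_ofPred_eq, h, coeffs_C_mul, eval_smul_of_isHomogeneous hF]
  simp [hc]

lemma mem_closure_iff_homogeneous {A : Set (Curve d)} {p : Curve d} :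
    p ∈ closure A ↔ ∀ (n : ℕ) (F : MvPolynomial (Fin 3 →₀ ℕ) ℂ), F.IsHomogeneous n →
      (∀ q ∈ A, eval (coeffs q.form) F = 0) → eval (coeffs p.form) F = 0 := by
  constructor
  · intro hp n F hF h
    by_contra hne
    obtain ⟨q, hq, hqA⟩ := mem_closure_iff.mp hp _ (isOpen_basicOpen hF) hne
    exact hq (h q hqA)
  · intro h
    rw [mem_closure_iff]
    intro U hU hp
    obtain ⟨n, F, hF, hpF, hFU⟩ := exists_basicOpen hU hp
    by_contra hne
    refine hpF (h n F hF fun q hq => ?_)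
    by_contra h0
    exact hne ⟨q, hFU h0, hq⟩

/-- The determinant of three vectors. -/
def tri {R : Type*} [CommRing R] (a b c : Fin 3 → R) : R :=
  a 0 * (b 1 * c 2 - b 2 * c 1) + a 1 * (b 2 * c 0 - b 0 * c 2) + a 2 * (b 0 * c 1 - b 1 * c 0)

/-! ### Families of arrangements -/

variable {ι : Type*}

/-- Open subsets of affine space for the Zariski topology. -/
def IsZOpen (D : Set (ι → ℂ)) : Prop :=
  ∀ t ∈ D, ∃ g : MvPolynomial ι ℂ, eval t g ≠ 0 ∧ ∀ s, eval s g ≠ 0 → s ∈ D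

lemma isZOpen_ne (g : MvPolynomial ι ℂ) : IsZOpen {t | eval t g ≠ 0} :=
  fun _ ht => ⟨g, ht, fun _ hs => hs⟩

lemma isZOpen_univ : IsZOpen (Set.univ : Set (ι → ℂ)) :=
  fun _ _ => ⟨1, by simp, fun _ _ => trivial⟩

lemma IsZOpen.inter {D E : Set (ι → ℂ)} (hD : IsZOpen D) (hE : IsZOpen E) : IsZOpen (D ∩ E) := by
  rintro t ⟨h1, h2⟩
  obtain ⟨g, hg, hgD⟩ := hD t h1
  obtain ⟨k, hk, hkE⟩ := hE t h2
  refine ⟨g * k, by simp [hg, hk], fun s hs => ?_⟩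
  have : eval s g ≠ 0 ∧ eval s k ≠ 0 := by simpa using hs
  exact ⟨hgD s this.1, hkE s this.2⟩

lemma isZOpen_forall {κ : Type*} [Finite κ] {D : κ → Set (ι → ℂ)} (h : ∀ k, IsZOpen (D k)) :
    IsZOpen {t | ∀ k, t ∈ D k} := by
  intro t ht
  cases nonempty_fintype κ
  choose g hg hgD using fun k => h k t (ht k)
  refine ⟨∏ k, g k, ?_, fun s hs k => hgD k s ?_⟩
  · rw [map_prod]; exact Finset.prod_ne_zero_iff.mpr fun k _ => hg k
  · rw [map_prod] at hs
    exact Finset.prod_ne_zero_iff.mp hs k (Finset.mem_univ k)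

lemma isZOpen_imp {P : Prop} {D : Set (ι → ℂ)} (h : P → IsZOpen D) :
    IsZOpen {t | P → t ∈ D} := by
  by_cases hP : P
  · simpa [hP] using h hP
  · simpa [hP] using isZOpen_univ

/-- The value of a vector of polynomials at a point. -/
noncomputable def evalVec {κ : Type*} (a : κ → Fin 3 → MvPolynomial ι ℂ) (t : ι → ℂ) :
    κ → Fin 3 → ℂ := fun i j => eval t (a i j)

lemma isZOpen_vec_ne {κ : Type*} (a : κ → MvPolynomial ι ℂ) :
    IsZOpen {t | (fun j => eval t (a j)) ≠ 0} := by
  intro t ht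
  obtain ⟨k, hk⟩ := Function.ne_iff.mp ht
  exact ⟨a k, hk, fun s hs => Function.ne_iff.mpr ⟨k, hs⟩⟩

lemma isZOpen_tri_ne {κ : Type*} (a : κ → Fin 3 → MvPolynomial ι ℂ) (i j k : κ) :
    IsZOpen {t | tri (evalVec a t i) (evalVec a t j) (evalVec a t k) ≠ 0} := by
  convert isZOpen_ne (tri (a i) (a j) (a k)) using 3 with t
  simp [tri, evalVec]

lemma isZOpen_distinct {κ : Type*} [Finite κ] (a : κ → Fin 3 → MvPolynomial ι ℂ) :
    IsZOpen {t | Distinct (evalVec a t)} := by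
  refine IsZOpen.inter (D := {t | ∀ i, evalVec a t i ≠ 0})
    (E := {t | ∀ i j, i ≠ j → evalVec a t i ⨯₃ evalVec a t j ≠ 0})
    (isZOpen_forall fun i => isZOpen_vec_ne (a i)) ?_
  refine isZOpen_forall (D := fun i => {t | ∀ j, i ≠ j → evalVec a t i ⨯₃ evalVec a t j ≠ 0})
    fun i => isZOpen_forall (D := fun j => {t | i ≠ j → evalVec a t i ⨯₃ evalVec a t j ≠ 0})
    fun j => isZOpen_imp (D := {t | evalVec a t i ⨯₃ evalVec a t j ≠ 0}) fun _ => ?_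
  convert isZOpen_vec_ne (a i ⨯₃ a j) using 4 with t
  rw [cross_apply, cross_apply]
  ext k
  fin_cases k <;> simp [evalVec]

/-- The set of curves of the arrangements `a t` for `t ∈ D`. -/
def family (a : Fin d → Fin 3 → MvPolynomial ι ℂ) (D : Set (ι → ℂ)) : Set (Curve d) :=
  {p | ∃ t ∈ D, Rep p (evalVec a t)}

/-- The product of the linear forms with given polynomial coefficients. -/
noncomputable def genericForm {R : Type*} [CommSemiring R] (a : Fin d → Fin 3 → R) :
    MvPolynomial (Fin 3) R := ∏ i, ∑ j, C (a i j) * X j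

/-- The polynomial `F` in the coefficients of a curve, evaluated on a family. -/
noncomputable def pull (a : Fin d → Fin 3 → MvPolynomial ι ℂ) (F : MvPolynomial (Fin 3 →₀ ℕ) ℂ) :
    MvPolynomial ι ℂ := aeval (coeffs (genericForm a)) F

lemma coeffs_genericForm (a : Fin d → Fin 3 → MvPolynomial ι ℂ) (t : ι → ℂ) :
    (fun m => eval t (coeffs (genericForm a) m)) = coeffs (∏ i, linearForm (evalVec a t i)) := by
  ext m
  rw [coeffs, coeffs, ← coeff_map]
  congr 1
  simp [genericForm, linearForm, evalVec, map_prod]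

lemma eval_pull (a : Fin d → Fin 3 → MvPolynomial ι ℂ) (F : MvPolynomial (Fin 3 →₀ ℕ) ℂ)
    (t : ι → ℂ) : eval t (pull a F) = eval (coeffs (∏ i, linearForm (evalVec a t i))) F := by
  rw [pull, eval_aeval, coeffs_genericForm]

/-- Two nonempty open subsets of the family pull back to nonvanishing loci of nonzero polynomials in
the parameters. A product of nonzero polynomials over ℂ has a nonzero value, so the open subsets
meet. -/
lemma family_isIrreducible {a : Fin d → Fin 3 → MvPolynomial ι ℂ} {D : Set (ι → ℂ)}
    (hD : IsZOpen D) (hne : D.Nonempty) (ha : ∀ t ∈ D, ∀ i, evalVec a t i ≠ 0) :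
    IsIrreducible (family a D) := by
  have hex : ∀ t ∈ D, ∃ p, Rep p (evalVec a t) := fun t ht => ⟨_, rep_psi_mk _ (ha t ht)⟩
  constructor
  · obtain ⟨t, ht⟩ := hne
    obtain ⟨p, hp⟩ := hex t ht
    exact ⟨p, t, ht, hp⟩
  · rintro U V hU hV ⟨p, ⟨t, ht, hp⟩, hpU⟩ ⟨q, ⟨s, hs, hq⟩, hqV⟩
    obtain ⟨n, F, hF, hpF, hFU⟩ := exists_basicOpen hU hpU
    obtain ⟨m, G, hG, hqG, hGV⟩ := exists_basicOpen hV hqV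
    obtain ⟨g, hg, hgD⟩ := hD t ht
    rw [mem_basicOpen_iff hF hp, ← eval_pull] at hpF
    rw [mem_basicOpen_iff hG hq, ← eval_pull] at hqG
    -- Each factor is nonzero because it has a nonzero value: `g` and `pull a F` at `t`, `pull a G`
    -- at `s`.
    have h1 : g * pull a F * pull a G ≠ 0 := by
      refine mul_ne_zero (mul_ne_zero ?_ ?_) ?_ <;> rintro h0 <;> simp [h0] at *
    obtain ⟨r, hr⟩ : ∃ r, eval r (g * pull a F * pull a G) ≠ 0 := by
      by_contra! h0
      exact h1 (MvPolynomial.funext fun r => by rw [h0 r, map_zero])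
    rw [map_mul, map_mul] at hr
    have hr1 := left_ne_zero_of_mul (left_ne_zero_of_mul hr)
    have hr2 := right_ne_zero_of_mul (left_ne_zero_of_mul hr)
    have hr3 := right_ne_zero_of_mul hr
    obtain ⟨x, hx⟩ := hex r (hgD r hr1)
    refine ⟨x, ⟨r, hgD r hr1, hx⟩, hFU ?_, hGV ?_⟩
    · rwa [mem_basicOpen_iff hF hx, ← eval_pull]
    · rwa [mem_basicOpen_iff hG hx, ← eval_pull]

/-- A point of a family over a line lies in the closure of the other members of the family. -/
lemma mem_closure_of_line {p : Curve d} {A : Set (Curve d)} {a b : Fin d → Fin 3 → ℂ}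
    (hp : Rep p a) (g : Polynomial ℂ) (hg : g ≠ 0)
    (h : ∀ s : ℂ, g.eval s ≠ 0 → ∃ q ∈ A, Rep q (a + s • b)) : p ∈ closure A := by
  rw [mem_closure_iff_homogeneous]
  intro n F hF hA
  by_contra hne
  have hpF := (mem_basicOpen_iff hF hp).mp hne
  set α : Fin d → Fin 3 → MvPolynomial Unit ℂ := fun i j => C (a i j) + X () * C (b i j) with hα
  have hev : ∀ s : ℂ, evalVec α (fun _ => s) = a + s • b := by
    intro s; ext i j; simp [evalVec, hα]
  -- `P` is the restriction of `F` to the line of arrangements. It does not vanish at 0, where the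
  -- arrangement is `a`, so only finitely many parameters are excluded by `g` and `P`.
  set P : Polynomial ℂ := aeval (fun _ => Polynomial.X) (pull α F) with hP
  have hPs : ∀ s, P.eval s = eval (fun _ => s) (pull α F) := by
    intro s
    rw [hP]
    generalize pull α F = Q
    induction Q using MvPolynomial.induction_on with
    | C c => simp
    | add p q hp hq => rw [map_add, Polynomial.eval_add, hp, hq, map_add]
    | mul_X p i hp => rw [map_mul, Polynomial.eval_mul, hp, aeval_X, map_mul, eval_X,
        Polynomial.eval_X]
  have hP0 : P ≠ 0 := by
    intro h0
    have := hPs 0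
    rw [h0, eval_pull, hev] at this
    simp only [zero_smul, add_zero, Polynomial.eval_zero] at this
    exact hpF this.symm
  obtain ⟨s, hs⟩ : ∃ s, (g * P).eval s ≠ 0 := by
    by_contra! h0
    exact mul_ne_zero hg hP0 (Polynomial.funext fun r => by rw [h0 r, Polynomial.eval_zero])
  rw [Polynomial.eval_mul] at hs
  obtain ⟨q, hq, hqa⟩ := h s (left_ne_zero_of_mul hs)
  have h1 := hA q hq
  have h2 : q ∈ basicOpen d F := by
    rw [mem_basicOpen_iff hF hqa, ← hev, ← eval_pull, ← hPs]
    exact right_ne_zero_of_mul hs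
  exact h2 h1

end

/-! ### Upper bounds for the Krull dimension: primes of the affine cone and transcendence degree. -/

section
variable {d : ℕ}

/-- A strictly increasing chain of prime ideals yields elements which are algebraically independent
modulo the smallest one. -/
lemma exists_algebraicIndependent_of_chain {k A : Type*} [Field k] [CommRing A] [Algebra k A]
    (m : ℕ) (p : ℕ → Ideal A) (hp : ∀ i, i ≤ m → (p i).IsPrime)
    (hlt : ∀ i, i < m → p i < p (i + 1)) :
    ∃ x : Fin m → A, ∀ P : MvPolynomial (Fin m) k, aeval x P ∈ p 0 → P = 0 := by
  induction m generalizing p with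
  | zero =>
    refine ⟨Fin.elim0, fun P hP => ?_⟩
    rw [eq_C_of_isEmpty P, aeval_C] at hP
    rw [eq_C_of_isEmpty P]
    by_contra hne
    have h0 : coeff 0 P ≠ 0 := fun h => hne (by rw [h, C_0])
    exact (hp 0 le_rfl).ne_top (Ideal.eq_top_of_isUnit_mem _ hP
      ((isUnit_iff_ne_zero.mpr h0).map (algebraMap k A)))
  | succ m ih =>
    obtain ⟨x, hx⟩ := ih (fun i => p (i + 1)) (fun i hi => hp _ (by omega))
      (fun i hi => hlt _ (by omega))
    -- The new element `y` lies in the second prime but not in the first; the others are independent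
    -- modulo the second prime.
    obtain ⟨y, hy1, hy0⟩ := Set.exists_of_ssubset (hlt 0 (by omega))
    have hle : p 0 ≤ p 1 := (hlt 0 (by omega)).le
    have hp0 := hp 0 (by omega)
    -- A relation is read as a polynomial in `y`. Modulo the second prime only the constant
    -- coefficient survives, so it is zero by independence; then `y` can be cancelled modulo the
    -- first prime and the degree drops.
    have key : ∀ (e : ℕ) (Q : Polynomial (MvPolynomial (Fin m) k)), Q.natDegree ≤ e →
        Q.eval₂ (aeval x : MvPolynomial (Fin m) k →ₐ[k] A).toRingHom y ∈ p 0 → Q = 0 := by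
      intro e
      induction e with
      | zero =>
        intro Q hQ h
        rw [Polynomial.eq_C_of_natDegree_le_zero hQ, Polynomial.eval₂_C] at h
        rw [Polynomial.eq_C_of_natDegree_le_zero hQ, hx _ (hle h), Polynomial.C_0]
      | succ e ihe =>
        intro Q hQ h
        have h1 := Polynomial.divX_mul_X_add Q
        rw [← h1, Polynomial.eval₂_add, Polynomial.eval₂_mul, Polynomial.eval₂_X,
          Polynomial.eval₂_C] at h
        have h2 : Q.coeff 0 = 0 := by
          apply hx
          have := Ideal.sub_mem _ (hle h) (Ideal.mul_mem_left (p 1)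
            (Q.divX.eval₂ (aeval x : MvPolynomial (Fin m) k →ₐ[k] A).toRingHom y) hy1)
          simpa using this
        rw [h2, map_zero, add_zero] at h
        have h3 := ihe Q.divX (by rw [Polynomial.natDegree_divX_eq_natDegree_tsub_one]; omega)
          ((hp0.mem_or_mem h).resolve_right hy0)
        rw [← h1, h2, h3]
        simp
    refine ⟨Fin.cons y x, fun P hP => ?_⟩
    have h1 : ∀ P : MvPolynomial (Fin (m + 1)) k, aeval (Fin.cons y x : Fin (m + 1) → A) P =
        (finSuccEquiv k m P).eval₂ (aeval x : MvPolynomial (Fin m) k →ₐ[k] A).toRingHom y := by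
      intro P
      induction P using MvPolynomial.induction_on with
      | C c => simp [finSuccEquiv_apply]
      | add p q hp hq => rw [map_add, map_add, Polynomial.eval₂_add, hp, hq]
      | mul_X p i hp =>
        rw [map_mul, map_mul, Polynomial.eval₂_mul, hp, aeval_X]
        congr 1
        refine Fin.cases ?_ (fun j => ?_) i
        · simp [finSuccEquiv_X_zero]
        · simp [finSuccEquiv_X_succ]
    rw [h1] at hP
    have := key _ _ le_rfl hP
    simpa using this

lemma eval_smul_eq_sum {σ : Type*} (F : MvPolynomial σ ℂ) (c : ℂ) (v : σ → ℂ) :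
    eval (c • v) F =
      ∑ i ∈ Finset.range (F.totalDegree + 1), c ^ i * eval v (homogeneousComponent i F) := by
  conv_lhs => rw [← sum_homogeneousComponent F, map_sum]
  exact Finset.sum_congr rfl fun i _ =>
    eval_smul_of_isHomogeneous (homogeneousComponent_isHomogeneous i F) c v

/-- The restriction of `F` to the line through `v`, as a univariate polynomial. -/
noncomputable def linePoly {σ : Type*} (F : MvPolynomial σ ℂ) (v : σ → ℂ) : Polynomial ℂ :=
  ∑ i ∈ Finset.range (F.totalDegree + 1),
    Polynomial.C (eval v (homogeneousComponent i F)) * Polynomial.X ^ i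

lemma eval_linePoly {σ : Type*} (F : MvPolynomial σ ℂ) (v : σ → ℂ) (c : ℂ) :
    (linePoly F v).eval c = eval (c • v) F := by
  rw [eval_smul_eq_sum, linePoly, Polynomial.eval_finsetSum]
  exact Finset.sum_congr rfl fun i _ => by
    rw [Polynomial.eval_C_mul, Polynomial.eval_pow, Polynomial.eval_X, mul_comm]

lemma coeff_linePoly {σ : Type*} (F : MvPolynomial σ ℂ) (v : σ → ℂ) (i : ℕ) :
    (linePoly F v).coeff i = eval v (homogeneousComponent i F) := by
  rw [linePoly, Polynomial.finsetSum_coeff]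
  simp only [Polynomial.coeff_C_mul_X_pow]
  rw [Finset.sum_ite_eq]
  split_ifs with h
  · rfl
  · rw [homogeneousComponent_eq_zero i F (by simpa using h), map_zero]

/-- On the line through `v`, the homogeneous components become the coefficients of a univariate
polynomial, which vanishes identically. -/
lemma eval_homogeneousComponent_eq_zero {σ : Type*} {F : MvPolynomial σ ℂ} {v : σ → ℂ}
    (h : ∀ c : ℂ, eval (c • v) F = 0) (i : ℕ) : eval v (homogeneousComponent i F) = 0 := by
  have h0 : linePoly F v = 0 := Polynomial.funext fun c => by
    rw [eval_linePoly, h, Polynomial.eval_zero]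
  rw [← coeff_linePoly, h0, Polynomial.coeff_zero]

/-- The ideal of the affine cone over a set of curves. -/
noncomputable def vanIdeal (Z : Set (Curve d)) : Ideal (MvPolynomial (Fin 3 →₀ ℕ) ℂ) where
  carrier := {F | ∀ p ∈ Z, ∀ c : ℂ, eval (c • coeffs p.form) F = 0}
  add_mem' hF hG p hp c := by rw [map_add, hF p hp c, hG p hp c, add_zero]
  zero_mem' p _ c := map_zero _
  smul_mem' G F hF p hp c := by rw [smul_eq_mul, map_mul, hF p hp c, mul_zero]

/-- If neither factor is in the ideal, some homogeneous component of each is nonzero on a nonempty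
open part of `Z`. Both are nonzero at a common point by irreducibility, while the product of the two
restrictions to the line over that point is zero. -/
lemma vanIdeal_isPrime {Z : Set (Curve d)} (hZ : IsIrreducible Z) : (vanIdeal Z).IsPrime := by
  have key : ∀ F ∉ vanIdeal Z, ∃ i, (Z ∩ basicOpen d (homogeneousComponent i F)).Nonempty := by
    intro F hF
    by_contra! h
    apply hF
    intro p hp c
    rw [eval_smul_eq_sum]
    refine Finset.sum_eq_zero fun i _ => ?_
    by_contra hne
    exact (Set.eq_empty_iff_forall_notMem.mp (h i) p) ⟨hp, right_ne_zero_of_mul hne⟩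
  constructor
  · rw [Ideal.ne_top_iff_one]
    intro h
    obtain ⟨p, hp⟩ := hZ.1
    simpa using h p hp 0
  · intro F G hFG
    by_contra! hne
    obtain ⟨i, hi⟩ := key F hne.1
    obtain ⟨j, hj⟩ := key G hne.2
    obtain ⟨q, hq, hq1, hq2⟩ := hZ.2 _ _
      (isOpen_basicOpen (homogeneousComponent_isHomogeneous i F))
      (isOpen_basicOpen (homogeneousComponent_isHomogeneous j G)) hi hj
    have h1 : linePoly F (coeffs q.form) * linePoly G (coeffs q.form) = 0 :=
      Polynomial.funext fun c => by
        rw [Polynomial.eval_mul, eval_linePoly, eval_linePoly, ← map_mul, hFG q hq c,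
          Polynomial.eval_zero]
    rcases mul_eq_zero.mp h1 with h | h
    · apply hq1
      rw [← coeff_linePoly, h, Polynomial.coeff_zero]
    · apply hq2
      rw [← coeff_linePoly, h, Polynomial.coeff_zero]

/-- Since `Y` is closed in `X`, a homogeneous polynomial separates a point of `Z` outside `Y` from
`Y`. -/
lemma vanIdeal_lt {X : Set (Curve d)} {Y Z : Set X} (hY : IsClosed Y) (h : Y < Z) :
    vanIdeal (Subtype.val '' Z) < vanIdeal (Subtype.val '' Y) := by
  refine lt_of_le_of_ne (fun F hF p hp => hF p (Set.image_mono h.le hp)) fun heq => ?_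
  obtain ⟨p, hpZ, hpY⟩ := Set.exists_of_ssubset h
  have h1 : (p : Curve d) ∉ closure (Subtype.val '' Y) := by
    rw [← closure_subtype, hY.closure_eq]
    exact hpY
  rw [mem_closure_iff_homogeneous] at h1
  push Not at h1
  obtain ⟨n, F, hF, hFY, hFp⟩ := h1
  have h2 : F ∈ vanIdeal (Subtype.val '' Z) := by
    rw [heq]
    intro q hq c
    rw [eval_smul_of_isHomogeneous hF, hFY q hq, mul_zero]
  have h3 := h2 p ⟨p, hpZ, rfl⟩ 1
  rw [one_smul] at h3
  exact hFp h3

/-- The vertex of the affine cone adds one step to every chain of primes, which accounts for the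
passage from the projective to the affine dimension. -/
lemma vanIdeal_lt_ker {Z : Set (Curve d)} (hZ : Z.Nonempty) :
    vanIdeal Z < RingHom.ker (eval (0 : (Fin 3 →₀ ℕ) → ℂ)) := by
  obtain ⟨p, hp⟩ := hZ
  refine lt_of_le_of_ne (fun F hF => ?_) fun heq => ?_
  · have := hF p hp 0
    rw [zero_smul] at this
    exact this
  · obtain ⟨m, hm⟩ := MvPolynomial.ne_zero_iff.mp p.form_ne_zero
    have h1 : (X m : MvPolynomial (Fin 3 →₀ ℕ) ℂ) ∈ vanIdeal Z := by
      rw [heq, RingHom.mem_ker, eval_X, Pi.zero_apply]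
    have h2 := h1 p hp 1
    rw [one_smul, eval_X] at h2
    exact hm h2

/-- A set of curves which lies in the closure of a family with `n` parameters has dimension at most
`n`. -/
theorem topologicalKrullDim_le_of_family {n : ℕ} {A : Set (Curve d)}
    {a : Fin d → Fin 3 → MvPolynomial (Fin n) ℂ} {D : Set (Fin n → ℂ)}
    (h : A ⊆ closure (family a D)) : topologicalKrullDim A ≤ n := by
  refine iSup_le fun s => ?_
  set N := s.length with hN
  set Z : ℕ → TopologicalSpace.IrreducibleCloseds A := fun i =>
    if hi : i < N + 1 then s ⟨i, hi⟩ else s (Fin.last _) with hZ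
  have hZlt : ∀ i j, i < j → j ≤ N → Z i < Z j := by
    intro i j hij hj
    simp only [hZ]
    rw [dif_pos (by omega), dif_pos (by omega)]
    exact s.strictMono (by simpa using hij)
  have hirr : ∀ i, IsIrreducible (Subtype.val '' (Z i : Set A)) := fun i =>
    (Z i).isIrreducible.image _ continuous_subtype_val.continuousOn
  -- Vanishing ideals reverse inclusion, so the chain is read from its top; the maximal ideal of the
  -- vertex is appended, which gives `N + 1` strict steps.
  set Q : ℕ → Ideal (MvPolynomial (Fin 3 →₀ ℕ) ℂ) := fun i =>
    if i ≤ N then vanIdeal (Subtype.val '' (Z (N - i) : Set A)) else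
      RingHom.ker (eval (0 : (Fin 3 →₀ ℕ) → ℂ)) with hQ
  obtain ⟨x, hx⟩ := exists_algebraicIndependent_of_chain (k := ℂ) (N + 1) Q
    (by
      intro i _
      simp only [hQ]
      split_ifs
      · exact vanIdeal_isPrime (hirr _)
      · exact RingHom.ker_isPrime _)
    (by
      intro i hi
      simp only [hQ]
      rw [if_pos (by omega)]
      split_ifs
      · exact vanIdeal_lt (Z (N - (i + 1))).isClosed (hZlt _ _ (by omega) (by omega))
      · exact vanIdeal_lt_ker (hirr _).1)
  -- `Θ` parametrises the affine cone over the family; the variable `none` is the scaling factor.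
  set Θ : MvPolynomial (Fin 3 →₀ ℕ) ℂ →ₐ[ℂ] MvPolynomial (Option (Fin n)) ℂ :=
    aeval fun m => X none * rename some (coeffs (genericForm a) m) with hΘ
  have hker : ∀ F, Θ F = 0 → F ∈ Q 0 := by
    intro F hF
    simp only [hQ]
    rw [if_pos (Nat.zero_le _)]
    rintro p ⟨q, -, rfl⟩ c
    rw [eval_smul_eq_sum]
    refine Finset.sum_eq_zero fun i _ => ?_
    rw [mem_closure_iff_homogeneous.mp (h q.2) i _ (homogeneousComponent_isHomogeneous i F),
      mul_zero]
    rintro r ⟨t, ht, e, he, hr⟩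
    rw [hr, coeffs_C_mul, eval_smul_of_isHomogeneous (homogeneousComponent_isHomogeneous i F),
      eval_homogeneousComponent_eq_zero, mul_zero]
    intro c
    have h1 := congrArg (eval fun o : Option (Fin n) => o.elim c t) hF
    rw [hΘ, eval_aeval, map_zero] at h1
    rw [← h1, ← coeffs_genericForm]
    congr 2
    ext m
    simp only [Pi.smul_apply, smul_eq_mul, map_mul, eval_X, Option.elim_none, eval_rename]
    rfl
  have hind : AlgebraicIndependent ℂ fun i => Θ (x i) := by
    rw [algebraicIndependent_iff]
    intro P hP
    apply hx
    apply hker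
    rw [← hP]
    rw [← AlgHom.comp_apply]
    congr 1
    apply algHom_ext
    simp
  -- Algebraic independence modulo `Q 0` passes to the images under `Θ`, which live in a polynomial
  -- ring in `n + 1` variables.
  have h1 := hind.lift_cardinalMk_le_trdeg
  rw [MvPolynomial.trdeg_of_isDomain] at h1
  simp only [Cardinal.mk_fin, Cardinal.lift_id, Cardinal.mk_option, Cardinal.lift_id] at h1
  have h2 : N + 1 ≤ n + 1 := by exact_mod_cast h1
  have h3 : N ≤ n := by omega
  exact_mod_cast h3

end

/-! ### Lower bounds for the Krull dimension: chains of specialised families. -/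

section
variable {d : ℕ}

/-- A chain of irreducible subsets, separated by closed sets, bounds the dimension from below. -/
lemma le_topologicalKrullDim {T : Type*} [TopologicalSpace T] {A : Set T} (n : ℕ) (W : ℕ → Set T)
    (hirr : ∀ k, IsIrreducible (W k)) (hA : ∀ k, W k ⊆ A) (hmono : ∀ k, W k ⊆ W (k + 1))
    (hsep : ∀ k < n, ∃ C, IsClosed C ∧ W k ⊆ C ∧ ¬ W (k + 1) ⊆ C) :
    (n : WithBot ℕ∞) ≤ topologicalKrullDim A := by
  have himg : ∀ k, Subtype.val '' (Subtype.val ⁻¹' W k : Set A) = W k := fun k => by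
    rw [Set.image_preimage_eq_iff, Subtype.range_coe]
    exact hA k
  have hirr' : ∀ k, IsIrreducible (Subtype.val ⁻¹' W k : Set A) := by
    intro k
    constructor
    · obtain ⟨x, hx⟩ := (hirr k).1
      exact ⟨⟨x, hA k hx⟩, hx⟩
    · rintro _ _ ⟨U, hU, rfl⟩ ⟨V, hV, rfl⟩ ⟨x, hx, hxU⟩ ⟨y, hy, hyV⟩
      obtain ⟨z, hz, hzU, hzV⟩ := (hirr k).2 U V hU hV ⟨x, hx, hxU⟩ ⟨y, hy, hyV⟩
      exact ⟨⟨z, hA k hz⟩, hz, hzU, hzV⟩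
  let Z : ℕ → TopologicalSpace.IrreducibleCloseds A := fun k =>
    ⟨closure (Subtype.val ⁻¹' W k), (hirr' k).closure, isClosed_closure⟩
  have hlt : ∀ k < n, Z k < Z (k + 1) := by
    intro k hk
    refine lt_of_le_not_ge ?_ ?_
    · exact closure_mono (Set.preimage_mono (hmono k))
    · intro hle
      obtain ⟨C, hC, h1, h2⟩ := hsep k hk
      apply h2
      intro x hx
      have h3 : (⟨x, hA _ hx⟩ : A) ∈ closure (Subtype.val ⁻¹' W k : Set A) :=
        hle (subset_closure hx)
      exact closure_minimal (Set.preimage_mono h1) (hC.preimage continuous_subtype_val) h3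
  let s : LTSeries (TopologicalSpace.IrreducibleCloseds A) :=
    { length := n
      toFun := fun i => Z i
      step := fun i => hlt i i.2 }
  exact le_iSup (fun p : LTSeries (TopologicalSpace.IrreducibleCloseds A) =>
    ((p.length : ℕ) : WithBot ℕ∞)) s

/-- The value of a form of degree `d` at `v`, as a linear form in the coefficients. -/
noncomputable def evalPoly (d : ℕ) (v : Fin 3 → ℂ) : MvPolynomial (Fin 3 →₀ ℕ) ℂ :=
  ∑ m ∈ Finset.finsuppAntidiag Finset.univ d, C (∏ i, v i ^ m i) * X m

lemma evalPoly_isHomogeneous (d : ℕ) (v : Fin 3 → ℂ) : (evalPoly d v).IsHomogeneous 1 :=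
  IsHomogeneous.sum _ _ _ fun m _ => by
    simpa using (isHomogeneous_C _ (∏ i, v i ^ m i)).mul (isHomogeneous_X ℂ m)

lemma eval_evalPoly {f : S} (hf : f.IsHomogeneous d) (v : Fin 3 → ℂ) :
    eval (coeffs f) (evalPoly d v) = eval v f := by
  rw [evalPoly, map_sum, eval_eq']
  simp only [map_mul, eval_C, eval_X, coeffs]
  symm
  rw [Finset.sum_subset (s₂ := Finset.finsuppAntidiag Finset.univ d)]
  · exact Finset.sum_congr rfl fun m _ => mul_comm _ _
  · intro m hm
    have := hf (mem_support_iff.mp hm)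
    rw [Finset.mem_finsuppAntidiag]
    refine ⟨?_, Finset.subset_univ _⟩
    rw [Finsupp.weight_apply, Finsupp.sum_fintype _ _ (by simp)] at this
    simpa using this
  · intro m _ hm
    rw [notMem_support_iff.mp hm, zero_mul]

/-- Passing through a fixed point is a linear condition on the coefficients. These are the closed
sets that separate consecutive families. -/
lemma isClosed_eval_eq_zero (v : Fin 3 → ℂ) : IsClosed {p : Curve d | eval v p.form = 0} := by
  have h : {p : Curve d | eval v p.form = 0} = (basicOpen d (evalPoly d v))ᶜ := by
    ext p
    simp [basicOpen, eval_evalPoly p.form_isHomogeneous]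
  rw [h]
  exact (isOpen_basicOpen (evalPoly_isHomogeneous d v)).isClosed_compl

variable {ι κ : Type*}

lemma IsZOpen.preimage {D : Set (ι → ℂ)} (hD : IsZOpen D) (φ : ι → MvPolynomial κ ℂ) :
    IsZOpen {t : κ → ℂ | (fun i => eval t (φ i)) ∈ D} := by
  intro t ht
  obtain ⟨g, hg, hgD⟩ := hD _ ht
  refine ⟨aeval φ g, by rwa [eval_aeval], fun s hs => hgD _ ?_⟩
  rwa [← eval_aeval]

/-- The substitution that keeps the first `k` variables and specializes the others to `c`. -/
noncomputable def specialize {n : ℕ} (c : Fin n → ℂ) (k : ℕ) : Fin n → MvPolynomial (Fin n) ℂ :=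
  fun j => if (j : ℕ) < k then X j else C (c j)

lemma eval_specialize {n : ℕ} (c : Fin n → ℂ) (k : ℕ) (t : Fin n → ℂ) :
    (fun j => eval t (specialize c k j)) = fun j : Fin n => if (j : ℕ) < k then t j else c j := by
  ext j
  simp only [specialize]
  split_ifs <;> simp

/-- Starting from the arrangement `c`, the parameters are set free one at a time. Before the `k`-th
one is freed, all members pass through `v k`, by `h1`; afterwards a general member does not, by
`h2`. So the closures of the successive families increase strictly. -/
theorem le_topologicalKrullDim_of_family {n : ℕ} {A : Set (Curve d)}
    {a : Fin d → Fin 3 → MvPolynomial (Fin n) ℂ} {D : Set (Fin n → ℂ)}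
    (hD : IsZOpen D) (ha : ∀ t ∈ D, ∀ i, evalVec a t i ≠ 0) (hA : family a D ⊆ A)
    (c : Fin n → ℂ) (hc : c ∈ D) (v : Fin n → Fin 3 → ℂ)
    (h1 : ∀ k t, (∀ j, k ≤ j → t j = c j) → ∃ i, evalVec a t i ⬝ᵥ v k = 0)
    (h2 : ∀ k, ∃ t, (∀ j, k < j → t j = c j) ∧ ∀ i, evalVec a t i ⬝ᵥ v k ≠ 0) :
    (n : WithBot ℕ∞) ≤ topologicalKrullDim A := by
  -- The slice on which the first `k` parameters are free and the others keep their value at `c`.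
  set L : ℕ → Set (Fin n → ℂ) := fun k => {t | ∀ j : Fin n, k ≤ (j : ℕ) → t j = c j} with hL
  have hfix : ∀ k, ∀ t ∈ L k, (fun j => eval t (specialize c k j)) = t := by
    intro k t ht
    rw [eval_specialize]
    ext j
    split_ifs with h
    · rfl
    · exact (ht j (by omega)).symm
  have hmem : ∀ k t, (fun j => eval t (specialize c k j)) ∈ L k := by
    intro k t j hj
    rw [eval_specialize]
    simp only
    rw [if_neg (by omega)]
  refine le_topologicalKrullDim n (fun k => family a (D ∩ L k)) ?_ ?_ ?_ ?_
  · intro k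
    set a' : Fin d → Fin 3 → MvPolynomial (Fin n) ℂ := fun i j => aeval (specialize c k) (a i j)
    have hev : ∀ t, evalVec a' t = evalVec a (fun j => eval t (specialize c k j)) := by
      intro t
      ext i j
      exact eval_aeval _ _ _
    have : family a (D ∩ L k) =
        family a' {t | (fun j => eval t (specialize c k j)) ∈ D} := by
      ext p
      constructor
      · rintro ⟨t, ⟨ht, htL⟩, hp⟩
        refine ⟨t, ?_, ?_⟩
        · rw [Set.mem_ofPred_eq, hfix k t htL]; exact ht
        · rwa [hev, hfix k t htL]
      · rintro ⟨t, ht, hp⟩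
        exact ⟨_, ⟨ht, hmem k t⟩, by rwa [← hev]⟩
    rw [this]
    refine family_isIrreducible (hD.preimage _) ⟨c, ?_⟩ fun t ht => ?_
    · rw [Set.mem_ofPred_eq, hfix k c fun _ _ => rfl]; exact hc
    · rw [hev]; exact ha _ ht
  · intro k
    refine subset_trans ?_ hA
    rintro p ⟨t, ht, hp⟩
    exact ⟨t, ht.1, hp⟩
  · rintro k p ⟨t, ⟨ht, htL⟩, hp⟩
    exact ⟨t, ⟨ht, fun j hj => htL j (by omega)⟩, hp⟩
  · intro k hk
    have hform : ∀ {p : Curve d} {b : Fin d → Fin 3 → ℂ}, Rep p b →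
        (eval (v ⟨k, hk⟩) p.form = 0 ↔ ∃ i, b i ⬝ᵥ v ⟨k, hk⟩ = 0) := by
      rintro p b ⟨e, he, hp⟩
      rw [hp, map_mul, map_prod, eval_C, mul_eq_zero, Finset.prod_eq_zero_iff]
      simp [he, eval_linearForm]
    refine ⟨_, isClosed_eval_eq_zero (v ⟨k, hk⟩), ?_, ?_⟩
    · rintro p ⟨t, ⟨ht, htL⟩, hp⟩
      exact (hform hp).mpr (h1 ⟨k, hk⟩ t fun j hj => htL j hj)
    · intro hsub
      obtain ⟨g, hg, hgD⟩ := hD c hc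
      obtain ⟨t, ht, hti⟩ := h2 ⟨k, hk⟩
      have htL : t ∈ L (k + 1) := fun j hj => ht j (by simpa [Fin.lt_def] using hj)
      set G : MvPolynomial (Fin n) ℂ := ∏ i, ∑ j, a i j * C (v ⟨k, hk⟩ j) with hG
      have hGe : ∀ s, eval s G = ∏ i, evalVec a s i ⬝ᵥ v ⟨k, hk⟩ := by
        intro s
        simp [hG, map_prod, evalVec, dotProduct]
      -- The point `t` of `h2` need not lie in `D`. But on the slice `g` is nonzero at `c` and `G`
      -- is nonzero at `t`, so both are nonzero at some common point, which lies in `D` and whose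
      -- lines all avoid `v k`.
      have hne : aeval (specialize c (k + 1)) g * aeval (specialize c (k + 1)) G ≠ 0 := by
        refine mul_ne_zero (fun h0 => hg ?_) (fun h0 => ?_)
        · have := congrArg (eval c) h0
          rwa [eval_aeval, hfix _ c (fun _ _ => rfl), map_zero] at this
        · have := congrArg (eval t) h0
          rw [eval_aeval, hfix _ t htL, map_zero, hGe, Finset.prod_eq_zero_iff] at this
          obtain ⟨i, -, hi⟩ := this
          exact hti i hi
      obtain ⟨r, hr⟩ : ∃ r, eval r (aeval (specialize c (k + 1)) g *
          aeval (specialize c (k + 1)) G) ≠ 0 := by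
        by_contra! h0
        exact hne (MvPolynomial.funext fun r => by rw [h0 r, map_zero])
      rw [map_mul, eval_aeval, eval_aeval, hGe] at hr
      have hrD := hgD _ (left_ne_zero_of_mul hr)
      set s : Fin n → ℂ := fun j => eval r (specialize c (k + 1) j) with hs
      have hrep := rep_psi_mk (evalVec a s) (ha _ hrD)
      have h3 := hsub ⟨s, ⟨hrD, hmem _ r⟩, hrep⟩
      obtain ⟨i, hi⟩ := (hform hrep).mp h3
      exact right_ne_zero_of_mul hr (Finset.prod_eq_zero (Finset.mem_univ i) hi)

end

/-! ### Limits of line arrangements, through integrality of the product map. -/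

section
variable {d : ℕ}

/-- The generic arrangement of `d` lines. -/
noncomputable def universalVec (d : ℕ) : Fin d → Fin 3 → MvPolynomial (Fin d × Fin 3) ℂ :=
  fun i j => X (i, j)

lemma evalVec_universalVec (b : Fin d × Fin 3 → ℂ) :
    evalVec (universalVec d) b = fun i j => b (i, j) := by
  ext i j
  simp [evalVec, universalVec]

/-- The ideal of the arrangements which satisfy the equations `E` and whose linear forms are
normalized at `w`. -/
noncomputable def chartIdeal (E : Set (MvPolynomial (Fin d × Fin 3) ℂ)) (w : Fin 3 → ℂ) :
    Ideal (MvPolynomial (Fin d × Fin 3) ℂ) :=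
  Ideal.span (E ∪ Set.range fun i => ∑ j, universalVec d i j * C (w j) - 1)

/-- The coefficients of the curve of an arrangement, as functions on a chart. -/
noncomputable def chartHom (E : Set (MvPolynomial (Fin d × Fin 3) ℂ)) (w : Fin 3 → ℂ) :
    MvPolynomial (Fin 3 →₀ ℕ) ℂ →ₐ[ℂ] MvPolynomial (Fin d × Fin 3) ℂ ⧸ chartIdeal E w :=
  (Ideal.Quotient.mkₐ ℂ (chartIdeal E w)).comp (aeval (coeffs (genericForm (universalVec d))))

/-- Let the i-th form have coefficients a_i, with a_i · w = 1. Its value at T w - e_j is T - a_ij.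
So the value of the product of all forms there is the monic polynomial in T with roots the j-th
coefficients, and its own coefficients are combinations of the coefficients of the curve. -/
lemma chartHom_isIntegral (E : Set (MvPolynomial (Fin d × Fin 3) ℂ)) (w : Fin 3 → ℂ) :
    (chartHom E w).toRingHom.IsIntegral := by
  set ρ := chartHom E w with hρ
  set B := MvPolynomial (Fin d × Fin 3) ℂ ⧸ chartIdeal E w
  set π : MvPolynomial (Fin d × Fin 3) ℂ →+* B := Ideal.Quotient.mk (chartIdeal E w) with hπ
  have hC : ∀ c : ℂ, ρ.toRingHom (C c) = π (C c) := by
    intro c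
    simp only [hρ, chartHom, AlgHom.toRingHom_eq_coe, RingHom.coe_coe, AlgHom.comp_apply, algHom_C]
    rfl
  have hX : ∀ m, ρ.toRingHom (X m) = π (coeff m (genericForm (universalVec d))) := by
    intro m
    simp [hρ, chartHom, hπ, coeffs]
  have hone : ∀ i, ∑ j, π (universalVec d i j) * π (C (w j)) = 1 := by
    intro i
    have : π (∑ j, universalVec d i j * C (w j) - 1) = 0 :=
      Ideal.Quotient.eq_zero_iff_mem.mpr (Ideal.subset_span (Or.inr ⟨i, rfl⟩))
    rw [map_sub, map_one, map_sum, sub_eq_zero] at this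
    simpa using this
  have key : ∀ i j, ρ.toRingHom.IsIntegralElem (π (X (i, j))) := by
    intro i j
    -- The coordinates of the point T w - e_j.
    set g : Fin 3 → Polynomial B := fun k =>
      Polynomial.C (π (C (w k))) * Polynomial.X - Polynomial.C (if k = j then 1 else 0) with hg
    have hgl : ∀ k, g k ∈ Polynomial.lifts ρ.toRingHom := by
      intro k
      refine ⟨Polynomial.C (C (w k)) * Polynomial.X - Polynomial.C (if k = j then 1 else 0), ?_⟩
      rw [Polynomial.coe_mapRingHom, Polynomial.map_sub, Polynomial.map_mul, Polynomial.map_C,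
        Polynomial.map_C, Polynomial.map_X, hC]
      split_ifs <;> simp [*]
    have hprod : eval₂ (Polynomial.C.comp π) g (genericForm (universalVec d)) =
        ∏ k, (Polynomial.X - Polynomial.C (π (X (k, j)))) := by
      rw [genericForm, eval₂_prod]
      refine Finset.prod_congr rfl fun k _ => ?_
      rw [eval₂_sum]
      have h1 := congrArg (Polynomial.C : B →+* Polynomial B) (hone k)
      rw [map_sum, map_one] at h1
      simp only [eval₂_mul, eval₂_C, eval₂_X, hg, RingHom.comp_apply, mul_sub, Finset.sum_sub_distrib]
      congr 1
      · refine Eq.trans ?_ ((congrArg (· * Polynomial.X) h1).trans (one_mul _))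
        rw [Finset.sum_mul]
        exact Finset.sum_congr rfl fun x _ => by rw [map_mul, mul_assoc]
      · rw [Finset.sum_eq_single j]
        · simp [universalVec]
        · intro x _ hx
          simp [hx]
        · simp
    have hlift : ∏ k, (Polynomial.X - Polynomial.C (π (X (k, j)))) ∈
        Polynomial.lifts ρ.toRingHom := by
      rw [← hprod, eval₂_eq']
      refine sum_mem fun m _ => mul_mem ?_ (prod_mem fun k _ => pow_mem (hgl k) _)
      refine ⟨Polynomial.C (X m), ?_⟩
      rw [Polynomial.coe_mapRingHom, Polynomial.map_C, hX]
      rfl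
    have hmon : (∏ k, (Polynomial.X - Polynomial.C (π (X (k, j))))).Monic :=
      Polynomial.monic_prod_of_monic _ _ fun k _ => Polynomial.monic_X_sub_C _
    -- The quotient may be the zero ring, when no arrangement in the chart satisfies `E`;
    -- integrality is then trivial.
    rcases subsingleton_or_nontrivial B with hB | hB
    · exact ⟨1, Polynomial.monic_one, Subsingleton.elim (α := B) _ _⟩
    obtain ⟨q, hq, -, hqm⟩ := Polynomial.lifts_and_degree_eq_and_monic hlift hmon
    refine ⟨q, hqm, ?_⟩
    rw [← Polynomial.eval_map, hq, Polynomial.eval_prod]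
    exact Finset.prod_eq_zero (Finset.mem_univ i) (by simp)
  intro y
  obtain ⟨F, rfl⟩ := Ideal.Quotient.mk_surjective y
  induction F using MvPolynomial.induction_on with
  | C c => rw [← hπ, ← hC]; exact ρ.toRingHom.isIntegralElem_map
  | add p q hp hq => rw [map_add]; exact hp.add _ hq
  | mul_X p i hp => rw [map_mul]; exact hp.mul _ (key i.1 i.2)

/-- A curve in the closure of a set of line arrangements defined by equations (invariant under
rescaling of the linear forms) is a line arrangement that satisfies these equations. -/
theorem exists_rep_of_mem_closure {A : Set (Curve d)} {p : Curve d} (hp : p ∈ closure A)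
    (E : Set (MvPolynomial (Fin d × Fin 3) ℂ))
    (hE : ∀ g ∈ E, ∀ (b : Fin d → Fin 3 → ℂ) (c : Fin d → ℂ), eval (fun x => b x.1 x.2) g = 0 →
      eval (fun x => c x.1 * b x.1 x.2) g = 0)
    (hA : ∀ q ∈ A, ∃ b, Rep q b ∧ ∀ g ∈ E, eval (fun x => b x.1 x.2) g = 0) :
    ∃ b, Rep p b ∧ ∀ g ∈ E, eval (fun x => b x.1 x.2) g = 0 := by
  -- A point off the curve: near `p` no line passes through `w`, so every linear form can be
  -- normalised to take the value 1 there.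
  obtain ⟨w, hw⟩ : ∃ w, eval w p.form ≠ 0 := by
    by_contra! h
    exact p.form_ne_zero (MvPolynomial.funext fun v => by rw [h v, map_zero])
  set c := eval w p.form with hc
  set ρ := chartHom E w with hρ
  set ε : MvPolynomial (Fin 3 →₀ ℕ) ℂ →+* ℂ := eval (c⁻¹ • coeffs p.form) with hε
  have hker : RingHom.ker ρ.toRingHom ≤ RingHom.ker ε := by
    intro F hF
    set N := F.totalDegree
    set e := evalPoly d w with he
    -- A homogenisation of `F` by the linear form `e`, the value of the curve at `w`. The exponent
    -- `N + 1 - i` is always positive, so that `Fh` vanishes also on the curves through `w`.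
    set Fh : MvPolynomial (Fin 3 →₀ ℕ) ℂ :=
      ∑ i ∈ Finset.range (N + 1), homogeneousComponent i F * e ^ (N + 1 - i) with hFh
    have hhom : Fh.IsHomogeneous (N + 1) := IsHomogeneous.sum _ _ _ fun i hi => by
      have h1 := (homogeneousComponent_isHomogeneous i F).mul
        ((evalPoly_isHomogeneous d w).pow (N + 1 - i))
      have h2 : i + 1 * (N + 1 - i) = N + 1 := by
        have := Finset.mem_range.mp hi
        omega
      rwa [h2] at h1
    have hone : ∀ v, eval v e = 1 → eval v Fh = eval v F := by
      intro v hv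
      conv_rhs => rw [← sum_homogeneousComponent F]
      rw [hFh, map_sum, map_sum]
      exact Finset.sum_congr rfl fun i _ => by rw [map_mul, map_pow, hv, one_pow, mul_one]
    have hzero : ∀ q ∈ A, eval (coeffs q.form) Fh = 0 := by
      intro q hq
      by_cases hqe : eval (coeffs q.form) e = 0
      · rw [hFh, map_sum]
        refine Finset.sum_eq_zero fun i hi => ?_
        rw [map_mul, map_pow, hqe, zero_pow, mul_zero]
        have := Finset.mem_range.mp hi
        omega
      · obtain ⟨b, hb, hbE⟩ := hA q hq
        have hbw : ∀ i, b i ⬝ᵥ w ≠ 0 := by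
          intro i h0
          apply hqe
          obtain ⟨s, -, hs⟩ := hb
          rw [eval_evalPoly q.form_isHomogeneous, hs, map_mul, map_prod,
            Finset.prod_eq_zero (Finset.mem_univ i), mul_zero]
          rw [eval_linearForm, h0]
        set b' : Fin d → Fin 3 → ℂ := fun i => (b i ⬝ᵥ w)⁻¹ • b i with hb'
        have hrep : Rep q b' := hb.smul fun i =>
          ⟨b i ⬝ᵥ w, hbw i, by rw [hb', smul_smul, mul_inv_cancel₀ (hbw i), one_smul]⟩
        have hb'w : ∀ i, b' i ⬝ᵥ w = 1 := by
          intro i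
          rw [hb', smul_dotProduct, smul_eq_mul, inv_mul_cancel₀ (hbw i)]
        have hJ : chartIdeal E w ≤ RingHom.ker (eval fun x : Fin d × Fin 3 => b' x.1 x.2) := by
          rw [chartIdeal, Ideal.span_le]
          rintro g (hg | ⟨i, rfl⟩)
          · exact hE g hg b (fun i => (b i ⬝ᵥ w)⁻¹) (hbE g hg)
          · have := hb'w i
            rw [dotProduct] at this
            simp [universalVec, this]
        have hmem : aeval (coeffs (genericForm (universalVec d))) F ∈ chartIdeal E w :=
          Ideal.Quotient.eq_zero_iff_mem.mp hF
        have h1 : eval (fun x : Fin d × Fin 3 => b' x.1 x.2) (pull (universalVec d) F) = 0 :=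
          hJ hmem
        rw [eval_pull, evalVec_universalVec] at h1
        obtain ⟨s, -, hs⟩ := hrep
        rw [hs, coeffs_C_mul, eval_smul_of_isHomogeneous hhom, hone, h1, mul_zero]
        have hh : (∏ i, linearForm (b' i)).IsHomogeneous d := by
          have := IsHomogeneous.prod Finset.univ (fun i => linearForm (b' i)) (fun _ => 1)
            (fun i _ => linearForm_isHomogeneous _)
          simpa using this
        rw [eval_evalPoly hh, map_prod]
        exact Finset.prod_eq_one fun i _ => by rw [eval_linearForm, hb'w]
    have h1 := mem_closure_iff_homogeneous.mp hp _ Fh hhom hzero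
    rw [RingHom.mem_ker, hε, ← hone, eval_smul_of_isHomogeneous hhom, h1, mul_zero]
    rw [eval_smul_of_isHomogeneous (evalPoly_isHomogeneous d w),
      eval_evalPoly p.form_isHomogeneous, pow_one, ← hc, inv_mul_cancel₀ hw]
  have hmax : (RingHom.ker ε).IsMaximal := RingHom.ker_isMaximal_of_surjective ε fun z => ⟨C z, by
    rw [hε, eval_C]⟩
  algebraize [ρ.toRingHom]
  have hint : Algebra.IsIntegral (MvPolynomial (Fin 3 →₀ ℕ) ℂ)
      (MvPolynomial (Fin d × Fin 3) ℂ ⧸ chartIdeal E w) := ⟨chartHom_isIntegral E w⟩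
  -- Lying over: the maximal ideal of the normalised curve `p` lifts to the chart of ordered
  -- arrangements, and by the Nullstellensatz the lift is a point `b`, the required arrangement.
  obtain ⟨Q, hQ, hQc⟩ := Ideal.exists_ideal_over_maximal_of_isIntegral (RingHom.ker ε) hker
  have hQ' : (Q.comap (Ideal.Quotient.mk (chartIdeal E w))).IsMaximal :=
    Ideal.comap_isMaximal_of_surjective _ Ideal.Quotient.mk_surjective
  obtain ⟨b, hb⟩ := isMaximal_iff_eq_vanishingIdeal_singleton.mp hQ'
  have hmemb : ∀ g, Ideal.Quotient.mk (chartIdeal E w) g ∈ Q → eval b g = 0 := by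
    intro g hg
    have : g ∈ vanishingIdeal ℂ {b} := by rw [← hb]; exact hg
    simpa using this
  refine ⟨fun i j => b (i, j), ⟨c, hw, ?_⟩, fun g hg => ?_⟩
  · ext m
    have h1 : (X m - C (ε (X m)) : MvPolynomial (Fin 3 →₀ ℕ) ℂ) ∈ RingHom.ker ε := by
      rw [RingHom.mem_ker, map_sub, hε, eval_C, sub_self]
    rw [← hQc] at h1
    have h2 : Ideal.Quotient.mk (chartIdeal E w)
        (coeff m (genericForm (universalVec d)) - C (ε (X m))) ∈ Q := by
      have h3 : ρ (X m - C (ε (X m))) ∈ Q := h1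
      simpa [hρ, chartHom, coeffs] using h3
    have h4 := hmemb _ h2
    rw [map_sub, eval_C, sub_eq_zero] at h4
    have h5 := congrFun (coeffs_genericForm (universalVec d) b) m
    rw [evalVec_universalVec] at h5
    simp only [coeffs] at h5
    rw [coeff_C_mul, ← h5, h4, hε, eval_X, Pi.smul_apply, smul_eq_mul, ← mul_assoc,
      mul_inv_cancel₀ hw, one_mul]
    rfl
  · refine hmemb g ?_
    have : Ideal.Quotient.mk (chartIdeal E w) g = 0 :=
      Ideal.Quotient.eq_zero_iff_mem.mpr (Ideal.subset_span (Or.inl hg))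
    rw [this]
    exact Q.zero_mem

end

section

/-! ### Colength of ideals in two variables -/

/-- The polynomial ring in two variables. -/
abbrev S₂ : Type := MvPolynomial (Fin 2) ℂ

/-- The ideal has colength `n` and contains a power of the ideal of the origin. -/
def HasColength (I : Ideal S₂) (n : ℕ) : Prop :=
  Module.rank ℂ (S₂ ⧸ I) = n ∧ ∃ K, idealOfVars (Fin 2) ℂ ^ K ≤ I

lemma span_pair_le {R : Type*} [CommRing R] {a b : R} {I : Ideal R} (ha : a ∈ I) (hb : b ∈ I) :
    Ideal.span {a, b} ≤ I := by
  rw [Ideal.span_le]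
  rintro x (rfl | rfl)
  · exact ha
  · exact hb

lemma comb_mem_span_pair {R : Type*} [CommRing R] (a b : R) {x : R} (u v : R)
    (h : x = u * a + v * b) : x ∈ Ideal.span {a, b} :=
  Ideal.mem_span_pair.mpr ⟨u, v, h.symm⟩

/-- Multiplication by `a` gives an exact sequence 0 → S₂/(b, c) → S₂/(ab, c) → S₂/(a, c) → 0. It is
injective on the left because `c` is not a zero divisor modulo `a`, which is the hypothesis `h`. -/
lemma rank_quotient_mul {a b c : S₂} (ha : a ≠ 0) (h : ∀ z, a ∣ c * z → a ∣ z) :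
    Module.rank ℂ (S₂ ⧸ Ideal.span {a * b, c}) =
      Module.rank ℂ (S₂ ⧸ Ideal.span {a, c}) + Module.rank ℂ (S₂ ⧸ Ideal.span {b, c}) := by
  set J := Ideal.span {a * b, c} with hJ
  set K := Ideal.span {a, c} with hK
  set L := Ideal.span {b, c} with hL
  have hJK : J ≤ K := span_pair_le (comb_mem_span_pair _ _ b 0 (by ring))
    (comb_mem_span_pair _ _ 0 1 (by ring))
  have hLJ : L ≤ Submodule.comap (LinearMap.mulLeft S₂ a) J :=
    span_pair_le (comb_mem_span_pair _ _ 1 0 (by simp))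
      (comb_mem_span_pair _ _ 0 a (by simp))
  let f : (S₂ ⧸ J) →ₗ[S₂] (S₂ ⧸ K) := Submodule.factor hJK
  let g : (S₂ ⧸ L) →ₗ[S₂] (S₂ ⧸ J) := Submodule.mapQ L J (LinearMap.mulLeft S₂ a) hLJ
  have hf : Function.Surjective f := Submodule.factor_surjective hJK
  have hg : Function.Injective g := by
    rw [← LinearMap.ker_eq_bot, LinearMap.ker_eq_bot']
    intro x hx
    obtain ⟨x, rfl⟩ := Submodule.Quotient.mk_surjective L x
    have h1 : a * x ∈ J := (Submodule.Quotient.mk_eq_zero J).mp hx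
    rw [Submodule.Quotient.mk_eq_zero]
    obtain ⟨u, v, huv⟩ := Ideal.mem_span_pair.mp h1
    obtain ⟨w, hw⟩ := h v ⟨x - u * b, by linear_combination huv⟩
    refine comb_mem_span_pair _ _ u w ?_
    apply mul_left_cancel₀ ha
    rw [← huv, hw]
    ring
  have hrange : LinearMap.range g = LinearMap.ker f := by
    ext y
    obtain ⟨y, rfl⟩ := Submodule.Quotient.mk_surjective J y
    rw [LinearMap.mem_ker]
    constructor
    · rintro ⟨x, hx⟩
      obtain ⟨x, rfl⟩ := Submodule.Quotient.mk_surjective L x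
      rw [← hx]
      change Submodule.Quotient.mk (a * x) = (0 : S₂ ⧸ K)
      rw [Submodule.Quotient.mk_eq_zero]
      exact comb_mem_span_pair _ _ x 0 (by ring)
    · intro hy
      have h1 : y ∈ K := (Submodule.Quotient.mk_eq_zero K).mp hy
      obtain ⟨u, v, huv⟩ := Ideal.mem_span_pair.mp h1
      refine ⟨Submodule.Quotient.mk u, ?_⟩
      change (Submodule.Quotient.mk (a * u) : S₂ ⧸ J) = Submodule.Quotient.mk y
      rw [Submodule.Quotient.eq]
      exact comb_mem_span_pair _ _ 0 (-v) (by linear_combination huv)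
  have h1 := LinearMap.rank_range_add_rank_ker (f.restrictScalars ℂ)
  rw [← h1, rank_range_of_surjective (f.restrictScalars ℂ) hf]
  congr 1
  have e : LinearMap.ker (f.restrictScalars ℂ) = LinearMap.range (g.restrictScalars ℂ) := by
    ext y
    rw [LinearMap.mem_ker, LinearMap.restrictScalars_apply, ← LinearMap.mem_ker, ← hrange]
    rfl
  rw [e]
  exact rank_range_of_injective (g.restrictScalars ℂ) hg

/-- Colengths add by the exact sequence, and (a, c)(b, c) ⊆ (ab, c) makes the exponents of the
powers of the maximal ideal add as well. -/
lemma HasColength.mul {a b c : S₂} {m n : ℕ} (ha : a ≠ 0) (h : ∀ z, a ∣ c * z → a ∣ z)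
    (h1 : HasColength (Ideal.span {a, c}) m) (h2 : HasColength (Ideal.span {b, c}) n) :
    HasColength (Ideal.span {a * b, c}) (m + n) := by
  obtain ⟨h1, K, hK⟩ := h1
  obtain ⟨h2, L, hL⟩ := h2
  refine ⟨by rw [rank_quotient_mul ha h, h1, h2, Nat.cast_add], K + L, ?_⟩
  rw [pow_add]
  refine (Ideal.mul_mono hK hL).trans ?_
  rw [Ideal.span_pair_mul_span_pair, Ideal.span_le]
  rintro x (rfl | rfl | rfl | rfl)
  · exact comb_mem_span_pair _ _ 1 0 (by ring)
  · exact comb_mem_span_pair _ _ 0 a (by ring)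
  · exact comb_mem_span_pair _ _ 0 b (by ring)
  · exact comb_mem_span_pair _ _ 0 c (by ring)

/-- A linear form in two variables. -/
noncomputable def linForm₂ (a : Fin 2 → ℂ) : S₂ := C (a 0) * X 0 + C (a 1) * X 1

/-- The determinant of two vectors of the plane. -/
def det₂ (a b : Fin 2 → ℂ) : ℂ := a 0 * b 1 - a 1 * b 0

lemma mem_idealOfVars_of {F : S₂} (h : constantCoeff F = 0) : F ∈ idealOfVars (Fin 2) ℂ := by
  rw [← pow_one (idealOfVars (Fin 2) ℂ), mem_pow_idealOfVars_iff']
  intro x hx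
  have : x = 0 := by
    rw [← Finsupp.degree_eq_zero_iff]; omega
  rw [this]
  exact h

lemma idealOfVars_le_iff {I : Ideal S₂} :
    idealOfVars (Fin 2) ℂ ≤ I ↔ X 0 ∈ I ∧ X 1 ∈ I := by
  rw [idealOfVars, Ideal.span_le, Set.range_subset_iff, Fin.forall_fin_two]
  rfl

lemma hasColength_idealOfVars : HasColength (idealOfVars (Fin 2) ℂ) 1 := by
  have h : idealOfVars (Fin 2) ℂ = RingHom.ker (aeval (fun _ => 0) : S₂ →ₐ[ℂ] ℂ) := by
    refine le_antisymm (idealOfVars_le_iff.mpr ⟨?_, ?_⟩) fun F hF => mem_idealOfVars_of ?_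
    · simp [RingHom.mem_ker]
    · simp [RingHom.mem_ker]
    · rw [RingHom.mem_ker] at hF
      simpa [aeval_zero'] using hF
  refine ⟨?_, 1, by rw [pow_one]⟩
  have e := Ideal.quotientKerAlgEquivOfSurjective
    (f := (aeval (fun _ => 0) : S₂ →ₐ[ℂ] ℂ)) fun z => ⟨C z, by simp⟩
  have h1 := e.toLinearEquiv.rank_eq
  rw [h, h1]
  simp

/-- Cramer's rule expresses both variables through the two forms. -/
lemma idealOfVars_le_of_det₂ {a b : Fin 2 → ℂ} {I : Ideal S₂} (hab : det₂ a b ≠ 0) (ha : linForm₂ a ∈ I)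
    (hb : linForm₂ b ∈ I) : idealOfVars (Fin 2) ℂ ≤ I := by
  have hC : (C (det₂ a b)⁻¹ * C (det₂ a b) : S₂) = 1 := by
    rw [← C_mul, inv_mul_cancel₀ hab, C_1]
  rw [idealOfVars_le_iff]
  constructor
  · have h1 : (X 0 : S₂) = C (det₂ a b)⁻¹ * (C (b 1) * linForm₂ a - C (a 1) * linForm₂ b) := by
      have : C (b 1) * linForm₂ a - C (a 1) * linForm₂ b = C (det₂ a b) * X 0 := by
        simp only [linForm₂, det₂, C_sub, C_mul]; ring
      rw [this, ← mul_assoc, hC, one_mul]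
    rw [h1]
    exact I.mul_mem_left _ (I.sub_mem (I.mul_mem_left _ ha) (I.mul_mem_left _ hb))
  · have h1 : (X 1 : S₂) = C (det₂ a b)⁻¹ * (C (a 0) * linForm₂ b - C (b 0) * linForm₂ a) := by
      have : C (a 0) * linForm₂ b - C (b 0) * linForm₂ a = C (det₂ a b) * X 1 := by
        simp only [linForm₂, det₂, C_sub, C_mul]; ring
      rw [this, ← mul_assoc, hC, one_mul]
    rw [h1]
    exact I.mul_mem_left _ (I.sub_mem (I.mul_mem_left _ hb) (I.mul_mem_left _ ha))

lemma linForm₂_mem (a : Fin 2 → ℂ) : linForm₂ a ∈ idealOfVars (Fin 2) ℂ :=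
  mem_idealOfVars_of (by simp [linForm₂])

lemma hasColength_linForm₂ {a b : Fin 2 → ℂ} (hab : det₂ a b ≠ 0) :
    HasColength (Ideal.span {linForm₂ a, linForm₂ b}) 1 := by
  have : Ideal.span {linForm₂ a, linForm₂ b} = idealOfVars (Fin 2) ℂ :=
    le_antisymm (span_pair_le (linForm₂_mem a) (linForm₂_mem b))
      (idealOfVars_le_of_det₂ hab (Ideal.subset_span (by simp)) (Ideal.subset_span (by simp)))
  rw [this]
  exact hasColength_idealOfVars

/-- A nonzero linear form vanishes on the line parametrized by this substitution. -/
noncomputable def lineHom (a : Fin 2 → ℂ) : S₂ →ₐ[ℂ] Polynomial ℂ :=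
  aeval ![Polynomial.C (a 1) * Polynomial.X, Polynomial.C (-a 0) * Polynomial.X]

lemma linForm₂_dvd_iff {a : Fin 2 → ℂ} (ha : a ≠ 0) {F : S₂} :
    linForm₂ a ∣ F ↔ lineHom a F = 0 := by
  have h0 : lineHom a (linForm₂ a) = 0 := by
    simp only [lineHom, linForm₂, map_add, map_mul, aeval_X, algHom_C, Matrix.cons_val_zero,
      Matrix.cons_val_one, Polynomial.algebraMap_eq, Polynomial.C_neg]
    ring
  constructor
  · rintro ⟨G, rfl⟩
    rw [map_mul, h0, zero_mul]
  · intro h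
    -- `F` is congruent to a polynomial in a complementary linear form
    obtain ⟨w0, w1, hw⟩ : ∃ w0 w1 : ℂ, a 0 * w0 + a 1 * w1 = 1 := by
      obtain ⟨k, hk⟩ := Function.ne_iff.mp ha
      simp only [Pi.zero_apply] at hk
      fin_cases k
      · exact ⟨(a 0)⁻¹, 0, by simp at hk ⊢; exact mul_inv_cancel₀ hk⟩
      · exact ⟨0, (a 1)⁻¹, by simp at hk ⊢; exact mul_inv_cancel₀ hk⟩
    have hC : (C (a 0) * C w0 + C (a 1) * C w1 : S₂) = 1 := by
      rw [← C_mul, ← C_mul, ← C_add, hw, C_1]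
    set p : S₂ := C w1 * X 0 - C w0 * X 1 with hp
    have key : ∀ F : S₂, linForm₂ a ∣ F - Polynomial.aeval p (lineHom a F) := by
      intro F
      induction F using MvPolynomial.induction_on with
      | C c =>
        simp [lineHom, algebraMap_eq]
      | add q r hq hr =>
        rw [map_add, map_add]
        convert dvd_add hq hr using 1
        ring
      | mul_X q i hq =>
        have h1 : linForm₂ a ∣ X i - Polynomial.aeval p (lineHom a (X i)) := by
          fin_cases i
          · refine ⟨C w0, ?_⟩
            simp only [lineHom, aeval_X, linForm₂, hp]
            simp [algebraMap_eq]
            linear_combination (-X 0) * hC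
          · refine ⟨C w1, ?_⟩
            simp only [lineHom, aeval_X, linForm₂, hp]
            simp [algebraMap_eq]
            linear_combination (-X 1) * hC
        rw [map_mul, map_mul]
        have h2 : q * X i - Polynomial.aeval p (lineHom a q) * Polynomial.aeval p (lineHom a (X i)) =
          (q - Polynomial.aeval p (lineHom a q)) * X i +
            Polynomial.aeval p (lineHom a q) * (X i - Polynomial.aeval p (lineHom a (X i))) := by
          ring
        rw [h2]
        exact dvd_add (hq.mul_right _) (h1.mul_left _)
    simpa [h] using key F

lemma lineHom_linForm₂ (a b : Fin 2 → ℂ) :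
    lineHom a (linForm₂ b) = Polynomial.C (-det₂ a b) * Polynomial.X := by
  simp only [lineHom, linForm₂, map_add, map_mul, aeval_X, algHom_C, Matrix.cons_val_zero,
    Matrix.cons_val_one, Polynomial.algebraMap_eq, Polynomial.C_neg, Polynomial.C_sub, det₂]
  ring

lemma prime_linForm₂ {a : Fin 2 → ℂ} (ha : a ≠ 0) : Prime (linForm₂ a) := by
  refine ⟨?_, fun hu => ?_, fun F G h => ?_⟩
  · intro h
    apply ha
    have h0 := congrArg (eval ![1, 0]) h
    have h1 := congrArg (eval ![0, 1]) h
    simp [linForm₂] at h0 h1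
    ext k
    fin_cases k
    · exact h0
    · exact h1
  · have := (linForm₂_dvd_iff ha (F := 1)).mp hu.dvd
    simp at this
  · rw [linForm₂_dvd_iff ha, map_mul, mul_eq_zero] at h
    rwa [linForm₂_dvd_iff ha, linForm₂_dvd_iff ha]

lemma det₂_ne_zero_left {a b : Fin 2 → ℂ} (h : det₂ a b ≠ 0) : a ≠ 0 := by
  rintro rfl; simp [det₂] at h

lemma dvd_of_dvd_mul {ℓ c : S₂} (hℓ : Prime ℓ) (hc : ¬ ℓ ∣ c) : ∀ z, ℓ ∣ c * z → ℓ ∣ z :=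
  fun _ hz => (hℓ.dvd_or_dvd hz).resolve_left hc

lemma hasColength_top : HasColength ⊤ 0 := by
  refine ⟨?_, 0, le_top⟩
  rw [Nat.cast_zero]
  have : Subsingleton (S₂ ⧸ (⊤ : Ideal S₂)) := Ideal.Quotient.subsingleton_iff.mpr rfl
  exact rank_subsingleton' ℂ _

/-- Each factor, being independent of the form of `a`, contributes one. -/
lemma hasColength_prod {κ : Type*} (s : Finset κ) (b : κ → Fin 2 → ℂ) {a : Fin 2 → ℂ}
    (h : ∀ i ∈ s, det₂ a (b i) ≠ 0) :
    HasColength (Ideal.span {∏ i ∈ s, linForm₂ (b i), linForm₂ a}) s.card := by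
  classical
  induction s using Finset.induction_on with
  | empty =>
    have : Ideal.span {∏ i ∈ (∅ : Finset κ), linForm₂ (b i), linForm₂ a} = ⊤ := by
      rw [Ideal.eq_top_iff_one]
      exact Ideal.subset_span (by simp)
    rw [this]
    exact hasColength_top
  | insert i s hi ih =>
    rw [Finset.prod_insert hi, Finset.card_insert_of_notMem hi, add_comm]
    have hia := h i (Finset.mem_insert_self i s)
    have hia' : det₂ (b i) a ≠ 0 := by
      intro h0; apply hia; rw [det₂] at *; linear_combination -h0
    refine HasColength.mul (prime_linForm₂ (det₂_ne_zero_left hia')).ne_zero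
      (dvd_of_dvd_mul (prime_linForm₂ (det₂_ne_zero_left hia')) ?_)
      (hasColength_linForm₂ hia') (ih fun j hj => h j (Finset.mem_insert_of_mem hj))
    rw [linForm₂_dvd_iff (det₂_ne_zero_left hia'), lineHom_linForm₂]
    simpa using hia'

lemma isHomogeneous_linForm₂ (a : Fin 2 → ℂ) : (linForm₂ a).IsHomogeneous 1 := by
  refine IsHomogeneous.add ?_ ?_
  · simpa using (isHomogeneous_C (Fin 2) (a 0)).mul (isHomogeneous_X ℂ (0 : Fin 2))
  · simpa using (isHomogeneous_C (Fin 2) (a 1)).mul (isHomogeneous_X ℂ (1 : Fin 2))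

lemma euler₂ {n : ℕ} {F : S₂} (hF : F.IsHomogeneous n) :
    X 0 * pderiv 0 F + X 1 * pderiv 1 F = C (n : ℂ) * F := by
  have := hF.sum_X_mul_pderiv
  rw [Fin.sum_univ_two] at this
  rw [this]
  simp

lemma pderiv_linForm₂ (a : Fin 2 → ℂ) (k : Fin 2) : pderiv k (linForm₂ a) = C (a k) := by
  fin_cases k <;> simp [linForm₂, pderiv_X]

/-- The Jacobian ideal of a product of `m` pairwise independent linear forms has colength
`(m - 1) ^ 2`. -/
theorem hasColength_jacobian {κ : Type*} (s : Finset κ) (b : κ → Fin 2 → ℂ)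
    (hb : ∀ i ∈ s, b i ≠ 0) (h : ∀ i ∈ s, ∀ j ∈ s, i ≠ j → det₂ (b i) (b j) ≠ 0)
    (hs : s.Nonempty) :
    HasColength (Ideal.span {pderiv 0 (∏ i ∈ s, linForm₂ (b i)), pderiv 1 (∏ i ∈ s, linForm₂ (b i))})
      ((s.card - 1) ^ 2) := by
  classical
  induction hs using Finset.Nonempty.cons_induction with
  | singleton i =>
    have hi := hb i (by simp)
    have : Ideal.span {pderiv 0 (∏ i ∈ {i}, linForm₂ (b i)),
        pderiv 1 (∏ i ∈ {i}, linForm₂ (b i))} = ⊤ := by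
      obtain ⟨k, hk⟩ := Function.ne_iff.mp hi
      refine Ideal.eq_top_of_isUnit_mem _ (x := C (b i k)) (Ideal.subset_span ?_)
        ((isUnit_iff_ne_zero.mpr hk).map C)
      rw [Finset.prod_singleton, pderiv_linForm₂, pderiv_linForm₂]
      fin_cases k <;> simp
    rw [this]
    exact hasColength_top
  | cons i s hi hs ih =>
    have IH := ih (fun j hj => hb j (Finset.mem_cons_of_mem hj)) fun j hj k hk =>
      h j (Finset.mem_cons_of_mem hj) k (Finset.mem_cons_of_mem hk)
    set k : S₂ := ∏ j ∈ s, linForm₂ (b j) with hk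
    set n := s.card with hn
    have hn0 : n ≠ 0 := Finset.card_ne_zero.mpr hs
    set a := b i with ha
    have ha0 : a ≠ 0 := hb i (Finset.mem_cons_self i s)
    have hdet : ∀ j ∈ s, det₂ a (b j) ≠ 0 := fun j hj =>
      h i (Finset.mem_cons_self i s) j (Finset.mem_cons_of_mem hj) (by rintro rfl; exact hi hj)
    have hkh : k.IsHomogeneous n := by
      have := IsHomogeneous.prod s (fun j => linForm₂ (b j)) (fun _ => 1)
        (fun j _ => isHomogeneous_linForm₂ _)
      simpa using this
    have heul := euler₂ hkh
    rw [Finset.prod_cons, Finset.card_cons, ← hn, ← hk]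
    obtain ⟨w0, w1, hw⟩ : ∃ w0 w1 : ℂ, a 0 * w0 + a 1 * w1 = 1 := by
      obtain ⟨k, hk⟩ := Function.ne_iff.mp ha0
      simp only [Pi.zero_apply] at hk
      fin_cases k
      · exact ⟨(a 0)⁻¹, 0, by simp at hk ⊢; exact mul_inv_cancel₀ hk⟩
      · exact ⟨0, (a 1)⁻¹, by simp at hk ⊢; exact mul_inv_cancel₀ hk⟩
    have hC : (C (a 0) * C w0 + C (a 1) * C w1 : S₂) = 1 := by
      rw [← C_mul, ← C_mul, ← C_add, hw, C_1]
    set ℓ := linForm₂ a with hℓ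
    set p : Fin 2 → ℂ := ![w1, -w0] with hp
    have hpa : det₂ p a ≠ 0 := by
      have : det₂ p a = 1 := by simp [hp, det₂]; linear_combination hw
      rw [this]; exact one_ne_zero
    -- `D` and `E` are the derivatives of `k` in a direction along which `ℓ` is constant and in one
    -- along which `ℓ` has derivative 1. The corresponding derivatives of `ℓ * k` are `ℓ * D` and `k
    -- + ℓ * E`, so these two generate the Jacobian ideal.
    set D : S₂ := C (a 1) * pderiv 0 k - C (a 0) * pderiv 1 k with hD
    set E : S₂ := C w0 * pderiv 0 k + C w1 * pderiv 1 k with hE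
    have hpl : linForm₂ p = C w1 * X 0 - C w0 * X 1 := by
      simp [linForm₂, hp]; ring
    have hll : ℓ = C (a 0) * X 0 + C (a 1) * X 1 := rfl
    have heul' : linForm₂ p * D + ℓ * E = C (n : ℂ) * k := by
      rw [← heul, hpl, hll, hD, hE]
      linear_combination (X 0 * pderiv 0 k + X 1 * pderiv 1 k) * hC
    have hnC : (C (n : ℂ)⁻¹ * C (n : ℂ) : S₂) = 1 := by
      rw [← C_mul, inv_mul_cancel₀ (by exact_mod_cast hn0), C_1]
    have hn1C : (C (n + 1 : ℂ)⁻¹ * C (n + 1 : ℂ) : S₂) = 1 := by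
      rw [← C_mul, inv_mul_cancel₀ (by exact_mod_cast Nat.succ_ne_zero n), C_1]
    have hn1 : (C (n + 1 : ℂ) : S₂) = C (n : ℂ) + 1 := by rw [C_add, C_1]
    have hprime := prime_linForm₂ ha0
    have hℓk : ¬ ℓ ∣ k := by
      intro hd
      obtain ⟨j, hj, hjd⟩ := (hprime.dvd_finsetProd_iff _).mp hd
      rw [linForm₂_dvd_iff ha0, lineHom_linForm₂] at hjd
      exact hdet j hj (by simpa using hjd)
    have hℓD : ¬ ℓ ∣ D := by
      intro hd
      apply hℓk
      have : k = C (n : ℂ)⁻¹ * (linForm₂ p * D + ℓ * E) := by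
        rw [heul', ← mul_assoc, hnC, one_mul]
      rw [this]
      exact (dvd_add (hd.mul_left _) (dvd_mul_right _ _)).mul_left _
    have hkl := hasColength_prod s b hdet
    rw [← hk, ← hn] at hkl
    -- the pair `(D, ℓ)`
    have e1 : Ideal.span {k, ℓ} = Ideal.span {linForm₂ p * D, ℓ} := by
      refine le_antisymm (span_pair_le ?_ ?_) (span_pair_le ?_ ?_)
      · exact comb_mem_span_pair _ _ (C (n : ℂ)⁻¹) (C (n : ℂ)⁻¹ * E)
          (by linear_combination (-C (n : ℂ)⁻¹) * heul' - k * hnC)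
      · exact comb_mem_span_pair _ _ 0 1 (by ring)
      · exact comb_mem_span_pair _ _ (C (n : ℂ)) (-E) (by linear_combination heul')
      · exact comb_mem_span_pair _ _ 0 1 (by ring)
    have hDl : HasColength (Ideal.span {D, ℓ}) (n - 1) := by
      have h1 := rank_quotient_mul (a := linForm₂ p) (b := D) (c := ℓ)
        (prime_linForm₂ (det₂_ne_zero_left hpa)).ne_zero (dvd_of_dvd_mul (prime_linForm₂ (det₂_ne_zero_left hpa)) (by
          rw [linForm₂_dvd_iff (det₂_ne_zero_left hpa), hℓ, lineHom_linForm₂]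
          simpa using hpa))
      rw [← e1, hkl.1, (hasColength_linForm₂ hpa).1] at h1
      constructor
      · have hlt : Module.rank ℂ (S₂ ⧸ Ideal.span {D, ℓ}) < Cardinal.aleph0 :=
          lt_of_le_of_lt (h1 ▸ self_le_add_left _ _) (Cardinal.natCast_lt_aleph0 (n := n))
        obtain ⟨r, hr⟩ := Cardinal.lt_aleph0.mp hlt
        rw [hr] at h1 ⊢
        have h2 : n = 1 + r := by exact_mod_cast h1
        rw [h2, Nat.add_sub_cancel_left]
      · obtain ⟨K, hK⟩ := hkl.2
        refine ⟨K, hK.trans ?_⟩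
        rw [e1]
        exact span_pair_le (comb_mem_span_pair _ _ (linForm₂ p) 0 (by ring))
          (comb_mem_span_pair _ _ 0 1 (by ring))
    have e2 : Ideal.span {pderiv 0 k, pderiv 1 k} = Ideal.span {E, D} := by
      refine le_antisymm (span_pair_le ?_ ?_) (span_pair_le ?_ ?_)
      · exact comb_mem_span_pair _ _ (C (a 0)) (C w1)
          (by rw [hD, hE]; linear_combination (-pderiv 0 k) * hC)
      · exact comb_mem_span_pair _ _ (C (a 1)) (-C w0)
          (by rw [hD, hE]; linear_combination (-pderiv 1 k) * hC)
      · exact comb_mem_span_pair _ _ (C w0) (C w1) rfl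
      · exact comb_mem_span_pair _ _ (C (a 1)) (-C (a 0)) (by rw [hD]; ring)
    rw [e2] at IH
    -- The ideal (ℓE, D) has colength (n - 1) + (n - 1)^2, by induction.
    have h3 := HasColength.mul hprime.ne_zero (dvd_of_dvd_mul hprime hℓD)
      (by rw [Set.pair_comm]; exact hDl) IH
    -- Euler's relation gives n (k + ℓE) = p D + (n + 1) ℓE, so modulo D the elements ℓE and k + ℓE
    -- are proportional.
    have e3 : Ideal.span {ℓ * E, D} = Ideal.span {D, k + ℓ * E} := by
      refine le_antisymm (span_pair_le ?_ ?_) (span_pair_le ?_ ?_)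
      · exact comb_mem_span_pair _ _ (-C (n + 1 : ℂ)⁻¹ * linForm₂ p) (C (n + 1 : ℂ)⁻¹ * C (n : ℂ))
          (by linear_combination C (n + 1 : ℂ)⁻¹ * heul' - ℓ * E * hn1C +
                C (n + 1 : ℂ)⁻¹ * ℓ * E * hn1)
      · exact comb_mem_span_pair _ _ 1 0 (by ring)
      · exact comb_mem_span_pair _ _ 0 1 (by ring)
      · exact comb_mem_span_pair _ _ (C (n : ℂ)⁻¹ + 1) (C (n : ℂ)⁻¹ * linForm₂ p)
          (by linear_combination (-C (n : ℂ)⁻¹) * heul' - k * hnC)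
    rw [e3] at h3
    have e4 : Ideal.span {k, ℓ} = Ideal.span {ℓ, k + ℓ * E} := by
      refine le_antisymm (span_pair_le ?_ ?_) (span_pair_le ?_ ?_)
      · exact comb_mem_span_pair _ _ (-E) 1 (by ring)
      · exact comb_mem_span_pair _ _ 1 0 (by ring)
      · exact comb_mem_span_pair _ _ 0 1 (by ring)
      · exact comb_mem_span_pair _ _ 1 E (by ring)
    rw [e4] at hkl
    -- Splitting off `ℓ` once more adds the colength n of (ℓ, k + ℓE) = (k, ℓ); the total is n^2.
    have h4 := HasColength.mul hprime.ne_zero (dvd_of_dvd_mul hprime (by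
      rwa [dvd_add_left (dvd_mul_right _ _)])) hkl h3
    have e5 : Ideal.span {ℓ * D, k + ℓ * E} =
        Ideal.span {pderiv 0 (ℓ * k), pderiv 1 (ℓ * k)} := by
      have h0 : pderiv 0 (ℓ * k) = C (a 0) * k + ℓ * pderiv 0 k := by
        rw [pderiv_mul, hℓ, pderiv_linForm₂]
      have h1 : pderiv 1 (ℓ * k) = C (a 1) * k + ℓ * pderiv 1 k := by
        rw [pderiv_mul, hℓ, pderiv_linForm₂]
      rw [h0, h1]
      refine le_antisymm (span_pair_le ?_ ?_) (span_pair_le ?_ ?_)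
      · exact comb_mem_span_pair _ _ (C (a 1)) (-C (a 0)) (by rw [hD]; ring)
      · exact comb_mem_span_pair _ _ (C w0) (C w1) (by rw [hE]; linear_combination (-k) * hC)
      · exact comb_mem_span_pair _ _ (C w1) (C (a 0))
          (by rw [hD, hE]; linear_combination (-ℓ * pderiv 0 k) * hC)
      · exact comb_mem_span_pair _ _ (-C w0) (C (a 1))
          (by rw [hD, hE]; linear_combination (-ℓ * pderiv 1 k) * hC)
    rw [e5] at h4
    convert h4 using 1
    have h5 : ∀ n : ℕ, n ≠ 0 → (n + 1 - 1) ^ 2 = n + (n - 1 + (n - 1) ^ 2) := by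
      rintro (_ | r) hr
      · exact absurd rfl hr
      · simp only [Nat.add_sub_cancel]
        ring
    exact h5 n hn0

end

section

/-! ### Local Tjurina numbers -/

/-- The ring of power series in two variables. -/
abbrev R₂ : Type := MvPowerSeries (Fin 2) ℂ

/-- The inclusion of polynomials into power series. -/
noncomputable abbrev toPS : S₂ →+* R₂ := coeToMvPowerSeries.ringHom

lemma mem_map_pow_idealOfVars (K : ℕ) (F : R₂)
    (hF : ∀ m : Fin 2 →₀ ℕ, m.degree < K → MvPowerSeries.coeff m F = 0) :
    F ∈ (idealOfVars (Fin 2) ℂ ^ K).map toPS := by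
  induction K generalizing F with
  | zero => simp [Ideal.map_top]
  | succ K ih =>
    have hX : ∀ k : Fin 2, (MvPowerSeries.X k : R₂) ∈ (idealOfVars (Fin 2) ℂ).map toPS := by
      intro k
      have : (X k : S₂) ∈ idealOfVars (Fin 2) ℂ := Ideal.subset_span ⟨k, rfl⟩
      simpa using Ideal.mem_map_of_mem toPS this
    have hquot : ∀ (k : Fin 2) (G : R₂), (∀ m : Fin 2 →₀ ℕ, m.degree < K + 1 →
        MvPowerSeries.coeff m G = 0) → MvPowerSeries.X k ∣ G →
        G ∈ (idealOfVars (Fin 2) ℂ ^ (K + 1)).map toPS := by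
      rintro k G hG ⟨H, rfl⟩
      rw [pow_succ', Ideal.map_mul]
      refine Ideal.mul_mem_mul (hX k) (ih H fun m hm => ?_)
      have h1 := hG (Finsupp.single k 1 + m) (by
        rw [map_add, Finsupp.degree_single]; omega)
      rw [MvPowerSeries.X, MvPowerSeries.coeff_add_monomial_mul, one_mul] at h1
      exact h1
    -- The terms of `F` free of the first variable. This part is divisible by the second variable,
    -- as `F` has no constant term, and the rest is divisible by the first; each quotient has order
    -- at least `K`.
    set F₁ : R₂ := fun m => if m 0 = 0 then MvPowerSeries.coeff m F else 0 with hF₁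
    have hc : ∀ m, MvPowerSeries.coeff m F₁ = if m 0 = 0 then MvPowerSeries.coeff m F else 0 :=
      fun m => rfl
    have h1 : F₁ ∈ (idealOfVars (Fin 2) ℂ ^ (K + 1)).map toPS := by
      refine hquot 1 F₁ (fun m hm => ?_) (MvPowerSeries.X_dvd_iff.mpr fun m hm => ?_)
      · rw [hc, hF m hm, ite_self]
      · rw [hc]
        split_ifs with h0
        · apply hF
          have : m = 0 := by
            ext k; fin_cases k
            · exact h0
            · exact hm
          rw [this, map_zero]
          omega
        · rfl
    have h2 : F - F₁ ∈ (idealOfVars (Fin 2) ℂ ^ (K + 1)).map toPS := by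
      refine hquot 0 _ (fun m hm => ?_) (MvPowerSeries.X_dvd_iff.mpr fun m hm => ?_)
      · rw [map_sub, hc, hF m hm, ite_self, sub_zero]
      · rw [map_sub, hc, if_pos hm, sub_self]
    have := Ideal.add_mem _ h1 h2
    rwa [add_sub_cancel] at this

/-- Because `I` contains a power of the maximal ideal, membership depends only on truncations, and
truncations of power series combinations of elements of `I` are again in `I`. -/
lemma comap_map_toPS {I : Ideal S₂} {K : ℕ} (hK : idealOfVars (Fin 2) ℂ ^ K ≤ I) :
    (I.map toPS).comap toPS = I := by
  refine le_antisymm (fun F hF => ?_) Ideal.le_comap_map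
  have htr : ∀ q : S₂, q - MvPowerSeries.truncTotal K (toPS q) ∈ idealOfVars (Fin 2) ℂ ^ K := by
    intro q
    rw [mem_pow_idealOfVars_iff']
    intro m hm
    rw [coeff_sub, MvPowerSeries.coeff_truncTotal _ hm]
    simp
  have key : ∀ x ∈ I.map toPS, MvPowerSeries.truncTotal K x ∈ I := by
    intro x hx
    induction hx using Submodule.span_induction with
    | mem x hx =>
      obtain ⟨q, hq, rfl⟩ := hx
      have := I.sub_mem hq (hK (htr q))
      simpa using this
    | zero => simp
    | add x y _ _ hx hy => rw [map_add]; exact I.add_mem hx hy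
    | smul g x _ hx =>
      have h1 : MvPowerSeries.truncTotal K (g • x) - MvPowerSeries.truncTotal K g *
          MvPowerSeries.truncTotal K x ∈ idealOfVars (Fin 2) ℂ ^ K := by
        rw [mem_pow_idealOfVars_iff']
        intro m hm
        rw [coeff_sub, MvPowerSeries.coeff_truncTotal _ hm,
          MvPowerSeries.coeff_truncTotal_mul_truncTotal_eq_coeff_mul _ _ hm, smul_eq_mul, sub_self]
      have := I.add_mem (hK h1) (I.mul_mem_left (MvPowerSeries.truncTotal K g) hx)
      rwa [sub_add_cancel] at this
  have := I.add_mem (hK (htr F)) (key _ hF)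
  rwa [sub_add_cancel] at this

/-- Completion at the origin does not change a quotient supported there: the polynomial ring maps
onto the power series quotient by truncation, with kernel `I`. -/
lemma finrank_quotient_map_toPS {I : Ideal S₂} {n : ℕ} (h : HasColength I n) :
    Module.finrank ℂ (R₂ ⧸ I.map toPS) = n := by
  obtain ⟨h1, K, hK⟩ := h
  let φ : S₂ →ₐ[ℂ] R₂ ⧸ I.map toPS :=
    (Ideal.Quotient.mkₐ ℂ (I.map toPS)).comp (coeToMvPowerSeries.algHom ℂ)
  have hφ : ∀ F, φ F = Ideal.Quotient.mk (I.map toPS) (toPS F) := by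
    intro F
    simp [φ]
  have hsurj : Function.Surjective φ := by
    intro y
    obtain ⟨F, rfl⟩ := Ideal.Quotient.mk_surjective y
    refine ⟨MvPowerSeries.truncTotal K F, ?_⟩
    rw [hφ, Ideal.Quotient.eq]
    refine Ideal.map_mono hK (mem_map_pow_idealOfVars K _ fun m hm => ?_)
    rw [map_sub, coeToMvPowerSeries.ringHom_apply, coeff_coe, MvPowerSeries.coeff_truncTotal _ hm,
      sub_self]
  have hker : RingHom.ker φ = I := by
    conv_rhs => rw [← comap_map_toPS hK]
    ext F
    rw [RingHom.mem_ker, hφ, Ideal.Quotient.eq_zero_iff_mem, Ideal.mem_comap]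
  have e := ((Ideal.quotientEquivAlgOfEq ℂ hker).symm.trans
    (Ideal.quotientKerAlgEquivOfSurjective hsurj)).toLinearEquiv
  rw [← e.finrank_eq]
  exact Module.finrank_eq_of_rank_eq h1

lemma tjurinaIdeal_eq_map (g : S₂) :
    tjurinaIdeal g = (Ideal.span {g, pderiv 0 g, pderiv 1 g}).map toPS := by
  rw [Ideal.map_span, tjurinaIdeal]
  congr 1
  simp [Set.image_insert_eq]

/-- Euler's relation puts `h` into its own Jacobian ideal, and `u` is a unit in the power series
ring, so the Tjurina ideal of the product is the Jacobian ideal of `h`. -/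
lemma tjurinaIdeal_mul {u h : S₂} {n : ℕ} (hu : constantCoeff u ≠ 0) (hh : h.IsHomogeneous n)
    (hn : n ≠ 0) :
    tjurinaIdeal (u * h) = (Ideal.span {pderiv 0 h, pderiv 1 h}).map toPS := by
  rw [tjurinaIdeal_eq_map]
  have hJ : h ∈ Ideal.span {pderiv 0 h, pderiv 1 h} := by
    have h1 := euler₂ hh
    have hnC : (C (n : ℂ)⁻¹ * C (n : ℂ) : S₂) = 1 := by
      rw [← C_mul, inv_mul_cancel₀ (by exact_mod_cast hn), C_1]
    exact comb_mem_span_pair _ _ (C (n : ℂ)⁻¹ * X 0) (C (n : ℂ)⁻¹ * X 1)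
      (by linear_combination (-C (n : ℂ)⁻¹) * h1 - h * hnC)
  have hd : ∀ k, pderiv k (u * h) = pderiv k u * h + u * pderiv k h := fun k => pderiv_mul
  refine le_antisymm (Ideal.map_mono ?_) ?_
  · rw [Ideal.span_le]
    rintro x (rfl | rfl | rfl)
    · exact Ideal.mul_mem_left _ _ hJ
    · rw [hd]
      exact Ideal.add_mem _ (Ideal.mul_mem_left _ _ hJ)
        (Ideal.mul_mem_left _ _ (Ideal.subset_span (by simp)))
    · rw [hd]
      exact Ideal.add_mem _ (Ideal.mul_mem_left _ _ hJ)
        (Ideal.mul_mem_left _ _ (Ideal.subset_span (by simp)))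
  · set I := (Ideal.span {u * h, pderiv 0 (u * h), pderiv 1 (u * h)}).map toPS with hI
    have hunit : IsUnit (toPS u) := by
      rw [MvPowerSeries.isUnit_iff_constantCoeff, isUnit_iff_ne_zero]
      have : MvPowerSeries.constantCoeff (toPS u) = constantCoeff u := by
        rw [coeToMvPowerSeries.ringHom_apply, ← MvPowerSeries.coeff_zero_eq_constantCoeff_apply,
          coeff_coe]
        rfl
      rwa [this]
    have hmem : ∀ x, toPS (u * x) ∈ I → toPS x ∈ I := by
      intro x hx
      rw [map_mul] at hx
      exact (Ideal.unit_mul_mem_iff_mem I hunit).mp hx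
    have h0 : toPS h ∈ I := hmem _ (Ideal.mem_map_of_mem _ (Ideal.subset_span (by simp)))
    have hk : ∀ k : Fin 2, toPS (pderiv k h) ∈ I := by
      intro k
      apply hmem
      have h1 : toPS (pderiv k (u * h)) ∈ I := by
        refine Ideal.mem_map_of_mem _ (Ideal.subset_span ?_)
        fin_cases k <;> simp
      have h2 : u * pderiv k h = pderiv k (u * h) - pderiv k u * h := by rw [hd]; ring
      rw [h2, map_sub, map_mul toPS]
      exact Ideal.sub_mem _ h1 (Ideal.mul_mem_left _ _ h0)
    rw [Ideal.map_span, Ideal.span_le]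
    rintro _ ⟨x, (rfl | rfl), rfl⟩
    · exact hk 0
    · exact hk 1

lemma tjurinaIdeal_eq_top {u : S₂} (hu : constantCoeff u ≠ 0) : tjurinaIdeal u = ⊤ := by
  have hunit : IsUnit (u : R₂) := by
    rw [MvPowerSeries.isUnit_iff_constantCoeff, isUnit_iff_ne_zero]
    rw [← MvPowerSeries.coeff_zero_eq_constantCoeff_apply, coeff_coe]
    exact hu
  exact Ideal.eq_top_of_isUnit_mem _ (Ideal.subset_span (by simp)) hunit

lemma chart_ne_zero {v : Fin 3 → ℂ} (hv : v ≠ 0) : v (chart v) ≠ 0 := by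
  rw [chart]
  split_ifs with h0 h1
  · exact h0
  · exact h1
  · intro h2
    push Not at h0 h1
    apply hv
    ext k
    fin_cases k
    · exact h0
    · exact h1
    · exact h2

lemma localEquation_linearForm (a v : Fin 3 → ℂ) :
    localEquation (linearForm a) v =
      C (a ⬝ᵥ v) + linForm₂ (fun j => a ((chart v).succAbove j)) := by
  rw [localEquation, linearForm, map_sum, Fin.sum_univ_succAbove _ (chart v), dotProduct,
    Fin.sum_univ_succAbove _ (chart v)]
  simp only [map_mul, aeval_X, algHom_C, algebraMap_eq, Fin.insertNth_apply_same,
    Fin.insertNth_apply_succAbove, Fin.sum_univ_two, linForm₂, C_add]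
  ring

/-- On vectors orthogonal to `v` the `k`-th coordinate is determined by the other two, as `v k ≠ 0`;
dropping it preserves independence. -/
lemma det₂_succAbove_ne_zero {a b v : Fin 3 → ℂ} {k : Fin 3} (hv : v k ≠ 0) (ha : a ⬝ᵥ v = 0)
    (hb : b ⬝ᵥ v = 0) (hab : a ⨯₃ b ≠ 0) :
    det₂ (fun j => a (k.succAbove j)) (fun j => b (k.succAbove j)) ≠ 0 := by
  intro h
  apply hab
  rw [cross_apply]
  simp only [dotProduct, Fin.sum_univ_three] at ha hb
  fin_cases k <;> simp [det₂, Fin.succAbove] at h hv <;> ext j <;> fin_cases j <;>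
    simp <;> apply mul_left_cancel₀ hv <;>
    first
    | linear_combination (v 0) * h
    | linear_combination (-v 1) * h
    | linear_combination (v 2) * h
    | linear_combination (a 2) * hb - (b 2) * ha + (v 1) * h
    | linear_combination -(a 1) * hb + (b 1) * ha + (v 2) * h
    | linear_combination -(a 2) * hb + (b 2) * ha + (v 0) * h
    | linear_combination (a 0) * hb - (b 0) * ha - (v 2) * h
    | linear_combination (a 1) * hb - (b 1) * ha + (v 0) * h
    | linear_combination -(a 0) * hb + (b 0) * ha + (v 1) * h
    | linear_combination (b 2) * ha - (a 2) * hb - (v 0) * h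

/-- The lines that avoid the point contribute a unit to the local equation, and those through it a
product of pairwise independent binary linear forms. -/
theorem localTjurina_eq {d : ℕ} {a : Fin d → Fin 3 → ℂ} (ha : Distinct a) {c : ℂ} (hc : c ≠ 0)
    {v : Fin 3 → ℂ} (hv : v ≠ 0) :
    localTjurina (C c * ∏ i, linearForm (a i)) v =
      ((Finset.univ.filter fun i => a i ⬝ᵥ v = 0).card - 1) ^ 2 := by
  classical
  set s := Finset.univ.filter fun i => a i ⬝ᵥ v = 0 with hs
  set b : Fin d → Fin 2 → ℂ := fun i j => a i ((chart v).succAbove j) with hb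
  set u : S₂ := C c * ∏ i ∈ sᶜ, (C (a i ⬝ᵥ v) + linForm₂ (b i)) with hu
  set h : S₂ := ∏ i ∈ s, linForm₂ (b i) with hh
  have hg : localEquation (C c * ∏ i, linearForm (a i)) v = u * h := by
    have : localEquation (C c * ∏ i, linearForm (a i)) v =
        C c * ∏ i, localEquation (linearForm (a i)) v := by
      simp only [localEquation, map_mul, map_prod, algHom_C, algebraMap_eq]
    rw [this, hu, hh, mul_assoc, ← Finset.prod_compl_mul_prod s]
    congr 2
    · exact Finset.prod_congr rfl fun i _ => localEquation_linearForm _ _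
    · refine Finset.prod_congr rfl fun i hi => ?_
      rw [localEquation_linearForm, (Finset.mem_filter.mp hi).2, C_0, zero_add]
  have hu0 : constantCoeff u ≠ 0 := by
    rw [hu, map_mul, map_prod, constantCoeff_C]
    refine mul_ne_zero hc (Finset.prod_ne_zero_iff.mpr fun i hi => ?_)
    have : a i ⬝ᵥ v ≠ 0 := by simpa [hs] using hi
    simpa [linForm₂] using this
  rw [localTjurina, hg]
  -- Off the curve the truncated subtraction `0 - 1 = 0` yields the value 0, as it should.
  rcases s.eq_empty_or_nonempty with hs0 | hne
  · have : u * h = u := by rw [hh, hs0, Finset.prod_empty, mul_one]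
    rw [this, tjurinaIdeal_eq_top hu0, hs0]
    have : Subsingleton (R₂ ⧸ (⊤ : Ideal R₂)) := Ideal.Quotient.subsingleton_iff.mpr rfl
    simp [Module.finrank_zero_of_subsingleton]
  · have hdet : ∀ i ∈ s, ∀ j ∈ s, i ≠ j → det₂ (b i) (b j) ≠ 0 := fun i hi j hj hij =>
      det₂_succAbove_ne_zero (chart_ne_zero hv) (Finset.mem_filter.mp hi).2
        (Finset.mem_filter.mp hj).2 (ha.2 i j hij)
    have hb0 : ∀ i ∈ s, b i ≠ 0 := by
      intro i hi h0
      apply ha.1 i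
      have h1 := (Finset.mem_filter.mp hi).2
      rw [dotProduct, Fin.sum_univ_succAbove _ (chart v)] at h1
      have h2 : ∀ j, a i ((chart v).succAbove j) = 0 := fun j => congrFun h0 j
      simp only [h2, zero_mul, Finset.sum_const_zero, add_zero, mul_eq_zero,
        chart_ne_zero hv, or_false] at h1
      ext k
      rcases Fin.eq_self_or_eq_succAbove (chart v) k with rfl | ⟨j, rfl⟩
      · exact h1
      · exact h2 j
    have hhom : h.IsHomogeneous s.card := by
      have := IsHomogeneous.prod s (fun j => linForm₂ (b j)) (fun _ => 1)
        (fun j _ => isHomogeneous_linForm₂ _)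
      simpa using this
    rw [tjurinaIdeal_mul hu0 hhom (Finset.card_ne_zero.mpr hne)]
    exact finrank_quotient_map_toPS (hasColength_jacobian s b hb0 hdet hne)

end

section

/-! ### Concurrent lines -/

lemma tri_eq_dot (a b c : Fin 3 → ℂ) : tri a b c = a ⬝ᵥ (b ⨯₃ c) := by
  simp [tri, cross_apply, dotProduct, Fin.sum_univ_three]

lemma tri_smul (x y z : ℂ) (a b c : Fin 3 → ℂ) :
    tri (x • a) (y • b) (z • c) = x * y * z * tri a b c := by
  simp [tri]; ring

lemma tri_swap_left (a b c : Fin 3 → ℂ) : tri b a c = -tri a b c := by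
  simp [tri]; ring

lemma tri_swap_right (a b c : Fin 3 → ℂ) : tri a c b = -tri a b c := by
  simp [tri]; ring

lemma tri_self_left (a b : Fin 3 → ℂ) : tri a a b = 0 := by
  simp [tri]; ring

lemma tri_self_right (a b : Fin 3 → ℂ) : tri a b b = 0 := by
  simp [tri]; ring

lemma tri_self_outer (a b : Fin 3 → ℂ) : tri a b a = 0 := by
  simp [tri]; ring

/-- Three dependent vectors, the last two of which are independent. -/
lemma exists_comb_of_tri {a b c : Fin 3 → ℂ} (h : tri a b c = 0) (hbc : b ⨯₃ c ≠ 0) :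
    ∃ x y : ℂ, a = x • b + y • c := by
  obtain ⟨k, hk⟩ := Function.ne_iff.mp hbc
  rw [cross_apply] at hk
  simp only [tri] at h
  fin_cases k <;> simp at hk
  · have hD := mul_inv_cancel₀ hk
    refine ⟨(a 1 * c 2 - a 2 * c 1) * (b 1 * c 2 - b 2 * c 1)⁻¹,
      (b 1 * a 2 - b 2 * a 1) * (b 1 * c 2 - b 2 * c 1)⁻¹, ?_⟩
    generalize (b 1 * c 2 - b 2 * c 1)⁻¹ = D at hD ⊢
    ext i
    fin_cases i <;> simp
    · linear_combination D * h - a 0 * hD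
    · linear_combination - a 1 * hD
    · linear_combination - a 2 * hD
  · have hD := mul_inv_cancel₀ hk
    refine ⟨(a 2 * c 0 - a 0 * c 2) * (b 2 * c 0 - b 0 * c 2)⁻¹,
      (b 2 * a 0 - b 0 * a 2) * (b 2 * c 0 - b 0 * c 2)⁻¹, ?_⟩
    generalize (b 2 * c 0 - b 0 * c 2)⁻¹ = D at hD ⊢
    ext i
    fin_cases i <;> simp
    · linear_combination - a 0 * hD
    · linear_combination D * h - a 1 * hD
    · linear_combination - a 2 * hD
  · have hD := mul_inv_cancel₀ hk
    refine ⟨(a 0 * c 1 - a 1 * c 0) * (b 0 * c 1 - b 1 * c 0)⁻¹,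
      (b 0 * a 1 - b 1 * a 0) * (b 0 * c 1 - b 1 * c 0)⁻¹, ?_⟩
    generalize (b 0 * c 1 - b 1 * c 0)⁻¹ = D at hD ⊢
    ext i
    fin_cases i <;> simp
    · linear_combination - a 0 * hD
    · linear_combination - a 1 * hD
    · linear_combination D * h - a 2 * hD

lemma dot_cross_left (a b : Fin 3 → ℂ) : a ⬝ᵥ (a ⨯₃ b) = 0 := dot_self_cross a b

lemma dot_cross_right (a b : Fin 3 → ℂ) : b ⬝ᵥ (a ⨯₃ b) = 0 := dot_cross_self a b

/-- The common zeros of two independent linear forms. -/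
lemma cross_cross_eq_zero {a b v : Fin 3 → ℂ} (ha : a ⬝ᵥ v = 0) (hb : b ⬝ᵥ v = 0) :
    (a ⨯₃ b) ⨯₃ v = 0 := by
  simp only [dotProduct, Fin.sum_univ_three] at ha hb
  ext i
  rw [cross_apply, cross_apply]
  fin_cases i <;> simp
  · linear_combination (b 0) * ha - (a 0) * hb
  · linear_combination (b 1) * ha - (a 1) * hb
  · linear_combination (b 2) * ha - (a 2) * hb

/-- The cross product of `b` and `c` is a nonzero multiple of `v`. -/
lemma tri_eq_zero_iff_dot {a b c v : Fin 3 → ℂ} (hbc : b ⨯₃ c ≠ 0) (hv : v ≠ 0)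
    (hb : b ⬝ᵥ v = 0) (hc : c ⬝ᵥ v = 0) : tri a b c = 0 ↔ a ⬝ᵥ v = 0 := by
  obtain ⟨s, hs⟩ := (cross_eq_zero_iff hbc).mp (cross_cross_eq_zero hb hc)
  have hs0 : s ≠ 0 := by rintro rfl; exact hv (by simpa using hs)
  rw [tri_eq_dot, hs, dotProduct_smul, smul_eq_mul]
  simp [hs0]

/-! ### The total Tjurina number of an arrangement of six lines -/

/-- A set of m indices has m(m-1)/2 pairs, of which (m-1)(m-2)/2 avoid the least index; the two
numbers add up to (m-1)^2. -/
lemma card_pairs_add (B : Finset (Fin 6)) :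
    ∑ x ∈ Finset.univ.filter (fun x : Fin 6 × Fin 6 => x.1 < x.2 ∧ x.1 ∈ B ∧ x.2 ∈ B),
      (1 + if ∃ i < x.1, i ∈ B then 1 else 0) = (B.card - 1) ^ 2 := by
  revert B
  decide

-- The pairs of lines are grouped by their meeting points, and `card_pairs_add` is applied to the
-- lines through each of them. The total becomes computable from the concurrent triples alone.
open Classical in
theorem tjurina_eq {p : Curve 6} {a : Fin 6 → Fin 3 → ℂ} (ha : Distinct a) (hp : Rep p a) :
    tjurina p = ∑ x ∈ Finset.univ.filter (fun x : Fin 6 × Fin 6 => x.1 < x.2),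
      (1 + if ∃ i < x.1, tri (a i) (a x.1) (a x.2) = 0 then 1 else 0) := by
  obtain ⟨c, hc, hpc⟩ := hp
  set B : Plane → Finset (Fin 6) := fun q => Finset.univ.filter fun i => a i ⬝ᵥ q.rep = 0 with hB
  set P : Finset (Fin 6 × Fin 6) := Finset.univ.filter (fun x => x.1 < x.2) with hP
  -- The second branch is a dummy value: distinct lines always have a nonzero cross product.
  set meet : Fin 6 × Fin 6 → Plane := fun x =>
    if h : a x.1 ⨯₃ a x.2 ≠ 0 then Projectivization.mk ℂ _ h else
      Projectivization.mk ℂ _ (ha.1 x.1) with hmeet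
  have hmeet_iff : ∀ x ∈ P, ∀ q, meet x = q ↔ x.1 ∈ B q ∧ x.2 ∈ B q := by
    intro x hx q
    have hne := ha.2 x.1 x.2 (Finset.mem_filter.mp hx).2.ne
    have h1 : meet x = Projectivization.mk ℂ _ hne := dif_pos hne
    rw [h1]
    constructor
    · rintro rfl
      obtain ⟨s, -, hs⟩ := exists_rep_mk _ hne
      simp [hB, hs, dotProduct_smul, dot_cross_left, dot_cross_right]
    · intro h
      have h2 : a x.1 ⬝ᵥ q.rep = 0 := (Finset.mem_filter.mp h.1).2
      have h3 : a x.2 ⬝ᵥ q.rep = 0 := (Finset.mem_filter.mp h.2).2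
      rw [← Projectivization.mk_rep q]
      exact (Projectivization.mk_eq_mk_iff_crossProduct_eq_zero _ _).mpr
        (cross_cross_eq_zero h2 h3)
  have hloc : ∀ q : Plane, localTjurina p.form q.rep = ((B q).card - 1) ^ 2 := by
    intro q
    rw [hpc]
    exact localTjurina_eq ha hc (Projectivization.rep_nonzero q)
  rw [tjurina, finsum_eq_sum_of_support_subset (s := P.image meet)]
  · rw [← Finset.sum_fiberwise_of_maps_to (s := P) (t := P.image meet) (g := meet)
      fun x hx => Finset.mem_image_of_mem _ hx]
    refine Finset.sum_congr rfl fun q _ => ?_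
    rw [hloc, ← card_pairs_add]
    have hfil : P.filter (fun x => meet x = q) =
        Finset.univ.filter (fun x : Fin 6 × Fin 6 => x.1 < x.2 ∧ x.1 ∈ B q ∧ x.2 ∈ B q) := by
      ext x
      constructor
      · intro hx'
        obtain ⟨hx, h⟩ := Finset.mem_filter.mp hx'
        exact Finset.mem_filter.mpr
          ⟨Finset.mem_univ _, (Finset.mem_filter.mp hx).2, (hmeet_iff x hx q).mp h⟩
      · intro hx'
        obtain ⟨-, h1, h2⟩ := Finset.mem_filter.mp hx'
        have hx : x ∈ P := Finset.mem_filter.mpr ⟨Finset.mem_univ _, h1⟩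
        exact Finset.mem_filter.mpr ⟨hx, (hmeet_iff x hx q).mpr h2⟩
    rw [hfil]
    refine Finset.sum_congr rfl fun x hx => ?_
    obtain ⟨-, h1, h2, h3⟩ := Finset.mem_filter.mp hx
    congr 1
    have : (∃ i < x.1, i ∈ B q) ↔ ∃ i < x.1, tri (a i) (a x.1) (a x.2) = 0 := by
      refine exists_congr fun i => and_congr_right fun _ => ?_
      rw [tri_eq_zero_iff_dot (ha.2 _ _ h1.ne) (Projectivization.rep_nonzero q)
        (Finset.mem_filter.mp h2).2 (Finset.mem_filter.mp h3).2]
      simp [hB]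
    simp only [this]
  -- A point with nonzero Tjurina number lies on two lines at least, hence is the meeting point of a
  -- pair.
  · intro q hq
    rw [Function.mem_support, hloc] at hq
    have h1 : 1 < (B q).card := by
      by_contra h0
      apply hq
      have : (B q).card - 1 = 0 := by omega
      rw [this]
      rfl
    obtain ⟨i, hi, j, hj, hij⟩ := Finset.one_lt_card.mp h1
    rw [Finset.coe_image]
    rcases lt_or_gt_of_ne hij with h | h
    · have hx : (i, j) ∈ P := Finset.mem_filter.mpr ⟨Finset.mem_univ _, h⟩
      exact ⟨(i, j), hx, (hmeet_iff _ hx q).mpr ⟨hi, hj⟩⟩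
    · have hx : (j, i) ∈ P := Finset.mem_filter.mpr ⟨Finset.mem_univ _, h⟩
      exact ⟨(j, i), hx, (hmeet_iff _ hx q).mpr ⟨hj, hi⟩⟩

/-! ### Combinatorial types -/

/-- The concurrent triples of the arrangement `a` are given by `T`. -/
def Pattern (T : Fin 6 → Fin 6 → Fin 6 → Bool) (a : Fin 6 → Fin 3 → ℂ) : Prop :=
  ∀ i j k, i < j → j < k → (tri (a i) (a j) (a k) = 0 ↔ T i j k = true)

/-- The curves of the arrangements of combinatorial type `T`. -/
def curvesOfType (T : Fin 6 → Fin 6 → Fin 6 → Bool) : Set (Curve 6) :=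
  {p | ∃ a, Distinct a ∧ Pattern T a ∧ Rep p a}

lemma tjurina_of_pattern {T : Fin 6 → Fin 6 → Fin 6 → Bool} {p : Curve 6}
    {a : Fin 6 → Fin 3 → ℂ} (ha : Distinct a) (hT : Pattern T a) (hp : Rep p a) :
    tjurina p = ∑ x ∈ Finset.univ.filter (fun x : Fin 6 × Fin 6 => x.1 < x.2),
      (1 + if ∃ i < x.1, T i x.1 x.2 = true then 1 else 0) := by
  classical
  rw [tjurina_eq ha hp]
  refine Finset.sum_congr rfl fun x hx => ?_
  congr 1
  have : (∃ i < x.1, tri (a i) (a x.1) (a x.2) = 0) ↔ ∃ i < x.1, T i x.1 x.2 = true :=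
    exists_congr fun i => and_congr_right fun hi => hT i x.1 x.2 hi (Finset.mem_filter.mp hx).2
  simp only [this]

/-- All lines are concurrent. -/
def type6 : Fin 6 → Fin 6 → Fin 6 → Bool := fun _ _ _ => true
/-- A point of multiplicity five. -/
def type5 : Fin 6 → Fin 6 → Fin 6 → Bool := fun _ _ k => k < 5
/-- A point of multiplicity four. -/
def type4 : Fin 6 → Fin 6 → Fin 6 → Bool := fun _ _ k => k < 4
/-- A point of multiplicity four and a triple point. -/
def type43 : Fin 6 → Fin 6 → Fin 6 → Bool := fun i j k => k < 4 || i = 0 && j = 4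
/-- Three triple points. -/
def type333 : Fin 6 → Fin 6 → Fin 6 → Bool := fun i j k =>
  i = 0 && j = 1 && k = 3 || i = 0 && j = 2 && k = 4 || i = 1 && j = 2 && k = 5
/-- Four triple points. -/
def type3333 : Fin 6 → Fin 6 → Fin 6 → Bool := fun i j k => type333 i j k || i = 3

lemma tjurina_type6 {p : Curve 6} (hp : p ∈ curvesOfType type6) : tjurina p = 25 := by
  obtain ⟨a, ha, hT, hp⟩ := hp
  rw [tjurina_of_pattern ha hT hp]; decide

lemma tjurina_type5 {p : Curve 6} (hp : p ∈ curvesOfType type5) : tjurina p = 21 := by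
  obtain ⟨a, ha, hT, hp⟩ := hp
  rw [tjurina_of_pattern ha hT hp]; decide

lemma tjurina_type4 {p : Curve 6} (hp : p ∈ curvesOfType type4) : tjurina p = 18 := by
  obtain ⟨a, ha, hT, hp⟩ := hp
  rw [tjurina_of_pattern ha hT hp]; decide

lemma tjurina_type43 {p : Curve 6} (hp : p ∈ curvesOfType type43) : tjurina p = 19 := by
  obtain ⟨a, ha, hT, hp⟩ := hp
  rw [tjurina_of_pattern ha hT hp]; decide

lemma tjurina_type333 {p : Curve 6} (hp : p ∈ curvesOfType type333) : tjurina p = 18 := by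
  obtain ⟨a, ha, hT, hp⟩ := hp
  rw [tjurina_of_pattern ha hT hp]; decide

lemma tjurina_type3333 {p : Curve 6} (hp : p ∈ curvesOfType type3333) : tjurina p = 19 := by
  obtain ⟨a, ha, hT, hp⟩ := hp
  rw [tjurina_of_pattern ha hT hp]; decide

end

section

/-! ### Intersection lattices -/

/-- Both ranges are the quotient of one and the same preorder on the index type. -/
lemma nonempty_orderIso_range {α X Y : Type*} {f : α → Set X} {g : α → Set Y}
    (h : ∀ I J, f I ⊆ f J ↔ g I ⊆ g J) : Nonempty (Set.range f ≃o Set.range g) := by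
  have hc : ∀ x : Set.range f, f x.2.choose = x := fun x => x.2.choose_spec
  let φ : Set.range f ↪o Set.range g := OrderEmbedding.ofMapLEIff
    (fun x => ⟨g x.2.choose, ⟨_, rfl⟩⟩) fun x y => by
      change g x.2.choose ⊆ g y.2.choose ↔ x ≤ y
      rw [← h, hc, hc]
      rfl
  refine ⟨RelIso.ofSurjective φ ?_⟩
  rintro ⟨_, I, rfl⟩
  refine ⟨⟨f I, I, rfl⟩, Subtype.ext ?_⟩
  have h1 := hc ⟨f I, I, rfl⟩
  exact Set.Subset.antisymm ((h _ _).mp h1.subset) ((h _ _).mp h1.symm.subset)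

variable {d : ℕ}

/-- The intersection of the planes with indices in `I`. -/
def flat (a : Fin d → Fin 3 → ℂ) (I : Finset (Fin d)) : Set (Fin 3 → ℂ) :=
  ⋂ i ∈ I, {v | a i ⬝ᵥ v = 0}

lemma mem_flat {a : Fin d → Fin 3 → ℂ} {I : Finset (Fin d)} {v : Fin 3 → ℂ} :
    v ∈ flat a I ↔ ∀ i ∈ I, a i ⬝ᵥ v = 0 := by
  simp [flat]

lemma flat_subset_flat_iff {a : Fin d → Fin 3 → ℂ} {I J : Finset (Fin d)} :
    flat a I ⊆ flat a J ↔ ∀ j ∈ J, flat a I ⊆ flat a {j} := by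
  constructor
  · intro h j hj v hv
    rw [mem_flat]
    intro i hi
    rw [Finset.mem_singleton.mp hi]
    exact mem_flat.mp (h hv) j hj
  · intro h v hv
    rw [mem_flat]
    exact fun j hj => mem_flat.mp (h j hj hv) j (Finset.mem_singleton_self j)

lemma exists_dot_ne_zero {a : Fin 3 → ℂ} (ha : a ≠ 0) : ∃ v, a ⬝ᵥ v ≠ 0 := by
  obtain ⟨k, hk⟩ := Function.ne_iff.mp ha
  exact ⟨Pi.single k 1, by simpa using hk⟩

lemma cross_eq_zero_of_dot {a b : Fin 3 → ℂ} (h : ∀ v, a ⬝ᵥ v = 0 → b ⬝ᵥ v = 0) :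
    a ⨯₃ b = 0 := by
  by_cases ha : a = 0
  · simp [ha]
  exact cross_eq_zero_of_dvd (linearForm_dvd_of_eval ha fun v hv => by
    rw [eval_linearForm]; exact h v hv)

/-- The three alternatives reflect the rank of the vectors in `I`: apart from `j ∈ I`, either `a j`
lies in the span of two of them, or three of them are independent and the flat is zero. Hence
inclusions depend only on concurrency. -/
lemma flat_subset_iff {a : Fin d → Fin 3 → ℂ} (ha : Distinct a) (I : Finset (Fin d))
    (j : Fin d) : flat a I ⊆ flat a {j} ↔
      j ∈ I ∨ (∃ x ∈ I, ∃ y ∈ I, x ≠ y ∧ tri (a j) (a x) (a y) = 0) ∨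
      ∃ x ∈ I, ∃ y ∈ I, ∃ z ∈ I, tri (a x) (a y) (a z) ≠ 0 := by
  constructor
  · intro h
    have h' : ∀ v ∈ flat a I, a j ⬝ᵥ v = 0 := fun v hv => mem_flat.mp (h hv) j (by simp)
    by_contra! hne
    obtain ⟨hj, h2, h3⟩ := hne
    rcases I.eq_empty_or_nonempty with rfl | ⟨i, hi⟩
    · obtain ⟨v, hv⟩ := exists_dot_ne_zero (ha.1 j)
      exact hv (h' v (by simp [mem_flat]))
    · by_cases hI : ∃ y ∈ I, i ≠ y
      · obtain ⟨y, hy, hiy⟩ := hI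
        apply h2 i hi y hy hiy
        rw [tri_eq_dot]
        apply h'
        rw [mem_flat]
        intro k hk
        rw [← tri_eq_dot]
        exact h3 k hk i hi y hy
      · push Not at hI
        apply ha.2 i j (by rintro rfl; exact hj hi)
        refine cross_eq_zero_of_dot fun v hv => h' v (mem_flat.mpr fun k hk => ?_)
        rw [← hI k hk]
        exact hv
  · rintro (h | ⟨x, hx, y, hy, hxy, h⟩ | ⟨x, hx, y, hy, z, hz, h⟩) v hv <;> rw [mem_flat] at hv ⊢
      <;> intro i hi <;> rw [Finset.mem_singleton.mp hi]
    · exact hv j h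
    · obtain ⟨s, t, hst⟩ := exists_comb_of_tri h (ha.2 x y hxy)
      rw [hst, add_dotProduct, smul_dotProduct, smul_dotProduct, hv x hx, hv y hy]
      simp
    · have hyz : a y ⨯₃ a z ≠ 0 := by
        intro h0
        apply h
        rw [tri_eq_dot, h0, dotProduct_zero]
      by_cases hv0 : v = 0
      · rw [hv0, dotProduct_zero]
      · exact absurd ((tri_eq_zero_iff_dot hyz hv0 (hv y hy) (hv z hz)).mpr (hv x hx)) h

/-- Isomorphisms of intersection lattices are relabellings which preserve concurrency. -/
theorem nonempty_orderIso_iff {a b : Fin d → Fin 3 → ℂ} (ha : Distinct a) (hb : Distinct b) :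
    Nonempty (intersectionLattice a ≃o intersectionLattice b) ↔
      ∃ σ : Equiv.Perm (Fin d), ∀ i j k,
        tri (a i) (a j) (a k) = 0 ↔ tri (b (σ i)) (b (σ j)) (b (σ k)) = 0 := by
  constructor
  · rintro ⟨Φ⟩
    set H : Fin d → intersectionLattice a := fun i => ⟨flat a {i}, {i}, rfl⟩ with hH
    set H' : Fin d → intersectionLattice b := fun i => ⟨flat b {i}, {i}, rfl⟩ with hH'
    have hle : ∀ (c : Fin d → Fin 3 → ℂ) (_ : Distinct c) i j, flat c {i} ⊆ flat c {j} → i = j := by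
      intro c hc i j h
      by_contra hij
      refine hc.2 i j hij (cross_eq_zero_of_dot fun v hv => ?_)
      exact mem_flat.mp (h (mem_flat.mpr fun k hk => by
        rw [Finset.mem_singleton.mp hk]; exact hv)) j (by simp)
    have hbelow : ∀ (c : Fin d → Fin 3 → ℂ) (X : intersectionLattice c), X.1 = Set.univ ∨
        ∃ j, X.1 ⊆ flat c {j} := by
      rintro c ⟨_, I, rfl⟩
      rcases I.eq_empty_or_nonempty with rfl | ⟨i, hi⟩
      · left; simp
      · exact Or.inr ⟨i, flat_subset_flat_iff.mp subset_rfl i hi⟩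
    have hproper : ∀ (c : Fin d → Fin 3 → ℂ) (_ : Distinct c) i, flat c {i} ≠ Set.univ := by
      intro c hc i h
      obtain ⟨v, hv⟩ := exists_dot_ne_zero (hc.1 i)
      exact hv (mem_flat.mp (h ▸ Set.mem_univ v) i (by simp))
    -- The planes are the maximal elements below the whole space, so an isomorphism permutes them.
    have key : ∀ i, ∃ j, Φ (H i) = H' j := by
      intro i
      rcases hbelow b (Φ (H i)) with h | ⟨j, hj⟩
      · exfalso
        set U : intersectionLattice a := ⟨flat a ∅, ∅, rfl⟩
        have h1 : Φ U ≤ Φ (H i) := fun v _ => by rw [h]; trivial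
        have h2 : U ≤ H i := Φ.le_iff_le.mp h1
        exact hproper a ha i (Set.eq_univ_of_univ_subset fun v _ => h2 (by simp [U, mem_flat]))
      · refine ⟨j, ?_⟩
        have h1 : Φ (H i) ≤ H' j := hj
        have h2 : H i ≤ Φ.symm (H' j) := by rwa [← Φ.le_iff_le, Φ.apply_symm_apply]
        rcases hbelow a (Φ.symm (H' j)) with h3 | ⟨k, hk⟩
        · exfalso
          set U : intersectionLattice b := ⟨flat b ∅, ∅, rfl⟩
          have h4 : Φ.symm U ≤ Φ.symm (H' j) := fun v _ => by rw [h3]; trivial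
          have h5 : U ≤ H' j := Φ.symm.le_iff_le.mp h4
          exact hproper b hb j (Set.eq_univ_of_univ_subset fun v _ => h5 (by simp [U, mem_flat]))
        · have h6 : Φ.symm (H' j) ≤ H k := hk
          have h7 : i = k := hle a ha i k (h2.trans h6)
          rw [← h7] at h6
          rw [le_antisymm h2 h6, Φ.apply_symm_apply]
    choose σ hσ using key
    have hinj : Function.Injective σ := by
      intro i j hij
      have h1 : Φ (H i) = Φ (H j) := by rw [hσ, hσ, hij]
      have h2 := Φ.injective h1
      exact hle a ha i j (congrArg Subtype.val h2).subset
    -- Concurrency in terms of the order alone: whatever lies below two of the planes lies below the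
    -- third.
    have hconc : ∀ (c : Fin d → Fin 3 → ℂ) (_ : Distinct c) (i j k), i ≠ j →
        (tri (c k) (c i) (c j) = 0 ↔ ∀ X : intersectionLattice c, X.1 ⊆ flat c {i} →
          X.1 ⊆ flat c {j} → X.1 ⊆ flat c {k}) := by
      intro c hc i j k hij
      constructor
      · intro h X hi hj v hv
        have h1 := mem_flat.mp (hi hv) i (by simp)
        have h2 := mem_flat.mp (hj hv) j (by simp)
        rw [mem_flat]
        intro l hl
        rw [Finset.mem_singleton.mp hl]
        obtain ⟨s, t, hst⟩ := exists_comb_of_tri h (hc.2 i j hij)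
        rw [hst, add_dotProduct, smul_dotProduct, smul_dotProduct, h1, h2]
        simp
      · intro h
        have h1 := h ⟨flat c {i, j}, {i, j}, rfl⟩
          (flat_subset_flat_iff.mp subset_rfl i (by simp))
          (flat_subset_flat_iff.mp subset_rfl j (by simp))
        rw [tri_eq_dot]
        refine mem_flat.mp (h1 (mem_flat.mpr fun l hl => ?_)) k (by simp)
        rcases Finset.mem_insert.mp hl with rfl | hl
        · exact dot_cross_left _ _
        · rw [Finset.mem_singleton.mp hl]
          exact dot_cross_right _ _
    refine ⟨Equiv.ofBijective σ (Finite.injective_iff_bijective.mp hinj), fun k i j => ?_⟩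
    simp only [Equiv.ofBijective_apply]
    by_cases hij : i = j
    · rw [hij, tri_self_right, tri_self_right]
    rw [hconc a ha i j k hij, hconc b hb _ _ _ (hinj.ne hij)]
    have htr : ∀ (X : intersectionLattice a) l, X.1 ⊆ flat a {l} ↔
        (Φ X).1 ⊆ flat b {σ l} := by
      intro X l
      change X ≤ H l ↔ Φ X ≤ H' (σ l)
      rw [← hσ, Φ.le_iff_le]
    constructor
    · intro h X hi hj
      obtain ⟨Y, rfl⟩ := Φ.surjective X
      exact (htr Y k).mp (h Y ((htr Y i).mpr hi) ((htr Y j).mpr hj))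
    · intro h X hi hj
      exact (htr X k).mpr (h (Φ X) ((htr X i).mp hi) ((htr X j).mp hj))
  · rintro ⟨σ, hσ⟩
    classical
    have h1 : Set.range (fun I : Finset (Fin d) => flat b (I.map σ.toEmbedding)) =
        intersectionLattice b := by
      apply Set.Subset.antisymm
      · rintro _ ⟨I, rfl⟩
        exact ⟨_, rfl⟩
      · rintro _ ⟨I, rfl⟩
        refine ⟨I.map σ.symm.toEmbedding, ?_⟩
        simp only [Finset.map_map]
        change flat b _ = flat b I
        congr 1
        ext i
        simp
    rw [← h1]
    refine nonempty_orderIso_range (f := flat a) fun I J => ?_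
    rw [flat_subset_flat_iff, flat_subset_flat_iff (a := b)]
    have h2 : ∀ j, flat a I ⊆ flat a {j} ↔ flat b (I.map σ.toEmbedding) ⊆ flat b {σ j} := by
      intro j
      rw [flat_subset_iff ha, flat_subset_iff hb]
      simp only [Finset.mem_map, Equiv.coe_toEmbedding, exists_exists_and_eq_and,
        EmbeddingLike.apply_eq_iff_eq, exists_eq_right, hσ, ne_eq]
    simp only [h2]
    simp only [Finset.mem_map, Equiv.coe_toEmbedding, forall_exists_index, and_imp,
      forall_apply_eq_imp_iff₂]

/-- The determinant is alternating, so increasing triples suffice. -/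
lemma tri_iff_of_lt {a b : Fin d → Fin 3 → ℂ}
    (h : ∀ i j k, i < j → j < k → (tri (a i) (a j) (a k) = 0 ↔ tri (b i) (b j) (b k) = 0))
    (i j k : Fin d) : tri (a i) (a j) (a k) = 0 ↔ tri (b i) (b j) (b k) = 0 := by
  rcases lt_trichotomy i j with hij | rfl | hij
  · rcases lt_trichotomy j k with hjk | rfl | hjk
    · exact h i j k hij hjk
    · simp [tri_self_right]
    · rcases lt_trichotomy i k with hik | rfl | hik
      · rw [tri_swap_right (a i) (a k), tri_swap_right (b i) (b k), neg_eq_zero, neg_eq_zero]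
        exact h i k j hik hjk
      · simp [tri_self_outer]
      · rw [tri_swap_right (a i) (a k), tri_swap_left (a k) (a i), tri_swap_right (b i) (b k),
          tri_swap_left (b k) (b i), neg_neg, neg_neg]
        exact h k i j hik hij
  · simp [tri_self_left]
  · rcases lt_trichotomy i k with hik | rfl | hik
    · rw [tri_swap_left (a j) (a i), tri_swap_left (b j) (b i), neg_eq_zero, neg_eq_zero]
      exact h j i k hij hik
    · simp [tri_self_outer]
    · rcases lt_trichotomy j k with hjk | rfl | hjk
      · rw [tri_swap_left (a j) (a i), tri_swap_right (a j) (a k), tri_swap_left (b j) (b i),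
          tri_swap_right (b j) (b k), neg_neg, neg_neg]
        exact h j k i hjk hik
      · simp [tri_self_right]
      · rw [tri_swap_left (a j) (a i), tri_swap_right (a j) (a k), tri_swap_left (a k) (a j),
          tri_swap_left (b j) (b i), tri_swap_right (b j) (b k), tri_swap_left (b k) (b j)]
        simp only [neg_neg, neg_eq_zero]
        exact h k j i hjk hij

/-- The stratum of the lattice of an arrangement of combinatorial type `T`. -/
theorem stratum_eq_curvesOfType {T : Fin 6 → Fin 6 → Fin 6 → Bool} {b : Fin 6 → Fin 3 → ℂ}
    (hb : Distinct b) (hT : Pattern T b) :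
    stratum 6 (intersectionLattice b) = curvesOfType T := by
  ext p
  constructor
  · rintro ⟨l, ⟨hl, hiso⟩, rfl⟩
    have hd := distinct_rep_iff.mpr hl
    obtain ⟨σ, hσ⟩ := (nonempty_orderIso_iff hd hb).mp hiso
    refine ⟨(fun i => (l i).rep) ∘ σ.symm, ⟨fun i => hd.1 _, fun i j hij =>
      hd.2 _ _ (σ.symm.injective.ne hij)⟩, fun i j k hij hjk => ?_, (rep_psi l).perm _⟩
    have h1 := hσ (σ.symm i) (σ.symm j) (σ.symm k)
    simp only [Equiv.apply_symm_apply] at h1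
    rw [← hT i j k hij hjk, ← h1]
    rfl
  · rintro ⟨a, ha, hTa, hp⟩
    refine ⟨_, ⟨mk_mem_orderedArrangements ha, ?_⟩, (rep_psi_mk a ha.1).eq hp⟩
    refine (nonempty_orderIso_iff (distinct_rep_iff.mpr (mk_mem_orderedArrangements ha)) hb).mpr
      ⟨1, tri_iff_of_lt fun i j k hij hjk => ?_⟩
    choose c hc hac using fun i => exists_rep_mk (a i) (ha.1 i)
    simp only [Equiv.Perm.coe_one, id_eq]
    rw [hac, hac, hac, tri_smul, hT i j k hij hjk, ← hTa i j k hij hjk]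
    simp [hc]

lemma curvesOfType_subset (T : Fin 6 → Fin 6 → Fin 6 → Bool) :
    curvesOfType T ⊆ arrangements 6 := by
  rintro p ⟨a, ha, -, hp⟩
  exact mem_arrangements_iff.mpr ⟨a, ha, hp⟩

end

section

/-! ### Classification of arrangements of six lines -/

section Points

variable {d : ℕ} {a : Fin d → Fin 3 → ℂ}

lemma Distinct.comp {d' : ℕ} (ha : Distinct a) {σ : Fin d' → Fin d}
    (hσ : Function.Injective σ) : Distinct (a ∘ σ) :=
  ⟨fun _ => ha.1 _, fun _ _ hij => ha.2 _ _ (hσ.ne hij)⟩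

lemma tri_eq_zero_of_dot {a b c v : Fin 3 → ℂ} (hv : v ≠ 0) (ha : a ⬝ᵥ v = 0)
    (hb : b ⬝ᵥ v = 0) (hc : c ⬝ᵥ v = 0) : tri a b c = 0 := by
  by_cases h : b ⨯₃ c = 0
  · rw [tri_eq_dot, h, dotProduct_zero]
  · exact (tri_eq_zero_iff_dot h hv hb hc).mpr ha

/-- Two points on two distinct lines are proportional. -/
lemma Distinct.dot_eq_zero (ha : Distinct a) {i j : Fin d} (hij : i ≠ j) {v w : Fin 3 → ℂ}
    (hv : v ≠ 0) (hiv : a i ⬝ᵥ v = 0) (hjv : a j ⬝ᵥ v = 0) (hiw : a i ⬝ᵥ w = 0)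
    (hjw : a j ⬝ᵥ w = 0) {k : Fin d} (hkv : a k ⬝ᵥ v = 0) : a k ⬝ᵥ w = 0 := by
  by_cases hw : w = 0
  · rw [hw, dotProduct_zero]
  · exact (tri_eq_zero_iff_dot (ha.2 i j hij) hw hiw hjw).mp
      (tri_eq_zero_of_dot hv hkv hiv hjv)

lemma Distinct.point_eq (ha : Distinct a) {i j : Fin d} (hij : i ≠ j) {q q' : Plane}
    (hi : a i ⬝ᵥ q.rep = 0) (hj : a j ⬝ᵥ q.rep = 0) (hi' : a i ⬝ᵥ q'.rep = 0)
    (hj' : a j ⬝ᵥ q'.rep = 0) : q = q' := by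
  obtain ⟨s, hs⟩ := (cross_eq_zero_iff (ha.2 i j hij)).mp (cross_cross_eq_zero hi hj)
  obtain ⟨t, ht⟩ := (cross_eq_zero_iff (ha.2 i j hij)).mp (cross_cross_eq_zero hi' hj')
  rw [← Projectivization.mk_rep q, ← Projectivization.mk_rep q']
  refine (Projectivization.mk_eq_mk_iff_crossProduct_eq_zero _ _).mpr ?_
  rw [hs, ht]
  simp

open Classical in
/-- The lines through a point. -/
noncomputable def linesThrough (a : Fin d → Fin 3 → ℂ) (v : Fin 3 → ℂ) : Finset (Fin d) :=
  Finset.univ.filter fun i => a i ⬝ᵥ v = 0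

lemma mem_linesThrough {v : Fin 3 → ℂ} {i : Fin d} :
    i ∈ linesThrough a v ↔ a i ⬝ᵥ v = 0 := by
  simp [linesThrough]

lemma intersectionLattice_comp (a : Fin d → Fin 3 → ℂ) (σ : Equiv.Perm (Fin d)) :
    intersectionLattice (a ∘ σ) = intersectionLattice a := by
  have key : ∀ (b : Fin d → Fin 3 → ℂ) (τ : Equiv.Perm (Fin d)),
      intersectionLattice (b ∘ τ) ⊆ intersectionLattice b := by
    rintro b τ _ ⟨I, rfl⟩
    refine ⟨I.map τ.toEmbedding, ?_⟩
    ext v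
    simp only [Set.mem_iInter, Finset.forall_mem_map]
    rfl
  refine (key a σ).antisymm ?_
  have h := key (a ∘ σ) σ.symm
  rwa [Function.comp_assoc, Equiv.self_comp_symm, Function.comp_id] at h

end Points

lemma exists_perm_mem_iff (B : Finset (Fin 6)) :
    ∃ σ : Equiv.Perm (Fin 6), ∀ i, σ i ∈ B ↔ (i : ℕ) < B.card := by
  have hB : B.card ≤ 6 := by simpa using Finset.card_le_univ B
  have hc : Fintype.card {i : Fin 6 // (i : ℕ) < B.card} = Fintype.card {i : Fin 6 // i ∈ B} := by
    rw [Fintype.card_coe, Fintype.card_subtype]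
    generalize B.card = m at hB
    interval_cases m <;> rfl
  let e := Fintype.equivOfCardEq hc
  refine ⟨e.extendSubtype, fun i => ⟨fun h => ?_, fun h => e.extendSubtype_mem i h⟩⟩
  by_contra h'
  exact e.extendSubtype_not_mem i h' h

lemma exists_perm_extend {m : ℕ} (hm : m ≤ 6) {f : Fin m → Fin 6} (hf : Function.Injective f) :
    ∃ σ : Equiv.Perm (Fin 6), ∀ i, σ (Fin.castLE hm i) = f i := by
  let e : {i : Fin 6 // i ∈ Set.range (Fin.castLE hm)} ≃ {i : Fin 6 // i ∈ Set.range f} :=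
    (Equiv.ofInjective _ (Fin.castLE_injective hm)).symm.trans (Equiv.ofInjective f hf)
  refine ⟨e.extendSubtype, fun i => ?_⟩
  rw [e.extendSubtype_apply_of_mem _ ⟨i, rfl⟩]
  simp [e, Equiv.ofInjective_symm_apply]

/-- The lines which are concurrent are among those given by `T`. -/
def SubPattern (T : Fin 6 → Fin 6 → Fin 6 → Bool) (a : Fin 6 → Fin 3 → ℂ) : Prop :=
  ∀ i j k, i < j → j < k → tri (a i) (a j) (a k) = 0 → T i j k = true

/-- Two triple points on a line. -/
def typeShared : Fin 6 → Fin 6 → Fin 6 → Bool := fun i j k =>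
  i = 0 && j = 1 && k = 2 || i = 0 && j = 3 && k = 4
/-- Two triple points not on a line of the arrangement. -/
def typeDisjoint : Fin 6 → Fin 6 → Fin 6 → Bool := fun i j k =>
  i = 0 && j = 1 && k = 2 || i = 3

/-- The curves of the arrangements with at most two triple points and only double points
elsewhere. -/
def weakCurves : Set (Curve 6) :=
  {p | ∃ a, Distinct a ∧ (SubPattern typeShared a ∨ SubPattern typeDisjoint a) ∧ Rep p a}

/-- The count by pairs is monotone in the set of concurrent triples, and for two triple points it is
15 + 2: one for each pair and one more for each triple point. -/
lemma tjurina_weak {p : Curve 6} (hp : p ∈ weakCurves) : tjurina p ≤ 17 := by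
  classical
  obtain ⟨a, ha, hT, hp⟩ := hp
  have key : ∀ T, SubPattern T a → tjurina p ≤
      ∑ x ∈ Finset.univ.filter (fun x : Fin 6 × Fin 6 => x.1 < x.2),
        (1 + if ∃ i < x.1, T i x.1 x.2 = true then 1 else 0) := by
    intro T hT
    rw [tjurina_eq ha hp]
    refine Finset.sum_le_sum fun x hx => ?_
    have h1 : (∃ i < x.1, tri (a i) (a x.1) (a x.2) = 0) → ∃ i < x.1, T i x.1 x.2 = true :=
      fun ⟨i, hi, h⟩ => ⟨i, hi, hT i x.1 x.2 hi (Finset.mem_filter.mp hx).2 h⟩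
    by_cases h2 : ∃ i < x.1, tri (a i) (a x.1) (a x.2) = 0
    · rw [if_pos h2, if_pos (h1 h2)]
    · rw [if_neg h2]
      exact Nat.add_le_add_left (Nat.zero_le _) _
  rcases hT with h | h
  · exact (key _ h).trans (by decide)
  · exact (key _ h).trans (by decide)

/-! ### Six lines of which at least four are concurrent. -/

section FourConcurrent

variable {a : Fin 6 → Fin 3 → ℂ}

/-- Lines `i` and `j` pass through `v`, so their only common point is `v`. -/
lemma pattern_point {v : Fin 3 → ℂ} {m : ℕ} (ha : Distinct a) (hv : v ≠ 0)
    (hB : ∀ i : Fin 6, a i ⬝ᵥ v = 0 ↔ (i : ℕ) < m) {i j k : Fin 6} (hij : i < j) (hjk : j < k)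
    (hj : (j : ℕ) < m) : tri (a i) (a j) (a k) = 0 ↔ (k : ℕ) < m := by
  rw [← hB k, ← tri_eq_zero_iff_dot (ha.2 i j hij.ne) hv ((hB i).mpr (lt_trans hij hj))
    ((hB j).mpr hj), tri_swap_left (a i), tri_swap_right (a i)]

lemma pattern_type6 {v : Fin 3 → ℂ} (hv : v ≠ 0) (hB : ∀ i : Fin 6, a i ⬝ᵥ v = 0) :
    Pattern type6 a :=
  fun _ _ _ _ _ => by simp [type6, tri_eq_zero_of_dot hv (hB _) (hB _) (hB _)]

lemma pattern_type5 {v : Fin 3 → ℂ} (ha : Distinct a) (hv : v ≠ 0)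
    (hB : ∀ i : Fin 6, a i ⬝ᵥ v = 0 ↔ (i : ℕ) < 5) : Pattern type5 a := by
  intro i j k hij hjk
  rw [pattern_point ha hv hB hij hjk (by omega)]
  simp [type5, Fin.lt_def]

lemma pattern_type4 {v : Fin 3 → ℂ} (ha : Distinct a) (hv : v ≠ 0)
    (hB : ∀ i : Fin 6, a i ⬝ᵥ v = 0 ↔ (i : ℕ) < 4)
    (h45 : ∀ i : Fin 6, i < 4 → tri (a i) (a 4) (a 5) ≠ 0) : Pattern type4 a := by
  intro i j k hij hjk
  by_cases hj : (j : ℕ) < 4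
  · rw [pattern_point ha hv hB hij hjk hj]
    simp [type4, Fin.lt_def]
  · obtain rfl : j = 4 := by omega
    obtain rfl : k = 5 := by omega
    simp [type4, h45 i hij]

lemma pattern_type43 {v : Fin 3 → ℂ} (ha : Distinct a) (hv : v ≠ 0)
    (hB : ∀ i : Fin 6, a i ⬝ᵥ v = 0 ↔ (i : ℕ) < 4)
    (h45 : tri (a 0) (a 4) (a 5) = 0) : Pattern type43 a := by
  intro i j k hij hjk
  by_cases hj : (j : ℕ) < 4
  · rw [pattern_point ha hv hB hij hjk hj]
    simp [type43, Fin.lt_def]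
    omega
  · obtain rfl : j = 4 := by omega
    obtain rfl : k = 5 := by omega
    rcases eq_or_ne i 0 with rfl | hi
    · simp [type43, h45]
    · have : tri (a i) (a 4) (a 5) ≠ 0 := by
        intro h
        have h1 := (tri_eq_zero_iff_dot (ha.2 4 5 (by decide))
          (ha.2 4 5 (by decide)) (dot_cross_left _ _) (dot_cross_right _ _)).mp h
        have h2 := (tri_eq_zero_iff_dot (ha.2 4 5 (by decide))
          (ha.2 4 5 (by decide)) (dot_cross_left _ _) (dot_cross_right _ _)).mp h45
        have h3 := ha.dot_eq_zero hi (ha.2 4 5 (by decide)) h1 h2 ((hB i).mpr hij)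
          ((hB 0).mpr (by decide)) (dot_cross_left (a 4) (a 5))
        simpa using (hB 4).mp h3
      simp [type43, this, hi]

/-- With five or six lines through the point the type is clear. With four, it depends on whether the
other two lines meet on one of the four. -/
lemma exists_perm_of_four (ha : Distinct a) {v : Fin 3 → ℂ} (hv : v ≠ 0)
    (h4 : 4 ≤ (linesThrough a v).card) : ∃ σ : Equiv.Perm (Fin 6),
      Pattern type6 (a ∘ σ) ∨ Pattern type5 (a ∘ σ) ∨ Pattern type4 (a ∘ σ) ∨
        Pattern type43 (a ∘ σ) := by
  obtain ⟨σ, hσ⟩ := exists_perm_mem_iff (linesThrough a v)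
  have h6 : (linesThrough a v).card ≤ 6 := by simpa using Finset.card_le_univ (linesThrough a v)
  simp only [mem_linesThrough] at hσ
  generalize (linesThrough a v).card = m at *
  have hd := ha.comp σ.injective
  interval_cases m
  · by_cases h : ∃ i : Fin 6, i < 4 ∧ tri (a (σ i)) (a (σ 4)) (a (σ 5)) = 0
    · obtain ⟨i, hi, h⟩ := h
      -- The swap gives the label 0 to the line that joins the two multiple points.
      refine ⟨(Equiv.swap 0 i).trans σ, Or.inr (Or.inr (Or.inr (pattern_type43
        (ha.comp (Equiv.injective _)) hv (fun k => ?_) ?_)))⟩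
      · simp only [Function.comp_apply, Equiv.trans_apply, hσ]
        rcases eq_or_ne k 0 with rfl | h0
        · simp [Equiv.swap_apply_left]; exact hi
        rcases eq_or_ne k i with rfl | h1
        · simp [Equiv.swap_apply_right]; exact hi
        · rw [Equiv.swap_apply_of_ne_of_ne h0 h1]
      · simp only [Function.comp_apply, Equiv.trans_apply, Equiv.swap_apply_left]
        rwa [Equiv.swap_apply_of_ne_of_ne (by decide) (by omega),
          Equiv.swap_apply_of_ne_of_ne (by decide) (by omega)]
    · push Not at h
      exact ⟨σ, Or.inr (Or.inr (Or.inl (pattern_type4 hd hv hσ h)))⟩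
  · exact ⟨σ, Or.inr (Or.inl (pattern_type5 hd hv hσ))⟩
  · exact ⟨σ, Or.inl (pattern_type6 hv fun i => (hσ i).mpr i.2)⟩

end FourConcurrent

/-- The lines with indices in `s` are concurrent. -/
def Concurrent (a : Fin 6 → Fin 3 → ℂ) (s : Finset (Fin 6)) : Prop :=
  ∃ v ≠ 0, ∀ i ∈ s, a i ⬝ᵥ v = 0

/-! ### Six lines with no four concurrent. -/

section ThreeConcurrent

variable {a : Fin 6 → Fin 3 → ℂ}

lemma tri_eq_zero_iff_concurrent (ha : Distinct a) {i j k : Fin 6} (hij : i ≠ j) :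
    tri (a k) (a i) (a j) = 0 ↔ Concurrent a {k, i, j} := by
  constructor
  · intro h
    refine ⟨_, ha.2 i j hij, ?_⟩
    simp only [Finset.mem_insert, Finset.mem_singleton, forall_eq_or_imp, forall_eq]
    exact ⟨by rwa [← tri_eq_dot], dot_cross_left _ _, dot_cross_right _ _⟩
  · rintro ⟨v, hv, h⟩
    exact tri_eq_zero_of_dot hv (h _ (by simp)) (h _ (by simp)) (h _ (by simp))

/-- The two points of concurrency lie on two common lines, hence coincide. -/
lemma Concurrent.union (ha : Distinct a) {s t : Finset (Fin 6)} (hs : Concurrent a s)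
    (ht : Concurrent a t) (h : 1 < (s ∩ t).card) : Concurrent a (s ∪ t) := by
  obtain ⟨v, hv, hs⟩ := hs
  obtain ⟨w, hw, ht⟩ := ht
  obtain ⟨i, hi, j, hj, hij⟩ := Finset.one_lt_card.mp h
  simp only [Finset.mem_inter] at hi hj
  refine ⟨v, hv, fun k hk => ?_⟩
  rcases Finset.mem_union.mp hk with hk | hk
  · exact hs k hk
  · exact ha.dot_eq_zero hij hw (ht i hi.2) (ht j hj.2) (hs i hi.1) (hs j hj.1) (ht k hk)

lemma concurrent_comp (σ : Equiv.Perm (Fin 6)) (s : Finset (Fin 6)) :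
    Concurrent (a ∘ σ) s ↔ Concurrent a (s.map σ.toEmbedding) := by
  simp only [Concurrent, Finset.forall_mem_map]
  rfl

/-- No four lines are concurrent. -/
def NoFour (a : Fin 6 → Fin 3 → ℂ) : Prop := ∀ s, Concurrent a s → s.card ≤ 3

lemma NoFour.comp (h : NoFour a) (σ : Equiv.Perm (Fin 6)) : NoFour (a ∘ σ) := by
  intro s hs
  have := h _ ((concurrent_comp σ s).mp hs)
  rwa [Finset.card_map] at this

lemma NoFour.not (h4 : NoFour a) (ha : Distinct a) {s t : Finset (Fin 6)}
    (hs : Concurrent a s) (h : 1 < (s ∩ t).card ∧ 3 < (s ∪ t).card) : ¬ Concurrent a t :=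
  fun ht => absurd (h4 _ (hs.union ha ht h.1)) (not_le.mpr h.2)

/-- Replaces a statement on increasing triples by its twenty instances, which are then treated one
by one. -/
lemma forall_lt_lt {P : Fin 6 → Fin 6 → Fin 6 → Prop}
    (h : P 0 1 2 ∧ P 0 1 3 ∧ P 0 1 4 ∧ P 0 1 5 ∧ P 0 2 3 ∧ P 0 2 4 ∧ P 0 2 5 ∧ P 0 3 4 ∧
      P 0 3 5 ∧ P 0 4 5 ∧ P 1 2 3 ∧ P 1 2 4 ∧ P 1 2 5 ∧ P 1 3 4 ∧ P 1 3 5 ∧ P 1 4 5 ∧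
      P 2 3 4 ∧ P 2 3 5 ∧ P 2 4 5 ∧ P 3 4 5) (i j k : Fin 6) (hij : i < j) (hjk : j < k) :
    P i j k := by
  revert i j k
  simp only [Fin.forall_fin_succ, IsEmpty.forall_iff]
  simp [Fin.lt_def]
  tauto

lemma pattern_iff (ha : Distinct a) {T : Fin 6 → Fin 6 → Fin 6 → Bool} :
    Pattern T a ↔ ∀ i j k, i < j → j < k → (Concurrent a {i, j, k} ↔ T i j k = true) :=
  forall₅_congr fun _ _ _ _ hjk => by rw [tri_eq_zero_iff_concurrent ha hjk.ne]

lemma subPattern_iff (ha : Distinct a) {T : Fin 6 → Fin 6 → Fin 6 → Bool} :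
    SubPattern T a ↔ ∀ i j k, i < j → j < k → Concurrent a {i, j, k} → T i j k = true :=
  forall₅_congr fun _ _ _ _ hjk => by rw [tri_eq_zero_iff_concurrent ha hjk.ne]

/-- Every triple other than the three given ones and {3, 4, 5} shares two lines with a given one, so
it cannot be concurrent. Only {3, 4, 5} remains open, and it decides between the two types. -/
lemma pattern_three (ha : Distinct a) (h4 : NoFour a) (h1 : Concurrent a {0, 1, 3})
    (h2 : Concurrent a {0, 2, 4}) (h3 : Concurrent a {1, 2, 5}) :
    Pattern type333 a ∨ Pattern type3333 a := by
  have key : ∀ T : Fin 6 → Fin 6 → Fin 6 → Bool,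
      (∀ i j k, i < j → j < k → (i ≠ 3 → T i j k = type333 i j k)) →
      (Concurrent a {3, 4, 5} ↔ T 3 4 5 = true) → Pattern T a := by
    intro T hT h5
    rw [pattern_iff ha]
    intro i j k hij hjk
    by_cases hi : i = 3
    · subst hi
      obtain rfl : j = 4 := by omega
      obtain rfl : k = 5 := by omega
      exact h5
    rw [hT i j k hij hjk hi]
    revert hi
    refine forall_lt_lt (P := fun i j k => ¬ i = 3 → (Concurrent a {i, j, k} ↔
      type333 i j k = true)) ?_ i j k hij hjk
    refine ⟨?_, ?_, ?_, ?_, ?_, ?_, ?_, ?_, ?_, ?_, ?_, ?_, ?_, ?_, ?_, ?_, ?_, ?_, ?_, ?_⟩ <;>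
      intro hi <;>
      first
      | exact iff_of_true h1 (by decide)
      | exact iff_of_true h2 (by decide)
      | exact iff_of_true h3 (by decide)
      | exact iff_of_false (h4.not ha h1 (by decide)) (by decide)
      | exact iff_of_false (h4.not ha h2 (by decide)) (by decide)
      | exact iff_of_false (h4.not ha h3 (by decide)) (by decide)
      | exact absurd rfl hi
  by_cases h5 : Concurrent a {3, 4, 5}
  · refine Or.inr (key _ (fun i j k _ _ hi => by simp [type3333, hi]) (iff_of_true h5 (by decide)))
  · refine Or.inl (key _ (fun i j k _ _ hi => rfl) (iff_of_false h5 (by decide)))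

/-- Two triple points share at most one line. If the complement of a concurrent triple is
concurrent, nothing else can be. Otherwise any other concurrent triple shares exactly one line with
it, and a third one must close a triangle. -/
lemma exists_perm_of_noFour (ha : Distinct a) (h4 : NoFour a) : ∃ σ : Equiv.Perm (Fin 6),
    Pattern type333 (a ∘ σ) ∨ Pattern type3333 (a ∘ σ) ∨
      SubPattern typeShared (a ∘ σ) ∨ SubPattern typeDisjoint (a ∘ σ) := by
  by_cases h0 : ∃ i j k, i < j ∧ j < k ∧ Concurrent a {i, j, k}
  swap
  · push Not at h0
    refine ⟨1, Or.inr (Or.inr (Or.inl ((subPattern_iff ha).mpr fun i j k hij hjk h => ?_)))⟩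
    exact absurd h (h0 i j k hij hjk)
  obtain ⟨i, j, k, hij, hjk, h0⟩ := h0
  obtain ⟨σ, hσ⟩ := exists_perm_extend (m := 3) (by norm_num) (f := ![i, j, k]) (by
    intro x y hxy
    fin_cases x <;> fin_cases y <;> simp at hxy ⊢ <;> omega)
  have hσ0 : σ 0 = i := hσ 0
  have hσ1 : σ 1 = j := hσ 1
  have hσ2 : σ 2 = k := hσ 2
  have h1 : Concurrent (a ∘ σ) {0, 1, 2} := by
    rw [concurrent_comp]
    simpa [hσ0, hσ1, hσ2] using h0
  suffices H : ∀ b : Fin 6 → Fin 3 → ℂ, Distinct b → NoFour b → Concurrent b {0, 1, 2} →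
      ∃ σ : Equiv.Perm (Fin 6), Pattern type333 (b ∘ σ) ∨ Pattern type3333 (b ∘ σ) ∨
      SubPattern typeShared (b ∘ σ) ∨ SubPattern typeDisjoint (b ∘ σ) by
    obtain ⟨τ, h⟩ := H _ (ha.comp σ.injective) (h4.comp σ) h1
    exact ⟨τ.trans σ, h⟩
  clear! a i j k σ
  intro a ha h4 h1
  by_cases h5 : Concurrent a {3, 4, 5}
  · refine ⟨1, Or.inr (Or.inr (Or.inr ((subPattern_iff ha).mpr (forall_lt_lt ?_))))⟩
    refine ⟨?_, ?_, ?_, ?_, ?_, ?_, ?_, ?_, ?_, ?_, ?_, ?_, ?_, ?_, ?_, ?_, ?_, ?_, ?_, ?_⟩ <;>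
      intro hi <;>
      first
      | decide
      | exact absurd hi (h4.not ha h1 (by decide))
      | exact absurd hi (h4.not ha h5 (by decide))
  -- The only triples still possible have exactly one line in common with {0, 1, 2}.
  by_cases h6 : ∃ x p q : Fin 6, x < 3 ∧ 3 ≤ p ∧ p < q ∧ Concurrent a {x, p, q}
  swap
  · push Not at h6
    refine ⟨1, Or.inr (Or.inr (Or.inl ((subPattern_iff ha).mpr (forall_lt_lt ?_))))⟩
    refine ⟨?_, ?_, ?_, ?_, ?_, ?_, ?_, ?_, ?_, ?_, ?_, ?_, ?_, ?_, ?_, ?_, ?_, ?_, ?_, ?_⟩ <;>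
      intro hi <;>
      first
      | decide
      | exact absurd hi (h4.not ha h1 (by decide))
      | exact absurd hi h5
      | exact absurd hi (h6 _ _ _ (by decide) (by decide) (by decide))
  obtain ⟨x, p, q, hx, hp, hpq, h6⟩ := h6
  obtain ⟨y, z, hxyz⟩ : ∃ y z : Fin 6, ({x, y, z} : Finset (Fin 6)) = {0, 1, 2} ∧ x ≠ y ∧ x ≠ z ∧
      y ≠ z ∧ y < 3 ∧ z < 3 := by
    clear h6
    revert x; decide
  obtain ⟨σ, hσ⟩ := exists_perm_extend (m := 5) (by norm_num) (f := ![x, y, z, p, q]) (by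
    intro x y hxy
    fin_cases x <;> fin_cases y <;> simp at hxy ⊢ <;> omega)
  have hσ0 : σ 0 = x := hσ 0
  have hσ1 : σ 1 = y := hσ 1
  have hσ2 : σ 2 = z := hσ 2
  have hσ3 : σ 3 = p := hσ 3
  have hσ4 : σ 4 = q := hσ 4
  have h1' : Concurrent (a ∘ σ) {0, 1, 2} := by
    rw [concurrent_comp]
    simpa [hσ0, hσ1, hσ2, hxyz.1] using h1
  have h6' : Concurrent (a ∘ σ) {0, 3, 4} := by
    rw [concurrent_comp]
    simpa [hσ0, hσ3, hσ4] using h6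
  suffices H : ∀ b : Fin 6 → Fin 3 → ℂ, Distinct b → NoFour b → Concurrent b {0, 1, 2} →
      Concurrent b {0, 3, 4} →
      ∃ σ : Equiv.Perm (Fin 6), Pattern type333 (b ∘ σ) ∨ Pattern type3333 (b ∘ σ) ∨
      SubPattern typeShared (b ∘ σ) ∨ SubPattern typeDisjoint (b ∘ σ) by
    obtain ⟨τ, h⟩ := H _ (ha.comp σ.injective) (h4.comp σ) h1' h6'
    exact ⟨τ.trans σ, h⟩
  clear! a x y z p q σ
  intro a ha h4 h1 h2
  have key : ∀ f : Fin 6 → Fin 6, Function.Injective f → Concurrent a {f 0, f 1, f 3} →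
      Concurrent a {f 0, f 2, f 4} → Concurrent a {f 1, f 2, f 5} →
      ∃ σ : Equiv.Perm (Fin 6), Pattern type333 (a ∘ σ) ∨ Pattern type3333 (a ∘ σ) ∨
      SubPattern typeShared (a ∘ σ) ∨ SubPattern typeDisjoint (a ∘ σ) := by
    intro f hf e1 e2 e3
    let σ : Equiv.Perm (Fin 6) := Equiv.ofBijective f (Finite.injective_iff_bijective.mp hf)
    have hs : ∀ i, σ i = f i := fun _ => rfl
    have := pattern_three (ha.comp σ.injective) (h4.comp σ)
      (by rw [concurrent_comp]; simpa [hs] using e1) (by rw [concurrent_comp]; simpa [hs] using e2)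
      (by rw [concurrent_comp]; simpa [hs] using e3)
    exact ⟨σ, this.elim Or.inl fun h => Or.inr (Or.inl h)⟩
  have e1 : ({0, 2, 1} : Finset (Fin 6)) = {0, 1, 2} := by decide
  have e2 : ({0, 4, 3} : Finset (Fin 6)) = {0, 3, 4} := by decide
  by_cases g1 : Concurrent a {1, 3, 5}
  · exact key ![0, 1, 3, 2, 4, 5] (by decide) h1 h2 g1
  by_cases g2 : Concurrent a {2, 3, 5}
  · exact key ![0, 2, 3, 1, 4, 5] (by decide) (by simpa [e1] using h1) h2 g2
  by_cases g3 : Concurrent a {1, 4, 5}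
  · exact key ![0, 1, 4, 2, 3, 5] (by decide) h1 (by simpa [e2] using h2) g3
  by_cases g4 : Concurrent a {2, 4, 5}
  · exact key ![0, 2, 4, 1, 3, 5] (by decide) (by simpa [e1] using h1) (by simpa [e2] using h2) g4
  refine ⟨1, Or.inr (Or.inr (Or.inl ((subPattern_iff ha).mpr (forall_lt_lt ?_))))⟩
  refine ⟨?_, ?_, ?_, ?_, ?_, ?_, ?_, ?_, ?_, ?_, ?_, ?_, ?_, ?_, ?_, ?_, ?_, ?_, ?_, ?_⟩ <;>
    intro hi <;>
    first
    | decide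
    | exact absurd hi (h4.not ha h1 (by decide))
    | exact absurd hi (h4.not ha h2 (by decide))
    | exact absurd hi g1
    | exact absurd hi g2
    | exact absurd hi g3
    | exact absurd hi g4

end ThreeConcurrent

/-- The combinatorial types of arrangements of six lines. -/
theorem arrangements_six {p : Curve 6} (hp : p ∈ arrangements 6) :
    p ∈ curvesOfType type6 ∨ p ∈ curvesOfType type5 ∨ p ∈ curvesOfType type4 ∨
      p ∈ curvesOfType type43 ∨ p ∈ curvesOfType type333 ∨ p ∈ curvesOfType type3333 ∨
      p ∈ weakCurves := by
  obtain ⟨a, ha, hp⟩ := mem_arrangements_iff.mp hp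
  have hm : ∀ {T} (σ : Equiv.Perm (Fin 6)), Pattern T (a ∘ σ) → p ∈ curvesOfType T :=
    fun σ h => ⟨_, ha.comp σ.injective, h, hp.perm σ⟩
  by_cases h4 : NoFour a
  · obtain ⟨σ, h | h | h⟩ := exists_perm_of_noFour ha h4
    · simp [hm σ h]
    · simp [hm σ h]
    · have : p ∈ weakCurves := ⟨_, ha.comp σ.injective, h, hp.perm σ⟩
      simp [this]
  · simp only [NoFour, not_forall] at h4
    obtain ⟨s, ⟨v, hv, hs⟩, hc⟩ := h4
    obtain ⟨σ, h⟩ := exists_perm_of_four ha hv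
      (le_trans (by omega) (Finset.card_le_card fun i hi => mem_linesThrough.mpr (hs i hi)))
    rcases h with h | h | h | h <;> simp [hm σ h]

lemma arrangementsTau_eq {τ : ℕ} (hτ : 17 < τ) : arrangementsTau 6 τ =
    {p | tjurina p = τ ∧ (p ∈ curvesOfType type6 ∨ p ∈ curvesOfType type5 ∨
      p ∈ curvesOfType type4 ∨ p ∈ curvesOfType type43 ∨ p ∈ curvesOfType type333 ∨
      p ∈ curvesOfType type3333)} := by
  ext p
  constructor
  · rintro ⟨hp, h⟩
    refine ⟨h, ?_⟩
    rcases arrangements_six hp with h1 | h1 | h1 | h1 | h1 | h1 | h1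
    any_goals simp [h1]
    have := tjurina_weak h1
    omega
  · rintro ⟨h, h1⟩
    refine ⟨?_, h⟩
    rcases h1 with h1 | h1 | h1 | h1 | h1 | h1 <;> exact curvesOfType_subset _ h1

lemma arrangementsTau_25 : arrangementsTau 6 25 = curvesOfType type6 := by
  rw [arrangementsTau_eq (by norm_num)]
  ext p
  constructor
  · rintro ⟨h, h1 | h1 | h1 | h1 | h1 | h1⟩
    · exact h1
    · rw [tjurina_type5 h1] at h; omega
    · rw [tjurina_type4 h1] at h; omega
    · rw [tjurina_type43 h1] at h; omega
    · rw [tjurina_type333 h1] at h; omega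
    · rw [tjurina_type3333 h1] at h; omega
  · intro h
    exact ⟨tjurina_type6 h, Or.inl h⟩

lemma arrangementsTau_21 : arrangementsTau 6 21 = curvesOfType type5 := by
  rw [arrangementsTau_eq (by norm_num)]
  ext p
  constructor
  · rintro ⟨h, h1 | h1 | h1 | h1 | h1 | h1⟩
    · rw [tjurina_type6 h1] at h; omega
    · exact h1
    · rw [tjurina_type4 h1] at h; omega
    · rw [tjurina_type43 h1] at h; omega
    · rw [tjurina_type333 h1] at h; omega
    · rw [tjurina_type3333 h1] at h; omega
  · intro h
    exact ⟨tjurina_type5 h, Or.inr (Or.inl h)⟩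

lemma arrangementsTau_19 :
    arrangementsTau 6 19 = curvesOfType type43 ∪ curvesOfType type3333 := by
  rw [arrangementsTau_eq (by norm_num)]
  ext p
  constructor
  · rintro ⟨h, h1 | h1 | h1 | h1 | h1 | h1⟩
    · rw [tjurina_type6 h1] at h; omega
    · rw [tjurina_type5 h1] at h; omega
    · rw [tjurina_type4 h1] at h; omega
    · exact Or.inl h1
    · rw [tjurina_type333 h1] at h; omega
    · exact Or.inr h1
  · rintro (h | h)
    · exact ⟨tjurina_type43 h, by simp [h]⟩
    · exact ⟨tjurina_type3333 h, by simp [h]⟩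

lemma arrangementsTau_18 :
    arrangementsTau 6 18 = curvesOfType type4 ∪ curvesOfType type333 := by
  rw [arrangementsTau_eq (by norm_num)]
  ext p
  constructor
  · rintro ⟨h, h1 | h1 | h1 | h1 | h1 | h1⟩
    · rw [tjurina_type6 h1] at h; omega
    · rw [tjurina_type5 h1] at h; omega
    · exact Or.inl h1
    · rw [tjurina_type43 h1] at h; omega
    · exact Or.inr h1
    · rw [tjurina_type3333 h1] at h; omega
  · rintro (h | h)
    · exact ⟨tjurina_type4 h, by simp [h]⟩
    · exact ⟨tjurina_type333 h, by simp [h]⟩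

end

section

/-! ### The strata of the four lattices -/

lemma multiplicity_eq {d : ℕ} (l : Fin d → Plane) (q : Plane) :
    multiplicity l q = (linesThrough (fun i => (l i).rep) q.rep).card := by
  rw [multiplicity, ← Set.ncard_coe_finset]
  congr 1
  ext i
  simp [mem_linesThrough]

lemma stratum_eq_of_perm {T : Fin 6 → Fin 6 → Fin 6 → Bool} {b : Fin 6 → Fin 3 → ℂ}
    (hb : Distinct b) (σ : Equiv.Perm (Fin 6)) (hT : Pattern T (b ∘ σ)) :
    stratum 6 (intersectionLattice b) = curvesOfType T := by
  rw [← intersectionLattice_comp b σ]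
  exact stratum_eq_curvesOfType (hb.comp σ.injective) hT

lemma Pattern.rep_mk {T : Fin 6 → Fin 6 → Fin 6 → Bool} {a : Fin 6 → Fin 3 → ℂ}
    (ha : Distinct a) (hT : Pattern T a) :
    Pattern T fun i => (Projectivization.mk ℂ (a i) (ha.1 i) : Plane).rep := by
  intro i j k hij hjk
  choose c hc hac using fun i => exists_rep_mk (a i) (ha.1 i)
  change tri (Projectivization.mk ℂ (a i) _).rep (Projectivization.mk ℂ (a j) _).rep
    (Projectivization.mk ℂ (a k) _).rep = 0 ↔ _
  erw [hac, hac, hac]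
  rw [tri_smul, ← hT i j k hij hjk]
  simp [hc]

/-- The curves of type `T` are the images of ordered arrangements of type `T`. -/
lemma exists_ordered_of_mem {T : Fin 6 → Fin 6 → Fin 6 → Bool} {p : Curve 6}
    (hp : p ∈ curvesOfType T) : ∃ l ∈ orderedArrangements 6,
      Distinct (fun i => (l i).rep) ∧ Pattern T (fun i => (l i).rep) ∧
      p ∈ stratum 6 (latticeOf l) := by
  obtain ⟨a, ha, hT, hp⟩ := hp
  have hl := mk_mem_orderedArrangements ha
  exact ⟨_, hl, distinct_rep_iff.mpr hl, hT.rep_mk ha, _, ⟨hl, ⟨OrderIso.refl _⟩⟩,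
    (rep_psi_mk a ha.1).eq hp⟩

/-- At a point of multiplicity at least three there are three concurrent lines. -/
lemma exists_lt_lt_of_card {s : Finset (Fin 6)} (h : 2 < s.card) :
    ∃ i j k, i < j ∧ j < k ∧ i ∈ s ∧ j ∈ s ∧ k ∈ s := by
  revert s; decide

/-- The point of intersection of two lines. -/
lemma exists_point {a b : Fin 3 → ℂ} (h : a ⨯₃ b ≠ 0) :
    ∃ q : Plane, a ⬝ᵥ q.rep = 0 ∧ b ⬝ᵥ q.rep = 0 := by
  obtain ⟨c, -, hc⟩ := exists_rep_mk _ h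
  refine ⟨Projectivization.mk ℂ _ h, ?_, ?_⟩
  · rw [hc, dotProduct_smul, dot_cross_left, smul_zero]
  · rw [hc, dotProduct_smul, dot_cross_right, smul_zero]

lemma card_linesThrough_le_two {a : Fin 6 → Fin 3 → ℂ} {q : Plane}
    (h : ∀ i j k, i < j → j < k → a i ⬝ᵥ q.rep = 0 → a j ⬝ᵥ q.rep = 0 → a k ⬝ᵥ q.rep = 0 →
      tri (a i) (a j) (a k) = 0 → False) : (linesThrough a q.rep).card ≤ 2 := by
  by_contra hc
  obtain ⟨i, j, k, hij, hjk, hi, hj, hk⟩ := exists_lt_lt_of_card (not_le.mp hc)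
  rw [mem_linesThrough] at hi hj hk
  exact h i j k hij hjk hi hj hk
    (tri_eq_zero_of_dot (Projectivization.rep_nonzero q) hi hj hk)

theorem stratumL_six_four : stratumL 6 4 = curvesOfType type4 := by
  ext p
  constructor
  · rintro ⟨l, hl, ⟨q, hq, hq'⟩, hp⟩
    have hd := distinct_rep_iff.mpr hl
    set a := fun i => (l i).rep with ha
    simp only [multiplicity_eq] at hq hq'
    obtain ⟨σ, hσ⟩ := exists_perm_mem_iff (linesThrough a q.rep)
    simp only [mem_linesThrough] at hσ
    change ∀ i, a (σ i) ⬝ᵥ q.rep = 0 ↔ (i : ℕ) < (linesThrough a q.rep).card at hσ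
    change (linesThrough a q.rep).card = 4 at hq
    change ∀ q', q' ≠ q → (linesThrough a q'.rep).card ≤ 2 at hq'
    rw [hq] at hσ
    have hT : Pattern type4 (a ∘ σ) := by
      refine pattern_type4 (hd.comp σ.injective) (Projectivization.rep_nonzero q) hσ
        fun i hi h => ?_
      -- If one of the four concurrent lines passed through the meeting point of the other two, that
      -- point would be a second point of multiplicity three.
      obtain ⟨q', h4, h5⟩ := exists_point (hd.2 _ _ (σ.injective.ne (show (4 : Fin 6) ≠ 5 by decide)))
      have h3 : a (σ i) ⬝ᵥ q'.rep = 0 :=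
        (tri_eq_zero_iff_dot (hd.2 _ _ (σ.injective.ne (by decide)))
          (Projectivization.rep_nonzero q') h4 h5).mp h
      have hne : q' ≠ q := by
        rintro rfl
        have h1 := (hσ 4).mp h4
        simp at h1
      have h2 := hq' q' hne
      have hsub : ({i, 4, 5} : Finset (Fin 6)).map σ.toEmbedding ⊆ linesThrough a q'.rep := by
        intro k hk
        simp only [Finset.map_insert, Finset.map_singleton, Finset.mem_insert,
          Finset.mem_singleton, Equiv.coe_toEmbedding] at hk
        rw [mem_linesThrough]
        rcases hk with rfl | rfl | rfl <;> assumption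
      have h6 := Finset.card_le_card hsub
      rw [Finset.card_map] at h6
      have h7 : ({i, 4, 5} : Finset (Fin 6)).card = 3 := by
        clear * - hi; revert i; decide
      omega
    rw [← stratum_eq_of_perm hd σ hT]
    exact hp
  · intro hp
    obtain ⟨l, hl, hd, hT, hp⟩ := exists_ordered_of_mem hp
    refine ⟨l, hl, ?_, hp⟩
    obtain ⟨q, h0, h1⟩ := exists_point (hd.2 0 1 (by decide))
    have hk : ∀ k : Fin 6, 1 < k → ((l k).rep ⬝ᵥ q.rep = 0 ↔ (k : ℕ) < 4) := by
      intro k hk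
      rw [← tri_eq_zero_iff_dot (hd.2 0 1 (by decide)) (Projectivization.rep_nonzero q) h0 h1,
        tri_swap_left (l 0).rep, tri_swap_right (l 0).rep, neg_neg, hT 0 1 k (by decide) hk]
      simp [type4, Fin.lt_def]
    have hq : ∀ k : Fin 6, (l k).rep ⬝ᵥ q.rep = 0 ↔ (k : ℕ) < 4 := by
      intro k
      rcases eq_or_ne k 0 with rfl | hk0
      · exact iff_of_true h0 (by decide)
      rcases eq_or_ne k 1 with rfl | hk1
      · exact iff_of_true h1 (by decide)
      exact hk k (by omega)
    refine ⟨q, ?_, fun q' hne => ?_⟩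
    · rw [multiplicity_eq]
      have : linesThrough (fun i => (l i).rep) q.rep = {0, 1, 2, 3} := by
        ext k
        rw [mem_linesThrough, hq]
        clear * -; revert k; decide
      rw [this]; rfl
    · rw [multiplicity_eq]
      refine card_linesThrough_le_two fun i j k hij hjk hi hj _ h => hne ?_
      have h4 := (hT i j k hij hjk).mp h
      simp only [type4, Fin.lt_def, decide_eq_true_eq] at h4
      refine hd.point_eq hij.ne hi hj ((hq i).mpr ?_) ((hq j).mpr ?_) <;> simp at h4 ⊢ <;> omega

theorem stratumLHat_three_four : (stratumLHat 3 4 : Set (Curve 6)) = curvesOfType type43 := by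
  ext p
  constructor
  · rintro ⟨l, hl, ⟨i, q₁, q₂, hne, hi₁, hi₂, h₁, h₂, -⟩, hp⟩
    change Fin 6 → Plane at l
    change l ∈ orderedArrangements 6 at hl
    change p ∈ stratum 6 (latticeOf l) at hp
    change Fin 6 at i
    have hd := distinct_rep_iff.mpr hl
    set a : Fin 6 → Fin 3 → ℂ := fun i => (l i).rep with ha
    change multiplicity (d := 6) l q₁ = 3 at h₁
    change multiplicity (d := 6) l q₂ = 4 at h₂
    rw [multiplicity_eq] at h₁ h₂
    obtain ⟨σ, hσ⟩ := exists_perm_mem_iff (linesThrough a q₂.rep)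
    simp only [mem_linesThrough] at hσ
    change ∀ i, a (σ i) ⬝ᵥ q₂.rep = 0 ↔ (i : ℕ) < (linesThrough a q₂.rep).card at hσ
    rw [h₂] at hσ
    -- Line `i` is the only one through both points. So the triple point lies on it and on exactly
    -- the two lines that avoid the quadruple point.
    have hk : ∀ k : Fin 6, a k ⬝ᵥ q₁.rep = 0 → a k ⬝ᵥ q₂.rep = 0 → k = i := by
      intro k hk₁ hk₂
      by_contra hki
      exact hne (hd.point_eq hki hk₁ hi₁ hk₂ hi₂)
    have hi4 : (σ.symm i : ℕ) < 4 := by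
      rw [← hσ, Equiv.apply_symm_apply]; exact hi₂
    let τ := (Equiv.swap 0 (σ.symm i)).trans σ
    have hτ : ∀ k : Fin 6, a (τ k) ⬝ᵥ q₂.rep = 0 ↔ (k : ℕ) < 4 := by
      intro k
      simp only [τ, Equiv.trans_apply, hσ]
      rcases eq_or_ne k 0 with rfl | h0
      · simp [Equiv.swap_apply_left, hi4]
      rcases eq_or_ne k (σ.symm i) with h1 | h1
      · rw [h1]; simp [Equiv.swap_apply_right, hi4]
      · rw [Equiv.swap_apply_of_ne_of_ne h0 h1]
    have hτ0 : τ 0 = i := by simp [τ]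
    have h45 : a (τ 4) ⬝ᵥ q₁.rep = 0 ∧ a (τ 5) ⬝ᵥ q₁.rep = 0 := by
      have hsub : (linesThrough a q₁.rep) ⊆ ({0, 4, 5} : Finset (Fin 6)).map τ.toEmbedding := by
        intro k hk'
        rw [mem_linesThrough] at hk'
        obtain ⟨m, rfl⟩ := τ.surjective k
        refine Finset.mem_map.mpr ⟨m, ?_, rfl⟩
        rcases eq_or_ne m 0 with rfl | hm
        · simp
        · have : ¬ (m : ℕ) < 4 := fun hm4 =>
            hm (τ.injective ((hk _ hk' ((hτ m).mpr hm4)).trans hτ0.symm))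
          clear * - this; revert m; decide
      have heq := Finset.eq_of_subset_of_card_le hsub (by rw [Finset.card_map]; exact h₁.ge)
      constructor <;> rw [← mem_linesThrough (a := a), heq] <;> simp
    have hT : Pattern type43 (a ∘ τ) :=
      pattern_type43 (hd.comp τ.injective) (Projectivization.rep_nonzero q₂) hτ
        (tri_eq_zero_of_dot (Projectivization.rep_nonzero q₁)
          (by rw [Function.comp_apply, hτ0]; exact hi₁) h45.1 h45.2)
    rw [← stratum_eq_of_perm hd τ hT]
    exact hp
  · intro hp
    obtain ⟨l, hl, hd, hT, hp⟩ := exists_ordered_of_mem hp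
    refine ⟨l, hl, ?_, hp⟩
    obtain ⟨q, h0, h1⟩ := exists_point (hd.2 0 1 (by decide))
    obtain ⟨q', h0', h4'⟩ := exists_point (hd.2 0 4 (by decide))
    have hk : ∀ k : Fin 6, 1 < k → ((l k).rep ⬝ᵥ q.rep = 0 ↔ (k : ℕ) < 4) := by
      intro k hk
      rw [← tri_eq_zero_iff_dot (hd.2 0 1 (by decide)) (Projectivization.rep_nonzero q) h0 h1,
        tri_swap_left (l 0).rep, tri_swap_right (l 0).rep, neg_neg, hT 0 1 k (by decide) hk]
      simp [type43, Fin.lt_def]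
    have hq : ∀ k : Fin 6, (l k).rep ⬝ᵥ q.rep = 0 ↔ (k : ℕ) < 4 := by
      intro k
      rcases eq_or_ne k 0 with rfl | hk0
      · exact iff_of_true h0 (by decide)
      rcases eq_or_ne k 1 with rfl | hk1
      · exact iff_of_true h1 (by decide)
      exact hk k (by omega)
    have hne : q' ≠ q := by
      rintro rfl
      simpa using (hq 4).mp h4'
    have h5' : (l 5).rep ⬝ᵥ q'.rep = 0 := by
      rw [← tri_eq_zero_iff_dot (hd.2 0 4 (by decide)) (Projectivization.rep_nonzero q') h0' h4',
        tri_swap_left (l 0).rep, tri_swap_right (l 0).rep, neg_neg,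
        hT 0 4 5 (by decide) (by decide)]
      decide
    have hq' : ∀ k : Fin 6, (l k).rep ⬝ᵥ q'.rep = 0 → k = 0 ∨ k = 4 ∨ k = 5 := by
      intro k hk'
      by_contra! hk0
      exact hne (hd.point_eq hk0.1 hk' h0' ((hq k).mpr (by omega)) h0)
    refine ⟨(0 : Fin 6), q', q, hne, h0', h0, ?_, ?_, fun q'' hne' hne'' => ?_⟩
    · change multiplicity (d := 6) l q' = 3
      rw [multiplicity_eq]
      have : linesThrough (fun i => (l i).rep) q'.rep = {0, 4, 5} := by
        ext k
        rw [mem_linesThrough]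
        constructor
        · intro h; simpa using hq' k h
        · intro h
          simp only [Finset.mem_insert, Finset.mem_singleton] at h
          rcases h with rfl | rfl | rfl <;> assumption
      rw [this]; rfl
    · change multiplicity (d := 6) l q = 4
      rw [multiplicity_eq]
      have : linesThrough (fun i => (l i).rep) q.rep = {0, 1, 2, 3} := by
        ext k
        rw [mem_linesThrough, hq]
        clear * -; revert k; decide
      rw [this]; rfl
    · change multiplicity (d := 6) l q'' ≤ 2
      rw [multiplicity_eq]
      refine card_linesThrough_le_two fun i j k hij hjk hi hj hk'' h => ?_
      have h4 := (hT i j k hij hjk).mp h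
      simp only [type43, Bool.or_eq_true, Bool.and_eq_true, decide_eq_true_eq] at h4
      rcases h4 with h4 | ⟨rfl, rfl⟩
      · rw [Fin.lt_def] at h4
        refine hne'' (hd.point_eq hij.ne hi hj ((hq i).mpr ?_) ((hq j).mpr ?_)) <;>
          simp at h4 ⊢ <;> omega
      · exact hne' (hd.point_eq hij.ne hi hj h0' h4')

lemma distinct_of_minors {a : Fin 6 → Fin 3 → ℂ}
    (h : ∀ i j, i < j → a i 1 * a j 2 - a i 2 * a j 1 ≠ 0 ∨ a i 2 * a j 0 - a i 0 * a j 2 ≠ 0 ∨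
      a i 0 * a j 1 - a i 1 * a j 0 ≠ 0) : Distinct a := by
  have h1 : ∀ i j, i < j → a i ⨯₃ a j ≠ 0 := by
    intro i j hij h0
    rw [cross_apply] at h0
    have e0 := congrFun h0 0
    have e1 := congrFun h0 1
    have e2 := congrFun h0 2
    simp at e0 e1 e2
    simpa [e0, e1, e2] using h i j hij
  have h2 : ∀ i j, i ≠ j → a i ⨯₃ a j ≠ 0 := by
    intro i j hij
    rcases lt_or_gt_of_ne hij with h | h
    · exact h1 i j h
    · rw [← cross_anticomm, neg_ne_zero]
      exact h1 j i h
  refine ⟨fun i h0 => ?_, h2⟩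
  obtain ⟨j, hj⟩ := exists_ne i
  exact h2 i j hj.symm (by rw [h0]; simp)

lemma forall_lt {P : Fin 6 → Fin 6 → Prop}
    (h : P 0 1 ∧ P 0 2 ∧ P 0 3 ∧ P 0 4 ∧ P 0 5 ∧ P 1 2 ∧ P 1 3 ∧ P 1 4 ∧ P 1 5 ∧ P 2 3 ∧ P 2 4 ∧
      P 2 5 ∧ P 3 4 ∧ P 3 5 ∧ P 4 5) (i j : Fin 6) (hij : i < j) : P i j := by
  revert i j
  simp only [Fin.forall_fin_succ, IsEmpty.forall_iff]
  simp [Fin.lt_def]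
  tauto

lemma latticeLPrime33_distinct : Distinct
    (![![1, 0, 0], ![0, 1, -1], ![1, -1, 0], ![1, -2, 0], ![1, 0, -2], ![1, 0, -3]] :
      Fin 6 → Fin 3 → ℂ) := by
  refine distinct_of_minors (forall_lt ?_)
  refine ⟨?_, ?_, ?_, ?_, ?_, ?_, ?_, ?_, ?_, ?_, ?_, ?_, ?_, ?_, ?_⟩ <;> simp <;> norm_num

theorem stratum_latticeLPrime33 : stratum 6 latticeLPrime33 = curvesOfType type333 := by
  -- The new order puts first the triangle x, x - 2y, x - 2z, whose vertices are the three triple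
  -- points.
  let σ : Equiv.Perm (Fin 6) := Equiv.ofBijective ![0, 3, 4, 2, 5, 1] (by decide)
  have hσ : (![![1, 0, 0], ![0, 1, -1], ![1, -1, 0], ![1, -2, 0], ![1, 0, -2], ![1, 0, -3]] :
      Fin 6 → Fin 3 → ℂ) ∘ σ = ![![1, 0, 0], ![1, -2, 0], ![1, 0, -2], ![1, -1, 0], ![1, 0, -3],
      ![0, 1, -1]] := by
    funext i
    fin_cases i <;> rfl
  refine stratum_eq_of_perm latticeLPrime33_distinct σ ?_
  rw [hσ]
  refine forall_lt_lt ⟨?_, ?_, ?_, ?_, ?_, ?_, ?_, ?_, ?_, ?_, ?_, ?_, ?_, ?_, ?_, ?_, ?_, ?_, ?_,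
    ?_⟩ <;> first
    | exact iff_of_true (by simp [tri] <;> norm_num) (by decide)
    | exact iff_of_false (by simp [tri] <;> norm_num) (by decide)

lemma latticeLDelta_distinct : Distinct
    (![![1, -1, 0], ![1, 1, 0], ![1, 0, -1], ![1, 0, 1], ![0, 1, -1], ![0, 1, 1]] :
      Fin 6 → Fin 3 → ℂ) := by
  refine distinct_of_minors (forall_lt ?_)
  refine ⟨?_, ?_, ?_, ?_, ?_, ?_, ?_, ?_, ?_, ?_, ?_, ?_, ?_, ?_, ?_⟩ <;> simp <;> norm_num

theorem stratum_latticeLDelta : stratum 6 latticeLDelta = curvesOfType type3333 := by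
  -- The lines x - y, x - z, y + z form a triangle with triple points at its vertices; the other
  -- three lines are concurrent.
  let σ : Equiv.Perm (Fin 6) := Equiv.ofBijective ![0, 2, 5, 4, 3, 1] (by decide)
  have hσ : (![![1, -1, 0], ![1, 1, 0], ![1, 0, -1], ![1, 0, 1], ![0, 1, -1], ![0, 1, 1]] :
      Fin 6 → Fin 3 → ℂ) ∘ σ = ![![1, -1, 0], ![1, 0, -1], ![0, 1, 1], ![0, 1, -1], ![1, 0, 1],
      ![1, 1, 0]] := by
    funext i
    fin_cases i <;> rfl
  refine stratum_eq_of_perm latticeLDelta_distinct σ ?_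
  rw [hσ]
  refine forall_lt_lt ⟨?_, ?_, ?_, ?_, ?_, ?_, ?_, ?_, ?_, ?_, ?_, ?_, ?_, ?_, ?_, ?_, ?_, ?_, ?_,
    ?_⟩ <;> first
    | exact iff_of_true (by simp [tri] <;> norm_num) (by decide)
    | exact iff_of_false (by simp [tri] <;> norm_num) (by decide)

end

section

/-! ### Irreducibility and dimension of the types -/

/-- The linear map `v ↦ v + s (w ⬝ᵥ v) e₀`. -/
def shear (w : Fin 3 → ℂ) (s : ℂ) (v : Fin 3 → ℂ) : Fin 3 → ℂ :=
  v + s • ((v ⬝ᵥ w) • Pi.single 0 1)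

lemma tri_shear (w : Fin 3 → ℂ) (s : ℂ) (a b c : Fin 3 → ℂ) :
    tri (shear w s a) (shear w s b) (shear w s c) = (1 + s * w 0) * tri a b c := by
  simp [tri, shear, dotProduct, Fin.sum_univ_three]
  ring

lemma exists_tri_ne_zero {a b : Fin 3 → ℂ} (h : a ⨯₃ b ≠ 0) : ∃ c, tri c a b ≠ 0 := by
  obtain ⟨v, hv⟩ := exists_dot_ne_zero h
  exact ⟨v, by rwa [tri_eq_dot, dotProduct_comm]⟩

lemma cross_ne_zero_of_tri {a b c : Fin 3 → ℂ} (h : tri c a b ≠ 0) : a ⨯₃ b ≠ 0 := by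
  intro h0
  exact h (by rw [tri_eq_dot, h0, dotProduct_zero])

/-- Two vectors are independent when some third one completes them to a basis, and the shear is
invertible. -/
lemma distinct_shear {a : Fin 6 → Fin 3 → ℂ} (ha : Distinct a) {w : Fin 3 → ℂ} {s : ℂ}
    (hs : 1 + s * w 0 ≠ 0) : Distinct fun i => shear w s (a i) := by
  have h2 : ∀ i j, i ≠ j → shear w s (a i) ⨯₃ shear w s (a j) ≠ 0 := by
    intro i j hij
    obtain ⟨c, hc⟩ := exists_tri_ne_zero (ha.2 i j hij)
    refine cross_ne_zero_of_tri (c := shear w s c) ?_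
    rw [tri_shear]
    exact mul_ne_zero hs hc
  refine ⟨fun i h0 => ?_, h2⟩
  obtain ⟨j, hj⟩ := exists_ne i
  have h0 : shear w s (a i) = 0 := h0
  exact h2 i j hj.symm (by rw [h0]; simp)

lemma exists_forall_dot_ne_zero {ι : Type*} [Fintype ι] {a : ι → Fin 3 → ℂ}
    (ha : ∀ i, a i ≠ 0) : ∃ w, ∀ i, a i ⬝ᵥ w ≠ 0 := by
  have h : ∏ i, linearForm (a i) ≠ 0 :=
    Finset.prod_ne_zero_iff.mpr fun i _ => linearForm_ne_zero (ha i)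
  obtain ⟨w, hw⟩ : ∃ w, eval w (∏ i, linearForm (a i)) ≠ 0 := by
    by_contra! h0
    exact h (MvPolynomial.funext fun v => by rw [h0 v, map_zero])
  rw [map_prod, Finset.prod_ne_zero_iff] at hw
  exact ⟨w, fun i => by simpa [eval_linearForm] using hw i (Finset.mem_univ i)⟩

variable {n : ℕ} {T : Fin 6 → Fin 6 → Fin 6 → Bool}

/-- `hgen` says that `vec` reaches every arrangement of the type whose lines have nonzero first
coordinate. Shears show that these are dense in the type, which gives irreducibility and the upper
bound. The sample `c` and the points `v` are the certificate for the lower bound. -/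
theorem irreducible_and_dim {a : Fin 6 → Fin 3 → MvPolynomial (Fin n) ℂ}
    (vec : (Fin n → ℂ) → Fin 6 → Fin 3 → ℂ) (ha : ∀ t, evalVec a t = vec t)
    (hconc : ∀ t i j k, i < j → j < k → T i j k = true → tri (vec t i) (vec t j) (vec t k) = 0)
    (hgen : ∀ b : Fin 6 → Fin 3 → ℂ, Distinct b → Pattern T b → (∀ i, b i 0 ≠ 0) →
      ∃ t, ∀ i, ∃ c : ℂ, c ≠ 0 ∧ b i = c • vec t i)
    (c : Fin n → ℂ) (hcd : Distinct (vec c)) (hcp : Pattern T (vec c)) (v : Fin n → Fin 3 → ℂ)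
    (h1 : ∀ k t, (∀ j, k ≤ j → t j = c j) → ∃ i, vec t i ⬝ᵥ v k = 0)
    (h2 : ∀ k i, vec (Function.update c k (c k + 10)) i ⬝ᵥ v k ≠ 0) :
    IsIrreducible (curvesOfType T) ∧ topologicalKrullDim (curvesOfType T) = n := by
  -- The concurrences of `T` hold identically in the parameters by `hconc`, so only open conditions
  -- remain.
  set D : Set (Fin n → ℂ) := {t | Distinct (evalVec a t)} ∩
    {t | ∀ i j k, i < j → j < k → T i j k = false →
      tri (evalVec a t i) (evalVec a t j) (evalVec a t k) ≠ 0} with hD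
  have hDo : IsZOpen D := by
    refine (isZOpen_distinct a).inter ?_
    refine isZOpen_forall (D := fun i => {t | ∀ j k, i < j → j < k → T i j k = false →
      tri (evalVec a t i) (evalVec a t j) (evalVec a t k) ≠ 0}) fun i =>
      isZOpen_forall (D := fun j => {t | ∀ k, i < j → j < k → T i j k = false →
      tri (evalVec a t i) (evalVec a t j) (evalVec a t k) ≠ 0}) fun j =>
      isZOpen_forall (D := fun k => {t | i < j → j < k → T i j k = false →
      tri (evalVec a t i) (evalVec a t j) (evalVec a t k) ≠ 0}) fun k =>
      isZOpen_imp (D := {t | j < k → T i j k = false →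
      tri (evalVec a t i) (evalVec a t j) (evalVec a t k) ≠ 0}) fun _ =>
      isZOpen_imp (D := {t | T i j k = false →
      tri (evalVec a t i) (evalVec a t j) (evalVec a t k) ≠ 0}) fun _ =>
      isZOpen_imp fun _ => isZOpen_tri_ne a i j k
  have hDP : ∀ t, t ∈ D ↔ Distinct (vec t) ∧ Pattern T (vec t) := by
    intro t
    simp only [hD, ← ha]
    refine and_congr_right fun _ => forall₅_congr fun i j k hij hjk => ?_
    have := hconc t i j k hij hjk
    rw [← ha] at this
    rcases Bool.eq_false_or_eq_true (T i j k) with h | h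
    · simp [h, this h]
    · simp [h]
  have hcD : c ∈ D := (hDP c).mpr ⟨hcd, hcp⟩
  have hne : ∀ t ∈ D, ∀ i, evalVec a t i ≠ 0 := fun t ht => ht.1.1
  have hsub : family a D ⊆ curvesOfType T := by
    rintro p ⟨t, ht, hp⟩
    rw [ha] at hp
    exact ⟨_, ((hDP t).mp ht).1, ((hDP t).mp ht).2, hp⟩
  have hcl : curvesOfType T ⊆ closure (family a D) := by
    rintro p ⟨b, hb, hT, hp⟩
    obtain ⟨w, hw⟩ := exists_forall_dot_ne_zero hb.1
    -- Along this line the arrangement is transformed by a shear. The excluded parameters are those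
    -- where the shear degenerates or some first coordinate vanishes; `w` is chosen so that each of
    -- these conditions is nontrivial.
    refine mem_closure_of_line (b := fun i => (b i ⬝ᵥ w) • Pi.single 0 1) hp
      ((1 + Polynomial.C (w 0) * Polynomial.X) *
        ∏ i, (Polynomial.C (b i 0) + Polynomial.C (b i ⬝ᵥ w) * Polynomial.X)) ?_ fun s hs => ?_
    · refine mul_ne_zero (fun h => ?_) (Finset.prod_ne_zero_iff.mpr fun i _ h => ?_)
      · simpa using congrArg (Polynomial.eval 0) h
      · have := congrArg (fun q => Polynomial.coeff q 1) h
        simp [hw i] at this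
    · rw [Polynomial.eval_mul, Polynomial.eval_prod, mul_ne_zero_iff,
        Finset.prod_ne_zero_iff] at hs
      obtain ⟨hs1, hs2⟩ := hs
      have hdet : 1 + s * w 0 ≠ 0 := by
        intro h0
        apply hs1
        simp only [Polynomial.eval_add, Polynomial.eval_one, Polynomial.eval_C,
          Polynomial.eval_mul, Polynomial.eval_X]
        linear_combination h0
      set b' : Fin 6 → Fin 3 → ℂ := fun i => shear w s (b i) with hb'
      have hd' : Distinct b' := distinct_shear hb hdet
      have hT' : Pattern T b' := by
        intro i j k hij hjk
        rw [← hT i j k hij hjk, hb', tri_shear]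
        simp [hdet]
      have h0 : ∀ i, b' i 0 ≠ 0 := by
        intro i h0
        apply hs2 i (Finset.mem_univ i)
        simp [hb', shear] at h0
        simp only [Polynomial.eval_add, Polynomial.eval_C, Polynomial.eval_mul, Polynomial.eval_X]
        linear_combination h0
      obtain ⟨t, ht⟩ := hgen b' hd' hT' h0
      choose κ hκ hbκ using ht
      obtain ⟨q, hq⟩ : ∃ q, Rep q b' := ⟨_, rep_psi_mk b' hd'.1⟩
      refine ⟨q, ⟨t, (hDP t).mpr ⟨?_, ?_⟩, ?_⟩, hq⟩
      · refine ⟨fun i h => hd'.1 i (by rw [hbκ, h, smul_zero]), fun i j hij h => hd'.2 i j hij ?_⟩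
        rw [hbκ, hbκ, map_smul, map_smul, LinearMap.smul_apply, h]
        simp
      · intro i j k hij hjk
        rw [← hT' i j k hij hjk, hbκ i, hbκ j, hbκ k, tri_smul]
        simp [hκ]
      · rw [ha]
        exact hq.smul fun i => ⟨κ i, hκ i, hbκ i⟩
  have hirr : IsIrreducible (family a D) := family_isIrreducible hDo ⟨c, hcD⟩ hne
  have hcle : closure (curvesOfType T) = closure (family a D) :=
    (closure_minimal hcl isClosed_closure).antisymm (closure_mono hsub)
  refine ⟨⟨hirr.1.mono hsub, ?_⟩, le_antisymm (topologicalKrullDim_le_of_family hcl) ?_⟩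
  · rw [← isPreirreducible_iff_closure, hcle, isPreirreducible_iff_closure]
    exact hirr.2
  · refine le_topologicalKrullDim_of_family hDo hne hsub c hcD v (fun k t ht => ?_) fun k =>
      ⟨Function.update c k (c k + 10), fun j hj => Function.update_of_ne hj.ne' _ _, fun i => ?_⟩
    · obtain ⟨i, hi⟩ := h1 k t ht
      exact ⟨i, by rwa [ha]⟩
    · rw [ha]
      exact h2 k i

/-! Normalisation of vectors -/

/-- The vector `(1, y, z)`. -/
def unitVec (y z : ℂ) : Fin 3 → ℂ := ![1, y, z]

lemma eq_smul_unitVec {b : Fin 3 → ℂ} (hb : b 0 ≠ 0) :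
    b = b 0 • unitVec (b 1 / b 0) (b 2 / b 0) := by
  ext i
  fin_cases i <;> simp [unitVec] <;> field_simp

/-- A vector in the plane of two others, after rescaling. -/
lemma exists_join {a b c A B : Fin 3 → ℂ} {s u : ℂ} (h : tri c a b = 0) (hab : a ⨯₃ b ≠ 0)
    (hcb : c ⨯₃ b ≠ 0) (hs : s ≠ 0) (hu : u ≠ 0) (ha : a = s • A) (hb : b = u • B) :
    ∃ β κ : ℂ, κ ≠ 0 ∧ c = κ • (A + β • B) := by
  obtain ⟨x, y, hc⟩ := exists_comb_of_tri h hab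
  have hx : x ≠ 0 := by
    rintro rfl
    apply hcb
    rw [hc]
    simp
  refine ⟨y * u / (x * s), x * s, mul_ne_zero hx hs, ?_⟩
  rw [hc, ha, hb, smul_add, smul_smul, smul_smul, smul_smul]
  congr 2
  field_simp

end

section

/-! ### Parametrisation of the six types -/

/-- The generic vector `(1, y, z)`. -/
noncomputable def genVec {n : ℕ} (y z : Fin n) : Fin 3 → MvPolynomial (Fin n) ℂ := ![1, X y, X z]

lemma tri_cycle (a b c : Fin 3 → ℂ) : tri c a b = tri a b c := by
  simp [tri]; ring

lemma eval_unitVec {n : ℕ} (t : Fin n → ℂ) (y z : Fin n) (j : Fin 3) :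
    eval t (genVec y z j) = unitVec (t y) (t z) j := by
  fin_cases j <;> simp [genVec, unitVec]

/-- Generators of lines through the common point of two other lines. -/
lemma exists_join_of_pattern {T : Fin 6 → Fin 6 → Fin 6 → Bool} {b : Fin 6 → Fin 3 → ℂ}
    (hb : Distinct b) (hT : Pattern T b) (h0 : ∀ i, b i 0 ≠ 0) (i j k : Fin 6)
    (h : (i < j ∧ j < k) ∧ T i j k = true) : ∃ β κ : ℂ, κ ≠ 0 ∧
      b k = κ • (unitVec (b i 1 / b i 0) (b i 2 / b i 0) +
        β • unitVec (b j 1 / b j 0) (b j 2 / b j 0)) :=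
  exists_join ((tri_cycle _ _ _).trans ((hT i j k h.1.1 h.1.2).mpr h.2))
    (hb.2 _ _ h.1.1.ne) (hb.2 _ _ h.1.2.ne') (h0 i) (h0 j) (eq_smul_unitVec (h0 i))
    (eq_smul_unitVec (h0 j))

/-- The generic arrangement of type `type6`. -/
noncomputable def gen6 : Fin 6 → Fin 3 → MvPolynomial (Fin 8) ℂ :=
  ![genVec 4 5,
    genVec 6 7,
    genVec 4 5 + (X 0 : MvPolynomial (Fin 8) ℂ) • genVec 6 7,
    genVec 4 5 + (X 1 : MvPolynomial (Fin 8) ℂ) • genVec 6 7,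
    genVec 4 5 + (X 2 : MvPolynomial (Fin 8) ℂ) • genVec 6 7,
    genVec 4 5 + (X 3 : MvPolynomial (Fin 8) ℂ) • genVec 6 7]

/-- The arrangements of type `type6`. -/
noncomputable def vec6 (t : Fin 8 → ℂ) : Fin 6 → Fin 3 → ℂ :=
  ![unitVec (t 4) (t 5),
    unitVec (t 6) (t 7),
    unitVec (t 4) (t 5) + t 0 • unitVec (t 6) (t 7),
    unitVec (t 4) (t 5) + t 1 • unitVec (t 6) (t 7),
    unitVec (t 4) (t 5) + t 2 • unitVec (t 6) (t 7),
    unitVec (t 4) (t 5) + t 3 • unitVec (t 6) (t 7)]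

lemma evalVec_gen6 (t : Fin 8 → ℂ) : evalVec gen6 t = vec6 t := by
  funext i j
  fin_cases i <;> simp [evalVec, gen6, vec6, eval_unitVec]

/-- A member of the pencil of A and B that differs from B is A + βB up to scale. -/
lemma exists_eq_vec6 {b : Fin 6 → Fin 3 → ℂ} (hb : Distinct b) (hT : Pattern type6 b)
    (h0 : ∀ i, b i 0 ≠ 0) : ∃ t, ∀ i, ∃ c : ℂ, c ≠ 0 ∧ b i = c • vec6 t i := by
  obtain ⟨β0, κ0, k0, e0⟩ := exists_join_of_pattern hb hT h0 0 1 2 (by decide)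
  obtain ⟨β1, κ1, k1, e1⟩ := exists_join_of_pattern hb hT h0 0 1 3 (by decide)
  obtain ⟨β2, κ2, k2, e2⟩ := exists_join_of_pattern hb hT h0 0 1 4 (by decide)
  obtain ⟨β3, κ3, k3, e3⟩ := exists_join_of_pattern hb hT h0 0 1 5 (by decide)
  refine ⟨![β0, β1, β2, β3, b 0 1 / b 0 0, b 0 2 / b 0 0, b 1 1 / b 1 0, b 1 2 / b 1 0], fun i => ?_⟩
  fin_cases i
  · exact ⟨_, h0 0, eq_smul_unitVec (h0 0)⟩
  · exact ⟨_, h0 1, eq_smul_unitVec (h0 1)⟩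
  · exact ⟨_, k0, e0⟩
  · exact ⟨_, k1, e1⟩
  · exact ⟨_, k2, e2⟩
  · exact ⟨_, k3, e3⟩

/-- Two vectors (1, y, z) and four pencil parameters: 4 + 4 = 8. -/
theorem irreducible_and_dim_type6 :
    IsIrreducible (curvesOfType type6) ∧ topologicalKrullDim (curvesOfType type6) = 8 := by
  -- The first list is a sample arrangement. The `k`-th point of the second list lies on the line
  -- governed by the `k`-th parameter, and on no line once that parameter is increased by 10. Pencil
  -- parameters come first, so that they are tested while the vectors spanning the pencil still have
  -- their sample values.
  refine irreducible_and_dim (n := 8) vec6 evalVec_gen6 (fun t => forall_lt_lt ?_)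
    (fun b => exists_eq_vec6) ![1, 2, 4, 3, 0, 0, 1, 1] (distinct_of_minors (forall_lt ?_))
    (forall_lt_lt ?_) ![![-1, 0, 2],
      ![-2, 0, 3],
      ![-4, 1, 4],
      ![-3, 0, 4],
      ![0, 1, 0],
      ![0, 0, 1],
      ![-1, 1, 0],
      ![-1, 0, 1]] (fun k t h => ?_) (fun k => ?_)
  · refine ⟨?_, ?_, ?_, ?_, ?_, ?_, ?_, ?_, ?_, ?_, ?_, ?_, ?_, ?_, ?_, ?_, ?_, ?_, ?_, ?_⟩ <;> first
    | exact fun h => absurd h (by decide)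
    | (intro _; simp [tri, vec6, unitVec] <;> ring)
  · refine ⟨?_, ?_, ?_, ?_, ?_, ?_, ?_, ?_, ?_, ?_, ?_, ?_, ?_, ?_, ?_⟩ <;>
      simp [vec6, unitVec] <;> norm_num
  · refine ⟨?_, ?_, ?_, ?_, ?_, ?_, ?_, ?_, ?_, ?_, ?_, ?_, ?_, ?_, ?_, ?_, ?_, ?_, ?_, ?_⟩ <;> first
    | exact iff_of_true (by simp [tri, vec6, unitVec] <;> norm_num) (by decide)
    | exact iff_of_false (by simp [tri, vec6, unitVec] <;> norm_num) (by decide)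
  · match k with
    | 0 =>
      have e0 : t 0 = 1 := h 0 (by decide)
      have e4 : t 4 = 0 := h 4 (by decide)
      have e5 : t 5 = 0 := h 5 (by decide)
      have e6 : t 6 = 1 := h 6 (by decide)
      have e7 : t 7 = 1 := h 7 (by decide)
      exact ⟨2, by simp [vec6, unitVec, e0, e4, e5, e6, e7] <;> norm_num⟩
    | 1 =>
      have e1 : t 1 = 2 := h 1 (by decide)
      have e4 : t 4 = 0 := h 4 (by decide)
      have e5 : t 5 = 0 := h 5 (by decide)
      have e6 : t 6 = 1 := h 6 (by decide)
      have e7 : t 7 = 1 := h 7 (by decide)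
      exact ⟨3, by simp [vec6, unitVec, e1, e4, e5, e6, e7] <;> norm_num⟩
    | 2 =>
      have e2 : t 2 = 4 := h 2 (by decide)
      have e4 : t 4 = 0 := h 4 (by decide)
      have e5 : t 5 = 0 := h 5 (by decide)
      have e6 : t 6 = 1 := h 6 (by decide)
      have e7 : t 7 = 1 := h 7 (by decide)
      exact ⟨4, by simp [vec6, unitVec, e2, e4, e5, e6, e7] <;> norm_num⟩
    | 3 =>
      have e3 : t 3 = 3 := h 3 (by decide)
      have e4 : t 4 = 0 := h 4 (by decide)
      have e5 : t 5 = 0 := h 5 (by decide)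
      have e6 : t 6 = 1 := h 6 (by decide)
      have e7 : t 7 = 1 := h 7 (by decide)
      exact ⟨5, by simp [vec6, unitVec, e3, e4, e5, e6, e7] <;> norm_num⟩
    | 4 =>
      have e4 : t 4 = 0 := h 4 (by decide)
      exact ⟨0, by simp [vec6, unitVec, e4]⟩
    | 5 =>
      have e5 : t 5 = 0 := h 5 (by decide)
      exact ⟨0, by simp [vec6, unitVec, e5]⟩
    | 6 =>
      have e6 : t 6 = 1 := h 6 (by decide)
      exact ⟨1, by simp [vec6, unitVec, e6]⟩
    | 7 =>
      have e7 : t 7 = 1 := h 7 (by decide)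
      exact ⟨1, by simp [vec6, unitVec, e7]⟩
  · match k with
    | 0 =>
      have e : Function.update (![1, 2, 4, 3, 0, 0, 1, 1] : Fin 8 → ℂ) 0 (![1, 2, 4, 3, 0, 0, 1, 1] 0 + 10) = ![11, 2, 4, 3, 0, 0, 1, 1] := by
        ext j; fin_cases j <;> simp [Function.update] <;> norm_num
      rw [e]
      intro i; fin_cases i <;> simp [vec6, unitVec] <;> norm_num
    | 1 =>
      have e : Function.update (![1, 2, 4, 3, 0, 0, 1, 1] : Fin 8 → ℂ) 1 (![1, 2, 4, 3, 0, 0, 1, 1] 1 + 10) = ![1, 12, 4, 3, 0, 0, 1, 1] := by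
        ext j; fin_cases j <;> simp [Function.update] <;> norm_num
      rw [e]
      intro i; fin_cases i <;> simp [vec6, unitVec] <;> norm_num
    | 2 =>
      have e : Function.update (![1, 2, 4, 3, 0, 0, 1, 1] : Fin 8 → ℂ) 2 (![1, 2, 4, 3, 0, 0, 1, 1] 2 + 10) = ![1, 2, 14, 3, 0, 0, 1, 1] := by
        ext j; fin_cases j <;> simp [Function.update] <;> norm_num
      rw [e]
      intro i; fin_cases i <;> simp [vec6, unitVec] <;> norm_num
    | 3 =>
      have e : Function.update (![1, 2, 4, 3, 0, 0, 1, 1] : Fin 8 → ℂ) 3 (![1, 2, 4, 3, 0, 0, 1, 1] 3 + 10) = ![1, 2, 4, 13, 0, 0, 1, 1] := by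
        ext j; fin_cases j <;> simp [Function.update] <;> norm_num
      rw [e]
      intro i; fin_cases i <;> simp [vec6, unitVec] <;> norm_num
    | 4 =>
      have e : Function.update (![1, 2, 4, 3, 0, 0, 1, 1] : Fin 8 → ℂ) 4 (![1, 2, 4, 3, 0, 0, 1, 1] 4 + 10) = ![1, 2, 4, 3, 10, 0, 1, 1] := by
        ext j; fin_cases j <;> simp [Function.update]
      rw [e]
      intro i; fin_cases i <;> simp [vec6, unitVec] <;> norm_num
    | 5 =>
      have e : Function.update (![1, 2, 4, 3, 0, 0, 1, 1] : Fin 8 → ℂ) 5 (![1, 2, 4, 3, 0, 0, 1, 1] 5 + 10) = ![1, 2, 4, 3, 0, 10, 1, 1] := by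
        ext j; fin_cases j <;> simp [Function.update]
      rw [e]
      intro i; fin_cases i <;> simp [vec6, unitVec] <;> norm_num
    | 6 =>
      have e : Function.update (![1, 2, 4, 3, 0, 0, 1, 1] : Fin 8 → ℂ) 6 (![1, 2, 4, 3, 0, 0, 1, 1] 6 + 10) = ![1, 2, 4, 3, 0, 0, 11, 1] := by
        ext j; fin_cases j <;> simp [Function.update] <;> norm_num
      rw [e]
      intro i; fin_cases i <;> simp [vec6, unitVec] <;> norm_num
    | 7 =>
      have e : Function.update (![1, 2, 4, 3, 0, 0, 1, 1] : Fin 8 → ℂ) 7 (![1, 2, 4, 3, 0, 0, 1, 1] 7 + 10) = ![1, 2, 4, 3, 0, 0, 1, 11] := by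
        ext j; fin_cases j <;> simp [Function.update] <;> norm_num
      rw [e]
      intro i; fin_cases i <;> simp [vec6, unitVec] <;> norm_num

/-- The generic arrangement of type `type5`. -/
noncomputable def gen5 : Fin 6 → Fin 3 → MvPolynomial (Fin 9) ℂ :=
  ![genVec 3 4,
    genVec 5 6,
    genVec 3 4 + (X 0 : MvPolynomial (Fin 9) ℂ) • genVec 5 6,
    genVec 3 4 + (X 1 : MvPolynomial (Fin 9) ℂ) • genVec 5 6,
    genVec 3 4 + (X 2 : MvPolynomial (Fin 9) ℂ) • genVec 5 6,
    genVec 7 8]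

/-- The arrangements of type `type5`. -/
noncomputable def vec5 (t : Fin 9 → ℂ) : Fin 6 → Fin 3 → ℂ :=
  ![unitVec (t 3) (t 4),
    unitVec (t 5) (t 6),
    unitVec (t 3) (t 4) + t 0 • unitVec (t 5) (t 6),
    unitVec (t 3) (t 4) + t 1 • unitVec (t 5) (t 6),
    unitVec (t 3) (t 4) + t 2 • unitVec (t 5) (t 6),
    unitVec (t 7) (t 8)]

lemma evalVec_gen5 (t : Fin 9 → ℂ) : evalVec gen5 t = vec5 t := by
  funext i j
  fin_cases i <;> simp [evalVec, gen5, vec5, eval_unitVec]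

lemma exists_eq_vec5 {b : Fin 6 → Fin 3 → ℂ} (hb : Distinct b) (hT : Pattern type5 b)
    (h0 : ∀ i, b i 0 ≠ 0) : ∃ t, ∀ i, ∃ c : ℂ, c ≠ 0 ∧ b i = c • vec5 t i := by
  obtain ⟨β0, κ0, k0, e0⟩ := exists_join_of_pattern hb hT h0 0 1 2 (by decide)
  obtain ⟨β1, κ1, k1, e1⟩ := exists_join_of_pattern hb hT h0 0 1 3 (by decide)
  obtain ⟨β2, κ2, k2, e2⟩ := exists_join_of_pattern hb hT h0 0 1 4 (by decide)
  refine ⟨![β0, β1, β2, b 0 1 / b 0 0, b 0 2 / b 0 0, b 1 1 / b 1 0, b 1 2 / b 1 0, b 5 1 / b 5 0, b 5 2 / b 5 0], fun i => ?_⟩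
  fin_cases i
  · exact ⟨_, h0 0, eq_smul_unitVec (h0 0)⟩
  · exact ⟨_, h0 1, eq_smul_unitVec (h0 1)⟩
  · exact ⟨_, k0, e0⟩
  · exact ⟨_, k1, e1⟩
  · exact ⟨_, k2, e2⟩
  · exact ⟨_, h0 5, eq_smul_unitVec (h0 5)⟩

/-- Three vectors (1, y, z), one of them off the pencil, and three pencil parameters: 6 + 3 = 9. -/
theorem irreducible_and_dim_type5 :
    IsIrreducible (curvesOfType type5) ∧ topologicalKrullDim (curvesOfType type5) = 9 := by
  refine irreducible_and_dim (n := 9) vec5 evalVec_gen5 (fun t => forall_lt_lt ?_)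
    (fun b => exists_eq_vec5) ![2, 3, 1, 0, 0, 1, 1, 2, 4] (distinct_of_minors (forall_lt ?_))
    (forall_lt_lt ?_) ![![-2, 0, 3],
      ![-3, 1, 3],
      ![-1, 0, 2],
      ![0, 1, 0],
      ![0, 0, 1],
      ![-1, 1, 0],
      ![-1, 0, 1],
      ![-2, 1, 0],
      ![-4, 0, 1]] (fun k t h => ?_) (fun k => ?_)
  · refine ⟨?_, ?_, ?_, ?_, ?_, ?_, ?_, ?_, ?_, ?_, ?_, ?_, ?_, ?_, ?_, ?_, ?_, ?_, ?_, ?_⟩ <;> first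
    | exact fun h => absurd h (by decide)
    | (intro _; simp [tri, vec5, unitVec] <;> ring)
  · refine ⟨?_, ?_, ?_, ?_, ?_, ?_, ?_, ?_, ?_, ?_, ?_, ?_, ?_, ?_, ?_⟩ <;>
      simp [vec5, unitVec] <;> norm_num
  · refine ⟨?_, ?_, ?_, ?_, ?_, ?_, ?_, ?_, ?_, ?_, ?_, ?_, ?_, ?_, ?_, ?_, ?_, ?_, ?_, ?_⟩ <;> first
    | exact iff_of_true (by simp [tri, vec5, unitVec] <;> norm_num) (by decide)
    | exact iff_of_false (by simp [tri, vec5, unitVec] <;> norm_num) (by decide)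
  · match k with
    | 0 =>
      have e0 : t 0 = 2 := h 0 (by decide)
      have e3 : t 3 = 0 := h 3 (by decide)
      have e4 : t 4 = 0 := h 4 (by decide)
      have e5 : t 5 = 1 := h 5 (by decide)
      have e6 : t 6 = 1 := h 6 (by decide)
      exact ⟨2, by simp [vec5, unitVec, e0, e3, e4, e5, e6] <;> norm_num⟩
    | 1 =>
      have e1 : t 1 = 3 := h 1 (by decide)
      have e3 : t 3 = 0 := h 3 (by decide)
      have e4 : t 4 = 0 := h 4 (by decide)
      have e5 : t 5 = 1 := h 5 (by decide)
      have e6 : t 6 = 1 := h 6 (by decide)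
      exact ⟨3, by simp [vec5, unitVec, e1, e3, e4, e5, e6] <;> norm_num⟩
    | 2 =>
      have e2 : t 2 = 1 := h 2 (by decide)
      have e3 : t 3 = 0 := h 3 (by decide)
      have e4 : t 4 = 0 := h 4 (by decide)
      have e5 : t 5 = 1 := h 5 (by decide)
      have e6 : t 6 = 1 := h 6 (by decide)
      exact ⟨4, by simp [vec5, unitVec, e2, e3, e4, e5, e6] <;> norm_num⟩
    | 3 =>
      have e3 : t 3 = 0 := h 3 (by decide)
      exact ⟨0, by simp [vec5, unitVec, e3]⟩
    | 4 =>
      have e4 : t 4 = 0 := h 4 (by decide)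
      exact ⟨0, by simp [vec5, unitVec, e4]⟩
    | 5 =>
      have e5 : t 5 = 1 := h 5 (by decide)
      exact ⟨1, by simp [vec5, unitVec, e5]⟩
    | 6 =>
      have e6 : t 6 = 1 := h 6 (by decide)
      exact ⟨1, by simp [vec5, unitVec, e6]⟩
    | 7 =>
      have e7 : t 7 = 2 := h 7 (by decide)
      exact ⟨5, by simp [vec5, unitVec, e7]⟩
    | 8 =>
      have e8 : t 8 = 4 := h 8 (by decide)
      exact ⟨5, by simp [vec5, unitVec, e8]⟩
  · match k with
    | 0 =>
      have e : Function.update (![2, 3, 1, 0, 0, 1, 1, 2, 4] : Fin 9 → ℂ) 0 (![2, 3, 1, 0, 0, 1, 1, 2, 4] 0 + 10) = ![12, 3, 1, 0, 0, 1, 1, 2, 4] := by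
        ext j; fin_cases j <;> simp [Function.update] <;> norm_num
      rw [e]
      intro i; fin_cases i <;> simp [vec5, unitVec] <;> norm_num
    | 1 =>
      have e : Function.update (![2, 3, 1, 0, 0, 1, 1, 2, 4] : Fin 9 → ℂ) 1 (![2, 3, 1, 0, 0, 1, 1, 2, 4] 1 + 10) = ![2, 13, 1, 0, 0, 1, 1, 2, 4] := by
        ext j; fin_cases j <;> simp [Function.update] <;> norm_num
      rw [e]
      intro i; fin_cases i <;> simp [vec5, unitVec] <;> norm_num
    | 2 =>
      have e : Function.update (![2, 3, 1, 0, 0, 1, 1, 2, 4] : Fin 9 → ℂ) 2 (![2, 3, 1, 0, 0, 1, 1, 2, 4] 2 + 10) = ![2, 3, 11, 0, 0, 1, 1, 2, 4] := by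
        ext j; fin_cases j <;> simp [Function.update] <;> norm_num
      rw [e]
      intro i; fin_cases i <;> simp [vec5, unitVec] <;> norm_num
    | 3 =>
      have e : Function.update (![2, 3, 1, 0, 0, 1, 1, 2, 4] : Fin 9 → ℂ) 3 (![2, 3, 1, 0, 0, 1, 1, 2, 4] 3 + 10) = ![2, 3, 1, 10, 0, 1, 1, 2, 4] := by
        ext j; fin_cases j <;> simp [Function.update]
      rw [e]
      intro i; fin_cases i <;> simp [vec5, unitVec] <;> norm_num
    | 4 =>
      have e : Function.update (![2, 3, 1, 0, 0, 1, 1, 2, 4] : Fin 9 → ℂ) 4 (![2, 3, 1, 0, 0, 1, 1, 2, 4] 4 + 10) = ![2, 3, 1, 0, 10, 1, 1, 2, 4] := by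
        ext j; fin_cases j <;> simp [Function.update]
      rw [e]
      intro i; fin_cases i <;> simp [vec5, unitVec] <;> norm_num
    | 5 =>
      have e : Function.update (![2, 3, 1, 0, 0, 1, 1, 2, 4] : Fin 9 → ℂ) 5 (![2, 3, 1, 0, 0, 1, 1, 2, 4] 5 + 10) = ![2, 3, 1, 0, 0, 11, 1, 2, 4] := by
        ext j; fin_cases j <;> simp [Function.update] <;> norm_num
      rw [e]
      intro i; fin_cases i <;> simp [vec5, unitVec] <;> norm_num
    | 6 =>
      have e : Function.update (![2, 3, 1, 0, 0, 1, 1, 2, 4] : Fin 9 → ℂ) 6 (![2, 3, 1, 0, 0, 1, 1, 2, 4] 6 + 10) = ![2, 3, 1, 0, 0, 1, 11, 2, 4] := by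
        ext j; fin_cases j <;> simp [Function.update] <;> norm_num
      rw [e]
      intro i; fin_cases i <;> simp [vec5, unitVec] <;> norm_num
    | 7 =>
      have e : Function.update (![2, 3, 1, 0, 0, 1, 1, 2, 4] : Fin 9 → ℂ) 7 (![2, 3, 1, 0, 0, 1, 1, 2, 4] 7 + 10) = ![2, 3, 1, 0, 0, 1, 1, 12, 4] := by
        ext j; fin_cases j <;> simp [Function.update] <;> norm_num
      rw [e]
      intro i; fin_cases i <;> simp [vec5, unitVec] <;> norm_num
    | 8 =>
      have e : Function.update (![2, 3, 1, 0, 0, 1, 1, 2, 4] : Fin 9 → ℂ) 8 (![2, 3, 1, 0, 0, 1, 1, 2, 4] 8 + 10) = ![2, 3, 1, 0, 0, 1, 1, 2, 14] := by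
        ext j; fin_cases j <;> simp [Function.update] <;> norm_num
      rw [e]
      intro i; fin_cases i <;> simp [vec5, unitVec] <;> norm_num

/-- The generic arrangement of type `type4`. -/
noncomputable def gen4 : Fin 6 → Fin 3 → MvPolynomial (Fin 10) ℂ :=
  ![genVec 2 3,
    genVec 4 5,
    genVec 2 3 + (X 0 : MvPolynomial (Fin 10) ℂ) • genVec 4 5,
    genVec 2 3 + (X 1 : MvPolynomial (Fin 10) ℂ) • genVec 4 5,
    genVec 6 7,
    genVec 8 9]

/-- The arrangements of type `type4`. -/
noncomputable def vec4 (t : Fin 10 → ℂ) : Fin 6 → Fin 3 → ℂ :=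
  ![unitVec (t 2) (t 3),
    unitVec (t 4) (t 5),
    unitVec (t 2) (t 3) + t 0 • unitVec (t 4) (t 5),
    unitVec (t 2) (t 3) + t 1 • unitVec (t 4) (t 5),
    unitVec (t 6) (t 7),
    unitVec (t 8) (t 9)]

lemma evalVec_gen4 (t : Fin 10 → ℂ) : evalVec gen4 t = vec4 t := by
  funext i j
  fin_cases i <;> simp [evalVec, gen4, vec4, eval_unitVec]

lemma exists_eq_vec4 {b : Fin 6 → Fin 3 → ℂ} (hb : Distinct b) (hT : Pattern type4 b)
    (h0 : ∀ i, b i 0 ≠ 0) : ∃ t, ∀ i, ∃ c : ℂ, c ≠ 0 ∧ b i = c • vec4 t i := by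
  obtain ⟨β0, κ0, k0, e0⟩ := exists_join_of_pattern hb hT h0 0 1 2 (by decide)
  obtain ⟨β1, κ1, k1, e1⟩ := exists_join_of_pattern hb hT h0 0 1 3 (by decide)
  refine ⟨![β0, β1, b 0 1 / b 0 0, b 0 2 / b 0 0, b 1 1 / b 1 0, b 1 2 / b 1 0, b 4 1 / b 4 0, b 4 2 / b 4 0, b 5 1 / b 5 0, b 5 2 / b 5 0], fun i => ?_⟩
  fin_cases i
  · exact ⟨_, h0 0, eq_smul_unitVec (h0 0)⟩
  · exact ⟨_, h0 1, eq_smul_unitVec (h0 1)⟩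
  · exact ⟨_, k0, e0⟩
  · exact ⟨_, k1, e1⟩
  · exact ⟨_, h0 4, eq_smul_unitVec (h0 4)⟩
  · exact ⟨_, h0 5, eq_smul_unitVec (h0 5)⟩

/-- Four vectors (1, y, z) and two pencil parameters: 8 + 2 = 10. -/
theorem irreducible_and_dim_type4 :
    IsIrreducible (curvesOfType type4) ∧ topologicalKrullDim (curvesOfType type4) = 10 := by
  refine irreducible_and_dim (n := 10) vec4 evalVec_gen4 (fun t => forall_lt_lt ?_)
    (fun b => exists_eq_vec4) ![3, 1, 0, 0, 1, 1, 2, 4, -2, 2] (distinct_of_minors (forall_lt ?_))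
    (forall_lt_lt ?_) ![![-3, 1, 3],
      ![-1, 0, 2],
      ![0, 1, 0],
      ![0, 0, 1],
      ![-1, 1, 0],
      ![-1, 0, 1],
      ![-2, 1, 0],
      ![-4, 0, 1],
      ![2, 1, 0],
      ![-2, 0, 1]] (fun k t h => ?_) (fun k => ?_)
  · refine ⟨?_, ?_, ?_, ?_, ?_, ?_, ?_, ?_, ?_, ?_, ?_, ?_, ?_, ?_, ?_, ?_, ?_, ?_, ?_, ?_⟩ <;> first
    | exact fun h => absurd h (by decide)
    | (intro _; simp [tri, vec4, unitVec] <;> ring)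
  · refine ⟨?_, ?_, ?_, ?_, ?_, ?_, ?_, ?_, ?_, ?_, ?_, ?_, ?_, ?_, ?_⟩ <;>
      simp [vec4, unitVec] <;> norm_num
  · refine ⟨?_, ?_, ?_, ?_, ?_, ?_, ?_, ?_, ?_, ?_, ?_, ?_, ?_, ?_, ?_, ?_, ?_, ?_, ?_, ?_⟩ <;> first
    | exact iff_of_true (by simp [tri, vec4, unitVec] <;> norm_num) (by decide)
    | exact iff_of_false (by simp [tri, vec4, unitVec] <;> norm_num) (by decide)
  · match k with
    | 0 =>
      have e0 : t 0 = 3 := h 0 (by decide)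
      have e2 : t 2 = 0 := h 2 (by decide)
      have e3 : t 3 = 0 := h 3 (by decide)
      have e4 : t 4 = 1 := h 4 (by decide)
      have e5 : t 5 = 1 := h 5 (by decide)
      exact ⟨2, by simp [vec4, unitVec, e0, e2, e3, e4, e5] <;> norm_num⟩
    | 1 =>
      have e1 : t 1 = 1 := h 1 (by decide)
      have e2 : t 2 = 0 := h 2 (by decide)
      have e3 : t 3 = 0 := h 3 (by decide)
      have e4 : t 4 = 1 := h 4 (by decide)
      have e5 : t 5 = 1 := h 5 (by decide)
      exact ⟨3, by simp [vec4, unitVec, e1, e2, e3, e4, e5] <;> norm_num⟩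
    | 2 =>
      have e2 : t 2 = 0 := h 2 (by decide)
      exact ⟨0, by simp [vec4, unitVec, e2]⟩
    | 3 =>
      have e3 : t 3 = 0 := h 3 (by decide)
      exact ⟨0, by simp [vec4, unitVec, e3]⟩
    | 4 =>
      have e4 : t 4 = 1 := h 4 (by decide)
      exact ⟨1, by simp [vec4, unitVec, e4]⟩
    | 5 =>
      have e5 : t 5 = 1 := h 5 (by decide)
      exact ⟨1, by simp [vec4, unitVec, e5]⟩
    | 6 =>
      have e6 : t 6 = 2 := h 6 (by decide)
      exact ⟨4, by simp [vec4, unitVec, e6]⟩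
    | 7 =>
      have e7 : t 7 = 4 := h 7 (by decide)
      exact ⟨4, by simp [vec4, unitVec, e7]⟩
    | 8 =>
      have e8 : t 8 = -2 := h 8 (by decide)
      exact ⟨5, by simp [vec4, unitVec, e8]⟩
    | 9 =>
      have e9 : t 9 = 2 := h 9 (by decide)
      exact ⟨5, by simp [vec4, unitVec, e9]⟩
  · match k with
    | 0 =>
      have e : Function.update (![3, 1, 0, 0, 1, 1, 2, 4, -2, 2] : Fin 10 → ℂ) 0 (![3, 1, 0, 0, 1, 1, 2, 4, -2, 2] 0 + 10) = ![13, 1, 0, 0, 1, 1, 2, 4, -2, 2] := by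
        ext j; fin_cases j <;> simp [Function.update] <;> norm_num
      rw [e]
      intro i; fin_cases i <;> simp [vec4, unitVec] <;> norm_num
    | 1 =>
      have e : Function.update (![3, 1, 0, 0, 1, 1, 2, 4, -2, 2] : Fin 10 → ℂ) 1 (![3, 1, 0, 0, 1, 1, 2, 4, -2, 2] 1 + 10) = ![3, 11, 0, 0, 1, 1, 2, 4, -2, 2] := by
        ext j; fin_cases j <;> simp [Function.update] <;> norm_num
      rw [e]
      intro i; fin_cases i <;> simp [vec4, unitVec] <;> norm_num
    | 2 =>
      have e : Function.update (![3, 1, 0, 0, 1, 1, 2, 4, -2, 2] : Fin 10 → ℂ) 2 (![3, 1, 0, 0, 1, 1, 2, 4, -2, 2] 2 + 10) = ![3, 1, 10, 0, 1, 1, 2, 4, -2, 2] := by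
        ext j; fin_cases j <;> simp [Function.update]
      rw [e]
      intro i; fin_cases i <;> simp [vec4, unitVec] <;> norm_num
    | 3 =>
      have e : Function.update (![3, 1, 0, 0, 1, 1, 2, 4, -2, 2] : Fin 10 → ℂ) 3 (![3, 1, 0, 0, 1, 1, 2, 4, -2, 2] 3 + 10) = ![3, 1, 0, 10, 1, 1, 2, 4, -2, 2] := by
        ext j; fin_cases j <;> simp [Function.update]
      rw [e]
      intro i; fin_cases i <;> simp [vec4, unitVec] <;> norm_num
    | 4 =>
      have e : Function.update (![3, 1, 0, 0, 1, 1, 2, 4, -2, 2] : Fin 10 → ℂ) 4 (![3, 1, 0, 0, 1, 1, 2, 4, -2, 2] 4 + 10) = ![3, 1, 0, 0, 11, 1, 2, 4, -2, 2] := by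
        ext j; fin_cases j <;> simp [Function.update] <;> norm_num
      rw [e]
      intro i; fin_cases i <;> simp [vec4, unitVec] <;> norm_num
    | 5 =>
      have e : Function.update (![3, 1, 0, 0, 1, 1, 2, 4, -2, 2] : Fin 10 → ℂ) 5 (![3, 1, 0, 0, 1, 1, 2, 4, -2, 2] 5 + 10) = ![3, 1, 0, 0, 1, 11, 2, 4, -2, 2] := by
        ext j; fin_cases j <;> simp [Function.update] <;> norm_num
      rw [e]
      intro i; fin_cases i <;> simp [vec4, unitVec] <;> norm_num
    | 6 =>
      have e : Function.update (![3, 1, 0, 0, 1, 1, 2, 4, -2, 2] : Fin 10 → ℂ) 6 (![3, 1, 0, 0, 1, 1, 2, 4, -2, 2] 6 + 10) = ![3, 1, 0, 0, 1, 1, 12, 4, -2, 2] := by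
        ext j; fin_cases j <;> simp [Function.update] <;> norm_num
      rw [e]
      intro i; fin_cases i <;> simp [vec4, unitVec] <;> norm_num
    | 7 =>
      have e : Function.update (![3, 1, 0, 0, 1, 1, 2, 4, -2, 2] : Fin 10 → ℂ) 7 (![3, 1, 0, 0, 1, 1, 2, 4, -2, 2] 7 + 10) = ![3, 1, 0, 0, 1, 1, 2, 14, -2, 2] := by
        ext j; fin_cases j <;> simp [Function.update] <;> norm_num
      rw [e]
      intro i; fin_cases i <;> simp [vec4, unitVec] <;> norm_num
    | 8 =>
      have e : Function.update (![3, 1, 0, 0, 1, 1, 2, 4, -2, 2] : Fin 10 → ℂ) 8 (![3, 1, 0, 0, 1, 1, 2, 4, -2, 2] 8 + 10) = ![3, 1, 0, 0, 1, 1, 2, 4, 8, 2] := by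
        ext j; fin_cases j <;> simp [Function.update] <;> norm_num
      rw [e]
      intro i; fin_cases i <;> simp [vec4, unitVec] <;> norm_num
    | 9 =>
      have e : Function.update (![3, 1, 0, 0, 1, 1, 2, 4, -2, 2] : Fin 10 → ℂ) 9 (![3, 1, 0, 0, 1, 1, 2, 4, -2, 2] 9 + 10) = ![3, 1, 0, 0, 1, 1, 2, 4, -2, 12] := by
        ext j; fin_cases j <;> simp [Function.update] <;> norm_num
      rw [e]
      intro i; fin_cases i <;> simp [vec4, unitVec] <;> norm_num

/-- The generic arrangement of type `type43`. -/
noncomputable def gen43 : Fin 6 → Fin 3 → MvPolynomial (Fin 9) ℂ :=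
  ![genVec 3 4,
    genVec 5 6,
    genVec 3 4 + (X 0 : MvPolynomial (Fin 9) ℂ) • genVec 5 6,
    genVec 3 4 + (X 1 : MvPolynomial (Fin 9) ℂ) • genVec 5 6,
    genVec 7 8,
    genVec 3 4 + (X 2 : MvPolynomial (Fin 9) ℂ) • genVec 7 8]

/-- The arrangements of type `type43`. -/
noncomputable def vec43 (t : Fin 9 → ℂ) : Fin 6 → Fin 3 → ℂ :=
  ![unitVec (t 3) (t 4),
    unitVec (t 5) (t 6),
    unitVec (t 3) (t 4) + t 0 • unitVec (t 5) (t 6),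
    unitVec (t 3) (t 4) + t 1 • unitVec (t 5) (t 6),
    unitVec (t 7) (t 8),
    unitVec (t 3) (t 4) + t 2 • unitVec (t 7) (t 8)]

lemma evalVec_gen43 (t : Fin 9 → ℂ) : evalVec gen43 t = vec43 t := by
  funext i j
  fin_cases i <;> simp [evalVec, gen43, vec43, eval_unitVec]

lemma exists_eq_vec43 {b : Fin 6 → Fin 3 → ℂ} (hb : Distinct b) (hT : Pattern type43 b)
    (h0 : ∀ i, b i 0 ≠ 0) : ∃ t, ∀ i, ∃ c : ℂ, c ≠ 0 ∧ b i = c • vec43 t i := by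
  obtain ⟨β0, κ0, k0, e0⟩ := exists_join_of_pattern hb hT h0 0 1 2 (by decide)
  obtain ⟨β1, κ1, k1, e1⟩ := exists_join_of_pattern hb hT h0 0 1 3 (by decide)
  obtain ⟨β2, κ2, k2, e2⟩ := exists_join_of_pattern hb hT h0 0 4 5 (by decide)
  refine ⟨![β0, β1, β2, b 0 1 / b 0 0, b 0 2 / b 0 0, b 1 1 / b 1 0, b 1 2 / b 1 0, b 4 1 / b 4 0, b 4 2 / b 4 0], fun i => ?_⟩
  fin_cases i
  · exact ⟨_, h0 0, eq_smul_unitVec (h0 0)⟩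
  · exact ⟨_, h0 1, eq_smul_unitVec (h0 1)⟩
  · exact ⟨_, k0, e0⟩
  · exact ⟨_, k1, e1⟩
  · exact ⟨_, h0 4, eq_smul_unitVec (h0 4)⟩
  · exact ⟨_, k2, e2⟩

/-- Three vectors (1, y, z), two parameters in the pencil of the quadruple point and one in that of
the triple point: 6 + 3 = 9. -/
theorem irreducible_and_dim_type43 :
    IsIrreducible (curvesOfType type43) ∧ topologicalKrullDim (curvesOfType type43) = 9 := by
  refine irreducible_and_dim (n := 9) vec43 evalVec_gen43 (fun t => forall_lt_lt ?_)
    (fun b => exists_eq_vec43) ![3, 1, 3, 0, 0, 1, 1, 2, 4] (distinct_of_minors (forall_lt ?_))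
    (forall_lt_lt ?_) ![![-3, 1, 3],
      ![-1, 0, 2],
      ![-3, 0, 1],
      ![0, 1, 0],
      ![0, 0, 1],
      ![-1, 1, 0],
      ![-1, 0, 1],
      ![-2, 1, 0],
      ![-4, 0, 1]] (fun k t h => ?_) (fun k => ?_)
  · refine ⟨?_, ?_, ?_, ?_, ?_, ?_, ?_, ?_, ?_, ?_, ?_, ?_, ?_, ?_, ?_, ?_, ?_, ?_, ?_, ?_⟩ <;> first
    | exact fun h => absurd h (by decide)
    | (intro _; simp [tri, vec43, unitVec] <;> ring)
  · refine ⟨?_, ?_, ?_, ?_, ?_, ?_, ?_, ?_, ?_, ?_, ?_, ?_, ?_, ?_, ?_⟩ <;>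
      simp [vec43, unitVec] <;> norm_num
  · refine ⟨?_, ?_, ?_, ?_, ?_, ?_, ?_, ?_, ?_, ?_, ?_, ?_, ?_, ?_, ?_, ?_, ?_, ?_, ?_, ?_⟩ <;> first
    | exact iff_of_true (by simp [tri, vec43, unitVec] <;> norm_num) (by decide)
    | exact iff_of_false (by simp [tri, vec43, unitVec] <;> norm_num) (by decide)
  · match k with
    | 0 =>
      have e0 : t 0 = 3 := h 0 (by decide)
      have e3 : t 3 = 0 := h 3 (by decide)
      have e4 : t 4 = 0 := h 4 (by decide)
      have e5 : t 5 = 1 := h 5 (by decide)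
      have e6 : t 6 = 1 := h 6 (by decide)
      exact ⟨2, by simp [vec43, unitVec, e0, e3, e4, e5, e6] <;> norm_num⟩
    | 1 =>
      have e1 : t 1 = 1 := h 1 (by decide)
      have e3 : t 3 = 0 := h 3 (by decide)
      have e4 : t 4 = 0 := h 4 (by decide)
      have e5 : t 5 = 1 := h 5 (by decide)
      have e6 : t 6 = 1 := h 6 (by decide)
      exact ⟨3, by simp [vec43, unitVec, e1, e3, e4, e5, e6] <;> norm_num⟩
    | 2 =>
      have e2 : t 2 = 3 := h 2 (by decide)
      have e3 : t 3 = 0 := h 3 (by decide)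
      have e4 : t 4 = 0 := h 4 (by decide)
      have e7 : t 7 = 2 := h 7 (by decide)
      have e8 : t 8 = 4 := h 8 (by decide)
      exact ⟨5, by simp [vec43, unitVec, e2, e3, e4, e7, e8] <;> norm_num⟩
    | 3 =>
      have e3 : t 3 = 0 := h 3 (by decide)
      exact ⟨0, by simp [vec43, unitVec, e3]⟩
    | 4 =>
      have e4 : t 4 = 0 := h 4 (by decide)
      exact ⟨0, by simp [vec43, unitVec, e4]⟩
    | 5 =>
      have e5 : t 5 = 1 := h 5 (by decide)
      exact ⟨1, by simp [vec43, unitVec, e5]⟩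
    | 6 =>
      have e6 : t 6 = 1 := h 6 (by decide)
      exact ⟨1, by simp [vec43, unitVec, e6]⟩
    | 7 =>
      have e7 : t 7 = 2 := h 7 (by decide)
      exact ⟨4, by simp [vec43, unitVec, e7]⟩
    | 8 =>
      have e8 : t 8 = 4 := h 8 (by decide)
      exact ⟨4, by simp [vec43, unitVec, e8]⟩
  · match k with
    | 0 =>
      have e : Function.update (![3, 1, 3, 0, 0, 1, 1, 2, 4] : Fin 9 → ℂ) 0 (![3, 1, 3, 0, 0, 1, 1, 2, 4] 0 + 10) = ![13, 1, 3, 0, 0, 1, 1, 2, 4] := by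
        ext j; fin_cases j <;> simp [Function.update] <;> norm_num
      rw [e]
      intro i; fin_cases i <;> simp [vec43, unitVec] <;> norm_num
    | 1 =>
      have e : Function.update (![3, 1, 3, 0, 0, 1, 1, 2, 4] : Fin 9 → ℂ) 1 (![3, 1, 3, 0, 0, 1, 1, 2, 4] 1 + 10) = ![3, 11, 3, 0, 0, 1, 1, 2, 4] := by
        ext j; fin_cases j <;> simp [Function.update] <;> norm_num
      rw [e]
      intro i; fin_cases i <;> simp [vec43, unitVec] <;> norm_num
    | 2 =>
      have e : Function.update (![3, 1, 3, 0, 0, 1, 1, 2, 4] : Fin 9 → ℂ) 2 (![3, 1, 3, 0, 0, 1, 1, 2, 4] 2 + 10) = ![3, 1, 13, 0, 0, 1, 1, 2, 4] := by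
        ext j; fin_cases j <;> simp [Function.update] <;> norm_num
      rw [e]
      intro i; fin_cases i <;> simp [vec43, unitVec] <;> norm_num
    | 3 =>
      have e : Function.update (![3, 1, 3, 0, 0, 1, 1, 2, 4] : Fin 9 → ℂ) 3 (![3, 1, 3, 0, 0, 1, 1, 2, 4] 3 + 10) = ![3, 1, 3, 10, 0, 1, 1, 2, 4] := by
        ext j; fin_cases j <;> simp [Function.update]
      rw [e]
      intro i; fin_cases i <;> simp [vec43, unitVec] <;> norm_num
    | 4 =>
      have e : Function.update (![3, 1, 3, 0, 0, 1, 1, 2, 4] : Fin 9 → ℂ) 4 (![3, 1, 3, 0, 0, 1, 1, 2, 4] 4 + 10) = ![3, 1, 3, 0, 10, 1, 1, 2, 4] := by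
        ext j; fin_cases j <;> simp [Function.update]
      rw [e]
      intro i; fin_cases i <;> simp [vec43, unitVec] <;> norm_num
    | 5 =>
      have e : Function.update (![3, 1, 3, 0, 0, 1, 1, 2, 4] : Fin 9 → ℂ) 5 (![3, 1, 3, 0, 0, 1, 1, 2, 4] 5 + 10) = ![3, 1, 3, 0, 0, 11, 1, 2, 4] := by
        ext j; fin_cases j <;> simp [Function.update] <;> norm_num
      rw [e]
      intro i; fin_cases i <;> simp [vec43, unitVec] <;> norm_num
    | 6 =>
      have e : Function.update (![3, 1, 3, 0, 0, 1, 1, 2, 4] : Fin 9 → ℂ) 6 (![3, 1, 3, 0, 0, 1, 1, 2, 4] 6 + 10) = ![3, 1, 3, 0, 0, 1, 11, 2, 4] := by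
        ext j; fin_cases j <;> simp [Function.update] <;> norm_num
      rw [e]
      intro i; fin_cases i <;> simp [vec43, unitVec] <;> norm_num
    | 7 =>
      have e : Function.update (![3, 1, 3, 0, 0, 1, 1, 2, 4] : Fin 9 → ℂ) 7 (![3, 1, 3, 0, 0, 1, 1, 2, 4] 7 + 10) = ![3, 1, 3, 0, 0, 1, 1, 12, 4] := by
        ext j; fin_cases j <;> simp [Function.update] <;> norm_num
      rw [e]
      intro i; fin_cases i <;> simp [vec43, unitVec] <;> norm_num
    | 8 =>
      have e : Function.update (![3, 1, 3, 0, 0, 1, 1, 2, 4] : Fin 9 → ℂ) 8 (![3, 1, 3, 0, 0, 1, 1, 2, 4] 8 + 10) = ![3, 1, 3, 0, 0, 1, 1, 2, 14] := by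
        ext j; fin_cases j <;> simp [Function.update] <;> norm_num
      rw [e]
      intro i; fin_cases i <;> simp [vec43, unitVec] <;> norm_num

/-- The generic arrangement of type `type333`. -/
noncomputable def gen333 : Fin 6 → Fin 3 → MvPolynomial (Fin 9) ℂ :=
  ![genVec 3 4,
    genVec 5 6,
    genVec 7 8,
    genVec 3 4 + (X 0 : MvPolynomial (Fin 9) ℂ) • genVec 5 6,
    genVec 3 4 + (X 1 : MvPolynomial (Fin 9) ℂ) • genVec 7 8,
    genVec 5 6 + (X 2 : MvPolynomial (Fin 9) ℂ) • genVec 7 8]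

/-- The arrangements of type `type333`. -/
noncomputable def vec333 (t : Fin 9 → ℂ) : Fin 6 → Fin 3 → ℂ :=
  ![unitVec (t 3) (t 4),
    unitVec (t 5) (t 6),
    unitVec (t 7) (t 8),
    unitVec (t 3) (t 4) + t 0 • unitVec (t 5) (t 6),
    unitVec (t 3) (t 4) + t 1 • unitVec (t 7) (t 8),
    unitVec (t 5) (t 6) + t 2 • unitVec (t 7) (t 8)]

lemma evalVec_gen333 (t : Fin 9 → ℂ) : evalVec gen333 t = vec333 t := by
  funext i j
  fin_cases i <;> simp [evalVec, gen333, vec333, eval_unitVec]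

lemma exists_eq_vec333 {b : Fin 6 → Fin 3 → ℂ} (hb : Distinct b) (hT : Pattern type333 b)
    (h0 : ∀ i, b i 0 ≠ 0) : ∃ t, ∀ i, ∃ c : ℂ, c ≠ 0 ∧ b i = c • vec333 t i := by
  obtain ⟨β0, κ0, k0, e0⟩ := exists_join_of_pattern hb hT h0 0 1 3 (by decide)
  obtain ⟨β1, κ1, k1, e1⟩ := exists_join_of_pattern hb hT h0 0 2 4 (by decide)
  obtain ⟨β2, κ2, k2, e2⟩ := exists_join_of_pattern hb hT h0 1 2 5 (by decide)
  refine ⟨![β0, β1, β2, b 0 1 / b 0 0, b 0 2 / b 0 0, b 1 1 / b 1 0, b 1 2 / b 1 0, b 2 1 / b 2 0, b 2 2 / b 2 0], fun i => ?_⟩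
  fin_cases i
  · exact ⟨_, h0 0, eq_smul_unitVec (h0 0)⟩
  · exact ⟨_, h0 1, eq_smul_unitVec (h0 1)⟩
  · exact ⟨_, h0 2, eq_smul_unitVec (h0 2)⟩
  · exact ⟨_, k0, e0⟩
  · exact ⟨_, k1, e1⟩
  · exact ⟨_, k2, e2⟩

/-- The three sides of the triangle and one further line through each vertex: 6 + 3 = 9. -/
theorem irreducible_and_dim_type333 :
    IsIrreducible (curvesOfType type333) ∧ topologicalKrullDim (curvesOfType type333) = 9 := by
  refine irreducible_and_dim (n := 9) vec333 evalVec_gen333 (fun t => forall_lt_lt ?_)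
    (fun b => exists_eq_vec333) ![1, 3, 1, 0, 0, 1, 1, 2, 4] (distinct_of_minors (forall_lt ?_))
    (forall_lt_lt ?_) ![![-1, 0, 2],
      ![-3, 0, 1],
      ![-1, -1, 1],
      ![0, 1, 0],
      ![0, 0, 1],
      ![-1, 1, 0],
      ![-1, 0, 1],
      ![-2, 1, 0],
      ![-4, 0, 1]] (fun k t h => ?_) (fun k => ?_)
  · refine ⟨?_, ?_, ?_, ?_, ?_, ?_, ?_, ?_, ?_, ?_, ?_, ?_, ?_, ?_, ?_, ?_, ?_, ?_, ?_, ?_⟩ <;> first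
    | exact fun h => absurd h (by decide)
    | (intro _; simp [tri, vec333, unitVec] <;> ring)
  · refine ⟨?_, ?_, ?_, ?_, ?_, ?_, ?_, ?_, ?_, ?_, ?_, ?_, ?_, ?_, ?_⟩ <;>
      simp [vec333, unitVec] <;> norm_num
  · refine ⟨?_, ?_, ?_, ?_, ?_, ?_, ?_, ?_, ?_, ?_, ?_, ?_, ?_, ?_, ?_, ?_, ?_, ?_, ?_, ?_⟩ <;> first
    | exact iff_of_true (by simp [tri, vec333, unitVec] <;> norm_num) (by decide)
    | exact iff_of_false (by simp [tri, vec333, unitVec] <;> norm_num) (by decide)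
  · match k with
    | 0 =>
      have e0 : t 0 = 1 := h 0 (by decide)
      have e3 : t 3 = 0 := h 3 (by decide)
      have e4 : t 4 = 0 := h 4 (by decide)
      have e5 : t 5 = 1 := h 5 (by decide)
      have e6 : t 6 = 1 := h 6 (by decide)
      exact ⟨3, by simp [vec333, unitVec, e0, e3, e4, e5, e6] <;> norm_num⟩
    | 1 =>
      have e1 : t 1 = 3 := h 1 (by decide)
      have e3 : t 3 = 0 := h 3 (by decide)
      have e4 : t 4 = 0 := h 4 (by decide)
      have e7 : t 7 = 2 := h 7 (by decide)
      have e8 : t 8 = 4 := h 8 (by decide)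
      exact ⟨4, by simp [vec333, unitVec, e1, e3, e4, e7, e8] <;> norm_num⟩
    | 2 =>
      have e2 : t 2 = 1 := h 2 (by decide)
      have e5 : t 5 = 1 := h 5 (by decide)
      have e6 : t 6 = 1 := h 6 (by decide)
      have e7 : t 7 = 2 := h 7 (by decide)
      have e8 : t 8 = 4 := h 8 (by decide)
      exact ⟨5, by simp [vec333, unitVec, e2, e5, e6, e7, e8] <;> norm_num⟩
    | 3 =>
      have e3 : t 3 = 0 := h 3 (by decide)
      exact ⟨0, by simp [vec333, unitVec, e3]⟩
    | 4 =>
      have e4 : t 4 = 0 := h 4 (by decide)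
      exact ⟨0, by simp [vec333, unitVec, e4]⟩
    | 5 =>
      have e5 : t 5 = 1 := h 5 (by decide)
      exact ⟨1, by simp [vec333, unitVec, e5]⟩
    | 6 =>
      have e6 : t 6 = 1 := h 6 (by decide)
      exact ⟨1, by simp [vec333, unitVec, e6]⟩
    | 7 =>
      have e7 : t 7 = 2 := h 7 (by decide)
      exact ⟨2, by simp [vec333, unitVec, e7]⟩
    | 8 =>
      have e8 : t 8 = 4 := h 8 (by decide)
      exact ⟨2, by simp [vec333, unitVec, e8]⟩
  · match k with
    | 0 =>
      have e : Function.update (![1, 3, 1, 0, 0, 1, 1, 2, 4] : Fin 9 → ℂ) 0 (![1, 3, 1, 0, 0, 1, 1, 2, 4] 0 + 10) = ![11, 3, 1, 0, 0, 1, 1, 2, 4] := by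
        ext j; fin_cases j <;> simp [Function.update] <;> norm_num
      rw [e]
      intro i; fin_cases i <;> simp [vec333, unitVec] <;> norm_num
    | 1 =>
      have e : Function.update (![1, 3, 1, 0, 0, 1, 1, 2, 4] : Fin 9 → ℂ) 1 (![1, 3, 1, 0, 0, 1, 1, 2, 4] 1 + 10) = ![1, 13, 1, 0, 0, 1, 1, 2, 4] := by
        ext j; fin_cases j <;> simp [Function.update] <;> norm_num
      rw [e]
      intro i; fin_cases i <;> simp [vec333, unitVec] <;> norm_num
    | 2 =>
      have e : Function.update (![1, 3, 1, 0, 0, 1, 1, 2, 4] : Fin 9 → ℂ) 2 (![1, 3, 1, 0, 0, 1, 1, 2, 4] 2 + 10) = ![1, 3, 11, 0, 0, 1, 1, 2, 4] := by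
        ext j; fin_cases j <;> simp [Function.update] <;> norm_num
      rw [e]
      intro i; fin_cases i <;> simp [vec333, unitVec] <;> norm_num
    | 3 =>
      have e : Function.update (![1, 3, 1, 0, 0, 1, 1, 2, 4] : Fin 9 → ℂ) 3 (![1, 3, 1, 0, 0, 1, 1, 2, 4] 3 + 10) = ![1, 3, 1, 10, 0, 1, 1, 2, 4] := by
        ext j; fin_cases j <;> simp [Function.update]
      rw [e]
      intro i; fin_cases i <;> simp [vec333, unitVec] <;> norm_num
    | 4 =>
      have e : Function.update (![1, 3, 1, 0, 0, 1, 1, 2, 4] : Fin 9 → ℂ) 4 (![1, 3, 1, 0, 0, 1, 1, 2, 4] 4 + 10) = ![1, 3, 1, 0, 10, 1, 1, 2, 4] := by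
        ext j; fin_cases j <;> simp [Function.update]
      rw [e]
      intro i; fin_cases i <;> simp [vec333, unitVec] <;> norm_num
    | 5 =>
      have e : Function.update (![1, 3, 1, 0, 0, 1, 1, 2, 4] : Fin 9 → ℂ) 5 (![1, 3, 1, 0, 0, 1, 1, 2, 4] 5 + 10) = ![1, 3, 1, 0, 0, 11, 1, 2, 4] := by
        ext j; fin_cases j <;> simp [Function.update] <;> norm_num
      rw [e]
      intro i; fin_cases i <;> simp [vec333, unitVec] <;> norm_num
    | 6 =>
      have e : Function.update (![1, 3, 1, 0, 0, 1, 1, 2, 4] : Fin 9 → ℂ) 6 (![1, 3, 1, 0, 0, 1, 1, 2, 4] 6 + 10) = ![1, 3, 1, 0, 0, 1, 11, 2, 4] := by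
        ext j; fin_cases j <;> simp [Function.update] <;> norm_num
      rw [e]
      intro i; fin_cases i <;> simp [vec333, unitVec] <;> norm_num
    | 7 =>
      have e : Function.update (![1, 3, 1, 0, 0, 1, 1, 2, 4] : Fin 9 → ℂ) 7 (![1, 3, 1, 0, 0, 1, 1, 2, 4] 7 + 10) = ![1, 3, 1, 0, 0, 1, 1, 12, 4] := by
        ext j; fin_cases j <;> simp [Function.update] <;> norm_num
      rw [e]
      intro i; fin_cases i <;> simp [vec333, unitVec] <;> norm_num
    | 8 =>
      have e : Function.update (![1, 3, 1, 0, 0, 1, 1, 2, 4] : Fin 9 → ℂ) 8 (![1, 3, 1, 0, 0, 1, 1, 2, 4] 8 + 10) = ![1, 3, 1, 0, 0, 1, 1, 2, 14] := by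
        ext j; fin_cases j <;> simp [Function.update] <;> norm_num
      rw [e]
      intro i; fin_cases i <;> simp [vec333, unitVec] <;> norm_num

/-- The generic arrangement of type `type3333`. -/
noncomputable def gen3333 : Fin 6 → Fin 3 → MvPolynomial (Fin 8) ℂ :=
  ![genVec 2 3,
    genVec 4 5,
    genVec 6 7,
    genVec 2 3 + (X 0 : MvPolynomial (Fin 8) ℂ) • genVec 4 5,
    genVec 2 3 + (X 1 : MvPolynomial (Fin 8) ℂ) • genVec 6 7,
    (X 0 : MvPolynomial (Fin 8) ℂ) • genVec 4 5 - (X 1 : MvPolynomial (Fin 8) ℂ) • genVec 6 7]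

/-- The arrangements of type `type3333`. -/
noncomputable def vec3333 (t : Fin 8 → ℂ) : Fin 6 → Fin 3 → ℂ :=
  ![unitVec (t 2) (t 3),
    unitVec (t 4) (t 5),
    unitVec (t 6) (t 7),
    unitVec (t 2) (t 3) + t 0 • unitVec (t 4) (t 5),
    unitVec (t 2) (t 3) + t 1 • unitVec (t 6) (t 7),
    t 0 • unitVec (t 4) (t 5) - t 1 • unitVec (t 6) (t 7)]

lemma evalVec_gen3333 (t : Fin 8 → ℂ) : evalVec gen3333 t = vec3333 t := by
  funext i j
  fin_cases i <;> simp [evalVec, gen3333, vec3333, eval_unitVec]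

lemma exists_eq_vec3333 {b : Fin 6 → Fin 3 → ℂ} (hb : Distinct b) (hT : Pattern type3333 b)
    (h0 : ∀ i, b i 0 ≠ 0) : ∃ t, ∀ i, ∃ c : ℂ, c ≠ 0 ∧ b i = c • vec3333 t i := by
  obtain ⟨β0, κ0, k0, e0⟩ := exists_join_of_pattern hb hT h0 0 1 3 (by decide)
  obtain ⟨β1, κ1, k1, e1⟩ := exists_join_of_pattern hb hT h0 0 2 4 (by decide)
  -- The sixth line has no freedom: it belongs to the pencil of B and C and to the pencil of A + β0
  -- B and A + β1 C, and the difference of the last two lies in both.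
  obtain ⟨κ, k, e⟩ : ∃ κ : ℂ, κ ≠ 0 ∧ b 5 = κ • (β0 • unitVec (b 1 1 / b 1 0) (b 1 2 / b 1 0) -
      β1 • unitVec (b 2 1 / b 2 0) (b 2 2 / b 2 0)) := by
    have hA := eq_smul_unitVec (h0 0)
    have hB := eq_smul_unitVec (h0 1)
    have hC := eq_smul_unitVec (h0 2)
    set A := unitVec (b 0 1 / b 0 0) (b 0 2 / b 0 0)
    set B := unitVec (b 1 1 / b 1 0) (b 1 2 / b 1 0)
    set C' := unitVec (b 2 1 / b 2 0) (b 2 2 / b 2 0)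
    have h012 : tri (b 0) (b 1) (b 2) ≠ 0 := by
      rw [Ne, hT 0 1 2 (by decide) (by decide)]; decide
    rw [hA, hB, hC, tri_smul] at h012
    have h012' : tri A B C' ≠ 0 := right_ne_zero_of_mul h012
    obtain ⟨x, y, e⟩ := exists_comb_of_tri ((tri_cycle _ _ _).trans
      ((hT 1 2 5 (by decide) (by decide)).mpr (by decide))) (hb.2 1 2 (by decide))
    have h345 : tri (b 3) (b 4) (b 5) = 0 := (hT 3 4 5 (by decide) (by decide)).mpr (by decide)
    have hβ : β1 ≠ 0 := by
      rintro rfl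
      apply hb.2 0 4 (by decide)
      rw [e1, hA]
      simp
    rw [hB, hC, smul_smul, smul_smul] at e
    rw [e0, e1, e] at h345
    have h1 : κ0 * κ1 * (β1 * (x * b 1 0) + β0 * (y * b 2 0)) * tri A B C' = 0 := by
      simp only [tri, Pi.smul_apply, Pi.add_apply, smul_eq_mul] at h345 ⊢
      linear_combination -h345
    have h2 : β1 * (x * b 1 0) + β0 * (y * b 2 0) = 0 := by
      simpa [k0, k1, h012'] using h1
    refine ⟨-(y * b 2 0) / β1, ?_, ?_⟩
    · intro h
      have hy : y * b 2 0 = 0 := by simpa [hβ] using h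
      rw [hy, mul_zero, add_zero] at h2
      have hx : x * b 1 0 = 0 := by simpa [hβ] using h2
      rw [hx, hy, zero_smul, zero_smul, add_zero] at e
      exact hb.1 5 e
    · rw [e, smul_sub, smul_smul, smul_smul, sub_eq_add_neg, ← neg_smul]
      congr 2
      · field_simp
        linear_combination h2
      · field_simp
  refine ⟨![β0, β1, b 0 1 / b 0 0, b 0 2 / b 0 0, b 1 1 / b 1 0, b 1 2 / b 1 0, b 2 1 / b 2 0, b 2 2 / b 2 0], fun i => ?_⟩
  fin_cases i
  · exact ⟨_, h0 0, eq_smul_unitVec (h0 0)⟩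
  · exact ⟨_, h0 1, eq_smul_unitVec (h0 1)⟩
  · exact ⟨_, h0 2, eq_smul_unitVec (h0 2)⟩
  · exact ⟨_, k0, e0⟩
  · exact ⟨_, k1, e1⟩
  · exact ⟨_, k, e⟩

/-- The three sides of the triangle and two pencil parameters; the last line is determined: 6 + 2 =
8. -/
theorem irreducible_and_dim_type3333 :
    IsIrreducible (curvesOfType type3333) ∧ topologicalKrullDim (curvesOfType type3333) = 8 := by
  refine irreducible_and_dim (n := 8) vec3333 evalVec_gen3333 (fun t => forall_lt_lt ?_)
    (fun b => exists_eq_vec3333) ![1, 3, 0, 0, 1, 1, 2, 4] (distinct_of_minors (forall_lt ?_))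
    (forall_lt_lt ?_) ![![-1, 0, 2],
      ![-3, 0, 1],
      ![0, 1, 0],
      ![0, 0, 1],
      ![-1, 1, 0],
      ![-1, 0, 1],
      ![-2, 1, 0],
      ![-4, 0, 1]] (fun k t h => ?_) (fun k => ?_)
  · refine ⟨?_, ?_, ?_, ?_, ?_, ?_, ?_, ?_, ?_, ?_, ?_, ?_, ?_, ?_, ?_, ?_, ?_, ?_, ?_, ?_⟩ <;> first
    | exact fun h => absurd h (by decide)
    | (intro _; simp [tri, vec3333, unitVec] <;> ring)
  · refine ⟨?_, ?_, ?_, ?_, ?_, ?_, ?_, ?_, ?_, ?_, ?_, ?_, ?_, ?_, ?_⟩ <;>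
      simp [vec3333, unitVec] <;> norm_num
  · refine ⟨?_, ?_, ?_, ?_, ?_, ?_, ?_, ?_, ?_, ?_, ?_, ?_, ?_, ?_, ?_, ?_, ?_, ?_, ?_, ?_⟩ <;> first
    | exact iff_of_true (by simp [tri, vec3333, unitVec] <;> norm_num) (by decide)
    | exact iff_of_false (by simp [tri, vec3333, unitVec] <;> norm_num) (by decide)
  · match k with
    | 0 =>
      have e0 : t 0 = 1 := h 0 (by decide)
      have e2 : t 2 = 0 := h 2 (by decide)
      have e3 : t 3 = 0 := h 3 (by decide)
      have e4 : t 4 = 1 := h 4 (by decide)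
      have e5 : t 5 = 1 := h 5 (by decide)
      exact ⟨3, by simp [vec3333, unitVec, e0, e2, e3, e4, e5] <;> norm_num⟩
    | 1 =>
      have e1 : t 1 = 3 := h 1 (by decide)
      have e2 : t 2 = 0 := h 2 (by decide)
      have e3 : t 3 = 0 := h 3 (by decide)
      have e6 : t 6 = 2 := h 6 (by decide)
      have e7 : t 7 = 4 := h 7 (by decide)
      exact ⟨4, by simp [vec3333, unitVec, e1, e2, e3, e6, e7] <;> norm_num⟩
    | 2 =>
      have e2 : t 2 = 0 := h 2 (by decide)
      exact ⟨0, by simp [vec3333, unitVec, e2]⟩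
    | 3 =>
      have e3 : t 3 = 0 := h 3 (by decide)
      exact ⟨0, by simp [vec3333, unitVec, e3]⟩
    | 4 =>
      have e4 : t 4 = 1 := h 4 (by decide)
      exact ⟨1, by simp [vec3333, unitVec, e4]⟩
    | 5 =>
      have e5 : t 5 = 1 := h 5 (by decide)
      exact ⟨1, by simp [vec3333, unitVec, e5]⟩
    | 6 =>
      have e6 : t 6 = 2 := h 6 (by decide)
      exact ⟨2, by simp [vec3333, unitVec, e6]⟩
    | 7 =>
      have e7 : t 7 = 4 := h 7 (by decide)
      exact ⟨2, by simp [vec3333, unitVec, e7]⟩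
  · match k with
    | 0 =>
      have e : Function.update (![1, 3, 0, 0, 1, 1, 2, 4] : Fin 8 → ℂ) 0 (![1, 3, 0, 0, 1, 1, 2, 4] 0 + 10) = ![11, 3, 0, 0, 1, 1, 2, 4] := by
        ext j; fin_cases j <;> simp [Function.update] <;> norm_num
      rw [e]
      intro i; fin_cases i <;> simp [vec3333, unitVec] <;> norm_num
    | 1 =>
      have e : Function.update (![1, 3, 0, 0, 1, 1, 2, 4] : Fin 8 → ℂ) 1 (![1, 3, 0, 0, 1, 1, 2, 4] 1 + 10) = ![1, 13, 0, 0, 1, 1, 2, 4] := by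
        ext j; fin_cases j <;> simp [Function.update] <;> norm_num
      rw [e]
      intro i; fin_cases i <;> simp [vec3333, unitVec] <;> norm_num
    | 2 =>
      have e : Function.update (![1, 3, 0, 0, 1, 1, 2, 4] : Fin 8 → ℂ) 2 (![1, 3, 0, 0, 1, 1, 2, 4] 2 + 10) = ![1, 3, 10, 0, 1, 1, 2, 4] := by
        ext j; fin_cases j <;> simp [Function.update]
      rw [e]
      intro i; fin_cases i <;> simp [vec3333, unitVec] <;> norm_num
    | 3 =>
      have e : Function.update (![1, 3, 0, 0, 1, 1, 2, 4] : Fin 8 → ℂ) 3 (![1, 3, 0, 0, 1, 1, 2, 4] 3 + 10) = ![1, 3, 0, 10, 1, 1, 2, 4] := by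
        ext j; fin_cases j <;> simp [Function.update]
      rw [e]
      intro i; fin_cases i <;> simp [vec3333, unitVec] <;> norm_num
    | 4 =>
      have e : Function.update (![1, 3, 0, 0, 1, 1, 2, 4] : Fin 8 → ℂ) 4 (![1, 3, 0, 0, 1, 1, 2, 4] 4 + 10) = ![1, 3, 0, 0, 11, 1, 2, 4] := by
        ext j; fin_cases j <;> simp [Function.update] <;> norm_num
      rw [e]
      intro i; fin_cases i <;> simp [vec3333, unitVec] <;> norm_num
    | 5 =>
      have e : Function.update (![1, 3, 0, 0, 1, 1, 2, 4] : Fin 8 → ℂ) 5 (![1, 3, 0, 0, 1, 1, 2, 4] 5 + 10) = ![1, 3, 0, 0, 1, 11, 2, 4] := by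
        ext j; fin_cases j <;> simp [Function.update] <;> norm_num
      rw [e]
      intro i; fin_cases i <;> simp [vec3333, unitVec] <;> norm_num
    | 6 =>
      have e : Function.update (![1, 3, 0, 0, 1, 1, 2, 4] : Fin 8 → ℂ) 6 (![1, 3, 0, 0, 1, 1, 2, 4] 6 + 10) = ![1, 3, 0, 0, 1, 1, 12, 4] := by
        ext j; fin_cases j <;> simp [Function.update] <;> norm_num
      rw [e]
      intro i; fin_cases i <;> simp [vec3333, unitVec] <;> norm_num
    | 7 =>
      have e : Function.update (![1, 3, 0, 0, 1, 1, 2, 4] : Fin 8 → ℂ) 7 (![1, 3, 0, 0, 1, 1, 2, 4] 7 + 10) = ![1, 3, 0, 0, 1, 1, 2, 14] := by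
        ext j; fin_cases j <;> simp [Function.update] <;> norm_num
      rw [e]
      intro i; fin_cases i <;> simp [vec3333, unitVec] <;> norm_num

end

section

/-! ### Irreducible components -/

/-- Each of the two sets is closed in the union, because its closure misses the other. An
irreducible subset of the union therefore lies in one of them. -/
lemma componentsOf_union {Y : Type*} [TopologicalSpace Y] {A B : Set Y} (hA : IsIrreducible A)
    (hB : IsIrreducible B) (hAB : Disjoint A (closure B)) (hBA : Disjoint B (closure A)) :
    componentsOf (A ∪ B) = {A, B} := by
  set i : (A ∪ B : Set Y) → Y := Subtype.val with hi
  have hpre : ∀ C, C ⊆ A ∪ B → IsIrreducible C → IsIrreducible (i ⁻¹' C) := by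
    intro C hC h
    refine ⟨?_, ?_⟩
    · obtain ⟨x, hx⟩ := h.1
      exact ⟨⟨x, hC hx⟩, hx⟩
    · rintro _ _ ⟨U, hU, rfl⟩ ⟨V, hV, rfl⟩ ⟨x, hx, hxU⟩ ⟨y, hy, hyV⟩
      obtain ⟨z, hz, hzU, hzV⟩ := h.2 U V hU hV ⟨x, hx, hxU⟩ ⟨y, hy, hyV⟩
      exact ⟨⟨z, hC hz⟩, hz, hzU, hzV⟩
  have himg : ∀ C, C ⊆ A ∪ B → i '' (i ⁻¹' C) = C := fun C hC =>
    Set.image_preimage_eq_of_subset (by rwa [Subtype.range_coe])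
  have hAi := hpre A Set.subset_union_left hA
  have hBi := hpre B Set.subset_union_right hB
  have hcl : ∀ C D : Set Y, Disjoint D (closure C) → A ∪ B ⊆ C ∪ D → IsClosed (i ⁻¹' C) := by
    intro C D hCD hsub
    have : i ⁻¹' C = i ⁻¹' closure C := by
      ext x
      refine ⟨fun h => subset_closure h, fun h => ?_⟩
      rcases hsub x.2 with h1 | h1
      · exact h1
      · exact absurd h (Set.disjoint_left.mp hCD h1)
    rw [this]
    exact isClosed_closure.preimage continuous_subtype_val
  have hAc := hcl A B hBA subset_rfl
  have hBc := hcl B A hAB (Set.union_comm A B).subset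
  have hcov : ∀ Z : Set (A ∪ B : Set Y), IsIrreducible Z → Z ⊆ i ⁻¹' A ∨ Z ⊆ i ⁻¹' B := by
    intro Z hZ
    exact isPreirreducible_iff_isClosed_union_isClosed.mp hZ.2 _ _ hAc hBc fun x _ => x.2
  have hdis : ∀ C D : Set Y, C.Nonempty → C ⊆ A ∪ B → Disjoint C (closure D) →
      ¬ i ⁻¹' C ⊆ i ⁻¹' D := by
    rintro C D ⟨x, hx⟩ hC hCD h
    exact Set.disjoint_left.mp hCD hx (subset_closure (h (show (⟨x, hC hx⟩ : (A ∪ B : Set Y)) ∈ _ from hx)))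
  ext Z
  simp only [componentsOf, Set.mem_image, Set.mem_insert_iff, Set.mem_singleton_iff]
  constructor
  · rintro ⟨W, hW, rfl⟩
    rcases hcov W hW.1 with h | h
    · left
      rw [show W = i ⁻¹' A from h.antisymm (hW.2 hAi h), himg A Set.subset_union_left]
    · right
      rw [show W = i ⁻¹' B from h.antisymm (hW.2 hBi h), himg B Set.subset_union_right]
  · rintro (rfl | rfl)
    · refine ⟨i ⁻¹' Z, ⟨hAi, fun W hW hle => ?_⟩, himg _ Set.subset_union_left⟩
      rcases hcov W hW with h | h
      · exact h
      · exact absurd (hle.trans h) (hdis _ _ hA.1 Set.subset_union_left hAB)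
    · refine ⟨i ⁻¹' Z, ⟨hBi, fun W hW hle => ?_⟩, himg _ Set.subset_union_right⟩
      rcases hcov W hW with h | h
      · exact absurd (hle.trans h) (hdis _ _ hB.1 Set.subset_union_right hBA)
      · exact h

/-- The relation `T` on increasing triples, made symmetric. -/
def symTriple (T : Fin 6 → Fin 6 → Fin 6 → Bool) (i j k : Fin 6) : Bool :=
  let ok := fun i j k : Fin 6 => decide (i < j) && decide (j < k) && T i j k
  ok i j k || ok i k j || ok j i k || ok j k i || ok k i j || ok k j i

lemma symTriple_eq_true_iff {T : Fin 6 → Fin 6 → Fin 6 → Bool} {a : Fin 6 → Fin 3 → ℂ}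
    (hT : Pattern T a) {i j k : Fin 6} (hij : i ≠ j) (hik : i ≠ k) (hjk : j ≠ k)
    (h : tri (a i) (a j) (a k) = 0) : symTriple T i j k = true := by
  have key : ∀ x y z, x < y → y < z → tri (a x) (a y) (a z) = 0 →
      (decide (x < y) && decide (y < z) && T x y z) = true := by
    intro x y z hxy hyz h
    simp [hxy, hyz, (hT x y z hxy hyz).mp h]
  have hs : ∀ {x y z}, tri (a x) (a y) (a z) = 0 → tri (a y) (a x) (a z) = 0 := fun h => by
    rw [tri_swap_left, h, neg_zero]
  have hr : ∀ {x y z}, tri (a x) (a y) (a z) = 0 → tri (a x) (a z) (a y) = 0 := fun h => by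
    rw [tri_swap_right, h, neg_zero]
  simp only [symTriple, Bool.or_eq_true]
  rcases lt_or_gt_of_ne hij with h1 | h1 <;> rcases lt_or_gt_of_ne hik with h2 | h2 <;>
    rcases lt_or_gt_of_ne hjk with h3 | h3
  · simp [key _ _ _ h1 h3 h]
  · simp [key _ _ _ h2 h3 (hr h)]
  · exact absurd (h1.trans h3) h2.not_gt
  · simp [key _ _ _ h2 h1 (hs (hr h))]
  · simp [key _ _ _ h1 h2 (hs h)]
  · exact absurd (h2.trans h3) h1.not_gt
  · simp [key _ _ _ h3 h2 (hr (hs h))]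
  · simp [key _ _ _ h3 h1 (hs (hr (hs h)))]

lemma ne_of_symTriple {T : Fin 6 → Fin 6 → Fin 6 → Bool} {i j k : Fin 6}
    (h : symTriple T i j k = true) : i ≠ j ∧ i ≠ k ∧ j ≠ k := by
  simp only [symTriple, Bool.or_eq_true, Bool.and_eq_true, decide_eq_true_eq] at h
  omega

/-- Limits of arrangements of type `T` have at least the concurrent triples of `T`. -/
lemma exists_perm_of_mem_closure {T T' : Fin 6 → Fin 6 → Fin 6 → Bool} {p : Curve 6}
    (hp : p ∈ closure (curvesOfType T)) (hp' : p ∈ curvesOfType T') :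
    ∃ τ : Equiv.Perm (Fin 6), ∀ i j k, symTriple T i j k = true →
      symTriple T' (τ i) (τ j) (τ k) = true := by
  obtain ⟨a, ha, hT', hpa⟩ := hp'
  have heval : ∀ (i j k : Fin 6) (b : Fin 6 → Fin 3 → ℂ),
      eval (fun x : Fin 6 × Fin 3 => b x.1 x.2) (tri (R := MvPolynomial (Fin 6 × Fin 3) ℂ)
        (fun m => X (i, m)) (fun m => X (j, m)) (fun m => X (k, m))) =
      tri (b i) (b j) (b k) := by
    intro i j k b
    simp [tri]
  -- The concurrences of `T` are polynomial equations in the lines, invariant under rescaling, so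
  -- they persist in the limit.
  obtain ⟨b, hb, hbE⟩ := exists_rep_of_mem_closure hp
    {g | ∃ i j k, i < j ∧ j < k ∧ T i j k = true ∧ g = tri (R := MvPolynomial (Fin 6 × Fin 3) ℂ)
      (fun m => X (i, m)) (fun m => X (j, m)) (fun m => X (k, m))}
    (by
      rintro g ⟨i, j, k, -, -, -, rfl⟩ b c h
      rw [heval] at h
      have h1 := heval i j k fun x m => c x * b x m
      rw [h1]
      have h2 := tri_smul (c i) (c j) (c k) (b i) (b j) (b k)
      rw [h, mul_zero] at h2
      exact h2)
    (by
      rintro q ⟨b, hb, hT, hq⟩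
      refine ⟨b, hq, ?_⟩
      rintro g ⟨i, j, k, hij, hjk, h, rfl⟩
      rw [heval]
      exact (hT i j k hij hjk).mpr h)
  have hb0 : ∀ i, b i ≠ 0 := by
    intro i h0
    obtain ⟨c, -, hc⟩ := hb
    apply Curve.form_ne_zero p
    rw [hc, Finset.prod_eq_zero (Finset.mem_univ i), mul_zero]
    rw [h0]
    simp [linearForm]
  -- The lines of the limit are those of `a` in some order.
  obtain ⟨σ, hσ⟩ := hpa.exists_perm hb ha hb0
  choose c hc hbc using hσ
  have hb' : ∀ i, b i = c (σ.symm i) • a (σ.symm i) := by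
    intro i
    rw [← hbc, Equiv.apply_symm_apply]
  have hlt : ∀ i j k, i < j → j < k → T i j k = true →
      tri (a (σ.symm i)) (a (σ.symm j)) (a (σ.symm k)) = 0 := by
    intro i j k hij hjk h
    have h1 := hbE _ ⟨i, j, k, hij, hjk, h, rfl⟩
    rw [heval, hb' i, hb' j, hb' k, tri_smul] at h1
    simpa [hc] using h1
  refine ⟨σ.symm, fun i j k h => ?_⟩
  obtain ⟨h1, h2, h3⟩ := ne_of_symTriple h
  refine symTriple_eq_true_iff hT' (σ.symm.injective.ne h1) (σ.symm.injective.ne h2)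
    (σ.symm.injective.ne h3) ?_
  have hs : ∀ {x y z}, tri (a x) (a y) (a z) = 0 → tri (a y) (a x) (a z) = 0 := fun h => by
    rw [tri_swap_left, h, neg_zero]
  have hr : ∀ {x y z}, tri (a x) (a y) (a z) = 0 → tri (a x) (a z) (a y) = 0 := fun h => by
    rw [tri_swap_right, h, neg_zero]
  simp only [symTriple, Bool.or_eq_true, Bool.and_eq_true, decide_eq_true_eq] at h
  rcases h with ((((h | h) | h) | h) | h) | h
  · exact hlt _ _ _ h.1.1 h.1.2 h.2
  · exact hr (hlt _ _ _ h.1.1 h.1.2 h.2)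
  · exact hs (hlt _ _ _ h.1.1 h.1.2 h.2)
  · exact hs (hr (hlt _ _ _ h.1.1 h.1.2 h.2))
  · exact hr (hs (hlt _ _ _ h.1.1 h.1.2 h.2))
  · exact hs (hr (hs (hlt _ _ _ h.1.1 h.1.2 h.2)))

lemma forall_fin_six {P : Fin 6 → Prop} (h : P 0 ∧ P 1 ∧ P 2 ∧ P 3 ∧ P 4 ∧ P 5) (i : Fin 6) :
    P i := by
  obtain ⟨h0, h1, h2, h3, h4, h5⟩ := h
  fin_cases i <;> assumption

/-- A quadruple point has two concurrent triples with two lines in common; in `type333` two lines of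
a concurrent triple determine the third. -/
lemma disjoint_type333_closure_type4 :
    Disjoint (curvesOfType type333) (closure (curvesOfType type4)) := by
  refine Set.disjoint_left.mpr fun p hp hp' => ?_
  obtain ⟨τ, h⟩ := exists_perm_of_mem_closure hp' hp
  have h1 := h 0 1 2 (by decide)
  have h2 := h 0 1 3 (by decide)
  have key : ∀ x y z w : Fin 6, symTriple type333 x y z = true →
      symTriple type333 x y w = true → z = w := by decide
  exact absurd (τ.injective (key _ _ _ _ h1 h2)) (by decide)

lemma disjoint_type3333_closure_type43 :
    Disjoint (curvesOfType type3333) (closure (curvesOfType type43)) := by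
  refine Set.disjoint_left.mpr fun p hp hp' => ?_
  obtain ⟨τ, h⟩ := exists_perm_of_mem_closure hp' hp
  have h1 := h 0 1 2 (by decide)
  have h2 := h 0 1 3 (by decide)
  have key : ∀ x y z w : Fin 6, symTriple type3333 x y z = true →
      symTriple type3333 x y w = true → z = w := by decide
  exact absurd (τ.injective (key _ _ _ _ h1 h2)) (by decide)

lemma disjoint_type4_closure_type333 :
    Disjoint (curvesOfType type4) (closure (curvesOfType type333)) := by
  refine Set.disjoint_left.mpr fun p hp hp' => ?_
  obtain ⟨τ, h⟩ := exists_perm_of_mem_closure hp' hp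
  have h1 : ∀ i, ∃ j k, symTriple type333 i j k = true := by decide
  obtain ⟨j, k, h2⟩ := h1 (τ.symm 5)
  have h3 := h _ _ _ h2
  rw [Equiv.apply_symm_apply] at h3
  have key : ∀ y z : Fin 6, symTriple type4 5 y z = false := by decide
  simp [key] at h3

lemma disjoint_type43_closure_type3333 :
    Disjoint (curvesOfType type43) (closure (curvesOfType type3333)) := by
  refine Set.disjoint_left.mpr fun p hp hp' => ?_
  obtain ⟨τ, h⟩ := exists_perm_of_mem_closure hp' hp
  have h1 : ∀ i, ∃ j k l m, symTriple type3333 i j k = true ∧ symTriple type3333 i l m = true ∧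
      j ≠ l ∧ j ≠ m := by
    refine forall_fin_six ⟨⟨1, 3, 2, 4, ?_⟩, ⟨0, 3, 2, 5, ?_⟩, ⟨0, 4, 1, 5, ?_⟩, ⟨0, 1, 4, 5, ?_⟩,
      ⟨0, 2, 3, 5, ?_⟩, ⟨1, 2, 3, 4, ?_⟩⟩ <;> decide
  obtain ⟨j, k, l, m, h2, h3, hjl, hjm⟩ := h1 (τ.symm 5)
  have h4 := h _ _ _ h2
  have h5 := h _ _ _ h3
  rw [Equiv.apply_symm_apply] at h4 h5
  have key : ∀ x y z w : Fin 6, symTriple type43 5 x y = true → symTriple type43 5 z w = true →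
      x = z ∨ x = w := by decide
  rcases key _ _ _ _ h4 h5 with h6 | h6
  · exact hjl (τ.injective h6)
  · exact hjm (τ.injective h6)

theorem componentsOf_18 : componentsOf (arrangementsTau 6 18) =
    {curvesOfType type4, curvesOfType type333} := by
  rw [arrangementsTau_18]
  exact componentsOf_union irreducible_and_dim_type4.1 irreducible_and_dim_type333.1
    disjoint_type4_closure_type333 disjoint_type333_closure_type4

theorem componentsOf_19 : componentsOf (arrangementsTau 6 19) =
    {curvesOfType type43, curvesOfType type3333} := by
  rw [arrangementsTau_19]
  exact componentsOf_union irreducible_and_dim_type43.1 irreducible_and_dim_type3333.1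
    disjoint_type43_closure_type3333 disjoint_type3333_closure_type43

end

section

/-! ### Polynomial vector fields -/

/-- The derivation of the polynomial ring which corresponds to the vector field `θ`. -/
noncomputable def der (θ : Fin 3 → S) (g : S) : S := ∑ i, θ i * pderiv i g

lemma gradMap_eq_der (f : S) (θ : Fin 3 → S) : gradMap f θ = der θ f := by
  simp [gradMap, der, Fintype.linearCombination_apply]

lemma mem_AR {f : S} {θ : Fin 3 → S} : θ ∈ AR f ↔ der θ f = 0 := by
  rw [AR, LinearMap.mem_ker, gradMap_eq_der]

lemma der_eq (θ : Fin 3 → S) (g : S) :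
    der θ g = θ 0 * pderiv 0 g + θ 1 * pderiv 1 g + θ 2 * pderiv 2 g := by
  simp [der, Fin.sum_univ_three]

lemma der_mul (θ : Fin 3 → S) (g h : S) : der θ (g * h) = g * der θ h + h * der θ g := by
  simp only [der_eq, Derivation.leibniz, smul_eq_mul]
  ring

lemma der_C (θ : Fin 3 → S) (c : ℂ) : der θ (C c) = 0 := by simp [der]

lemma der_C_mul (θ : Fin 3 → S) (c : ℂ) (g : S) : der θ (C c * g) = C c * der θ g := by
  rw [der_mul, der_C, mul_zero, add_zero]

lemma der_add (θ : Fin 3 → S) (g h : S) : der θ (g + h) = der θ g + der θ h := by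
  simp only [der_eq, map_add]; ring

lemma add_der (θ η : Fin 3 → S) (g : S) : der (θ + η) g = der θ g + der η g := by
  simp only [der_eq, Pi.add_apply]; ring

lemma sub_der (θ η : Fin 3 → S) (g : S) : der (θ - η) g = der θ g - der η g := by
  simp only [der_eq, Pi.sub_apply]; ring

lemma smul_der (u : S) (θ : Fin 3 → S) (g : S) : der (u • θ) g = u * der θ g := by
  simp only [der_eq, Pi.smul_apply, smul_eq_mul]; ring

lemma der_linearForm (θ : Fin 3 → S) (a : Fin 3 → ℂ) :
    der θ (linearForm a) = C (a 0) * θ 0 + C (a 1) * θ 1 + C (a 2) * θ 2 := by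
  simp only [der_eq, pderiv_linearForm]; ring

/-- The Euler vector field. -/
noncomputable def eul : Fin 3 → S := X

lemma der_eul {g : S} {n : ℕ} (hg : g.IsHomogeneous n) : der eul g = C (n : ℂ) * g := by
  rw [der, eul, hg.sum_X_mul_pderiv, nsmul_eq_mul]
  simp

lemma der_eul_linearForm (a : Fin 3 → ℂ) : der eul (linearForm a) = linearForm a := by
  rw [der_eul (linearForm_isHomogeneous a)]
  simp

/-! ### Vector fields and products of linear forms. -/

section Products

variable {ι : Type*} {a : ι → Fin 3 → ℂ}

lemma not_dvd_of_distinct (ha : Distinct a) {i j : ι} (h : i ≠ j) :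
    ¬ linearForm (a i) ∣ linearForm (a j) :=
  fun hd => ha.2 i j h (cross_eq_zero_of_dvd hd)

lemma not_dvd_prod (ha : Distinct a) {i : ι} {I : Finset ι} (h : i ∉ I) :
    ¬ linearForm (a i) ∣ ∏ j ∈ I, linearForm (a j) := by
  intro hd
  obtain ⟨j, hj, hd⟩ := ((prime_linearForm (ha.1 i)).dvd_finsetProd_iff _).mp hd
  exact not_dvd_of_distinct ha (i := i) (j := j) (fun e => h (by rw [e]; exact hj)) hd

lemma prod_dvd_of_forall_dvd (ha : Distinct a) (I : Finset ι) {t : S}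
    (h : ∀ i ∈ I, linearForm (a i) ∣ t) : ∏ i ∈ I, linearForm (a i) ∣ t := by
  classical
  induction I using Finset.induction_on with
  | empty => simp
  | insert i I hi ih =>
    obtain ⟨q, hq⟩ := ih fun j hj => h j (Finset.mem_insert_of_mem hj)
    have h1 := h i (Finset.mem_insert_self i I)
    rw [hq] at h1
    obtain ⟨u, hu⟩ := ((prime_linearForm (ha.1 i)).dvd_or_dvd h1).resolve_left (not_dvd_prod ha hi)
    refine ⟨u, ?_⟩
    rw [Finset.prod_insert hi, hq, hu]
    ring

/-- A vector field which kills a product of distinct lines is tangent to each of them. -/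
lemma dvd_der_of_der_prod (ha : Distinct a) {I : Finset ι} {θ : Fin 3 → S}
    (h : der θ (∏ j ∈ I, linearForm (a j)) = 0) {i : ι} (hi : i ∈ I) :
    linearForm (a i) ∣ der θ (linearForm (a i)) := by
  classical
  rw [← Finset.mul_prod_erase I _ hi, der_mul] at h
  -- By the Leibniz rule the other summand is divisible by the form, and the form is prime to the
  -- remaining factors.
  have h1 : linearForm (a i) ∣
      (∏ j ∈ I.erase i, linearForm (a j)) * der θ (linearForm (a i)) := by
    refine ⟨-der θ (∏ j ∈ I.erase i, linearForm (a j)), ?_⟩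
    linear_combination h
  exact ((prime_linearForm (ha.1 i)).dvd_or_dvd h1).resolve_left
    (not_dvd_prod ha (Finset.notMem_erase i I))

lemma der_prod_of_forall {I : Finset ι} {θ : Fin 3 → S} {l : ι → S}
    (h : ∀ i ∈ I, der θ (linearForm (a i)) = l i * linearForm (a i)) :
    der θ (∏ i ∈ I, linearForm (a i)) = (∑ i ∈ I, l i) * ∏ i ∈ I, linearForm (a i) := by
  classical
  induction I using Finset.induction_on with
  | empty => simpa using der_C θ 1
  | insert i I hi ih =>
    rw [Finset.prod_insert hi, Finset.sum_insert hi, der_mul,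
      ih fun j hj => h j (Finset.mem_insert_of_mem hj), h i (Finset.mem_insert_self i I)]
    ring

end Products

/-- Three vector fields tangent to a line are dependent along this line. -/
lemma dvd_tri_of_dvd {a : Fin 3 → ℂ} (ha : a ≠ 0) {θ₁ θ₂ θ₃ : Fin 3 → S}
    (h₁ : linearForm a ∣ der θ₁ (linearForm a)) (h₂ : linearForm a ∣ der θ₂ (linearForm a))
    (h₃ : linearForm a ∣ der θ₃ (linearForm a)) : linearForm a ∣ tri θ₁ θ₂ θ₃ := by
  -- By Cramer's rule, a nonzero coefficient of `a` times the determinant is a combination of the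
  -- values of the three fields on the form.
  have key : ∀ (c : ℂ) (m₁ m₂ m₃ : S), c ≠ 0 → C c * tri θ₁ θ₂ θ₃ =
      der θ₁ (linearForm a) * m₁ + der θ₂ (linearForm a) * m₂ + der θ₃ (linearForm a) * m₃ →
      linearForm a ∣ tri θ₁ θ₂ θ₃ := by
    intro c m₁ m₂ m₃ hc h
    have h1 : linearForm a ∣ C c * tri θ₁ θ₂ θ₃ := by
      rw [h]
      exact dvd_add (dvd_add (h₁.mul_right _) (h₂.mul_right _)) (h₃.mul_right _)
    refine ((prime_linearForm ha).dvd_or_dvd h1).resolve_left fun hd => ?_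
    exact (prime_linearForm ha).not_isUnit
      (isUnit_of_dvd_unit hd ((isUnit_iff_ne_zero.mpr hc).map (C : ℂ →+* S)))
  obtain ⟨k, hk⟩ := Function.ne_iff.mp ha
  fin_cases k
  · refine key (a 0) (θ₂ 1 * θ₃ 2 - θ₂ 2 * θ₃ 1) (θ₃ 1 * θ₁ 2 - θ₃ 2 * θ₁ 1)
      (θ₁ 1 * θ₂ 2 - θ₁ 2 * θ₂ 1) hk ?_
    simp only [der_linearForm, tri]
    ring
  · refine key (a 1) (θ₂ 2 * θ₃ 0 - θ₂ 0 * θ₃ 2) (θ₃ 2 * θ₁ 0 - θ₃ 0 * θ₁ 2)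
      (θ₁ 2 * θ₂ 0 - θ₁ 0 * θ₂ 2) hk ?_
    simp only [der_linearForm, tri]
    ring
  · refine key (a 2) (θ₂ 0 * θ₃ 1 - θ₂ 1 * θ₃ 0) (θ₃ 0 * θ₁ 1 - θ₃ 1 * θ₁ 0)
      (θ₁ 0 * θ₂ 1 - θ₁ 1 * θ₂ 0) hk ?_
    simp only [der_linearForm, tri]
    ring

/-! ### Cross products of Jacobian syzygies. -/

section Syzygies

variable {d : ℕ} {p : Curve d} {a : Fin d → Fin 3 → ℂ}

lemma dvd_der_of_mem_AR (ha : Distinct a) (hp : Rep p a) {r : Fin 3 → S} (hr : r ∈ AR p.form)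
    (i : Fin d) : linearForm (a i) ∣ der r (linearForm (a i)) := by
  obtain ⟨c, hc, h⟩ := hp
  rw [mem_AR, h, der_C_mul] at hr
  exact dvd_der_of_der_prod ha ((mul_eq_zero.mp hr).resolve_left (by simpa using hc))
    (Finset.mem_univ i)

/-- The Euler field and both syzygies are tangent to every line, so their determinant vanishes along
each of them; distinct lines give coprime primes. -/
lemma form_dvd_tri (ha : Distinct a) (hp : Rep p a) {r r' : Fin 3 → S} (hr : r ∈ AR p.form)
    (hr' : r' ∈ AR p.form) : p.form ∣ tri eul r r' := by
  have h1 : ∏ i, linearForm (a i) ∣ tri eul r r' :=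
    prod_dvd_of_forall_dvd ha _ fun i _ => dvd_tri_of_dvd (ha.1 i)
      (by rw [der_eul_linearForm]) (dvd_der_of_mem_AR ha hp hr i) (dvd_der_of_mem_AR ha hp hr' i)
  obtain ⟨c, hc, h⟩ := hp
  rw [h]
  obtain ⟨q, hq⟩ := h1
  refine ⟨C c⁻¹ * q, ?_⟩
  rw [hq]
  have : (C c * C c⁻¹ : S) = 1 := by rw [← C_mul, mul_inv_cancel₀ hc, C_1]
  linear_combination -(∏ i, linearForm (a i)) * q * this

/-- The gradient of a polynomial. -/
noncomputable def grad (f : S) : Fin 3 → S := fun i => pderiv i f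

/-- Both syzygies are orthogonal to the gradient, so their cross product is parallel to it. -/
lemma cross_mul_grad {f : S} {r r' : Fin 3 → S} (hr : r ∈ AR f) (hr' : r' ∈ AR f) (i j : Fin 3) :
    (r ⨯₃ r') i * grad f j = (r ⨯₃ r') j * grad f i := by
  rw [mem_AR, der_eq] at hr hr'
  rw [cross_apply]
  fin_cases i <;> fin_cases j <;> simp [grad]
  all_goals first
    | ring1
    | linear_combination (r 2) * hr' - (r' 2) * hr
    | linear_combination (r' 2) * hr - (r 2) * hr'
    | linear_combination (r 1) * hr' - (r' 1) * hr
    | linear_combination (r' 1) * hr - (r 1) * hr'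
    | linear_combination (r 0) * hr' - (r' 0) * hr
    | linear_combination (r' 0) * hr - (r 0) * hr'

lemma tri_eul (r r' : Fin 3 → S) : tri eul r r' = X 0 * (r ⨯₃ r') 0 + X 1 * (r ⨯₃ r') 1 +
    X 2 * (r ⨯₃ r') 2 := by
  simp [tri, eul, cross_apply]

/-- The cross product of two Jacobian syzygies is a multiple of the gradient. -/
theorem exists_cross_eq (hd : d ≠ 0) (ha : Distinct a) (hp : Rep p a) {r r' : Fin 3 → S}
    (hr : r ∈ AR p.form) (hr' : r' ∈ AR p.form) :
    ∃ H : S, r ⨯₃ r' = H • grad p.form ∧ tri eul r r' = C (d : ℂ) * H * p.form := by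
  obtain ⟨q, hq⟩ := form_dvd_tri ha hp hr hr'
  have hd' : (C ((d : ℂ)⁻¹) * C (d : ℂ) : S) = 1 := by
    rw [← C_mul, inv_mul_cancel₀ (by exact_mod_cast hd), C_1]
  refine ⟨C ((d : ℂ)⁻¹) * q, ?_, ?_⟩
  · funext i
    have heul := der_eul p.form_isHomogeneous
    have hne := Curve.form_ne_zero p
    -- Parallelism is contracted with the Euler field: it turns the gradient into d f and the cross
    -- product into the determinant q f.
    have h1 : p.form * (C (d : ℂ) * (r ⨯₃ r') i) = p.form * (q * grad p.form i) := by
      rw [tri_eul] at hq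
      rw [der_eq] at heul
      have e0 := cross_mul_grad hr hr' i 0
      have e1 := cross_mul_grad hr hr' i 1
      have e2 := cross_mul_grad hr hr' i 2
      simp only [eul, grad] at heul e0 e1 e2 ⊢
      linear_combination (-(r ⨯₃ r') i) * heul + X 0 * e0 + X 1 * e1 + X 2 * e2 +
        pderiv i p.form * hq
    have h2 := mul_left_cancel₀ hne h1
    rw [Pi.smul_apply, smul_eq_mul]
    linear_combination C ((d : ℂ)⁻¹) * h2 - (r ⨯₃ r') i * hd'
  · rw [hq]
    linear_combination -q * p.form * hd'

lemma grad_ne_zero (hd : d ≠ 0) (p : Curve d) : ∃ k, grad p.form k ≠ 0 := by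
  by_contra! h
  have h1 := der_eul p.form_isHomogeneous
  rw [der_eq] at h1
  simp only [grad] at h
  rw [h, h, h] at h1
  have h2 : (C (d : ℂ) : S) ≠ 0 := by simpa using hd
  exact mul_ne_zero h2 (Curve.form_ne_zero p) (by rw [← h1]; ring)

lemma eq_zero_of_smul_grad (hd : d ≠ 0) {p : Curve d} {u : S} (h : u • grad p.form = 0) :
    u = 0 := by
  obtain ⟨k, hk⟩ := grad_ne_zero hd p
  have h1 := congrFun h k
  exact (mul_eq_zero.mp h1).resolve_right hk

/-- A vector parallel to two independent vectors vanishes. -/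
lemma eq_zero_of_cross {R : Type*} [CommRing R] [IsDomain R] {r r₁ r₂ : Fin 3 → R}
    (h₁ : r ⨯₃ r₁ = 0) (h₂ : r ⨯₃ r₂ = 0) (h : r₁ ⨯₃ r₂ ≠ 0) : r = 0 := by
  obtain ⟨k, hk⟩ := Function.ne_iff.mp h
  rw [cross_apply] at h₁ h₂ hk
  have a0 := congrFun h₁ 0
  have a1 := congrFun h₁ 1
  have a2 := congrFun h₁ 2
  have b0 := congrFun h₂ 0
  have b1 := congrFun h₂ 1
  have b2 := congrFun h₂ 2
  simp at a0 a1 a2 b0 b1 b2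
  funext i
  refine (mul_eq_zero.mp ?_).resolve_right hk
  fin_cases k <;> fin_cases i <;> simp [-mul_eq_zero]
  · linear_combination r₂ 2 * a2 + r₂ 1 * a1 + r₁ 0 * b0
  · linear_combination r₁ 1 * b0 - r₂ 1 * a0
  · linear_combination r₁ 2 * b0 - r₂ 2 * a0
  · linear_combination r₁ 0 * b1 - r₂ 0 * a1
  · linear_combination r₂ 0 * a0 + r₂ 2 * a2 + r₁ 1 * b1
  · linear_combination r₁ 2 * b1 - r₂ 2 * a1
  · linear_combination r₁ 0 * b2 - r₂ 0 * a2
  · linear_combination r₁ 1 * b2 - r₂ 1 * a2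
  · linear_combination r₂ 1 * a1 + r₂ 0 * a0 + r₁ 2 * b2

end Syzygies

end

section

/-! ### Linear forms in three variables as regular sequences -/

lemma exists_dual {u w : Fin 3 → ℂ} (h : u ⨯₃ w ≠ 0) : ∃ e f : Fin 3 → ℂ,
    u ⬝ᵥ e = 1 ∧ w ⬝ᵥ e = 0 ∧ u ⬝ᵥ f = 0 ∧ w ⬝ᵥ f = 1 := by
  obtain ⟨n, hn⟩ := exists_tri_ne_zero h
  refine ⟨(tri n u w)⁻¹ • (w ⨯₃ n), (tri n u w)⁻¹ • (n ⨯₃ u), ?_, ?_, ?_, ?_⟩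
  · rw [dotProduct_smul, ← tri_eq_dot, ← tri_cycle u w n, smul_eq_mul, inv_mul_cancel₀ hn]
  · rw [dotProduct_smul, dot_cross_left, smul_zero]
  · rw [dotProduct_smul, dot_cross_right, smul_zero]
  · rw [dotProduct_smul, ← tri_eq_dot, ← tri_cycle w n u, ← tri_cycle u w n, smul_eq_mul,
      inv_mul_cancel₀ hn]

/-- The restriction of a polynomial to the line spanned by `v`. -/
noncomputable def restrictLine (v : Fin 3 → ℂ) : S →ₐ[ℂ] Polynomial ℂ :=
  aeval fun i => Polynomial.C (v i) * Polynomial.X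

lemma eval_restrictLine (v : Fin 3 → ℂ) (t : ℂ) (g : S) :
    (restrictLine v g).eval t = eval (t • v) g := by
  induction g using MvPolynomial.induction_on with
  | C c => simp [restrictLine]
  | add p q hp hq => simp [hp, hq]
  | mul_X p i hp =>
    rw [map_mul, Polynomial.eval_mul, hp, map_mul]
    simp [restrictLine]
    ring_nf
    simp

lemma restrictLine_linearForm {u v : Fin 3 → ℂ} (h : u ⬝ᵥ v = 0) :
    restrictLine v (linearForm u) = 0 := by
  refine Polynomial.funext fun t => ?_
  rw [eval_restrictLine, eval_linearForm, dotProduct_smul, h]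
  simp

/-- Polynomials which vanish on a line belong to the ideal of this line. -/
lemma exists_eq_of_restrictLine {u w v : Fin 3 → ℂ} (h : u ⨯₃ w ≠ 0) (hv : v ≠ 0)
    (hu : u ⬝ᵥ v = 0) (hw : w ⬝ᵥ v = 0) {g : S} (hg : restrictLine v g = 0) :
    ∃ A B : S, g = A * linearForm u + B * linearForm w := by
  obtain ⟨e, f, hue, hwe, huf, hwf⟩ := exists_dual h
  -- `φ` is composition with the projection onto the common zero line of the two forms. It kills
  -- `g`, and it is the identity modulo the two forms.
  set φ : S →ₐ[ℂ] S :=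
    aeval fun i => X i - C (e i) * linearForm u - C (f i) * linearForm w with hφ
  have h0 : φ g = 0 := by
    refine MvPolynomial.funext fun x => ?_
    rw [hφ, eval_aeval, map_zero]
    set y : Fin 3 → ℂ := x - (u ⬝ᵥ x) • e - (w ⬝ᵥ x) • f with hy
    have h1 : (fun i => eval x (X i - C (e i) * linearForm u - C (f i) * linearForm w)) = y := by
      funext i
      simp [eval_linearForm, hy, mul_comm]
    rw [h1]
    have hyu : u ⬝ᵥ y = 0 := by simp [hy, dotProduct_sub, dotProduct_smul, hue, huf]
    have hyw : w ⬝ᵥ y = 0 := by simp [hy, dotProduct_sub, dotProduct_smul, hwe, hwf]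
    obtain ⟨s, hs⟩ := (cross_eq_zero_iff h).mp (cross_cross_eq_zero hu hw)
    obtain ⟨t, ht⟩ := (cross_eq_zero_iff h).mp (cross_cross_eq_zero hyu hyw)
    have hs0 : s ≠ 0 := by rintro rfl; exact hv (by simpa using hs)
    have h2 : y = (t * s⁻¹) • v := by
      rw [ht, hs, smul_smul, mul_assoc, inv_mul_cancel₀ hs0, mul_one]
    rw [h2, ← eval_restrictLine, hg, Polynomial.eval_zero]
  have h1 : g ∈ Ideal.span {linearForm u, linearForm w} := by
    rw [← Ideal.Quotient.eq_zero_iff_mem, ← map_zero (Ideal.Quotient.mk _), ← h0]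
    have : (Ideal.Quotient.mkₐ ℂ (Ideal.span {linearForm u, linearForm w})) =
        (Ideal.Quotient.mkₐ ℂ (Ideal.span {linearForm u, linearForm w})).comp φ := by
      refine MvPolynomial.algHom_ext fun i => ?_
      rw [AlgHom.comp_apply, hφ, aeval_X, Ideal.Quotient.mkₐ_eq_mk, Ideal.Quotient.eq]
      have : X i - (X i - C (e i) * linearForm u - C (f i) * linearForm w) =
          C (e i) * linearForm u + C (f i) * linearForm w := by ring
      rw [this]
      exact add_mem (Ideal.mul_mem_left _ _ (Ideal.subset_span (by simp)))
        (Ideal.mul_mem_left _ _ (Ideal.subset_span (by simp)))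
    exact AlgHom.congr_fun this g
  obtain ⟨A, B, hAB⟩ := Ideal.mem_span_pair.mp h1
  exact ⟨A, B, hAB.symm⟩

lemma linearForm_not_dvd {u w : Fin 3 → ℂ} (h : u ⨯₃ w ≠ 0) :
    ¬ linearForm u ∣ linearForm w := fun hd => h (cross_eq_zero_of_dvd hd)

lemma ne_zero_of_cross_left {u w : Fin 3 → ℂ} (h : u ⨯₃ w ≠ 0) : u ≠ 0 := by
  rintro rfl; simp at h

lemma ne_zero_of_cross_right {u w : Fin 3 → ℂ} (h : u ⨯₃ w ≠ 0) : w ≠ 0 := by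
  rintro rfl; simp at h

/-- Syzygies of `c, u, w`, where the linear forms `u, w` are independent and `c` does not vanish at
their common zero. -/
lemma exists_koszul {u w v : Fin 3 → ℂ} (h : u ⨯₃ w ≠ 0) (hu : u ⬝ᵥ v = 0) (hw : w ⬝ᵥ v = 0)
    {c : S} (hv : v ≠ 0) (hc : eval v c ≠ 0) {h₀ h₁ h₂ : S}
    (hs : c * h₀ + linearForm u * h₁ + linearForm w * h₂ = 0) : ∃ A B W : S,
      h₀ = A * linearForm u + B * linearForm w ∧ h₁ = W * linearForm w - A * c ∧
      h₂ = -W * linearForm u - B * c := by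
  -- On the common zero line of `u` and `w` only the term with `c` survives, and `c` is nonzero
  -- there, so `h₀` lies in the ideal of the line.
  have h1 := congrArg (restrictLine v) hs
  simp only [map_add, map_mul, restrictLine_linearForm hu, restrictLine_linearForm hw, zero_mul,
    add_zero, map_zero] at h1
  have hc' : restrictLine v c ≠ 0 := by
    intro h0
    apply hc
    rw [← one_smul ℂ v, ← eval_restrictLine, h0, Polynomial.eval_zero]
  obtain ⟨A, B, hAB⟩ :=
    exists_eq_of_restrictLine h hv hu hw ((mul_eq_zero.mp h1).resolve_left hc')
  have h2 : linearForm u ∣ linearForm w * (B * c + h₂) := by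
    refine ⟨-(A * c + h₁), ?_⟩
    rw [hAB] at hs
    linear_combination hs
  have hup := prime_linearForm (ne_zero_of_cross_left h)
  obtain ⟨W, hW⟩ := (hup.dvd_or_dvd h2).resolve_left (linearForm_not_dvd h)
  refine ⟨A, B, -W, hAB, ?_, ?_⟩
  · refine mul_left_cancel₀ hup.ne_zero ?_
    rw [hAB] at hs
    linear_combination hs - linearForm w * hW
  · linear_combination hW

/-! ### Criteria of freeness -/

lemma isHomogeneous_tri {θ₁ θ₂ θ₃ : Fin 3 → S} {n₁ n₂ n₃ : ℕ}
    (h₁ : ∀ i, (θ₁ i).IsHomogeneous n₁) (h₂ : ∀ i, (θ₂ i).IsHomogeneous n₂)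
    (h₃ : ∀ i, (θ₃ i).IsHomogeneous n₃) : (tri θ₁ θ₂ θ₃).IsHomogeneous (n₁ + (n₂ + n₃)) := by
  have h : ∀ i j k, (θ₁ i * (θ₂ j * θ₃ k - θ₂ k * θ₃ j)).IsHomogeneous (n₁ + (n₂ + n₃)) :=
    fun i j k => (h₁ i).mul (((h₂ j).mul (h₃ k)).sub ((h₂ k).mul (h₃ j)))
  exact ((h 0 1 2).add (h 1 2 0)).add (h 2 0 1)

section Criteria

variable {d : ℕ} {p : Curve d} {a : Fin d → Fin 3 → ℂ}

/-- Both sides of the determinant identity are compared in degree; the 1 is the degree of the Euler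
field. -/
lemma totalDegree_of_tri (hd : d ≠ 0) {r r' : Fin 3 → S} {n n' : ℕ} {H : S}
    (h : tri eul r r' = C (d : ℂ) * H * p.form) (hr : ∀ i, (r i).IsHomogeneous n)
    (hr' : ∀ i, (r' i).IsHomogeneous n') (h0 : tri eul r r' ≠ 0) :
    H.totalDegree + d = 1 + (n + n') := by
  have h1 := (isHomogeneous_tri (fun i => isHomogeneous_X ℂ i) hr hr').totalDegree h0
  have hC : (C (d : ℂ) : S) ≠ 0 := by simpa using hd
  have hH : H ≠ 0 := by rintro rfl; exact h0 (by rw [h]; ring)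
  change (tri eul r r').totalDegree = _ at h1
  rw [h, totalDegree_mul_of_isDomain (mul_ne_zero hC hH) (Curve.form_ne_zero p),
    totalDegree_mul_of_isDomain hC hH, totalDegree_C,
    p.form_isHomogeneous.totalDegree (Curve.form_ne_zero p)] at h1
  omega

lemma cross_comb_left {R : Type*} [CommRing R] (u v : R) (r r₁ r₂ : Fin 3 → R) :
    (r - (u • r₁ + v • r₂)) ⨯₃ r₁ = r ⨯₃ r₁ + v • (r₁ ⨯₃ r₂) := by
  funext i
  fin_cases i <;> simp [cross_apply] <;> ring

lemma cross_comb_right {R : Type*} [CommRing R] (u v : R) (r r₁ r₂ : Fin 3 → R) :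
    (r - (u • r₁ + v • r₂)) ⨯₃ r₂ = r ⨯₃ r₂ - u • (r₁ ⨯₃ r₂) := by
  funext i
  fin_cases i <;> simp [cross_apply] <;> ring

/-- Saito's criterion: two independent Jacobian syzygies whose degrees add up to `d - 1` form a
basis. -/
theorem isFreeWith_of_tri (hd : d ≠ 0) (ha : Distinct a) (hp : Rep p a) {r₁ r₂ : Fin 3 → S}
    {d₁ d₂ : ℕ} (h₁ : r₁ ∈ AR p.form) (h₂ : r₂ ∈ AR p.form) (hr₁ : ∀ i, (r₁ i).IsHomogeneous d₁)
    (hr₂ : ∀ i, (r₂ i).IsHomogeneous d₂) (hle : d₁ ≤ d₂) (hsum : d₁ + d₂ + 1 = d)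
    (h0 : tri eul r₁ r₂ ≠ 0) : IsFreeWith p d₁ d₂ := by
  obtain ⟨H, hH, hHt⟩ := exists_cross_eq hd ha hp h₁ h₂
  have hdeg := totalDegree_of_tri hd hHt hr₁ hr₂ h0
  -- The degrees leave nothing for `H`, so it is a nonzero constant.
  obtain ⟨κ, hκ⟩ : ∃ κ, H = C κ := ⟨_, totalDegree_eq_zero_iff_eq_C.mp (by omega)⟩
  have hκ0 : κ ≠ 0 := by
    rintro rfl
    apply h0
    rw [hHt, hκ]
    simp
  have hcr : r₁ ⨯₃ r₂ ≠ 0 := by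
    intro h
    rw [hH, hκ] at h
    have := eq_zero_of_smul_grad hd h
    simp [hκ0] at this
  have hκi : (C κ⁻¹ * C κ : S) = 1 := by rw [← C_mul, inv_mul_cancel₀ hκ0, C_1]
  set b : Fin 2 → AR p.form := ![⟨r₁, h₁⟩, ⟨r₂, h₂⟩] with hb
  have hli : LinearIndependent S b := by
    rw [hb, LinearIndependent.pair_iff]
    intro s t hst
    have hst : s • r₁ + t • r₂ = 0 := congrArg Subtype.val hst
    have e1 := cross_comb_left s t 0 r₁ r₂
    have e2 := cross_comb_right s t 0 r₁ r₂
    rw [hst] at e1 e2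
    simp only [sub_zero, map_zero, LinearMap.zero_apply, zero_add, zero_sub] at e1 e2
    constructor
    · exact (smul_eq_zero.mp (neg_eq_zero.mp e2.symm)).resolve_right hcr
    · exact (smul_eq_zero.mp e1.symm).resolve_right hcr
  have hsp : ⊤ ≤ Submodule.span S (Set.range b) := by
    rintro ⟨r, hr⟩ -
    obtain ⟨H₁, hH₁, -⟩ := exists_cross_eq hd ha hp hr h₁
    obtain ⟨H₂, hH₂, -⟩ := exists_cross_eq hd ha hp hr h₂
    -- The coordinates of `r` are read off from its cross products with the two syzygies, up to the
    -- constant; the difference is parallel to both and vanishes.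
    have hz : r - ((C κ⁻¹ * H₂) • r₁ + (-(C κ⁻¹ * H₁)) • r₂) = 0 := by
      refine eq_zero_of_cross ?_ ?_ hcr
      · rw [cross_comb_left, hH₁, hH, hκ, smul_smul, ← add_smul]
        rw [show H₁ + -(C κ⁻¹ * H₁) * C κ = 0 by linear_combination -H₁ * hκi, zero_smul]
      · rw [cross_comb_right, hH₂, hH, hκ, smul_smul, ← sub_smul]
        rw [show H₂ - C κ⁻¹ * H₂ * C κ = 0 by linear_combination -H₂ * hκi, zero_smul]
    have hr' : (⟨r, hr⟩ : AR p.form) = (C κ⁻¹ * H₂) • b 0 + (-(C κ⁻¹ * H₁)) • b 1 :=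
      Subtype.ext (sub_eq_zero.mp hz)
    rw [hr']
    exact add_mem (Submodule.smul_mem _ _ (Submodule.subset_span ⟨0, rfl⟩))
      (Submodule.smul_mem _ _ (Submodule.subset_span ⟨1, rfl⟩))
  refine ⟨hle, Module.Basis.mk hli hsp, fun j => ?_, fun j => ?_⟩
  · rw [Module.Basis.mk_apply]
    exact hr₁ j
  · rw [Module.Basis.mk_apply]
    exact hr₂ j

lemma linearCombination_three (r : Fin 3 → Fin 3 → S) (g : Fin 3 → S) :
    Fintype.linearCombination S r g = g 0 • r 0 + g 1 • r 1 + g 2 • r 2 := by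
  rw [Fintype.linearCombination_apply, Fin.sum_univ_three]

lemma comb_cross_zero {R : Type*} [CommRing R] (g r₀ r₁ r₂ : Fin 3 → R) :
    (g 0 • r₀ + g 1 • r₁ + g 2 • r₂) ⨯₃ r₀ = g 2 • (r₂ ⨯₃ r₀) - g 1 • (r₀ ⨯₃ r₁) := by
  funext i
  fin_cases i <;> simp [cross_apply] <;> ring

lemma comb_cross_one {R : Type*} [CommRing R] (g r₀ r₁ r₂ : Fin 3 → R) :
    (g 0 • r₀ + g 1 • r₁ + g 2 • r₂) ⨯₃ r₁ = g 0 • (r₀ ⨯₃ r₁) - g 2 • (r₁ ⨯₃ r₂) := by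
  funext i
  fin_cases i <;> simp [cross_apply] <;> ring

lemma comb_cross_two {R : Type*} [CommRing R] (g r₀ r₁ r₂ : Fin 3 → R) :
    (g 0 • r₀ + g 1 • r₁ + g 2 • r₂) ⨯₃ r₂ = g 1 • (r₁ ⨯₃ r₂) - g 0 • (r₂ ⨯₃ r₀) := by
  funext i
  fin_cases i <;> simp [cross_apply] <;> ring

/-- Three Jacobian syzygies with one relation, whose first two coefficients of degree one are
independent, and with degrees `d₁`, `d₂`, `d₂` such that `d₁ + d₂ = d`. -/
theorem isNearlyFreeWith_of_relation (hd : d ≠ 0) (ha : Distinct a) (hp : Rep p a)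
    {r : Fin 3 → Fin 3 → S} {d₁ d₂ : ℕ} (hr : ∀ i, r i ∈ AR p.form)
    (hr₀ : ∀ i, (r 0 i).IsHomogeneous d₁) (hr₁ : ∀ i, (r 1 i).IsHomogeneous d₂)
    (hr₂ : ∀ i, (r 2 i).IsHomogeneous d₂) (h1 : 1 ≤ d₁) (hle : d₁ ≤ d₂) (hsum : d₁ + d₂ = d)
    {c : S} {u w v : Fin 3 → ℂ} (hc : c.IsHomogeneous (d₂ - d₁ + 1)) (huw : u ⨯₃ w ≠ 0)
    (hu : u ⬝ᵥ v = 0) (hw : w ⬝ᵥ v = 0) (hv : v ≠ 0) (hcv : eval v c ≠ 0)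
    (hrel : c • r 0 + linearForm u • r 1 + linearForm w • r 2 = 0)
    (h0 : tri eul (r 0) (r 1) ≠ 0) : IsNearlyFreeWith p d₁ d₂ := by
  obtain ⟨H₂, hH₂, hHt⟩ := exists_cross_eq hd ha hp (hr 0) (hr 1)
  obtain ⟨H₁, hH₁, -⟩ := exists_cross_eq hd ha hp (hr 2) (hr 0)
  obtain ⟨H₀, hH₀, -⟩ := exists_cross_eq hd ha hp (hr 1) (hr 2)
  have hup := prime_linearForm (ne_zero_of_cross_left huw)
  have hwp := prime_linearForm (ne_zero_of_cross_right huw)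
  set γ : Fin 3 → S := ![c, linearForm u, linearForm w] with hγ
  have hrel' : γ 0 • r 0 + γ 1 • r 1 + γ 2 • r 2 = 0 := hrel
  -- Crossing the relation with `r 0` and `r 1` shows that (H₀, H₁, H₂) is proportional to (c, u,
  -- w). Independence of `u` and `w` makes the factor a polynomial `e`, and the degrees make it
  -- constant.
  have e0 : linearForm w * H₁ - linearForm u * H₂ = 0 := by
    have h := comb_cross_zero γ (r 0) (r 1) (r 2)
    rw [hrel', hH₁, hH₂, smul_smul, smul_smul, ← sub_smul, map_zero, LinearMap.zero_apply] at h
    exact eq_zero_of_smul_grad hd h.symm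
  have e1 : c * H₂ - linearForm w * H₀ = 0 := by
    have h := comb_cross_one γ (r 0) (r 1) (r 2)
    rw [hrel', hH₂, hH₀, smul_smul, smul_smul, ← sub_smul, map_zero, LinearMap.zero_apply] at h
    exact eq_zero_of_smul_grad hd h.symm
  obtain ⟨e, he⟩ : linearForm u ∣ H₁ :=
    (hup.dvd_or_dvd (show linearForm u ∣ linearForm w * H₁ from
      ⟨H₂, by linear_combination e0⟩)).resolve_left (linearForm_not_dvd huw)
  have he2 : H₂ = e * linearForm w := by
    refine mul_left_cancel₀ hup.ne_zero ?_
    rw [he] at e0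
    linear_combination -e0
  have he0 : H₀ = e * c := by
    refine mul_left_cancel₀ hwp.ne_zero ?_
    rw [he2] at e1
    linear_combination -e1
  have hdeg := totalDegree_of_tri hd hHt hr₀ hr₁ h0
  have hH2 : H₂ ≠ 0 := by rintro rfl; exact h0 (by rw [hHt]; ring)
  have hene : e ≠ 0 := by rintro rfl; exact hH2 (by rw [he2]; ring)
  rw [he2, totalDegree_mul_of_isDomain hene hwp.ne_zero,
    (linearForm_isHomogeneous w).totalDegree hwp.ne_zero] at hdeg
  obtain ⟨κ, hκ⟩ : ∃ κ, e = C κ := ⟨_, totalDegree_eq_zero_iff_eq_C.mp (by omega)⟩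
  have hκ0 : κ ≠ 0 := by
    rintro rfl
    exact hene (by rw [hκ, C_0])
  have hκi : (C κ⁻¹ * C κ : S) = 1 := by rw [← C_mul, inv_mul_cancel₀ hκ0, C_1]
  have hcr : r 0 ⨯₃ r 1 ≠ 0 := by
    intro h
    rw [hH₂] at h
    exact hH2 (eq_zero_of_smul_grad hd h)
  refine ⟨h1, hle, r, γ, hr₀, hr₁, hr₂, hc, linearForm_isHomogeneous u,
    linearForm_isHomogeneous w, ?_, ?_, ?_⟩
  · refine (injective_iff_map_eq_zero _).mpr fun g hg => ?_
    have h := congrFun hg 1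
    simp only [LinearMap.toSpanSingleton_apply, Pi.smul_apply, smul_eq_mul, Pi.zero_apply] at h
    exact (mul_eq_zero.mp h).resolve_right hup.ne_zero
  · intro g
    rw [linearCombination_three]
    constructor
    · intro hg
      have k0 : g 2 * H₁ - g 1 * H₂ = 0 := by
        have h := comb_cross_zero g (r 0) (r 1) (r 2)
        rw [hg, hH₁, hH₂, smul_smul, smul_smul, ← sub_smul, map_zero, LinearMap.zero_apply] at h
        exact eq_zero_of_smul_grad hd h.symm
      have k1 : g 0 * H₂ - g 2 * H₀ = 0 := by
        have h := comb_cross_one g (r 0) (r 1) (r 2)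
        rw [hg, hH₂, hH₀, smul_smul, smul_smul, ← sub_smul, map_zero, LinearMap.zero_apply] at h
        exact eq_zero_of_smul_grad hd h.symm
      rw [he, he2] at k0
      rw [he2, he0] at k1
      have k0' : g 2 * linearForm u = g 1 * linearForm w := by
        refine mul_left_cancel₀ hene ?_
        linear_combination k0
      have k1' : g 0 * linearForm w = g 2 * c := by
        refine mul_left_cancel₀ hene ?_
        linear_combination k1
      obtain ⟨m, hm⟩ : linearForm u ∣ g 1 :=
        (hup.dvd_or_dvd (show linearForm u ∣ linearForm w * g 1 from
          ⟨g 2, by linear_combination -k0'⟩)).resolve_left (linearForm_not_dvd huw)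
      have hm2 : g 2 = m * linearForm w := by
        refine mul_left_cancel₀ hup.ne_zero ?_
        rw [hm] at k0'
        linear_combination k0'
      have hm0 : g 0 = m * c := by
        refine mul_left_cancel₀ hwp.ne_zero ?_
        rw [hm2] at k1'
        linear_combination k1'
      refine ⟨m, funext fun i => ?_⟩
      fin_cases i
      · simp [hγ, hm0]
      · simp [hγ, hm, mul_comm]
      · simp [hγ, hm2]
    · rintro ⟨m, rfl⟩
      simp only [LinearMap.toSpanSingleton_apply, Pi.smul_apply, smul_eq_mul]
      rw [← smul_smul, ← smul_smul, ← smul_smul, ← smul_add, ← smul_add, hrel', smul_zero]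
  · intro s
    rw [gradMap_eq_der, ← mem_AR]
    constructor
    · intro hs
      obtain ⟨h₀, hh₀, -⟩ := exists_cross_eq hd ha hp hs (hr 0)
      obtain ⟨h₁, hh₁, -⟩ := exists_cross_eq hd ha hp hs (hr 1)
      obtain ⟨h₂, hh₂, -⟩ := exists_cross_eq hd ha hp hs (hr 2)
      -- Crossing the relation with `s` gives a syzygy of the regular sequence (c, u, w), which is
      -- of Koszul type; its coefficients yield those of `s`.
      have hsyz : c * h₀ + linearForm u * h₁ + linearForm w * h₂ = 0 := by
        have h : s ⨯₃ (γ 0 • r 0 + γ 1 • r 1 + γ 2 • r 2) =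
            (c * h₀ + linearForm u * h₁ + linearForm w * h₂) • grad p.form := by
          rw [map_add, map_add, map_smul, map_smul, map_smul, hh₀, hh₁, hh₂, smul_smul, smul_smul,
            smul_smul, ← add_smul, ← add_smul]
          rfl
        rw [hrel', map_zero] at h
        exact eq_zero_of_smul_grad hd h.symm
      obtain ⟨A, B, W, hA, hB, hW⟩ := exists_koszul huw hu hw hv hcv hsyz
      set g : Fin 3 → S := ![C κ⁻¹ * W, -(C κ⁻¹ * B), C κ⁻¹ * A] with hg
      have hz : s - (g 0 • r 0 + g 1 • r 1 + g 2 • r 2) = 0 := by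
        refine eq_zero_of_cross (r₁ := r 0) (r₂ := r 1) ?_ ?_ hcr
        · rw [map_sub, LinearMap.sub_apply, comb_cross_zero, hh₀, hH₁, hH₂, smul_smul, smul_smul,
            ← sub_smul, ← sub_smul]
          convert zero_smul S (grad p.form)
          rw [he, he2, hκ, hA]
          simp only [hg, Matrix.cons_val]
          linear_combination -(A * linearForm u + B * linearForm w) * hκi
        · rw [map_sub, LinearMap.sub_apply, comb_cross_one, hh₁, hH₀, hH₂, smul_smul, smul_smul,
            ← sub_smul, ← sub_smul]
          convert zero_smul S (grad p.form)
          rw [he0, he2, hκ, hB]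
          simp only [hg, Matrix.cons_val]
          linear_combination -(W * linearForm w - A * c) * hκi
      exact ⟨g, by rw [linearCombination_three]; exact (sub_eq_zero.mp hz).symm⟩
    · rintro ⟨g, rfl⟩
      rw [linearCombination_three]
      exact add_mem (add_mem (Submodule.smul_mem _ _ (hr 0)) (Submodule.smul_mem _ _ (hr 1)))
        (Submodule.smul_mem _ _ (hr 2))

end Criteria

end

section

/-! ### Logarithmic vector fields -/

/-- A constant vector field. -/
noncomputable def cst (v : Fin 3 → ℂ) : Fin 3 → S := fun i => C (v i)

lemma der_cst_linearForm (v a : Fin 3 → ℂ) : der (cst v) (linearForm a) = C (a ⬝ᵥ v) := by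
  rw [der_linearForm]
  simp [cst, dotProduct, Fin.sum_univ_three]

lemma isHomogeneous_cst (v : Fin 3 → ℂ) (i : Fin 3) : (cst v i).IsHomogeneous 0 :=
  isHomogeneous_C _ _

lemma isHomogeneous_cross_grad {h : S} {n : ℕ} (hh : h.IsHomogeneous n) (u : Fin 3 → ℂ)
    (i : Fin 3) : ((cst u ⨯₃ grad h) i).IsHomogeneous (n - 1) := by
  have key : ∀ j k, (cst u j * grad h k).IsHomogeneous (n - 1) := fun j k => by
    have := (isHomogeneous_cst u j).mul (hh.pderiv (i := k))
    rwa [zero_add] at this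
  rw [cross_apply]
  fin_cases i
  · exact (key 1 2).sub (key 2 1)
  · exact (key 2 0).sub (key 0 2)
  · exact (key 0 1).sub (key 1 0)

lemma der_cross_grad_self (u : Fin 3 → ℂ) (h : S) : der (cst u ⨯₃ grad h) h = 0 := by
  rw [der_eq]
  simp [cross_apply, grad]
  ring

lemma der_cross_grad (u a : Fin 3 → ℂ) (h : S) :
    der (cst u ⨯₃ grad h) (linearForm a) = tri (cst a) (cst u) (grad h) := by
  rw [der_linearForm]
  simp [cross_apply, tri, cst]

lemma tri_eul_cross_grad (v u : Fin 3 → ℂ) (h : S) :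
    tri eul (cst v) (cst u ⨯₃ grad h) =
      linearForm u * der (cst v) h - C (u ⬝ᵥ v) * der eul h := by
  rw [der_eq, der_eq, linearForm, Fin.sum_univ_three, dotProduct, Fin.sum_univ_three]
  simp [cross_apply, tri, cst, eul, grad]
  ring

lemma der_cst_prod {ι : Type*} {a : ι → Fin 3 → ℂ} {I : Finset ι} {v : Fin 3 → ℂ}
    (h : ∀ i ∈ I, a i ⬝ᵥ v = 0) : der (cst v) (∏ i ∈ I, linearForm (a i)) = 0 := by
  rw [der_prod_of_forall (l := fun _ => 0) fun i hi => by rw [der_cst_linearForm, h i hi]; simp]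
  simp

lemma isHomogeneous_prod {ι : Type*} (a : ι → Fin 3 → ℂ) (I : Finset ι) :
    (∏ i ∈ I, linearForm (a i)).IsHomogeneous I.card := by
  have h := IsHomogeneous.prod I (fun i => linearForm (a i)) (fun _ => 1)
    (fun i _ => linearForm_isHomogeneous _)
  simpa using h

section Criteria

variable {d : ℕ} {p : Curve d} {a : Fin d → Fin 3 → ℂ}

/-- The Jacobian syzygy which corresponds to a logarithmic vector field `θ` such that
`θ f = l f`. -/
noncomputable def toSyzygy (d : ℕ) (θ : Fin 3 → S) (l : S) : Fin 3 → S :=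
  θ - (C ((d : ℂ)⁻¹) * l) • eul

lemma toSyzygy_mem (hd : d ≠ 0) (hp : Rep p a) {θ : Fin 3 → S} {l : S}
    (h : der θ (∏ i, linearForm (a i)) = l * ∏ i, linearForm (a i)) :
    toSyzygy d θ l ∈ AR p.form := by
  have hd' : (C ((d : ℂ)⁻¹) * C (d : ℂ) : S) = 1 := by
    rw [← C_mul, inv_mul_cancel₀ (by exact_mod_cast hd), C_1]
  rw [mem_AR, toSyzygy, sub_der, smul_der, der_eul p.form_isHomogeneous]
  obtain ⟨c, -, hp⟩ := hp
  rw [hp, der_C_mul, h]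
  linear_combination -l * C c * (∏ i, linearForm (a i)) * hd'

/-- The correction is a multiple of the Euler field, which is already a row of the determinant. -/
lemma tri_toSyzygy (θ₁ θ₂ : Fin 3 → S) (l₁ l₂ : S) :
    tri eul (toSyzygy d θ₁ l₁) (toSyzygy d θ₂ l₂) = tri eul θ₁ θ₂ := by
  simp [tri, toSyzygy]
  ring

lemma isHomogeneous_toSyzygy {θ : Fin 3 → S} {l : S} {n : ℕ} (hθ : ∀ i, (θ i).IsHomogeneous n)
    (hl : ∀ i, (l * X i).IsHomogeneous n) (i : Fin 3) : (toSyzygy d θ l i).IsHomogeneous n := by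
  have h := (hθ i).sub ((isHomogeneous_C (Fin 3) ((d : ℂ)⁻¹)).mul (hl i) |> fun h => by
    rwa [zero_add, ← mul_assoc] at h)
  exact h

/-- Saito's criterion for logarithmic vector fields. -/
theorem isFreeWith_of_fields (hd : d ≠ 0) (ha : Distinct a) (hp : Rep p a) {θ₁ θ₂ : Fin 3 → S}
    {l₁ l₂ : S} {d₁ d₂ : ℕ}
    (h₁ : der θ₁ (∏ i, linearForm (a i)) = l₁ * ∏ i, linearForm (a i))
    (h₂ : der θ₂ (∏ i, linearForm (a i)) = l₂ * ∏ i, linearForm (a i))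
    (hθ₁ : ∀ i, (θ₁ i).IsHomogeneous d₁) (hl₁ : ∀ i, (l₁ * X i).IsHomogeneous d₁)
    (hθ₂ : ∀ i, (θ₂ i).IsHomogeneous d₂) (hl₂ : ∀ i, (l₂ * X i).IsHomogeneous d₂)
    (hle : d₁ ≤ d₂) (hsum : d₁ + d₂ + 1 = d) (h0 : tri eul θ₁ θ₂ ≠ 0) : IsFreeWith p d₁ d₂ :=
  isFreeWith_of_tri hd ha hp (toSyzygy_mem hd hp h₁) (toSyzygy_mem hd hp h₂)
    (isHomogeneous_toSyzygy hθ₁ hl₁) (isHomogeneous_toSyzygy hθ₂ hl₂) hle hsum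
    (by rwa [tri_toSyzygy])

theorem isNearlyFreeWith_of_fields (hd : d ≠ 0) (ha : Distinct a) (hp : Rep p a)
    {θ₀ θ₁ θ₂ : Fin 3 → S} {l₀ l₁ l₂ : S} {d₁ d₂ : ℕ}
    (h₀ : der θ₀ (∏ i, linearForm (a i)) = l₀ * ∏ i, linearForm (a i))
    (h₁ : der θ₁ (∏ i, linearForm (a i)) = l₁ * ∏ i, linearForm (a i))
    (h₂ : der θ₂ (∏ i, linearForm (a i)) = l₂ * ∏ i, linearForm (a i))
    (hθ₀ : ∀ i, (θ₀ i).IsHomogeneous d₁) (hl₀ : ∀ i, (l₀ * X i).IsHomogeneous d₁)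
    (hθ₁ : ∀ i, (θ₁ i).IsHomogeneous d₂) (hl₁ : ∀ i, (l₁ * X i).IsHomogeneous d₂)
    (hθ₂ : ∀ i, (θ₂ i).IsHomogeneous d₂) (hl₂ : ∀ i, (l₂ * X i).IsHomogeneous d₂)
    (h1 : 1 ≤ d₁) (hle : d₁ ≤ d₂) (hsum : d₁ + d₂ = d)
    {c : S} {u w v : Fin 3 → ℂ} (hc : c.IsHomogeneous (d₂ - d₁ + 1)) (huw : u ⨯₃ w ≠ 0)
    (hu : u ⬝ᵥ v = 0) (hw : w ⬝ᵥ v = 0) (hcv : eval v c ≠ 0) (hv : v ≠ 0)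
    (hrel : c • θ₀ + linearForm u • θ₁ + linearForm w • θ₂ = 0)
    (hl : c * l₀ + linearForm u * l₁ + linearForm w * l₂ = 0)
    (h0 : tri eul θ₀ θ₁ ≠ 0) : IsNearlyFreeWith p d₁ d₂ := by
  refine isNearlyFreeWith_of_relation hd ha hp
    (r := ![toSyzygy d θ₀ l₀, toSyzygy d θ₁ l₁, toSyzygy d θ₂ l₂]) ?_
    (isHomogeneous_toSyzygy hθ₀ hl₀) (isHomogeneous_toSyzygy hθ₁ hl₁)
    (isHomogeneous_toSyzygy hθ₂ hl₂) h1 hle hsum hc huw hu hw hv hcv ?_ ?_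
  · intro i
    fin_cases i
    · exact toSyzygy_mem hd hp h₀
    · exact toSyzygy_mem hd hp h₁
    · exact toSyzygy_mem hd hp h₂
  · funext i
    have hi := congrFun hrel i
    simp only [Pi.add_apply, Pi.smul_apply, smul_eq_mul, Pi.zero_apply] at hi
    -- The relation `hl` between the eigenvalues is what makes the Euler corrections satisfy the
    -- same relation as the fields.
    simp [toSyzygy]
    linear_combination hi - C ((d : ℂ)⁻¹) * eul i * hl
  · change tri eul (toSyzygy d θ₀ l₀) (toSyzygy d θ₁ l₁) ≠ 0
    rwa [tri_toSyzygy]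

end Criteria

lemma isHomogeneous_mul_X {l : S} {n : ℕ} (hl : l.IsHomogeneous n) (i : Fin 3) :
    (l * X i).IsHomogeneous (n + 1) := hl.mul (isHomogeneous_X ℂ i)

lemma isHomogeneous_mul_cst {l : S} {n : ℕ} (hl : l.IsHomogeneous n) (v : Fin 3 → ℂ)
    (i : Fin 3) : ((l • cst v) i).IsHomogeneous n := hl.mul (isHomogeneous_cst v i)

lemma isHomogeneous_tri_grad {h : S} {n : ℕ} (hh : h.IsHomogeneous n) (u w : Fin 3 → ℂ) :
    (tri (cst u) (cst w) (grad h)).IsHomogeneous (n - 1) := by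
  have h1 : ∀ i, (grad h i).IsHomogeneous (n - 1) := fun i => hh.pderiv
  simpa using isHomogeneous_tri (isHomogeneous_cst u) (isHomogeneous_cst w) h1

lemma prod_linearForm_ne {ι : Type*} {a : ι → Fin 3 → ℂ} (ha : Distinct a) (I : Finset ι) :
    ∏ i ∈ I, linearForm (a i) ≠ 0 :=
  Finset.prod_ne_zero_iff.mpr fun i _ => linearForm_ne_zero (ha.1 i)

/-! ### Arrangements with a point of high multiplicity -/

section Pencils

variable {p : Curve 6}

lemma dot_cross_of_tri {a b c : Fin 3 → ℂ} (h : tri a b c = 0) : c ⬝ᵥ (a ⨯₃ b) = 0 := by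
  rw [← tri_eq_dot, tri_cycle, h]

lemma dot_cross_ne_zero {a b c : Fin 3 → ℂ} (h : tri a b c ≠ 0) : c ⬝ᵥ (a ⨯₃ b) ≠ 0 := by
  rwa [← tri_eq_dot, tri_cycle]

/-- All lines contain `v`, so the constant field `v` kills the equation; a Koszul field in a
direction `u` with u · v ≠ 0 completes the basis. -/
theorem isFreeWith_type6 (hp : p ∈ curvesOfType type6) : IsFreeWith p 0 5 := by
  obtain ⟨a, ha, hT, hp⟩ := hp
  set v := a 0 ⨯₃ a 1 with hv
  have hdot : ∀ i, a i ⬝ᵥ v = 0 := by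
    exact forall_fin_six ⟨dot_cross_left _ _, dot_cross_right _ _,
      dot_cross_of_tri ((hT 0 1 2 (by decide) (by decide)).mpr rfl),
      dot_cross_of_tri ((hT 0 1 3 (by decide) (by decide)).mpr rfl),
      dot_cross_of_tri ((hT 0 1 4 (by decide) (by decide)).mpr rfl),
      dot_cross_of_tri ((hT 0 1 5 (by decide) (by decide)).mpr rfl)⟩
  obtain ⟨u, hu⟩ := exists_dot_ne_zero (ha.2 0 1 (by decide))
  have hu : u ⬝ᵥ v ≠ 0 := by rwa [dotProduct_comm]
  have hhom := isHomogeneous_prod a Finset.univ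
  refine isFreeWith_of_fields (by decide) ha hp (θ₁ := cst v) (l₁ := 0)
    (θ₂ := cst u ⨯₃ grad (∏ i, linearForm (a i))) (l₂ := 0) ?_ ?_ (isHomogeneous_cst v) ?_
    (isHomogeneous_cross_grad hhom u) ?_ (by decide) rfl ?_
  · rw [der_cst_prod fun i _ => hdot i, zero_mul]
  · rw [der_cross_grad_self, zero_mul]
  · intro i; rw [zero_mul]; exact isHomogeneous_zero _ _ _
  · intro i; rw [zero_mul]; exact isHomogeneous_zero _ _ _
  · rw [tri_eul_cross_grad, der_cst_prod fun i _ => hdot i, der_eul hhom]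
    simp [hu, ha.1, linearForm_ne_zero, Finset.prod_eq_zero_iff]

/-- With `h` the product of the five concurrent forms, the fields are the constant field `v`
multiplied by the sixth form, and the Koszul field of `h` that annihilates the sixth form. -/
theorem isFreeWith_type5 (hp : p ∈ curvesOfType type5) : IsFreeWith p 1 4 := by
  obtain ⟨a, ha, hT, hp⟩ := hp
  set v := a 0 ⨯₃ a 1 with hv
  set I : Finset (Fin 6) := {0, 1, 2, 3, 4} with hI
  have hdot : ∀ i ∈ I, a i ⬝ᵥ v = 0 := by
    simp only [hI, Finset.forall_mem_insert, Finset.mem_singleton, forall_eq]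
    exact ⟨dot_cross_left _ _, dot_cross_right _ _,
      dot_cross_of_tri ((hT 0 1 2 (by decide) (by decide)).mpr rfl),
      dot_cross_of_tri ((hT 0 1 3 (by decide) (by decide)).mpr rfl),
      dot_cross_of_tri ((hT 0 1 4 (by decide) (by decide)).mpr rfl)⟩
  have hs : a 5 ⬝ᵥ v ≠ 0 := dot_cross_ne_zero fun h =>
    absurd ((hT 0 1 5 (by decide) (by decide)).mp h) (by decide)
  have hhom := isHomogeneous_prod a I
  have hprod : ∏ i, linearForm (a i) = (∏ i ∈ I, linearForm (a i)) * linearForm (a 5) := by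
    simp [hI, Fin.prod_univ_six, -mul_eq_mul_right_iff]; ring
  have hne := prod_linearForm_ne ha I
  set h := ∏ i ∈ I, linearForm (a i) with hh
  have hvh : der (cst v) h = 0 := der_cst_prod hdot
  refine isFreeWith_of_fields (by decide) ha hp (θ₁ := linearForm (a 5) • cst v)
    (l₁ := C (a 5 ⬝ᵥ v)) (θ₂ := cst (a 5) ⨯₃ grad h) (l₂ := 0) ?_ ?_
    (isHomogeneous_mul_cst (linearForm_isHomogeneous _) v)
    (isHomogeneous_mul_X (isHomogeneous_C _ _))
    (isHomogeneous_cross_grad hhom _) ?_ (by decide) rfl ?_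
  · rw [hprod, smul_der, der_mul, hvh, der_cst_linearForm]
    ring
  · rw [hprod, der_mul, der_cross_grad_self, der_cross_grad]
    simp [tri, -mul_eq_zero]
    ring
  · intro i; rw [zero_mul]; exact isHomogeneous_zero _ _ _
  · have e : tri eul (linearForm (a 5) • cst v) (cst (a 5) ⨯₃ grad h) =
        linearForm (a 5) * tri eul (cst v) (cst (a 5) ⨯₃ grad h) := by
      simp only [tri, Pi.smul_apply, smul_eq_mul]; ring
    rw [e, tri_eul_cross_grad, hvh, der_eul hhom]
    simp [hs, hne, linearForm_ne_zero (ha.1 5), hI]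

theorem isFreeWith_type43 (hp : p ∈ curvesOfType type43) : IsFreeWith p 2 3 := by
  obtain ⟨a, ha, hT, hp⟩ := hp
  set v := a 0 ⨯₃ a 1 with hv
  set I : Finset (Fin 6) := {1, 2, 3} with hI
  have h0 : a 0 ⬝ᵥ v = 0 := dot_cross_left _ _
  have hdot : ∀ i ∈ I, a i ⬝ᵥ v = 0 := by
    simp only [hI, Finset.forall_mem_insert, Finset.mem_singleton, forall_eq]
    exact ⟨dot_cross_right _ _,
      dot_cross_of_tri ((hT 0 1 2 (by decide) (by decide)).mpr rfl),
      dot_cross_of_tri ((hT 0 1 3 (by decide) (by decide)).mpr rfl)⟩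
  have hs : a 4 ⬝ᵥ v ≠ 0 := dot_cross_ne_zero fun h =>
    absurd ((hT 0 1 4 (by decide) (by decide)).mp h) (by decide)
  obtain ⟨x, y, hxy⟩ := exists_comb_of_tri (a := a 5) (b := a 0) (c := a 4)
    (by rw [tri_cycle]; exact (hT 0 4 5 (by decide) (by decide)).mpr rfl) (ha.2 0 4 (by decide))
  have h5 : linearForm (a 5) = C x * linearForm (a 0) + C y * linearForm (a 4) := by
    rw [hxy, linearForm_add, linearForm_smul, linearForm_smul]
  have hhom := isHomogeneous_prod a I
  have hprod : ∏ i, linearForm (a i) =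
      (linearForm (a 0) * ∏ i ∈ I, linearForm (a i)) * (linearForm (a 4) * linearForm (a 5)) := by
    simp [hI, Fin.prod_univ_six]; ring
  have hne := prod_linearForm_ne ha I
  set k := ∏ i ∈ I, linearForm (a i) with hk
  have hvk : der (cst v) k = 0 := der_cst_prod hdot
  set h := linearForm (a 0) * k with hh
  have hvh : der (cst v) h = 0 := by
    rw [hh, der_mul, hvk, der_cst_linearForm, h0]; simp
  have hhh : h.IsHomogeneous 4 := (linearForm_isHomogeneous _).mul hhom
  have hhne : h ≠ 0 := mul_ne_zero (linearForm_ne_zero (ha.1 0)) hne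
  set T := tri (cst (a 0)) (cst (a 4)) (grad k) with hTdef
  have hTh : T.IsHomogeneous 2 := isHomogeneous_tri_grad hhom _ _
  have hT0 : tri (cst (a 0)) (cst (a 4)) (grad h) = linearForm (a 0) * T := by
    have : grad h = linearForm (a 0) • grad k + k • cst (a 0) := by
      funext i
      simp [grad, hh, pderiv_linearForm, cst]
    rw [this, hTdef]
    simp [tri]
    ring
  set s := a 4 ⬝ᵥ v with hsd
  have h5v : a 5 ⬝ᵥ v = y * s := by
    rw [hxy, add_dotProduct, smul_dotProduct, smul_dotProduct, h0]; simp [hsd]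
  refine isFreeWith_of_fields (by decide) ha hp
    (θ₁ := (linearForm (a 4) * linearForm (a 5)) • cst v)
    (l₁ := C s * linearForm (a 5) + C (y * s) * linearForm (a 4))
    (θ₂ := (C s : S) • (cst (a 4) ⨯₃ grad h) + (T * linearForm (a 4)) • cst v)
    (l₂ := C (2 * s) * T) ?_ ?_
    (isHomogeneous_mul_cst ((linearForm_isHomogeneous _).mul (linearForm_isHomogeneous _)) v)
    (isHomogeneous_mul_X ?_) ?_ (isHomogeneous_mul_X ?_) (by decide) rfl ?_
  · rw [hprod, smul_der, der_mul, der_mul, hvh, der_cst_linearForm, der_cst_linearForm, h5v]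
    ring
  · have e0 : der ((C s : S) • (cst (a 4) ⨯₃ grad h) + (T * linearForm (a 4)) • cst v)
        (linearForm (a 0)) = C s * T * linearForm (a 0) := by
      rw [add_der, smul_der, smul_der, der_cross_grad, hT0, der_cst_linearForm, h0, C_0]
      ring
    have e4 : der ((C s : S) • (cst (a 4) ⨯₃ grad h) + (T * linearForm (a 4)) • cst v)
        (linearForm (a 4)) = C s * T * linearForm (a 4) := by
      rw [add_der, smul_der, smul_der, der_cross_grad, der_cst_linearForm]
      simp [tri, ← hsd]
      ring
    have eh : der ((C s : S) • (cst (a 4) ⨯₃ grad h) + (T * linearForm (a 4)) • cst v) h = 0 := by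
      rw [add_der, smul_der (C s), smul_der (T * _), der_cross_grad_self, hvh]
      ring
    rw [hprod, der_mul, der_mul, eh, e4, h5, der_add, der_C_mul, der_C_mul, e0, e4, C_mul, map_ofNat]
    ring
  · exact (by simpa using (isHomogeneous_C _ s).mul (linearForm_isHomogeneous (a 5)) :
      (C s * linearForm (a 5)).IsHomogeneous 1).add
      (by simpa using (isHomogeneous_C _ (y * s)).mul (linearForm_isHomogeneous (a 4)))
  · intro i
    refine IsHomogeneous.add (n := 3) ?_
      (isHomogeneous_mul_cst (hTh.mul (linearForm_isHomogeneous (a 4))) v i)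
    have := (isHomogeneous_C (Fin 3) s).mul (isHomogeneous_cross_grad hhh (a 4) i)
    simpa using this
  · simpa using (isHomogeneous_C _ (2 * s)).mul hTh
  · have e : tri eul ((linearForm (a 4) * linearForm (a 5)) • cst v)
        ((C s : S) • (cst (a 4) ⨯₃ grad h) + (T * linearForm (a 4)) • cst v) =
        linearForm (a 4) * linearForm (a 5) * C s * tri eul (cst v) (cst (a 4) ⨯₃ grad h) := by
      simp only [tri, Pi.smul_apply, Pi.add_apply, smul_eq_mul]; ring
    rw [e, tri_eul_cross_grad, hvh, der_eul hhh]
    simp [hs, hhne, linearForm_ne_zero (ha.1 _), ← hsd]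

/-- With `h` the product of the four concurrent forms, the fields are v times the last two forms,
and two quartic combinations of a Koszul field of `h` with `v`. Their relation has linear
coefficients that vanish together only at the meeting point of the last two lines. -/
theorem isNearlyFreeWith_type4 (hp : p ∈ curvesOfType type4) : IsNearlyFreeWith p 2 4 := by
  obtain ⟨a', ha', hT', hp'⟩ := hp
  have hs4 : a' 4 ⬝ᵥ (a' 0 ⨯₃ a' 1) ≠ 0 := dot_cross_ne_zero fun h =>
    absurd ((hT' 0 1 4 (by decide) (by decide)).mp h) (by decide)
  have hs5 : a' 5 ⬝ᵥ (a' 0 ⨯₃ a' 1) ≠ 0 := dot_cross_ne_zero fun h =>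
    absurd ((hT' 0 1 5 (by decide) (by decide)).mp h) (by decide)
  set v := a' 0 ⨯₃ a' 1 with hv
  have hdot' : a' 0 ⬝ᵥ v = 0 ∧ a' 1 ⬝ᵥ v = 0 ∧ a' 2 ⬝ᵥ v = 0 ∧ a' 3 ⬝ᵥ v = 0 :=
    ⟨dot_cross_left _ _, dot_cross_right _ _,
      dot_cross_of_tri ((hT' 0 1 2 (by decide) (by decide)).mpr rfl),
      dot_cross_of_tri ((hT' 0 1 3 (by decide) (by decide)).mpr rfl)⟩
  -- The last two forms are scaled to take the value 1 at `v`, so that their difference `x` vanishes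
  -- at `v`.
  set a : Fin 6 → Fin 3 → ℂ := ![a' 0, a' 1, a' 2, a' 3, (a' 4 ⬝ᵥ v)⁻¹ • a' 4,
    (a' 5 ⬝ᵥ v)⁻¹ • a' 5] with hadef
  obtain ⟨c, hc0, hca⟩ : ∃ c : Fin 6 → ℂ, (∀ i, c i ≠ 0) ∧ ∀ i, a i = c i • a' i := by
    refine ⟨![1, 1, 1, 1, (a' 4 ⬝ᵥ v)⁻¹, (a' 5 ⬝ᵥ v)⁻¹], ?_, ?_⟩
    · exact forall_fin_six (by simp [hs4, hs5])
    · exact forall_fin_six (by simp [hadef])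
  have ha : Distinct a := by
    refine ⟨fun i => ?_, fun i j hij => ?_⟩
    · rw [hca]; exact smul_ne_zero (hc0 i) (ha'.1 i)
    · rw [hca, hca, map_smul, map_smul, LinearMap.smul_apply]
      exact smul_ne_zero (hc0 _) (smul_ne_zero (hc0 _) (ha'.2 i j hij))
  have hp : Rep p a := hp'.smul fun i => ⟨(c i)⁻¹, inv_ne_zero (hc0 i), by
    rw [hca, smul_smul, inv_mul_cancel₀ (hc0 i), one_smul]⟩
  set I : Finset (Fin 6) := {0, 1, 2, 3} with hI
  have hdot : ∀ i ∈ I, a i ⬝ᵥ v = 0 := by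
    simp only [hI, Finset.forall_mem_insert, Finset.mem_singleton, forall_eq]
    exact hdot'
  have h4 : a 4 ⬝ᵥ v = 1 := by
    change ((a' 4 ⬝ᵥ v)⁻¹ • a' 4) ⬝ᵥ v = 1
    rw [smul_dotProduct, smul_eq_mul, inv_mul_cancel₀ hs4]
  have h5 : a 5 ⬝ᵥ v = 1 := by
    change ((a' 5 ⬝ᵥ v)⁻¹ • a' 5) ⬝ᵥ v = 1
    rw [smul_dotProduct, smul_eq_mul, inv_mul_cancel₀ hs5]
  have hq : ∀ i ∈ I, a i ⬝ᵥ (a 4 ⨯₃ a 5) ≠ 0 := by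
    intro i hi
    rw [← tri_eq_dot, hca i, hca 4, hca 5, tri_smul]
    refine mul_ne_zero (mul_ne_zero (mul_ne_zero (hc0 _) (hc0 _)) (hc0 _)) fun h => ?_
    have hi4 : i < 4 := by clear * - hi; revert i; decide
    have := (hT' i 4 5 hi4 (by decide)).mp h
    simp [type4] at this
  have hhom := isHomogeneous_prod a I
  have hprod : ∏ i, linearForm (a i) =
      (∏ i ∈ I, linearForm (a i)) * (linearForm (a 4) * linearForm (a 5)) := by
    simp [hI, Fin.prod_univ_six]; ring
  have hne := prod_linearForm_ne ha I
  have hevh : eval (a 4 ⨯₃ a 5) (∏ i ∈ I, linearForm (a i)) ≠ 0 := by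
    rw [map_prod]
    exact Finset.prod_ne_zero_iff.mpr fun i hi => by rw [eval_linearForm]; exact hq i hi
  set h := ∏ i ∈ I, linearForm (a i) with hh
  have hvh : der (cst v) h = 0 := der_cst_prod hdot
  set x := a 4 - a 5 with hx
  have hlx : linearForm (a 4) = linearForm x + linearForm (a 5) := by
    rw [← linearForm_add, hx, sub_add_cancel]
  have hxv : x ⬝ᵥ v = 0 := by rw [hx, sub_dotProduct, h4, h5, sub_self]
  have hcx : a 5 ⨯₃ x = -(a 4 ⨯₃ a 5) := by
    rw [hx, map_sub, cross_self, sub_zero, cross_anticomm]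
  have hx0 : linearForm x ≠ 0 := linearForm_ne_zero fun h0 => by
    rw [h0, map_zero] at hcx
    exact ha.2 4 5 (by decide) (neg_eq_zero.mp hcx.symm)
  set T := tri (cst x) (cst (a 5)) (grad h) with hTdef
  have hTh : T.IsHomogeneous 3 := isHomogeneous_tri_grad hhom _ _
  have hξh := der_cross_grad_self (a 5) h
  have hξx := der_cross_grad (a 5) x h
  have hξ5 := der_cross_grad (a 5) (a 5) h
  have hξt := tri_eul_cross_grad v (a 5) h
  have hξhom := isHomogeneous_cross_grad hhom (a 5)
  rw [← hTdef] at hξx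
  have hξ5 : der (cst (a 5) ⨯₃ grad h) (linearForm (a 5)) = 0 := by
    rw [hξ5]; simp [tri]; ring
  rw [hvh, der_eul hhom, h5] at hξt
  set ξ := cst (a 5) ⨯₃ grad h with hξ
  have hv5 : der (cst v) (linearForm (a 5)) = 1 := by rw [der_cst_linearForm, h5, C_1]
  have hvx : der (cst v) (linearForm x) = 0 := by rw [der_cst_linearForm, hxv, C_0]
  have hTv : eval (a 4 ⨯₃ a 5) T ≠ 0 := by
    have e1 : eval (a 4 ⨯₃ a 5) (der eul h) = 4 * eval (a 4 ⨯₃ a 5) h := by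
      rw [der_eul hhom]; simp [hI]
    have e2 : eval (a 4 ⨯₃ a 5) T = eval (a 4 ⨯₃ a 5) (der eul h) := by
      rw [der_eq, hTdef, hx]
      simp [tri, cst, grad, cross_apply, eul]
      ring
    rw [e2, e1]
    exact mul_ne_zero (by norm_num) hevh
  have hl := linearForm_isHomogeneous
  refine isNearlyFreeWith_of_fields (by decide) ha hp (u := a 5) (w := -x) (v := a 4 ⨯₃ a 5)
    (c := -T)
    (θ₀ := (linearForm (a 4) * linearForm (a 5)) • cst v)
    (l₀ := linearForm (a 4) + linearForm (a 5))
    (θ₁ := linearForm x • ξ + (linearForm (a 5) * T) • cst v)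
    (l₁ := C 2 * T)
    (θ₂ := linearForm (a 5) • ξ - (linearForm (a 5) * T) • cst v)
    (l₂ := -T) ?_ ?_ ?_
    (isHomogeneous_mul_cst ((hl _).mul (hl _)) v) (isHomogeneous_mul_X ((hl _).add (hl _)))
    (fun i => ?_) (isHomogeneous_mul_X ?_) (fun i => ?_) (isHomogeneous_mul_X hTh.neg)
    (by decide) (by decide) rfl hTh.neg ?_ (dot_cross_right _ _) ?_ ?_ ?_ ?_ ?_ ?_
  · rw [hprod, smul_der, der_mul, der_mul, hvh, hlx, der_add, hv5, hvx]
    ring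
  · rw [hprod, der_mul, der_mul, hlx, der_add]
    simp only [add_der, smul_der, hξh, hξx, hξ5, hv5, hvx, hvh, map_ofNat]
    ring
  · rw [hprod, der_mul, der_mul, hlx, der_add]
    simp only [sub_der, smul_der, hξh, hξx, hξ5, hv5, hvx, hvh]
    ring
  · have h1 := (hl x).mul (hξhom i)
    have h2 := isHomogeneous_mul_cst ((hl (a 5)).mul hTh) v i
    exact h1.add h2
  · have := (isHomogeneous_C (Fin 3) (2 : ℂ)).mul hTh
    simpa using this
  · have h1 := (hl (a 5)).mul (hξhom i)
    have h2 := isHomogeneous_mul_cst ((hl (a 5)).mul hTh) v i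
    exact h1.sub h2
  · rw [map_neg, hcx, neg_neg]; exact ha.2 4 5 (by decide)
  · rw [neg_dotProduct, hx, sub_dotProduct, dot_cross_left, dot_cross_right]; simp
  · rw [map_neg]; exact neg_ne_zero.mpr hTv
  · exact ha.2 4 5 (by decide)
  · have : linearForm (-x) = -linearForm x := by
      rw [← neg_one_smul ℂ, linearForm_smul]; simp
    funext i
    rw [this, hlx]
    simp only [Pi.add_apply, Pi.sub_apply, Pi.smul_apply, smul_eq_mul, Pi.zero_apply]
    ring
  · have : linearForm (-x) = -linearForm x := by
      rw [← neg_one_smul ℂ, linearForm_smul]; simp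
    rw [this, hlx, map_ofNat]
    ring
  · have e : tri eul ((linearForm (a 4) * linearForm (a 5)) • cst v)
        (linearForm x • ξ + (linearForm (a 5) * T) • cst v) =
        linearForm (a 4) * linearForm (a 5) * linearForm x * tri eul (cst v) ξ := by
      simp only [tri, Pi.smul_apply, Pi.add_apply, smul_eq_mul]; ring
    rw [e, hξt]
    simp [hne, linearForm_ne_zero (ha.1 _), hx0, hI]

end Pencils

end

section

/-! ### Arrangements containing three non-concurrent lines with three triple points -/

section Coordinates

variable {u v w : Fin 3 → ℂ}

/-- The vector field with prescribed values on three independent linear forms. -/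
noncomputable def fieldOf (u v w : Fin 3 → ℂ) (f g h : S) : Fin 3 → S := fun i =>
  C ((tri u v w)⁻¹) * (f * C ((v ⨯₃ w) i) + g * C ((w ⨯₃ u) i) + h * C ((u ⨯₃ v) i))

lemma der_fieldOf (h0 : tri u v w ≠ 0) (f g h : S) :
    der (fieldOf u v w f g h) (linearForm u) = f ∧
    der (fieldOf u v w f g h) (linearForm v) = g ∧
    der (fieldOf u v w f g h) (linearForm w) = h := by
  have hD : (C ((tri u v w)⁻¹) * C (tri u v w) : S) = 1 := by
    rw [← C_mul, inv_mul_cancel₀ h0, C_1]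
  simp only [der_linearForm, fieldOf]
  generalize C ((tri u v w)⁻¹) = κ at hD
  simp [tri, cross_apply] at hD ⊢
  refine ⟨?_, ?_, ?_⟩
  · linear_combination f * hD
  · linear_combination g * hD
  · linear_combination h * hD

lemma isHomogeneous_fieldOf {f g h : S} {n : ℕ} (hf : f.IsHomogeneous n) (hg : g.IsHomogeneous n)
    (hh : h.IsHomogeneous n) (i : Fin 3) : (fieldOf u v w f g h i).IsHomogeneous n := by
  have h1 := ((hf.mul (isHomogeneous_C _ ((v ⨯₃ w) i))).add
    (hg.mul (isHomogeneous_C _ ((w ⨯₃ u) i)))).add (hh.mul (isHomogeneous_C _ ((u ⨯₃ v) i)))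
  have h2 := (isHomogeneous_C (Fin 3) ((tri u v w)⁻¹)).mul h1
  rwa [add_zero, zero_add] at h2

lemma tri_fieldOf (h0 : tri u v w ≠ 0) (f g h f' g' h' : S) :
    C (tri u v w) * tri eul (fieldOf u v w f g h) (fieldOf u v w f' g' h') =
      tri ![linearForm u, linearForm v, linearForm w] ![f, g, h] ![f', g', h'] := by
  have key : ∀ θ₁ θ₂ θ₃ : Fin 3 → S, C (tri u v w) * tri θ₁ θ₂ θ₃ =
      tri ![der θ₁ (linearForm u), der θ₁ (linearForm v), der θ₁ (linearForm w)]
        ![der θ₂ (linearForm u), der θ₂ (linearForm v), der θ₂ (linearForm w)]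
        ![der θ₃ (linearForm u), der θ₃ (linearForm v), der θ₃ (linearForm w)] := by
    intro θ₁ θ₂ θ₃
    simp [tri, der_linearForm]
    ring
  obtain ⟨e1, e2, e3⟩ := der_fieldOf h0 f g h
  obtain ⟨e1', e2', e3'⟩ := der_fieldOf h0 f' g' h'
  rw [key, e1, e2, e3, e1', e2', e3']
  simp only [der_eul_linearForm]

lemma tri_comb (x y z x' y' z' x'' y'' z'' : ℂ) (u v w : Fin 3 → ℂ) :
    tri (x • u + y • v + z • w) (x' • u + y' • v + z' • w) (x'' • u + y'' • v + z'' • w) =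
      tri ![x, y, z] ![x', y', z'] ![x'', y'', z''] * tri u v w := by
  simp [tri]
  ring

end Coordinates

/-- The arrangement `xyz(x-y)(x-z)(y-gz)` in the coordinates `u, v, w`. -/
def triangle (u v w : Fin 3 → ℂ) (g : ℂ) : Fin 6 → Fin 3 → ℂ :=
  ![u, v, w, u - v, u - w, v - g • w]

lemma smul_ne_zero_of_distinct {ι : Type*} {a : ι → Fin 3 → ℂ} (ha : Distinct a) {i j k : ι}
    (hij : i ≠ j) {x y : ℂ} (h : a i = x • a k + y • a j) : x ≠ 0 := by
  rintro rfl
  apply ha.2 i j hij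
  rw [h]
  simp

/-- The sides of the triangle can be rescaled so that the further lines through two vertices become
u - v and u - w. One parameter `g` remains for the third vertex, and the three further lines are
concurrent exactly when it is 1. -/
lemma exists_triangle {p : Curve 6} {a : Fin 6 → Fin 3 → ℂ} (ha : Distinct a) (hp : Rep p a)
    (h012 : tri (a 0) (a 1) (a 2) ≠ 0) (h013 : tri (a 0) (a 1) (a 3) = 0)
    (h024 : tri (a 0) (a 2) (a 4) = 0) (h125 : tri (a 1) (a 2) (a 5) = 0) :
    ∃ (u v w : Fin 3 → ℂ) (g : ℂ), tri u v w ≠ 0 ∧ Distinct (triangle u v w g) ∧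
      Rep p (triangle u v w g) ∧ (tri (a 3) (a 4) (a 5) = 0 ↔ g = 1) := by
  obtain ⟨x, y, h3⟩ := exists_comb_of_tri (a := a 3) (b := a 0) (c := a 1)
    (by rw [tri_cycle, h013]) (ha.2 0 1 (by decide))
  obtain ⟨x', z, h4⟩ := exists_comb_of_tri (a := a 4) (b := a 0) (c := a 2)
    (by rw [tri_cycle, h024]) (ha.2 0 2 (by decide))
  obtain ⟨y', z', h5⟩ := exists_comb_of_tri (a := a 5) (b := a 1) (c := a 2)
    (by rw [tri_cycle, h125]) (ha.2 1 2 (by decide))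
  have hx := smul_ne_zero_of_distinct ha (by decide) h3
  have hx' := smul_ne_zero_of_distinct ha (by decide) h4
  have hy' := smul_ne_zero_of_distinct ha (by decide) h5
  have hy := smul_ne_zero_of_distinct ha (i := 3) (j := 0) (k := 1) (by decide)
    (by rw [h3, add_comm])
  have hz := smul_ne_zero_of_distinct ha (i := 4) (j := 0) (k := 2) (by decide)
    (by rw [h4, add_comm])
  have hz' := smul_ne_zero_of_distinct ha (i := 5) (j := 1) (k := 2) (by decide)
    (by rw [h5, add_comm])
  set g : ℂ := -(z' * x' * y) / (z * y' * x) with hg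
  set c : Fin 6 → ℂ := ![1, -(y / x), -(z / x'), x⁻¹, x'⁻¹, -(y / (x * y'))] with hc
  have hc0 : ∀ i, c i ≠ 0 := forall_fin_six (by simp [hc, hx, hx', hy, hy', hz])
  have hca : ∀ i, triangle (a 0) (-(y / x) • a 1) (-(z / x') • a 2) g i = c i • a i := by
    refine forall_fin_six ⟨?_, ?_, ?_, ?_, ?_, ?_⟩
    · simp [triangle, hc]
    · simp [triangle, hc]
    · simp [triangle, hc]
    · change a 0 - (-(y / x)) • a 1 = x⁻¹ • a 3
      rw [h3, smul_add, smul_smul, smul_smul, inv_mul_cancel₀ hx]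
      module
    · change a 0 - (-(z / x')) • a 2 = x'⁻¹ • a 4
      rw [h4, smul_add, smul_smul, smul_smul, inv_mul_cancel₀ hx']
      module
    · change (-(y / x)) • a 1 - g • (-(z / x')) • a 2 = -(y / (x * y')) • a 5
      rw [h5, smul_add, smul_smul, smul_smul, smul_smul, hg]
      have e1 : -(y / (x * y')) * y' = -(y / x) := by field_simp
      have e2 : -(y / (x * y')) * z' =
          -(-(z' * x' * y) / (z * y' * x) * -(z / x')) := by field_simp
      rw [e1, e2]
      module
  refine ⟨a 0, -(y / x) • a 1, -(z / x') • a 2, g, ?_, ⟨fun i => ?_, fun i j hij => ?_⟩,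
    hp.smul fun i => ⟨(c i)⁻¹, inv_ne_zero (hc0 i), ?_⟩, ?_⟩
  · rw [← one_smul ℂ (a 0), tri_smul]
    simp [hx, hx', hy, hz, h012]
  · rw [hca]; exact smul_ne_zero (hc0 i) (ha.1 i)
  · rw [hca, hca, map_smul, map_smul, LinearMap.smul_apply]
    exact smul_ne_zero (hc0 _) (smul_ne_zero (hc0 _) (ha.2 i j hij))
  · rw [hca, smul_smul, inv_mul_cancel₀ (hc0 i), one_smul]
  · have e : tri (a 3) (a 4) (a 5) = (-x * z * y' - y * x' * z') * tri (a 0) (a 1) (a 2) := by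
      have h := tri_comb x y 0 x' 0 z 0 y' z' (a 0) (a 1) (a 2)
      simp only [zero_smul, add_zero, zero_add] at h
      rw [h3, h4, h5, h]
      simp [tri]
      left
      ring
    rw [e, mul_eq_zero, or_iff_left h012, hg, div_eq_one_iff_eq (by simp [hz, hy', hx])]
    constructor <;> intro h <;> linear_combination h

section Triangle

variable {p : Curve 6} {u v w : Fin 3 → ℂ} {g : ℂ}

lemma linearForm_sub (a b : Fin 3 → ℂ) : linearForm (a - b) = linearForm a - linearForm b := by
  have h := linearForm_add (a - b) b
  rw [sub_add_cancel] at h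
  rw [h, add_sub_cancel_right]

lemma prod_triangle : ∏ i, linearForm (triangle u v w g i) =
    linearForm u * linearForm v * linearForm w * (linearForm u - linearForm v) *
      (linearForm u - linearForm w) * (linearForm v - C g * linearForm w) := by
  rw [Fin.prod_univ_six]
  simp [triangle, linearForm_sub, linearForm_smul]

lemma triangle_factors_ne_zero (ha : Distinct (triangle u v w g)) :
    linearForm u ≠ 0 ∧ linearForm v ≠ 0 ∧ linearForm w ≠ 0 ∧ linearForm u - linearForm v ≠ 0 ∧
      linearForm u - linearForm w ≠ 0 ∧ linearForm v - C g * linearForm w ≠ 0 := by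
  have h : ∀ i, linearForm (triangle u v w g i) ≠ 0 := fun i => linearForm_ne_zero (ha.1 i)
  refine ⟨h 0, h 1, h 2, ?_, ?_, ?_⟩
  · rw [← linearForm_sub]; exact h 3
  · rw [← linearForm_sub]; exact h 4
  · rw [← linearForm_smul, ← linearForm_sub]; exact h 5

lemma sub_der_eq (θ : Fin 3 → S) (f g : S) : der θ (f - g) = der θ f - der θ g := by
  simp only [der_eq, map_sub]; ring

/-- In the coordinates x, y, z this is the braid arrangement. The fields with values x², y², z² and
x³, y³, z³ are tangent to it, and their determinant with the Euler field is of Vandermonde type. -/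
theorem isFreeWith_triangle (h0 : tri u v w ≠ 0) (ha : Distinct (triangle u v w 1))
    (hp : Rep p (triangle u v w 1)) : IsFreeWith p 2 3 := by
  obtain ⟨n0, n1, n2, n3, n4, n5⟩ := triangle_factors_ne_zero ha
  have hu := linearForm_isHomogeneous u
  have hv := linearForm_isHomogeneous v
  have hw := linearForm_isHomogeneous w
  have htri := tri_fieldOf h0 (linearForm u ^ 2) (linearForm v ^ 2) (linearForm w ^ 2)
    (linearForm u ^ 3) (linearForm v ^ 3) (linearForm w ^ 3)
  have hprod := prod_triangle (u := u) (v := v) (w := w) (g := 1)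
  have hdu := (der_fieldOf h0 (linearForm u ^ 2) (linearForm v ^ 2) (linearForm w ^ 2)).1
  have hdv := (der_fieldOf h0 (linearForm u ^ 2) (linearForm v ^ 2) (linearForm w ^ 2)).2.1
  have hdw := (der_fieldOf h0 (linearForm u ^ 2) (linearForm v ^ 2) (linearForm w ^ 2)).2.2
  have hdu' := (der_fieldOf h0 (linearForm u ^ 3) (linearForm v ^ 3) (linearForm w ^ 3)).1
  have hdv' := (der_fieldOf h0 (linearForm u ^ 3) (linearForm v ^ 3) (linearForm w ^ 3)).2.1
  have hdw' := (der_fieldOf h0 (linearForm u ^ 3) (linearForm v ^ 3) (linearForm w ^ 3)).2.2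
  have hθ₁ := isHomogeneous_fieldOf (u := u) (v := v) (w := w) (hu.pow 2) (hv.pow 2) (hw.pow 2)
  have hθ₂ := isHomogeneous_fieldOf (u := u) (v := v) (w := w) (hu.pow 3) (hv.pow 3) (hw.pow 3)
  generalize fieldOf u v w (linearForm u ^ 2) (linearForm v ^ 2) (linearForm w ^ 2) = θ₁ at *
  generalize fieldOf u v w (linearForm u ^ 3) (linearForm v ^ 3) (linearForm w ^ 3) = θ₂ at *
  generalize linearForm u = x at *
  generalize linearForm v = y at *
  generalize linearForm w = z at *
  refine isFreeWith_of_fields (by decide) ha hp (θ₁ := θ₁) (θ₂ := θ₂)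
    (l₁ := C 3 * (x + y + z))
    (l₂ := C 3 * (x ^ 2 + y ^ 2 + z ^ 2) + (x * y + x * z + y * z)) ?_ ?_
    hθ₁ (isHomogeneous_mul_X ?_) hθ₂ (isHomogeneous_mul_X ?_) (by decide) rfl ?_
  · rw [hprod]
    simp only [der_mul, sub_der_eq, hdu, hdv, hdw, C_1, one_mul, map_ofNat]
    ring
  · rw [hprod]
    simp only [der_mul, sub_der_eq, hdu', hdv', hdw', C_1, one_mul, map_ofNat]
    ring
  · have := (isHomogeneous_C (Fin 3) (3 : ℂ)).mul ((hu.add hv).add hw)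
    rwa [zero_add] at this
  · have h2 := (isHomogeneous_C (Fin 3) (3 : ℂ)).mul (((hu.pow 2).add (hv.pow 2)).add (hw.pow 2))
    rw [zero_add] at h2
    exact h2.add (((hu.mul hv).add (hu.mul hw)).add (hv.mul hw))
  · intro h
    rw [h, mul_zero] at htri
    have h1 : x * y * z * (x - y) * (x - z) * (y - C 1 * z) = 0 := by
      simp [tri] at htri
      rw [C_1]
      linear_combination htri
    simp only [mul_eq_zero] at h1
    tauto

/-- Three cubic fields are related by the linear forms y - x, x - z, y - gz, which have no common
zero in the plane precisely because `g ≠ 1`. -/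
theorem isNearlyFreeWith_triangle (h0 : tri u v w ≠ 0) (hg : g ≠ 1)
    (ha : Distinct (triangle u v w g)) (hp : Rep p (triangle u v w g)) :
    IsNearlyFreeWith p 3 3 := by
  obtain ⟨n0, n1, n2, n3, n4, n5⟩ := triangle_factors_ne_zero ha
  have hu := linearForm_isHomogeneous u
  have hv := linearForm_isHomogeneous v
  have hw := linearForm_isHomogeneous w
  have hprod := prod_triangle (u := u) (v := v) (w := w) (g := g)
  set x := linearForm u with hx
  set y := linearForm v with hy
  set z := linearForm w with hz
  have hgz : (C g * z).IsHomogeneous 1 := by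
    have := (isHomogeneous_C (Fin 3) g).mul hw
    rwa [zero_add] at this
  have h1 := hv.sub hu
  have h2 := hu.sub hw
  have h3 := hv.sub hgz
  have htri := tri_fieldOf h0 0 0 (-(z * (x - z) * (y - C g * z)))
    (x * (y - x) * (y - C g * z)) 0 (z * (y - x) * (y - C g * z))
  obtain ⟨au, av, aw⟩ := der_fieldOf h0 0 0 (-(z * (x - z) * (y - C g * z)))
  obtain ⟨bu, bv, bw⟩ := der_fieldOf h0 (x * (y - x) * (y - C g * z)) 0
    (z * (y - x) * (y - C g * z))
  obtain ⟨cu, cv, cw⟩ := der_fieldOf h0 (-(x * (y - x) * (x - z))) 0 0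
  have hrel : (y - x) • fieldOf u v w 0 0 (-(z * (x - z) * (y - C g * z))) +
      (x - z) • fieldOf u v w (x * (y - x) * (y - C g * z)) 0 (z * (y - x) * (y - C g * z)) +
      (y - C g * z) • fieldOf u v w (-(x * (y - x) * (x - z))) 0 0 = 0 := by
    funext i
    simp only [fieldOf, Pi.add_apply, Pi.smul_apply, smul_eq_mul, Pi.zero_apply]
    ring
  have hz3 : (0 : S).IsHomogeneous 3 := isHomogeneous_zero _ _ _
  have hθa := isHomogeneous_fieldOf (u := u) (v := v) (w := w) hz3 hz3 ((hw.mul h2).mul h3).neg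
  have hθb := isHomogeneous_fieldOf (u := u) (v := v) (w := w) ((hu.mul h1).mul h3) hz3
    ((hw.mul h1).mul h3)
  have hθc := isHomogeneous_fieldOf (u := u) (v := v) (w := w) ((hu.mul h1).mul h2).neg hz3 hz3
  rw [← hx] at au bu cu
  rw [← hy] at av bv cv
  rw [← hz] at aw bw cw
  have e2 : linearForm (u - w) = x - z := linearForm_sub u w
  have e3 : linearForm (v - g • w) = y - C g * z := by rw [linearForm_sub, linearForm_smul]
  have hdot : (v - u) ⬝ᵥ ((u - w) ⨯₃ (v - g • w)) = (g - 1) * tri u v w := by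
    rw [← tri_eq_dot]
    simp [tri]
    ring
  refine isNearlyFreeWith_of_fields (by decide) ha hp (u := u - w) (w := v - g • w)
    (v := (u - w) ⨯₃ (v - g • w)) (c := y - x)
    (θ₀ := fieldOf u v w 0 0 (-(z * (x - z) * (y - C g * z))))
    (l₀ := -((x - z) * (y - C g * z)) + z * (y - C g * z) + C g * z * (x - z))
    (θ₁ := fieldOf u v w (x * (y - x) * (y - C g * z)) 0 (z * (y - x) * (y - C g * z)))
    (l₁ := C 3 * ((y - x) * (y - C g * z)) - x * (y - C g * z) - C g * z * (y - x))
    (θ₂ := fieldOf u v w (-(x * (y - x) * (x - z))) 0 0)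
    (l₂ := -((y - x) * (x - z)) + x * (x - z) - x * (y - x))
    ?_ ?_ ?_ hθa (isHomogeneous_mul_X ?_) hθb (isHomogeneous_mul_X ?_) hθc
    (isHomogeneous_mul_X ?_) (by decide) (by decide) rfl h1 (ha.2 4 5 (by decide))
    (dot_cross_left _ _) (dot_cross_right _ _) ?_ (ha.2 4 5 (by decide)) ?_ ?_ ?_
  · rw [hprod]
    simp only [der_mul, sub_der_eq, der_C, au, av, aw]
    ring
  · rw [hprod]
    simp only [der_mul, sub_der_eq, der_C, bu, bv, bw, map_ofNat]
    ring
  · rw [hprod]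
    simp only [der_mul, sub_der_eq, der_C, cu, cv, cw]
    ring
  · exact ((h2.mul h3).neg.add (hw.mul h3)).add (hgz.mul h2)
  · have := (isHomogeneous_C (Fin 3) (3 : ℂ)).mul (h1.mul h3)
    rw [zero_add] at this
    exact (this.sub (hu.mul h3)).sub (hgz.mul h1)
  · exact ((h1.mul h2).neg.add (hu.mul h2)).sub (hu.mul h1)
  · rw [hx, hy, ← linearForm_sub, eval_linearForm, hdot]
    exact mul_ne_zero (sub_ne_zero.mpr hg) h0
  · rw [e2, e3]; exact hrel
  · rw [e2, e3, map_ofNat]; ring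
  · intro h
    have e : tri ![x, y, z] ![0, 0, -(z * (x - z) * (y - C g * z))]
        ![x * (y - x) * (y - C g * z), 0, z * (y - x) * (y - C g * z)] =
        x * y * z * (x - y) * (x - z) * (y - C g * z) * (y - C g * z) := by
      simp only [tri, Matrix.cons_val]
      ring
    rw [h, mul_zero, e] at htri
    exact mul_ne_zero (mul_ne_zero (mul_ne_zero (mul_ne_zero (mul_ne_zero (mul_ne_zero n0 n1) n2)
      n3) n4) n5) n5 htri.symm

theorem isFreeWith_type3333 (hp : p ∈ curvesOfType type3333) : IsFreeWith p 2 3 := by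
  obtain ⟨a, ha, hT, hp⟩ := hp
  obtain ⟨u, v, w, g, h0, ha', hp', hg⟩ := exists_triangle ha hp
    (fun h => absurd ((hT 0 1 2 (by decide) (by decide)).mp h) (by decide))
    ((hT 0 1 3 (by decide) (by decide)).mpr rfl) ((hT 0 2 4 (by decide) (by decide)).mpr rfl)
    ((hT 1 2 5 (by decide) (by decide)).mpr rfl)
  obtain rfl := hg.mp ((hT 3 4 5 (by decide) (by decide)).mpr rfl)
  exact isFreeWith_triangle h0 ha' hp'

theorem isNearlyFreeWith_type333 (hp : p ∈ curvesOfType type333) : IsNearlyFreeWith p 3 3 := by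
  obtain ⟨a, ha, hT, hp⟩ := hp
  obtain ⟨u, v, w, g, h0, ha', hp', hg⟩ := exists_triangle ha hp
    (fun h => absurd ((hT 0 1 2 (by decide) (by decide)).mp h) (by decide))
    ((hT 0 1 3 (by decide) (by decide)).mpr rfl) ((hT 0 2 4 (by decide) (by decide)).mpr rfl)
    ((hT 1 2 5 (by decide) (by decide)).mpr rfl)
  refine isNearlyFreeWith_triangle h0 (fun h => ?_) ha' hp'
  exact absurd ((hT 3 4 5 (by decide) (by decide)).mp (hg.mpr h)) (by decide)

end Triangle

end

section

/-! ### Exponents of free and nearly free arrangements -/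

lemma eval_zero_of_isHomogeneous {g : S} {n : ℕ} (hg : g.IsHomogeneous n) (hn : n ≠ 0) :
    eval 0 g = 0 := by
  rw [eval_zero, constantCoeff_eq]
  exact hg.coeff_eq_zero (by simpa using hn.symm)

/-- The relation between the three generators has coefficients that vanish at the origin, so three
is the minimal number of generators; a basis of two would contradict this. -/
lemma isNearlyFree_not_isFree {d : ℕ} {p : Curve d} (h : IsNearlyFree p) : ¬ IsFree p := by
  rintro ⟨-, -, -, b, -, -⟩
  obtain ⟨d₁, d₂, -, -, r, c, -, -, -, hc0, hc1, hc2, -, hex, hex'⟩ := h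
  have hr : ∀ i, r i ∈ AR p.form := fun i => by
    have := (hex' (r i)).mpr ⟨Pi.single i 1, by
      rw [Fintype.linearCombination_apply_single, one_smul]⟩
    exact this
  have hb : ∀ j, ∃ U : Fin 3 → S, Fintype.linearCombination S r U = (b j : Fin 3 → S) :=
    fun j => (hex' _).mp (b j).2
  choose U hU using hb
  have hW : ∀ i, ∃ W : Fin 2 → S, r i = ∑ j, W j • (b j : Fin 3 → S) := fun i =>
    ⟨b.repr ⟨r i, hr i⟩, by
      have := congrArg Subtype.val (b.sum_repr ⟨r i, hr i⟩)
      rw [Fin.sum_univ_two] at this ⊢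
      exact this.symm⟩
  choose W hW using hW
  have hc : ∀ k, eval 0 (c k) = 0 := by
    intro k
    obtain ⟨n, hn, hk⟩ : ∃ n, n ≠ 0 ∧ (c k).IsHomogeneous n := by
      fin_cases k
      · exact ⟨_, Nat.succ_ne_zero _, hc0⟩
      · exact ⟨1, one_ne_zero, hc1⟩
      · exact ⟨1, one_ne_zero, hc2⟩
    exact eval_zero_of_isHomogeneous hk hn
  have hker : ∀ i, ∃ m : S, m • c = Pi.single i 1 - ∑ j, W i j • U j := by
    intro i
    refine (hex _).mp ?_
    rw [map_sub, Fintype.linearCombination_apply_single, one_smul, map_sum, hW i, sub_eq_zero]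
    exact Finset.sum_congr rfl fun j _ => by rw [map_smul, hU]
  -- At the origin the identity of size 3 would factor through a space of dimension 2.
  have h1 : (Matrix.of fun i j => eval 0 (W i j)) * (Matrix.of fun j k => eval 0 (U j k)) =
      (1 : Matrix (Fin 3) (Fin 3) ℂ) := by
    ext i k
    obtain ⟨m, hm⟩ := hker i
    have h := congrArg (eval 0) (congrFun hm k)
    simp only [Pi.smul_apply, smul_eq_mul, map_mul, hc, mul_zero, Pi.sub_apply, map_sub,
      Finset.sum_apply, map_sum] at h
    rw [Matrix.mul_apply, Matrix.one_apply]
    simp only [Matrix.of_apply]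
    rw [← sub_eq_zero.mp h.symm, Pi.single_apply]
    simp only [eq_comm (a := k)]
    split_ifs <;> simp
  have h2 := Matrix.rank_mul_le_left (Matrix.of fun i j => eval 0 (W i j))
    (Matrix.of fun j k => eval 0 (U j k))
  rw [h1, Matrix.rank_one] at h2
  have h3 := h2.trans (Matrix.rank_le_width (Matrix.of fun i j => eval (0 : Fin 3 → ℂ) (W i j)))
  simp at h3

section Exponents

variable {d : ℕ} {p : Curve d} {a : Fin d → Fin 3 → ℂ}

/-- By Euler a common factor of the partial derivatives divides `f`, so if it is not a unit it is
divisible by one of the lines. Modulo that line, a suitable partial derivative is a nonzero constant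
times the product of the other forms. -/
lemma isUnit_of_dvd_grad (hd : d ≠ 0) (ha : Distinct a) (hp : Rep p a) {H : S}
    (h : ∀ k, H ∣ grad p.form k) : IsUnit H := by
  by_contra hH
  have hf : H ∣ p.form := by
    have h1 := der_eul p.form_isHomogeneous
    rw [der_eq] at h1
    have h2 : (C ((d : ℂ)⁻¹) * C (d : ℂ) : S) = 1 := by
      rw [← C_mul, inv_mul_cancel₀ (by exact_mod_cast hd), C_1]
    have h3 : H ∣ C (d : ℂ) * p.form := by
      rw [← h1]
      exact dvd_add (dvd_add ((h 0).mul_left _) ((h 1).mul_left _)) ((h 2).mul_left _)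
    have h4 := h3.mul_left (C ((d : ℂ)⁻¹))
    rwa [← mul_assoc, h2, one_mul] at h4
  have hH0 : H ≠ 0 := fun h0 => Curve.form_ne_zero p (by rwa [h0, zero_dvd_iff] at hf)
  obtain ⟨q, hq, hqH⟩ := WfDvdMonoid.exists_irreducible_factor hH hH0
  obtain ⟨c, hc, hform⟩ := hp
  have hqp : q ∣ ∏ i, linearForm (a i) := by
    have h1 := hqH.trans hf
    rw [hform] at h1
    refine (hq.prime.dvd_or_dvd h1).resolve_left fun hd => ?_
    exact hq.not_isUnit (isUnit_of_dvd_unit hd ((isUnit_iff_ne_zero.mpr hc).map (C : ℂ →+* S)))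
  obtain ⟨i, -, hi⟩ := (hq.prime.dvd_finsetProd_iff _).mp hqp
  have hpi := prime_linearForm (ha.1 i)
  have hiH : linearForm (a i) ∣ H := (hq.associated_of_dvd hpi.irreducible hi).symm.dvd.trans hqH
  rw [← Finset.mul_prod_erase _ _ (Finset.mem_univ i)] at hform
  obtain ⟨k, hk⟩ := Function.ne_iff.mp (ha.1 i)
  have h1 := hiH.trans (h k)
  rw [grad, hform, Derivation.leibniz, Derivation.leibniz, pderiv_C, pderiv_linearForm] at h1
  simp only [smul_eq_mul, mul_zero, add_zero] at h1
  have h2 : linearForm (a i) ∣ C (c * a i k) *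
      ∏ x ∈ Finset.univ.erase i, linearForm (a x) := by
    rw [mul_add, ← mul_assoc, mul_comm (C c) (linearForm (a i)), mul_assoc] at h1
    have := (dvd_add_right (dvd_mul_right _ _)).mp h1
    rw [C_mul]
    convert this using 1
    ring
  rcases hpi.dvd_or_dvd h2 with h3 | h3
  · exact hpi.not_isUnit (isUnit_of_dvd_unit h3
      ((isUnit_iff_ne_zero.mpr (mul_ne_zero hc hk)).map (C : ℂ →+* S)))
  · exact not_dvd_prod ha (Finset.notMem_erase i _) h3

lemma cross_grad_mem_AR (u : Fin 3 → ℂ) (f : S) : cst u ⨯₃ grad f ∈ AR f := by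
  rw [mem_AR, der_cross_grad_self]

/-- Each partial derivative is, up to the gradient, the cross product of two Koszul syzygies. -/
lemma exists_cross_koszul (f : S) (k : Fin 3) : ∃ u v : Fin 3 → ℂ,
    (cst u ⨯₃ grad f) ⨯₃ (cst v ⨯₃ grad f) = grad f k • grad f := by
  have key : ∀ u v : Fin 3 → ℂ, (cst u ⨯₃ grad f) ⨯₃ (cst v ⨯₃ grad f) =
      tri (cst u) (cst v) (grad f) • grad f := by
    intro u v
    funext i
    fin_cases i <;> simp [cross_apply, tri] <;> ring
  fin_cases k
  · exact ⟨![0, 1, 0], ![0, 0, 1], by rw [key]; simp [tri, cst]⟩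
  · exact ⟨![0, 0, 1], ![1, 0, 0], by rw [key]; simp [tri, cst]⟩
  · exact ⟨![1, 0, 0], ![0, 1, 0], by rw [key]; simp [tri, cst]⟩

lemma totalDegree_of_isUnit {H : S} (h : IsUnit H) : H.totalDegree = 0 := by
  rw [MvPolynomial.isUnit_iff_eq_C_of_isReduced] at h
  obtain ⟨c, -, rfl⟩ := h
  exact totalDegree_C c

/-- The Koszul syzygies are combinations of the basis, so each partial derivative is a multiple of
`H`. Hence `H` is a unit, and the degrees give the formula. -/
theorem IsFreeWith.add_eq (hd : d ≠ 0) (ha : Distinct a) (hp : Rep p a) {d₁ d₂ : ℕ}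
    (h : IsFreeWith p d₁ d₂) : d₁ + d₂ + 1 = d := by
  obtain ⟨-, b, hb₀, hb₁⟩ := h
  obtain ⟨H, hH, hHt⟩ := exists_cross_eq hd ha hp (b 0).2 (b 1).2
  have hdvd : ∀ k, H ∣ grad p.form k := by
    intro k
    obtain ⟨u, v, huv⟩ := exists_cross_koszul p.form k
    have hrep : ∀ w : Fin 3 → ℂ, ∃ s t : S, cst w ⨯₃ grad p.form =
        s • (b 0 : Fin 3 → S) + t • (b 1 : Fin 3 → S) := fun w =>
      ⟨b.repr ⟨_, cross_grad_mem_AR w p.form⟩ 0, b.repr ⟨_, cross_grad_mem_AR w p.form⟩ 1, by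
        have := congrArg Subtype.val (b.sum_repr ⟨_, cross_grad_mem_AR w p.form⟩)
        rw [Fin.sum_univ_two] at this
        exact this.symm⟩
    obtain ⟨s, t, hst⟩ := hrep u
    obtain ⟨s', t', hst'⟩ := hrep v
    have e : (s • (b 0 : Fin 3 → S) + t • (b 1 : Fin 3 → S)) ⨯₃
        (s' • (b 0 : Fin 3 → S) + t' • (b 1 : Fin 3 → S)) =
        (s * t' - t * s') • ((b 0 : Fin 3 → S) ⨯₃ (b 1 : Fin 3 → S)) := by
      funext i
      fin_cases i <;> simp [cross_apply] <;> ring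
    rw [hst, hst', e, hH, smul_smul, ← sub_eq_zero, ← sub_smul] at huv
    have := eq_zero_of_smul_grad hd huv
    exact ⟨s * t' - t * s', by linear_combination -this⟩
  have hu := isUnit_of_dvd_grad hd ha hp hdvd
  have h0 : tri eul (b 0 : Fin 3 → S) (b 1 : Fin 3 → S) ≠ 0 := by
    rw [hHt]
    exact mul_ne_zero (mul_ne_zero (by simpa using hd) hu.ne_zero) (Curve.form_ne_zero p)
  have := totalDegree_of_tri hd hHt hb₀ hb₁ h0
  rw [totalDegree_of_isUnit hu] at this
  omega

lemma cross_comb_three {R : Type*} [CommRing R] (s t : Fin 3 → R) (r₀ r₁ r₂ : Fin 3 → R) :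
    (s 0 • r₀ + s 1 • r₁ + s 2 • r₂) ⨯₃ (t 0 • r₀ + t 1 • r₁ + t 2 • r₂) =
      (s ⨯₃ t) 0 • (r₁ ⨯₃ r₂) + (s ⨯₃ t) 1 • (r₂ ⨯₃ r₀) + (s ⨯₃ t) 2 • (r₀ ⨯₃ r₁) := by
  funext i
  fin_cases i <;> simp [cross_apply] <;> ring

/-- The three factors H₀, H₁, H₂ form a relation between the generators, so they are `e` times `c`;
as they generate an ideal containing the partial derivatives, `e` is a unit. The degree is read off
from a nonzero linear coefficient of `c`. -/
theorem IsNearlyFreeWith.add_eq (hd : d ≠ 0) (ha : Distinct a) (hp : Rep p a) {d₁ d₂ : ℕ}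
    (h : IsNearlyFreeWith p d₁ d₂) : d₁ + d₂ = d := by
  obtain ⟨-, -, r, c, hr0, hr1, hr2, hc0, hc1, hc2, -, hex, hex'⟩ := h
  have hr : ∀ i, r i ∈ AR p.form := fun i => (hex' (r i)).mpr ⟨Pi.single i 1, by
    rw [Fintype.linearCombination_apply_single, one_smul]⟩
  obtain ⟨H₂, hH₂, hHt₂⟩ := exists_cross_eq hd ha hp (hr 0) (hr 1)
  obtain ⟨H₁, hH₁, hHt₁⟩ := exists_cross_eq hd ha hp (hr 2) (hr 0)
  obtain ⟨H₀, hH₀, -⟩ := exists_cross_eq hd ha hp (hr 1) (hr 2)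
  have hmem : ∀ k, ∃ m : Fin 3 → S, grad p.form k = m 0 * H₀ + m 1 * H₁ + m 2 * H₂ := by
    intro k
    obtain ⟨u, v, huv⟩ := exists_cross_koszul p.form k
    obtain ⟨s, hs⟩ := (hex' _).mp (cross_grad_mem_AR u p.form)
    obtain ⟨t, ht⟩ := (hex' _).mp (cross_grad_mem_AR v p.form)
    rw [← hs, ← ht, linearCombination_three, linearCombination_three, cross_comb_three, hH₀, hH₁,
      hH₂, smul_smul, smul_smul, smul_smul, ← add_smul, ← add_smul, ← sub_eq_zero,
      ← sub_smul] at huv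
    exact ⟨s ⨯₃ t, by linear_combination -(eq_zero_of_smul_grad hd huv)⟩
  have hsum : Fintype.linearCombination S r ![H₀, H₁, H₂] = 0 := by
    rw [linearCombination_three]
    set g : Fin 3 → S := ![H₀, H₁, H₂] with hg
    have e0 := comb_cross_zero g (r 0) (r 1) (r 2)
    have e1 := comb_cross_one g (r 0) (r 1) (r 2)
    have e2 := comb_cross_two g (r 0) (r 1) (r 2)
    rw [hH₁, hH₂, smul_smul, smul_smul, ← sub_smul,
      show g 2 * H₁ - g 1 * H₂ = 0 by simp [hg]; ring, zero_smul] at e0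
    rw [hH₀, hH₂, smul_smul, smul_smul, ← sub_smul,
      show g 0 * H₂ - g 2 * H₀ = 0 by simp [hg]; ring, zero_smul] at e1
    rw [hH₀, hH₁, smul_smul, smul_smul, ← sub_smul,
      show g 1 * H₀ - g 0 * H₁ = 0 by simp [hg]; ring, zero_smul] at e2
    -- The combination is parallel to all three generators; if it were nonzero, all the factors
    -- would vanish, and so would the gradient.
    by_contra hne
    have hc : ∀ {s t : Fin 3 → S} {H : S}, (g 0 • r 0 + g 1 • r 1 + g 2 • r 2) ⨯₃ s = 0 →
        (g 0 • r 0 + g 1 • r 1 + g 2 • r 2) ⨯₃ t = 0 → s ⨯₃ t = H • grad p.form → H = 0 := by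
      intro s t H hs ht hst
      by_contra hH
      refine hne (eq_zero_of_cross hs ht fun h => hH ?_)
      rw [h] at hst
      exact eq_zero_of_smul_grad hd hst.symm
    obtain ⟨k, hk⟩ := grad_ne_zero hd p
    obtain ⟨m, hm⟩ := hmem k
    rw [hc e1 e2 hH₀, hc e2 e0 hH₁, hc e0 e1 hH₂] at hm
    exact hk (by rw [hm]; ring)
  obtain ⟨e, he⟩ := (hex _).mp hsum
  have he0 : H₀ = e * c 0 := (congrFun he 0).symm
  have he1 : H₁ = e * c 1 := (congrFun he 1).symm
  have he2 : H₂ = e * c 2 := (congrFun he 2).symm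
  have hu : IsUnit e := by
    refine isUnit_of_dvd_grad hd ha hp fun k => ?_
    obtain ⟨m, hm⟩ := hmem k
    exact ⟨m 0 * c 0 + m 1 * c 1 + m 2 * c 2, by rw [hm, he0, he1, he2]; ring⟩
  have key : ∀ {s t : Fin 3 → S} {n m : ℕ} {l : S}, l.IsHomogeneous 1 → l ≠ 0 →
      tri eul s t = C (d : ℂ) * (e * l) * p.form → (∀ i, (s i).IsHomogeneous n) →
      (∀ i, (t i).IsHomogeneous m) → n + m = d := by
    intro s t n m l hl hl0 hst hs ht
    have h0 : tri eul s t ≠ 0 := by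
      rw [hst]
      exact mul_ne_zero (mul_ne_zero (by simpa using hd) (mul_ne_zero hu.ne_zero hl0))
        (Curve.form_ne_zero p)
    have := totalDegree_of_tri hd hst hs ht h0
    rw [totalDegree_mul_of_isDomain hu.ne_zero hl0, totalDegree_of_isUnit hu,
      hl.totalDegree hl0] at this
    omega
  by_cases h2 : c 2 = 0
  · by_cases h1 : c 1 = 0
    -- If both linear coefficients vanished, the first generator would be zero and the first unit
    -- vector a multiple of `c`, although `c` vanishes at the origin.
    · exfalso
      have hrel := (hex c).mpr ⟨1, by simp⟩
      rw [linearCombination_three, h1, h2, zero_smul, zero_smul, add_zero, add_zero] at hrel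
      have hr0 : r 0 = 0 := by
        refine (smul_eq_zero.mp hrel).resolve_left fun h0 => ?_
        obtain ⟨k, hk⟩ := grad_ne_zero hd p
        obtain ⟨m, hm⟩ := hmem k
        rw [he0, he1, he2, h0, h1, h2] at hm
        exact hk (by rw [hm]; ring)
      obtain ⟨m, hm⟩ := (hex (Pi.single 0 1)).mp (by
        rw [Fintype.linearCombination_apply_single, hr0, smul_zero])
      have h3 := congrArg (eval 0) (congrFun hm 0)
      simp [eval_zero_of_isHomogeneous hc0 (Nat.succ_ne_zero _), -eval_zero] at h3
    · rw [he1] at hHt₁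
      rw [add_comm]
      exact key hc1 h1 hHt₁ hr2 hr0
  · rw [he2] at hHt₂
    exact key hc2 h2 hHt₂ hr0 hr1

end Exponents

end

section

/-! ### Bounds for the number of Jacobian syzygies of small degree -/

lemma homogeneousComponent_succ_mul {L : S} (hL : L.IsHomogeneous 1) (A : S) (n : ℕ) :
    homogeneousComponent (n + 1) (A * L) = homogeneousComponent n A * L := by
  have h : ∀ i, homogeneousComponent (n + 1) (homogeneousComponent i A * L) =
      if i = n then homogeneousComponent i A * L else 0 := by
    intro i
    rw [homogeneousComponent_of_mem ((homogeneousComponent_isHomogeneous i A).mul hL)]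
    simp only [Nat.add_right_cancel_iff, eq_comm]
  conv_lhs => rw [← sum_homogeneousComponent A, Finset.sum_mul, map_sum]
  simp_rw [h]
  rw [Finset.sum_ite_eq']
  split_ifs with hn
  · rfl
  · rw [homogeneousComponent_eq_zero n A (by simpa [Nat.lt_succ_iff] using hn), zero_mul]

lemma isHomogeneous_of_mul {L q : S} {n : ℕ} (hL : L.IsHomogeneous 1) (hL0 : L ≠ 0)
    (h : (L * q).IsHomogeneous (n + 1)) : q.IsHomogeneous n := by
  have h1 := homogeneousComponent_succ_mul hL q n
  rw [mul_comm q, homogeneousComponent_eq_self h, mul_comm L] at h1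
  rw [mul_right_cancel₀ hL0 h1]
  exact homogeneousComponent_isHomogeneous n q

lemma restrictLine_eq_zero {G : S} {n : ℕ} (hG : G.IsHomogeneous n) {v : Fin 3 → ℂ}
    (h : eval v G = 0) : restrictLine v G = 0 := by
  refine Polynomial.funext fun t => ?_
  rw [eval_restrictLine, Polynomial.eval_zero]
  rw [eval_smul_of_isHomogeneous hG, h, mul_zero]

lemma exists_isHomogeneous_eq {u w v : Fin 3 → ℂ} (h : u ⨯₃ w ≠ 0) (hv : v ≠ 0)
    (hu : u ⬝ᵥ v = 0) (hw : w ⬝ᵥ v = 0) {G : S} {n : ℕ} (hG : G.IsHomogeneous (n + 1))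
    (h0 : restrictLine v G = 0) :
    ∃ A B : S, A.IsHomogeneous n ∧ B.IsHomogeneous n ∧
      G = A * linearForm u + B * linearForm w := by
  obtain ⟨A, B, hAB⟩ := exists_eq_of_restrictLine h hv hu hw h0
  refine ⟨homogeneousComponent n A, homogeneousComponent n B,
    homogeneousComponent_isHomogeneous n A, homogeneousComponent_isHomogeneous n B, ?_⟩
  rw [← homogeneousComponent_succ_mul (linearForm_isHomogeneous u),
    ← homogeneousComponent_succ_mul (linearForm_isHomogeneous w), ← map_add, ← hAB,
    homogeneousComponent_eq_self hG]

/-! ### Fields tangent to an arrangement, and removal of one line. -/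

section Deletion

variable {ι : Type*} {a : ι → Fin 3 → ℂ}

/-- A form which vanishes at the points of a line cut out by some other lines. -/
lemma exists_eq_of_vanish {h : Fin 3 → ℂ} (J : Finset ι) (hJ : ∀ j ∈ J, a j ⨯₃ h ≠ 0)
    (hJ' : ∀ i ∈ J, ∀ j ∈ J, i ≠ j → tri (a i) (a j) h ≠ 0) {G : S} {m : ℕ}
    (hG : G.IsHomogeneous m) (hv : ∀ j ∈ J, eval (a j ⨯₃ h) G = 0) :
    linearForm h ∣ G ∨ J.card ≤ m ∧ ∃ A B : S, B.IsHomogeneous (m - J.card) ∧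
      G = A * linearForm h + B * ∏ j ∈ J, linearForm (a j) := by
  classical
  induction J using Finset.induction_on with
  | empty => exact Or.inr ⟨Nat.zero_le m, 0, G, by simpa using hG, by simp⟩
  | insert j J hj ih =>
    have hmem : ∀ {i}, i ∈ J → i ∈ insert j J := fun hi => Finset.mem_insert_of_mem hi
    have hjm := Finset.mem_insert_self j J
    rcases ih (fun i hi => hJ i (hmem hi)) (fun i hi k hk => hJ' i (hmem hi) k (hmem hk))
      (fun i hi => hv i (hmem hi)) with hd | ⟨hcard, A, B, hB, hAB⟩
    · exact Or.inl hd
    have hv0 : a j ⨯₃ h ≠ 0 := hJ j hjm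
    -- At the new point `h` vanishes and the earlier forms do not, so the cofactor `B` must vanish;
    -- it lies in the ideal of the two forms, and its degree drops by one.
    have hBv : eval (a j ⨯₃ h) B = 0 := by
      have h1 := hv j hjm
      rw [hAB, map_add, map_mul, map_mul, eval_linearForm, dot_cross_right, mul_zero, zero_add,
        map_prod] at h1
      refine (mul_eq_zero.mp h1).resolve_right (Finset.prod_ne_zero_iff.mpr fun i hi => ?_)
      rw [eval_linearForm, ← tri_eq_dot]
      exact hJ' i (hmem hi) j hjm fun e => hj (e ▸ hi)
    have hBr := restrictLine_eq_zero hB hBv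
    rw [Finset.card_insert_of_notMem hj, Finset.prod_insert hj]
    rcases Nat.eq_zero_or_pos (m - J.card) with h0 | hpos
    · left
      rw [h0] at hB
      obtain ⟨b, rfl⟩ : ∃ b, B = C b :=
        ⟨_, totalDegree_eq_zero_iff_eq_C.mp (Nat.le_zero.mp hB.totalDegree_le)⟩
      rw [eval_C] at hBv
      exact ⟨A, by rw [hAB, hBv, C_0]; ring⟩
    · right
      obtain ⟨n, hn⟩ := Nat.exists_eq_succ_of_ne_zero hpos.ne'
      rw [hn] at hB
      obtain ⟨A', B', -, hB', hAB'⟩ := exists_isHomogeneous_eq (u := h) (w := a j)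
        (fun h1 => hv0 (by rw [← neg_eq_zero, cross_anticomm, h1])) hv0 (dot_cross_right _ _)
        (dot_cross_left _ _) hB hBr
      refine ⟨by omega, A + A' * ∏ i ∈ J, linearForm (a i), B', ?_, ?_⟩
      · rwa [show m - (J.card + 1) = n by omega]
      · rw [hAB, hAB']; ring

/-- The homogeneous vector fields which are tangent to a family of lines. -/
def Tangent (a : ι → Fin 3 → ℂ) (I : Finset ι) (k : ℕ) (θ : Fin 3 → S) : Prop :=
  (∀ i, (θ i).IsHomogeneous k) ∧ ∀ i ∈ I, linearForm (a i) ∣ der θ (linearForm (a i))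

lemma Tangent.sub_smul {I : Finset ι} {k : ℕ} {θ η : Fin 3 → S} (hθ : Tangent a I k θ)
    (hη : Tangent a I k η) (c : ℂ) : Tangent a I k (θ - (C c : S) • η) := by
  refine ⟨fun i => (hθ.1 i).sub ?_, fun i hi => ?_⟩
  · have := (isHomogeneous_C (Fin 3) c).mul (hη.1 i)
    rwa [zero_add] at this
  · rw [sub_der, smul_der]
    exact dvd_sub (hθ.2 i hi) ((hη.2 i hi).mul_left _)

/-- The difference of a vector field and the Euler field, measured in a frame. -/
noncomputable def crossValue (u w : Fin 3 → ℂ) (θ : Fin 3 → S) : S :=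
  linearForm u * der θ (linearForm w) - linearForm w * der θ (linearForm u)

lemma crossValue_sub_smul (u w : Fin 3 → ℂ) (θ η : Fin 3 → S) (c : S) :
    crossValue u w (θ - c • η) = crossValue u w θ - c * crossValue u w η := by
  simp only [crossValue, sub_der, smul_der]
  ring

lemma isHomogeneous_der_linearForm {θ : Fin 3 → S} {k : ℕ} (hθ : ∀ i, (θ i).IsHomogeneous k)
    (b : Fin 3 → ℂ) : (der θ (linearForm b)).IsHomogeneous k := by
  have h : ∀ i, (C (b i) * θ i).IsHomogeneous k := fun i => by
    have := (isHomogeneous_C (Fin 3) (b i)).mul (hθ i)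
    rwa [zero_add] at this
  rw [der_linearForm]
  exact ((h 0).add (h 1)).add (h 2)

lemma isHomogeneous_crossValue {θ : Fin 3 → S} {k : ℕ} (hθ : ∀ i, (θ i).IsHomogeneous k)
    (u w : Fin 3 → ℂ) : (crossValue u w θ).IsHomogeneous (1 + k) :=
  ((linearForm_isHomogeneous u).mul (isHomogeneous_der_linearForm hθ w)).sub
    ((linearForm_isHomogeneous w).mul (isHomogeneous_der_linearForm hθ u))

/-- At the meeting point of two lines to which the field is tangent, its value is proportional to
the position vector. -/
lemma eval_crossValue {b h : Fin 3 → ℂ} (hbh : b ⨯₃ h ≠ 0) {θ : Fin 3 → S}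
    (hb : linearForm b ∣ der θ (linearForm b)) (hh : linearForm h ∣ der θ (linearForm h))
    (u w : Fin 3 → ℂ) : eval (b ⨯₃ h) (crossValue u w θ) = 0 := by
  set v := b ⨯₃ h with hv
  set T : Fin 3 → ℂ := fun i => eval v (θ i) with hT
  have hder : ∀ c, eval v (der θ (linearForm c)) = c ⬝ᵥ T := fun c => by
    rw [der_linearForm, dotProduct, Fin.sum_univ_three]
    simp [hT]
  have hz : ∀ c, c ⬝ᵥ v = 0 → linearForm c ∣ der θ (linearForm c) → c ⬝ᵥ T = 0 := by
    rintro c hc ⟨q, hq⟩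
    rw [← hder, hq, map_mul, eval_linearForm, hc, zero_mul]
  obtain ⟨t, ht⟩ := (cross_eq_zero_iff hbh).mp
    (cross_cross_eq_zero (hz b (dot_cross_left _ _) hb) (hz h (dot_cross_right _ _) hh))
  rw [crossValue, map_sub, map_mul, map_mul, hder, hder, eval_linearForm, eval_linearForm, ht,
    dotProduct_smul, dotProduct_smul]
  simp only [smul_eq_mul]
  ring

/-- The hypotheses say that, along the plane of `h`, the field is parallel to the Euler field. After
a multiple of the latter is subtracted, every component is divisible by `h`. -/
lemma exists_eq_eul_add {h u w : Fin 3 → ℂ} (h0 : tri h u w ≠ 0) {θ : Fin 3 → S} {k : ℕ}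
    (hθ : ∀ i, (θ i).IsHomogeneous (k + 1)) (hh : linearForm h ∣ der θ (linearForm h))
    (hc : linearForm h ∣ crossValue u w θ) : ∃ (g : S) (θ' : Fin 3 → S),
      (∀ i, (θ' i).IsHomogeneous k) ∧ θ = g • eul + linearForm h • θ' := by
  have hw0 : w ⬝ᵥ (h ⨯₃ u) ≠ 0 := dot_cross_ne_zero h0
  have hhu : h ⨯₃ u ≠ 0 := fun h1 => hw0 (by rw [h1, dotProduct_zero])
  have hhp := prime_linearForm (ne_zero_of_cross_left hhu)
  obtain ⟨q, hq⟩ := hc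
  have hr : restrictLine (h ⨯₃ u) (der θ (linearForm u)) = 0 := by
    have h1 := congrArg (restrictLine (h ⨯₃ u)) hq
    rw [crossValue, map_sub, map_mul, map_mul, map_mul,
      restrictLine_linearForm (dot_cross_left h u), restrictLine_linearForm (dot_cross_right h u),
      zero_mul, zero_mul, zero_sub, neg_eq_zero] at h1
    refine (mul_eq_zero.mp h1).resolve_left fun h2 => hw0 ?_
    have h3 := eval_restrictLine (h ⨯₃ u) 1 (linearForm w)
    rw [h2, one_smul, eval_linearForm] at h3
    simpa using h3.symm
  obtain ⟨g, A, hg, -, hgA⟩ := exists_isHomogeneous_eq (u := u) (w := h)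
    (fun h1 => hhu (by rw [← neg_eq_zero, cross_anticomm, h1])) hhu (dot_cross_right _ _)
    (dot_cross_left _ _) (isHomogeneous_der_linearForm hθ u) hr
  have hwd : linearForm h ∣ der θ (linearForm w) - g * linearForm w := by
    have h1 : linearForm h ∣ linearForm u * (der θ (linearForm w) - g * linearForm w) := by
      refine ⟨q + linearForm w * A, ?_⟩
      rw [crossValue, hgA] at hq
      linear_combination hq
    exact (hhp.dvd_or_dvd h1).resolve_left (linearForm_not_dvd hhu)
  have hcomp : ∀ i, linearForm h ∣ (θ - g • eul) i := by
    intro i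
    have key : C (tri h u w) * (θ - g • eul) i =
        der (θ - g • eul) (linearForm h) * C ((u ⨯₃ w) i) +
        der (θ - g • eul) (linearForm u) * C ((w ⨯₃ h) i) +
        der (θ - g • eul) (linearForm w) * C ((h ⨯₃ u) i) := by
      simp only [der_linearForm]
      generalize θ - g • eul = η
      fin_cases i <;> simp [tri, cross_apply] <;> ring
    have h1 : linearForm h ∣ C (tri h u w) * (θ - g • eul) i := by
      rw [key]
      refine dvd_add (dvd_add (Dvd.dvd.mul_right ?_ _) (Dvd.dvd.mul_right ?_ _))
        (Dvd.dvd.mul_right ?_ _)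
      · rw [sub_der, smul_der, der_eul_linearForm]
        exact dvd_sub hh (dvd_mul_left _ _)
      · rw [sub_der, smul_der, der_eul_linearForm, hgA, add_sub_cancel_left]
        exact dvd_mul_left _ _
      · rw [sub_der, smul_der, der_eul_linearForm]
        exact hwd
    refine (hhp.dvd_or_dvd h1).resolve_left fun hd => hhp.not_isUnit ?_
    exact isUnit_of_dvd_unit hd ((isUnit_iff_ne_zero.mpr h0).map (C : ℂ →+* S))
  choose θ' hθ' using hcomp
  refine ⟨g, θ', fun i => isHomogeneous_of_mul (linearForm_isHomogeneous h) hhp.ne_zero ?_, ?_⟩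
  · rw [← hθ' i]
    exact (hθ i).sub (hg.mul (isHomogeneous_X ℂ i))
  · funext i
    rw [Pi.add_apply, Pi.smul_apply (linearForm h), smul_eq_mul, ← hθ' i]
    simp

/-- Any `n + 1` homogeneous vector fields of degree `k` tangent to the given lines are linearly
dependent modulo the multiples of the Euler field. -/
def Dependent (a : ι → Fin 3 → ℂ) (I : Finset ι) (k n : ℕ) : Prop :=
  ∀ θ : Fin (n + 1) → Fin 3 → S, (∀ j, Tangent a I k (θ j)) →
    ∃ κ : Fin (n + 1) → ℂ, κ ≠ 0 ∧ ∃ g : S, ∑ j, (C (κ j) : S) • θ j = g • eul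

lemma exists_frame {h : Fin 3 → ℂ} (h0 : h ≠ 0) : ∃ u w, tri h u w ≠ 0 := by
  obtain ⟨k, hk⟩ := Function.ne_iff.mp h0
  fin_cases k
  · exact ⟨![0, 1, 0], ![0, 0, 1], by simpa [tri] using hk⟩
  · exact ⟨![0, 0, 1], ![1, 0, 0], by simpa [tri] using hk⟩
  · exact ⟨![1, 0, 0], ![0, 1, 0], by simpa [tri] using hk⟩

/-- A constant field tangent to two lines is a multiple of their meeting point. -/
lemma dependent_zero (ha : Distinct a) {I : Finset ι} {i j : ι} (hi : i ∈ I) (hj : j ∈ I)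
    (hij : i ≠ j) : Dependent a I 0 1 := by
  intro θ hθ
  have h1 : ∀ l, ∃ c : Fin 3 → ℂ, θ l = cst c := by
    intro l
    have : ∀ m, ∃ c, θ l m = C c := fun m =>
      ⟨_, totalDegree_eq_zero_iff_eq_C.mp (Nat.le_zero.mp ((hθ l).1 m).totalDegree_le)⟩
    choose c hc using this
    exact ⟨c, funext hc⟩
  choose c hc using h1
  have h2 : ∀ l, ∀ m ∈ I, a m ⬝ᵥ c l = 0 := by
    intro l m hm
    have h := (hθ l).2 m hm
    rw [hc l, der_cst_linearForm] at h
    by_contra h0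
    exact (prime_linearForm (ha.1 m)).not_isUnit
      (isUnit_of_dvd_unit h ((isUnit_iff_ne_zero.mpr h0).map (C : ℂ →+* S)))
  have h3 : ∀ l, ∃ t : ℂ, c l = t • (a i ⨯₃ a j) := fun l =>
    (cross_eq_zero_iff (ha.2 i j hij)).mp (cross_cross_eq_zero (h2 l i hi) (h2 l j hj))
  choose t ht using h3
  have hsum : ∀ κ : Fin 2 → ℂ, κ 0 * t 0 + κ 1 * t 1 = 0 →
      ∑ l, (C (κ l) : S) • θ l = (0 : S) • eul := by
    intro κ hκ
    rw [Fin.sum_univ_two, zero_smul]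
    funext m
    have : κ 0 * c 0 m + κ 1 * c 1 m = 0 := by
      rw [ht 0, ht 1]
      simp only [Pi.smul_apply, smul_eq_mul]
      linear_combination (a i ⨯₃ a j) m * hκ
    rw [hc 0, hc 1]
    simp only [Pi.add_apply, Pi.smul_apply, cst, smul_eq_mul, Pi.zero_apply]
    rw [← C_mul, ← C_mul, ← C_add, this, C_0]
  by_cases h0 : t 0 = 0
  · exact ⟨![1, 0], fun h => one_ne_zero (congrFun h 0), 0, hsum _ (by simp [h0])⟩
  · refine ⟨![t 1, -t 0], fun h => h0 ?_, 0, hsum _ (by simp; ring)⟩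
    simpa using congrFun h 1

variable [DecidableEq ι]

/-- Modulo the Euler field, which is tangent to every line, the fields can be divided by the form of
`H`. The quotients have one degree less and remain tangent to the other lines. -/
lemma Dependent.of_dvd (ha : Distinct a) {I : Finset ι} {H : ι} (hH : H ∉ I) {k n : ℕ}
    (hI : Dependent a I k n) {u w : Fin 3 → ℂ} (h0 : tri (a H) u w ≠ 0)
    {θ : Fin (n + 1) → Fin 3 → S} (hθ : ∀ j, Tangent a (insert H I) (k + 1) (θ j))
    (hc : ∀ j, linearForm (a H) ∣ crossValue u w (θ j)) :
    ∃ κ : Fin (n + 1) → ℂ, κ ≠ 0 ∧ ∃ g : S, ∑ j, (C (κ j) : S) • θ j = g • eul := by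
  have h1 := fun j => exists_eq_eul_add h0 (hθ j).1
    ((hθ j).2 H (Finset.mem_insert_self H I)) (hc j)
  choose g θ' hθ' hg using h1
  obtain ⟨κ, hκ, e, he⟩ := hI θ' fun j => by
    refine ⟨hθ' j, fun i hi => ?_⟩
    have h2 := (hθ j).2 i (Finset.mem_insert_of_mem hi)
    rw [hg j, add_der, smul_der, smul_der, der_eul_linearForm] at h2
    have h3 := (dvd_add_right (dvd_mul_left (linearForm (a i)) (g j))).mp h2
    exact ((prime_linearForm (ha.1 i)).dvd_or_dvd h3).resolve_left
      (not_dvd_of_distinct ha fun h => hH (h ▸ hi))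
  refine ⟨κ, hκ, ∑ j, C (κ j) * g j + linearForm (a H) * e, ?_⟩
  rw [add_smul, mul_smul, ← he, Finset.smul_sum, Finset.sum_smul, ← Finset.sum_add_distrib]
  refine Finset.sum_congr rfl fun j _ => ?_
  conv_lhs => rw [hg j]
  rw [smul_add, smul_smul, smul_smul, smul_smul, mul_comm (linearForm (a H))]

/-- Deletion of a line which meets the others in many points. -/
theorem Dependent.of_deletion (ha : Distinct a) {I J : Finset ι} {H : ι} (hH : H ∉ I) (hJI : J ⊆ I)
    (hJ : ∀ i ∈ J, ∀ j ∈ J, i ≠ j → tri (a i) (a j) (a H) ≠ 0) {k n : ℕ}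
    (hcard : k + 3 ≤ J.card) (hI : Dependent a I k n) : Dependent a (insert H I) (k + 1) n := by
  intro θ hθ
  obtain ⟨u, w, h0⟩ := exists_frame (ha.1 H)
  refine hI.of_dvd ha hH h0 hθ fun j => ?_
  have hJH : ∀ i ∈ J, a i ⨯₃ a H ≠ 0 := fun i hi => ha.2 i H fun h => hH (hJI (h ▸ hi))
  -- The cross value has degree `k + 2` and vanishes at `k + 3` or more points of the line `H`, so
  -- it is divisible by the form of `H`.
  rcases exists_eq_of_vanish J hJH hJ (isHomogeneous_crossValue (hθ j).1 u w) fun i hi =>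
    eval_crossValue (hJH i hi) ((hθ j).2 i (Finset.mem_insert_of_mem (hJI hi)))
      ((hθ j).2 H (Finset.mem_insert_self H I)) u w with hd | ⟨hle, -⟩
  · exact hd
  · omega

/-- Deletion of a line which meets the others in one point less. -/
theorem Dependent.of_deletion_succ (ha : Distinct a) {I J : Finset ι} {H : ι} (hH : H ∉ I)
    (hJI : J ⊆ I) (hJ : ∀ i ∈ J, ∀ j ∈ J, i ≠ j → tri (a i) (a j) (a H) ≠ 0) {k n : ℕ}
    (hcard : k + 2 = J.card) (hI : Dependent a I k n) :
    Dependent a (insert H I) (k + 1) (n + 1) := by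
  intro θ hθ
  obtain ⟨u, w, h0⟩ := exists_frame (ha.1 H)
  have hJH : ∀ i ∈ J, a i ⨯₃ a H ≠ 0 := fun i hi => ha.2 i H fun h => hH (hJI (h ▸ hi))
  -- With only `k + 2` points there remains, modulo the form of `H`, a constant multiple `b` of one
  -- fixed product. One field serves to eliminate this constant from the others, which costs one in
  -- the bound.
  have hφ : ∀ j, ∃ (A : S) (b : ℂ), crossValue u w (θ j) =
      A * linearForm (a H) + C b * ∏ i ∈ J, linearForm (a i) := by
    intro j
    rcases exists_eq_of_vanish J hJH hJ (isHomogeneous_crossValue (hθ j).1 u w) fun i hi =>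
      eval_crossValue (hJH i hi) ((hθ j).2 i (Finset.mem_insert_of_mem (hJI hi)))
        ((hθ j).2 H (Finset.mem_insert_self H I)) u w with ⟨A, hA⟩ | ⟨-, A, B, hB, hAB⟩
    · exact ⟨A, 0, by rw [hA, C_0]; ring⟩
    · rw [show 1 + (k + 1) - J.card = 0 by omega] at hB
      obtain ⟨b, rfl⟩ : ∃ b, B = C b :=
        ⟨_, totalDegree_eq_zero_iff_eq_C.mp (Nat.le_zero.mp hB.totalDegree_le)⟩
      exact ⟨A, b, hAB⟩
  choose A b hAb using hφ
  obtain ⟨m, hm⟩ : ∃ m, ∀ j, b j = b j / b m * b m := by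
    by_cases hb : ∃ m, b m ≠ 0
    · obtain ⟨m, hm⟩ := hb
      exact ⟨m, fun j => (div_mul_cancel₀ _ hm).symm⟩
    · push Not at hb
      -- If all the constants vanish, any index serves, and the quotients by zero are zero.
      exact ⟨0, fun j => by simp [hb]⟩
  set t : Fin (n + 1) → ℂ := fun j => b (m.succAbove j) / b m with ht
  obtain ⟨κ, hκ, g, hg⟩ := hI.of_dvd ha hH h0
    (θ := fun j => θ (m.succAbove j) - (C (t j) : S) • θ m)
    (fun j => (hθ _).sub_smul (hθ m) _) (fun j => by
      rw [crossValue_sub_smul, hAb, hAb m]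
      refine ⟨A (m.succAbove j) - C (t j) * A m, ?_⟩
      have : (C (b (m.succAbove j)) : S) = C (t j) * C (b m) := by
        rw [← C_mul, ← hm]
      rw [this]
      ring)
  refine ⟨m.insertNth (-∑ j, κ j * t j) κ, fun h => hκ (funext fun j => ?_), g, ?_⟩
  · have := congrFun h (m.succAbove j)
    simpa using this
  · rw [← hg, Fin.sum_univ_succAbove _ m]
    simp only [Fin.insertNth_apply_same, Fin.insertNth_apply_succAbove, smul_sub,
      Finset.sum_sub_distrib, smul_smul, map_neg, map_sum, neg_smul, Finset.sum_smul, C_mul]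
    abel

end Deletion

end

section

/-! ### Arrangements of six lines with at most two triple points -/

/-- The concurrency given by `T` for three lines in any order. -/
def unordered (T : Fin 6 → Fin 6 → Fin 6 → Bool) (i j k : Fin 6) : Bool :=
  (i < j && j < k && T i j k) || (i < k && k < j && T i k j) || (j < i && i < k && T j i k) ||
  (j < k && k < i && T j k i) || (k < i && i < j && T k i j) || (k < j && j < i && T k j i)

lemma SubPattern.tri_ne_zero {T : Fin 6 → Fin 6 → Fin 6 → Bool} {a : Fin 6 → Fin 3 → ℂ}
    (hT : SubPattern T a) {i j k : Fin 6} (hij : i ≠ j) (hik : i ≠ k) (hjk : j ≠ k)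
    (h : unordered T i j k = false) : tri (a i) (a j) (a k) ≠ 0 := by
  intro h0
  have key : ∀ l m n : Fin 6, l < m → m < n → tri (a l) (a m) (a n) = 0 →
      (l < m && m < n && T l m n) = true := fun l m n hlm hmn h1 => by
    simp [hlm, hmn, hT l m n hlm hmn h1]
  have h0' : tri (a i) (a k) (a j) = 0 := by rw [tri_swap_right, h0, neg_zero]
  simp only [unordered, Bool.or_eq_false_iff] at h
  obtain ⟨⟨⟨⟨⟨e1, e2⟩, e3⟩, e4⟩, e5⟩, e6⟩ := h
  rcases lt_or_gt_of_ne hij with h1 | h1 <;> rcases lt_or_gt_of_ne hjk with h2 | h2 <;>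
    rcases lt_or_gt_of_ne hik with h3 | h3
  · exact absurd (key i j k h1 h2 h0) (by rw [e1]; decide)
  · exact absurd h3 (not_lt.mpr (h1.trans h2).le)
  · exact absurd (key i k j h3 h2 h0') (by rw [e2]; decide)
  · exact absurd (key k i j h3 h1 (by rw [tri_cycle, h0])) (by rw [e5]; decide)
  · exact absurd (key j i k h1 h3 (by rw [tri_swap_left, h0, neg_zero])) (by rw [e3]; decide)
  · exact absurd (key j k i h2 h3 (by rw [← tri_cycle, h0])) (by rw [e4]; decide)
  · exact absurd h3 (not_lt.mpr (h2.trans h1).le)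
  · exact absurd (key k j i h2 h1 (by rw [tri_swap_right, tri_cycle, h0, neg_zero])) (by rw [e6]; decide)

lemma dependent_of_subPattern_typeShared {a : Fin 6 → Fin 3 → ℂ} (ha : Distinct a)
    (hT : SubPattern typeShared a) : Dependent a Finset.univ 3 2 := by
  have key : ∀ (J : Finset (Fin 6)) (H : Fin 6),
      (∀ i ∈ J, ∀ j ∈ J, i ≠ j → (i ≠ H ∧ j ≠ H ∧ unordered typeShared i j H = false)) →
      ∀ i ∈ J, ∀ j ∈ J, i ≠ j → tri (a i) (a j) (a H) ≠ 0 := fun J H h i hi j hj hij =>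
    hT.tri_ne_zero hij (h i hi j hj hij).1 (h i hi j hj hij).2.1 (h i hi j hj hij).2.2
  have h0 : Dependent a {0, 3, 4} 0 1 :=
    dependent_zero ha (i := 0) (j := 3) (by decide) (by decide) (by decide)
  have h1 := h0.of_deletion ha (H := 2) (J := {0, 3, 4}) (by decide) (by decide)
    (key _ _ (by decide)) (by decide)
  have h2 := h1.of_deletion_succ ha (H := 1) (J := {0, 3, 4}) (by decide) (by decide)
    (key _ _ (by decide)) (by decide)
  have h3 := h2.of_deletion ha (H := 5) (J := {0, 1, 2, 3, 4}) (by decide) (by decide)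
    (key _ _ (by decide)) (by decide)
  have e : insert 5 (insert 1 (insert 2 ({0, 3, 4} : Finset (Fin 6)))) = Finset.univ := by decide
  rwa [e] at h3

lemma dependent_of_subPattern_typeDisjoint {a : Fin 6 → Fin 3 → ℂ} (ha : Distinct a)
    (hT : SubPattern typeDisjoint a) : Dependent a Finset.univ 3 2 := by
  have key : ∀ (J : Finset (Fin 6)) (H : Fin 6),
      (∀ i ∈ J, ∀ j ∈ J, i ≠ j → (i ≠ H ∧ j ≠ H ∧ unordered typeDisjoint i j H = false)) →
      ∀ i ∈ J, ∀ j ∈ J, i ≠ j → tri (a i) (a j) (a H) ≠ 0 := fun J H h i hi j hj hij =>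
    hT.tri_ne_zero hij (h i hi j hj hij).1 (h i hi j hj hij).2.1 (h i hi j hj hij).2.2
  have h0 : Dependent a {0, 1, 2} 0 1 :=
    dependent_zero ha (i := 0) (j := 1) (by decide) (by decide) (by decide)
  have h1 := h0.of_deletion ha (H := 3) (J := {0, 1, 2}) (by decide) (by decide)
    (key _ _ (by decide)) (by decide)
  have h2 := h1.of_deletion ha (H := 4) (J := {0, 1, 2, 3}) (by decide) (by decide)
    (key _ _ (by decide)) (by decide)
  have h3 := h2.of_deletion_succ ha (H := 5) (J := {0, 1, 2, 3}) (by decide) (by decide)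
    (key _ _ (by decide)) (by decide)
  have e : insert 5 (insert 4 (insert 3 ({0, 1, 2} : Finset (Fin 6)))) = Finset.univ := by decide
  rwa [e] at h3

section Weak

variable {p : Curve 6}

/-- The dependence holds modulo the Euler field, but a nonzero multiple of the latter does not
annihilate the equation. -/
lemma exists_relation_of_weak (hp : p ∈ weakCurves) {r : Fin 3 → Fin 3 → S}
    (hr : ∀ j, r j ∈ AR p.form) (hr' : ∀ j i, (r j i).IsHomogeneous 3) :
    ∃ κ : Fin 3 → ℂ, κ ≠ 0 ∧ ∑ j, (C (κ j) : S) • r j = 0 := by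
  obtain ⟨a, ha, hT, hp⟩ := hp
  have hdep : Dependent a Finset.univ 3 2 := by
    rcases hT with hT | hT
    · exact dependent_of_subPattern_typeShared ha hT
    · exact dependent_of_subPattern_typeDisjoint ha hT
  obtain ⟨κ, hκ, g, hg⟩ := hdep r fun j =>
    ⟨hr' j, fun i _ => dvd_der_of_mem_AR ha hp (hr j) i⟩
  refine ⟨κ, hκ, ?_⟩
  have hmem : g • eul ∈ AR p.form := by
    rw [← hg]
    exact Submodule.sum_mem _ fun j _ => Submodule.smul_mem _ _ (hr j)
  rw [mem_AR, smul_der, der_eul p.form_isHomogeneous] at hmem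
  have : g = 0 := by
    refine (mul_eq_zero.mp hmem).resolve_right (mul_ne_zero ?_ (Curve.form_ne_zero p))
    simp
  rw [hg, this, zero_smul]

/-- There are no Jacobian syzygies of degree at most two. -/
lemma eq_zero_of_weak (hp : p ∈ weakCurves) {r : Fin 3 → S} (hr : r ∈ AR p.form) {n : ℕ}
    (hn : n ≤ 2) (hr' : ∀ i, (r i).IsHomogeneous n) : r = 0 := by
  -- A nonzero syzygy of smaller degree would have three independent multiples of degree 3, obtained
  -- with the three variables.
  obtain ⟨κ, hκ, h⟩ := exists_relation_of_weak hp (r := fun j => (X 0 ^ (2 - n) * X j : S) • r)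
    (fun j => Submodule.smul_mem _ _ hr) fun j i => by
      have := (((isHomogeneous_X ℂ (0 : Fin 3)).pow (2 - n)).mul (isHomogeneous_X ℂ j)).mul (hr' i)
      rwa [show 1 * (2 - n) + 1 + n = 3 by omega] at this
  have h1 : ((X 0 ^ (2 - n) * linearForm κ : S)) • r = 0 := by
    rw [← h, linearForm, Finset.mul_sum, Finset.sum_smul]
    refine Finset.sum_congr rfl fun j _ => ?_
    rw [smul_smul]
    congr 1
    ring
  exact (smul_eq_zero.mp h1).resolve_left
    (mul_ne_zero (pow_ne_zero _ (X_ne_zero 0)) (linearForm_ne_zero hκ))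

/-- The exponents add up to 5, so the smaller is at most 2, and a basis vector would vanish. -/
theorem not_isFree_of_weak (hp : p ∈ weakCurves) : ¬ IsFree p := by
  rintro ⟨d₁, d₂, hfree⟩
  obtain ⟨a, ha, -, hrep⟩ := id hp
  have hsum := hfree.add_eq (by decide) ha hrep
  obtain ⟨hle, b, hb, -⟩ := hfree
  have h0 := eq_zero_of_weak hp (b 0).2 (by omega) hb
  exact b.ne_zero 0 (Subtype.ext h0)

/-- The exponents add up to 6. Either the first generator has degree at most 2 and vanishes, or all
three have degree 3 and are dependent over ℂ; both contradict the minimality of the resolution. -/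
theorem not_isNearlyFree_of_weak (hp : p ∈ weakCurves) : ¬ IsNearlyFree p := by
  rintro ⟨d₁, d₂, hnf⟩
  obtain ⟨a, ha, -, hrep⟩ := id hp
  have hsum := hnf.add_eq (by decide) ha hrep
  obtain ⟨-, hle, r, c, hr0, hr1, hr2, hc0, hc1, hc2, -, hex, hex'⟩ := hnf
  have hr : ∀ i, r i ∈ AR p.form := fun i => (hex' (r i)).mpr ⟨Pi.single i 1, by
    rw [Fintype.linearCombination_apply_single, one_smul]⟩
  have hc : ∀ k, eval 0 (c k) = 0 := by
    intro k
    fin_cases k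
    · exact eval_zero_of_isHomogeneous hc0 (Nat.succ_ne_zero _)
    · exact eval_zero_of_isHomogeneous hc1 one_ne_zero
    · exact eval_zero_of_isHomogeneous hc2 one_ne_zero
  suffices h : ∃ κ : Fin 3 → ℂ, κ ≠ 0 ∧ ∑ j, (C (κ j) : S) • r j = 0 by
    obtain ⟨κ, hκ, h⟩ := h
    obtain ⟨m, hm⟩ := (hex fun j => C (κ j)).mp (by rwa [Fintype.linearCombination_apply])
    refine hκ (funext fun k => ?_)
    have h3 := congrArg (eval 0) (congrFun hm k)
    simp only [LinearMap.toSpanSingleton_apply, Pi.smul_apply, smul_eq_mul, map_mul, hc, mul_zero,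
      eval_C] at h3
    exact h3.symm
  by_cases h2 : d₁ ≤ 2
  · have h0 := eq_zero_of_weak hp (hr 0) h2 hr0
    exact ⟨Pi.single 0 1, by simp, by simp [Fin.sum_univ_three, h0]⟩
  · obtain rfl : d₁ = 3 := by omega
    obtain rfl : d₂ = 3 := by omega
    refine exists_relation_of_weak hp hr fun j => ?_
    fin_cases j
    · exact hr0
    · exact hr1
    · exact hr2

end Weak

end

end PlaneArr

/-! ### Free and nearly free arrangements of six lines: the classification. -/

theorem proposition5p3 :
    -- the complete list of free and of nearly free arrangements of six lines
    {p ∈ arrangements 6 | IsFree p} =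
      arrangementsTau 6 19 ∪ arrangementsTau 6 21 ∪ arrangementsTau 6 25 ∧
    {p ∈ arrangements 6 | IsNearlyFree p} = arrangementsTau 6 18 ∧
    -- Tjurina number 18
    (componentsOf (arrangementsTau 6 18) = {stratumL 6 4, stratum 6 latticeLPrime33} ∧
      stratumL 6 4 ≠ stratum 6 latticeLPrime33 ∧
      topologicalKrullDim (stratumL 6 4) = 10 ∧
      topologicalKrullDim (stratum 6 latticeLPrime33) = 9 ∧
      (∀ p ∈ stratumL 6 4, IsNearlyFreeWith p 2 4) ∧
      (∀ p ∈ stratum 6 latticeLPrime33, IsNearlyFreeWith p 3 3)) ∧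
    -- Tjurina number 19
    (componentsOf (arrangementsTau 6 19) = {stratumLHat 3 4, stratum 6 latticeLDelta} ∧
      stratumLHat 3 4 ≠ stratum 6 latticeLDelta ∧
      topologicalKrullDim (stratumLHat 3 4) = 9 ∧
      topologicalKrullDim (stratum 6 latticeLDelta) = 8 ∧
      ∀ p ∈ arrangementsTau 6 19, IsFreeWith p 2 3) ∧
    -- Tjurina number 21
    (IsIrreducible (arrangementsTau 6 21) ∧
      topologicalKrullDim (arrangementsTau 6 21) = 9 ∧
      ∀ p ∈ arrangementsTau 6 21, IsFreeWith p 1 4) ∧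
    -- Tjurina number 25
    (IsIrreducible (arrangementsTau 6 25) ∧
      topologicalKrullDim (arrangementsTau 6 25) = 8 ∧
      ∀ p ∈ arrangementsTau 6 25, IsFreeWith p 0 5) := by
  have hfree : ∀ p ∈ arrangementsTau 6 19, IsFreeWith p 2 3 := by
    intro p hp
    rw [arrangementsTau_19] at hp
    exact hp.elim isFreeWith_type43 isFreeWith_type3333
  -- If the two types coincided, a nonempty set would be disjoint from its own closure.
  have hne₁₈ : curvesOfType type4 ≠ curvesOfType type333 := fun h =>
    irreducible_and_dim_type4.1.nonempty.ne_empty (disjoint_self.mp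
      ((h.symm ▸ disjoint_type4_closure_type333 :
        Disjoint (curvesOfType type4) (closure (curvesOfType type4))).mono_right subset_closure))
  have hne₁₉ : curvesOfType type43 ≠ curvesOfType type3333 := fun h =>
    irreducible_and_dim_type43.1.nonempty.ne_empty (disjoint_self.mp
      ((h.symm ▸ disjoint_type43_closure_type3333 :
        Disjoint (curvesOfType type43) (closure (curvesOfType type43))).mono_right subset_closure))
  refine ⟨?_, ?_, ⟨?_, ?_, ?_, ?_, ?_, ?_⟩, ⟨?_, ?_, ?_, ?_, hfree⟩, ⟨?_, ?_, ?_⟩, ?_, ?_, ?_⟩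
  · rw [arrangementsTau_19, arrangementsTau_21, arrangementsTau_25]
    ext p
    constructor
    · rintro ⟨hp, hf⟩
      rcases arrangements_six hp with h | h | h | h | h | h | h
      · exact Or.inr h
      · exact Or.inl (Or.inr h)
      · exact absurd hf (isNearlyFree_not_isFree ⟨_, _, isNearlyFreeWith_type4 h⟩)
      · exact Or.inl (Or.inl (Or.inl h))
      · exact absurd hf (isNearlyFree_not_isFree ⟨_, _, isNearlyFreeWith_type333 h⟩)
      · exact Or.inl (Or.inl (Or.inr h))
      · exact absurd hf (not_isFree_of_weak h)
    · rintro (((h | h) | h) | h)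
      · exact ⟨curvesOfType_subset _ h, _, _, isFreeWith_type43 h⟩
      · exact ⟨curvesOfType_subset _ h, _, _, isFreeWith_type3333 h⟩
      · exact ⟨curvesOfType_subset _ h, _, _, isFreeWith_type5 h⟩
      · exact ⟨curvesOfType_subset _ h, _, _, isFreeWith_type6 h⟩
  · rw [arrangementsTau_18]
    ext p
    constructor
    · rintro ⟨hp, hf⟩
      rcases arrangements_six hp with h | h | h | h | h | h | h
      · exact absurd ⟨_, _, isFreeWith_type6 h⟩ (isNearlyFree_not_isFree hf)
      · exact absurd ⟨_, _, isFreeWith_type5 h⟩ (isNearlyFree_not_isFree hf)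
      · exact Or.inl h
      · exact absurd ⟨_, _, isFreeWith_type43 h⟩ (isNearlyFree_not_isFree hf)
      · exact Or.inr h
      · exact absurd ⟨_, _, isFreeWith_type3333 h⟩ (isNearlyFree_not_isFree hf)
      · exact absurd hf (not_isNearlyFree_of_weak h)
    · rintro (h | h)
      · exact ⟨curvesOfType_subset _ h, _, _, isNearlyFreeWith_type4 h⟩
      · exact ⟨curvesOfType_subset _ h, _, _, isNearlyFreeWith_type333 h⟩
  · rw [stratumL_six_four, stratum_latticeLPrime33, componentsOf_18]
  · rwa [stratumL_six_four, stratum_latticeLPrime33]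
  · rw [stratumL_six_four, irreducible_and_dim_type4.2]
  · rw [stratum_latticeLPrime33, irreducible_and_dim_type333.2]
  · rw [stratumL_six_four]
    exact fun p hp => isNearlyFreeWith_type4 hp
  · rw [stratum_latticeLPrime33]
    exact fun p hp => isNearlyFreeWith_type333 hp
  · rw [stratum_latticeLDelta, componentsOf_19]
    exact congrArg (fun s : Set (Curve 6) => ({s, curvesOfType type3333} : Set (Set (Curve 6))))
      stratumLHat_three_four.symm
  · rw [stratum_latticeLDelta]
    exact fun h => hne₁₉ (stratumLHat_three_four.symm.trans h)
  · have h : topologicalKrullDim (stratumLHat 3 4 : Set (Curve 6)) = 9 := by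
      rw [stratumLHat_three_four, irreducible_and_dim_type43.2]
    exact h
  · rw [stratum_latticeLDelta, irreducible_and_dim_type3333.2]
  · rw [arrangementsTau_21]
    exact irreducible_and_dim_type5.1
  · rw [arrangementsTau_21, irreducible_and_dim_type5.2]
  · rw [arrangementsTau_21]
    exact fun p hp => isFreeWith_type5 hp
  · rw [arrangementsTau_25]
    exact irreducible_and_dim_type6.1
  · rw [arrangementsTau_25, irreducible_and_dim_type6.2]
  · rw [arrangementsTau_25]
    exact fun p hp => isFreeWith_type6 hp
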